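/- Let $\Delta\subset(\mathbb R^3)^*$ be the regular octahedron with vertices $\nu_1=e_1,\nu_2=-e_1,\nu_3=e_2,\nu_4=-e_2,\nu_5=e_3,\nu_6=-e_3$. Let $Y_1=(1,1,1)$, $Y_2=(1,-1,-1)$, $Y_3=(-1,1,-1)$, $Y_4=(-1,-1,1)$, let $L=\mathrm{Span}_{\mathbb Z}\{Y_1,\dots,Y_4\}$, and put $X_i=Y_i$, $X_{4+i}=-Y_i$ ($i=1,\dots,4$). Conventions. For vectors $X_1,\dots,X_d$ in a lattice $Q\subset\mathbb R^n$ and the polyhedron $P=\{\mu\mid\langle\mu,X_j\rangle\ge\lambda_j,\ j=1,\dots,d\}$, let $\pi:\mathbb R^d\to\mathbb R^n$, $e_j\mapsto X_j$, $\mathfrak n=\ker\pi$, let $N$ be the kernel of the induced map $\mathbb R^d/\mathbb Z^d\to\mathbb R^n/Q$, and $\exp\theta=(e^{2\pi i\theta_1},\dots,e^{2\pi i\theta_d})$. On $\mathbb C^d$ take $\omega_0=\frac1{2\pi i}\sum dz_j\wedge d\bar z_j$ and $J(z)=\sum_j(|z_j|^2+\lambda_j)e_j^*$; let $\Psi=J|_{\mathfrak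 n}$ and $M_P=\Psi^{-1}(0)/N$. Let $I_\mu=\{j\mid\langle\mu,X_j\rangle=\lambda_j\}$, $\mathbb C^d_P=\bigcup_{\mu\in P}\{z\mid z_j\ne0\text{ for }j\notin I_\mu\}$, $A=\exp(i\mathfrak n)$, and let $X_P=\mathbb C^d_P/\!/N_{\mathbb C}$ be the quotient of $\mathbb C^d_P$ by the relation $z\sim w\iff N\,\overline{A z}\cap\overline{A w}\neq\emptyset$ (closures in $\mathbb C^d_P$). Both quotients carry the quotient topology; $\chi:M_P\to X_P$ is induced by inclusion. For an $n$-tuple $a$ of indices with linearly independent normals contained in some $I_\mu$, $\mu\in P$, the symplectic chart of $a$ is defined on the classes in $M_P$ with $z_j\neq0$ for $j\notin a$: it picks the representative with $z_j>0$ for $j\notin a$ and reads off $(z_j)_{j\in a}$. The complex chart of $a$ is defined on the classes in $X_P$ of points $z$ with $z_j\ne0$ for $j\notin a$ whose zero set is some $I_\mu$, $\mu\in P$: it picks the representative of this kind with $z_j=1$ for $j\notin a$. We say that $P$ is Kähler off $S\subset M_P$ if $\sim$ is an equivalence relation, $\chi$ is a homeomorphism, all these charts exist and form a symplectic atlas of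 $M_P\setminus S$ (smooth transition maps preserving $\omega_0$) and a holomorphic atlas of $X_P\setminus\chi(S)$, and on these manifolds $\chi$ is a diffeomorphism under which the complex structure is compatible with the symplectic form, so that $M_P\setminus S$ is Kähler. Then the following hold. 1. $L$ is a lattice, $\Delta=\bigcap_{j=1}^8\{\langle\mu,X_j\rangle\ge-1\}$ (so $\Delta$ is rational with respect to $L$), and its vertices are exactly $\nu_1,\dots,\nu_6$. The vertices $\nu_1,\dots,\nu_6$ lie on exactly the four facet planes $\langle\mu,X_j\rangle=-1$ with $j$ in $I_1=\{3,4,5,6\}$, $I_2=\{1,2,7,8\}$, $I_3=\{2,4,5,7\}$, $I_4=\{1,3,6,8\}$, $I_5=\{2,3,5,8\}$, $I_6=\{1,4,6,7\}$ respectively; each plane cuts out a facet that is the convex hull of exactly three vertices. Hence $\Delta$ is not simple. 2. $N=\exp\{(\theta_1,\theta_2,\theta_3,\theta_4,\theta_1+s,\theta_2+s,\theta_3+s,\theta_4+s)\}$, and $\Psi^{-1}(0)$ is the compact set $|z_i|^2+|z_{4+i}|^2=2$ ($i=1,\dots,4$), $|z_3|^2+|z_4|^2=|z_5|^2+|z_6|^2$.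 For each $k$ the points with $|z_j|^2=2$ for all $j\notin I_k$ form one $N$-orbit $m_k$, with isotropy group the circle $z_j\mapsto cz_j$ on one pair of indices of $I_k$ and $z_j\mapsto c^{-1}z_j$ on the other pair ($\{3,4\}$ and $\{5,6\}$ for $k=1$), and trivial on the other coordinates. All other points have trivial isotropy in $N$. 3. $M_\Delta$ is compact, connected, Hausdorff and second countable; $m_1,\dots,m_6$ are six distinct points, and their complement, the regular stratum, is open and dense. $\Delta$ is Kähler off $\{m_1,\dots,m_6\}$; in particular $\chi:M_\Delta\simeq X_\Delta$ and the regular stratum is a Kähler manifold of real dimension $6$. The torus $\mathbb R^3/L$ acts effectively and continuously on $M_\Delta$. There is a continuous $\Phi:M_\Delta\to(\mathbb R^3)^*$ with $\langle\Phi([z]),X_j\rangle=|z_j|^2-1$, with image $\Delta$ and with $\Phi^{-1}(\nu_k)=\{m_k\}$; on the regular stratum the action is smooth and Hamiltonian with moment mapping $\Phi$. 4. The charts of the regular stratum are indexed by the triples contained in one of the $I_k$. For $(3,4,5)$ the symplectic chart is the inverse of $u\mapsto[\tau(u)]$ on $U=\{(u_3,u_4,u_5)\ne0\mid|u_5|^2<|u_3|^2+|u_4|^2<2+|u_5|^2,\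 |u_i|^2<2\}$, where $$\tau(u)=\Big(\sqrt{2-|u_5|^2},\sqrt{2-|u_3|^2-|u_4|^2+|u_5|^2},u_3,u_4,u_5,\sqrt{|u_3|^2+|u_4|^2-|u_5|^2},\sqrt{2-|u_3|^2},\sqrt{2-|u_4|^2}\Big),$$ and the complex chart is the inverse of $u\mapsto[(1,1,u_3,u_4,u_5,1,1,1)]$ on $V=\{u\in\mathbb C^3\mid(u_3,u_4)\neq(0,0)\}$. 5. Let $\mathcal C_k=\bigcap_{j\in I_k}\{\langle\mu,X_j\rangle\ge-1\}$, with lattice $L$, and list the coordinates of $\mathbb C^4$ so that the first two and the last two are the opposite pairs in $I_k$. Then $N(\mathcal C_k)=\exp\{(s,s,-s,-s)\}$, $M_{\mathcal C_k}=\{|z_1|^2+|z_2|^2=|z_3|^2+|z_4|^2\}/N(\mathcal C_k)$, $X_{\mathcal C_k}=\mathbb C^4/\!/N_{\mathbb C}(\mathcal C_k)$, and $\mathcal C_k$ is Kähler off the apex $[0]$. Filling in the coordinates $j\notin I_k$ by $\sqrt{2-|z_{j'}|^2}$, where $X_{j'}=-X_j$, defines a homeomorphism from $\{|z_i|^2<2\}\subset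 M_{\mathcal C_k}$ onto the open neighborhood $\{z_j\neq0\ \forall j\notin I_k\}$ of $m_k$ in $M_\Delta$; filling them in by $1$ defines a homeomorphism from $X_{\mathcal C_k}$ onto the open neighborhood $\{z_j\ne0\ \forall j\notin I_k\}/\!/N_{\mathbb C}$ of $\chi(m_k)$ in $X_\Delta$. They send apex to singular point and are a symplectomorphism and a biholomorphism, respectively, on the regular parts. 6. Let $\mathcal L=(S^3\times S^3)/S^1$, where the spheres in $\mathbb C^2$ have radius $\sqrt2$ and $S^1$ acts with weight $+1$ on the first and $-1$ on the second factor (the real link). It is a closed smooth $5$-manifold. The map $([x:y],r)\mapsto[rx:ry]$ identifies the open cone over $\mathcal L$ with $M_{\mathcal C_k}$ and is a diffeomorphism from $\mathcal L\times\mathbb R_{>0}$ onto $M_{\mathcal C_k}\setminus[0]$. Some open neighborhood of $m_k$ in $M_\Delta$ is homeomorphic to the open cone over $\mathcal L$, with apex $m_k$. The inclusion induces a homeomorphism from $\mathcal L$ to $\mathcal L_{\mathbb C}=(\mathbb C^2\setminus0)^2/\big(N_{\mathbb C}(\mathcal C_k)\exp\{i(s,s,s,s)\mid s\in\mathbb R\}\big)$.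 7. The section of $\mathcal C_k$ by the plane $\langle\mu,\nu_k\rangle=0$ (coordinatewise inner product) is linearly isomorphic to the square $\Delta_L$ with vertices $(\pm1,\pm1)$, taken with normals $\pm e_1,\pm e_2$ and lattice $\mathbb Z^2$. Here $N(\Delta_L)=\exp\{(s,s,t,t)\}$, the level set is $|z_1|^2+|z_2|^2=|z_3|^2+|z_4|^2=2$, and $\Delta_L$ is Kähler off $\emptyset$. The symplectic link $M_{\Delta_L}$ is diffeomorphic to $S^2\times S^2$, the complex link $X_{\Delta_L}$ is biholomorphic to $\mathbb{CP}^1\times\mathbb{CP}^1$ by $[z]\mapsto([z_1:z_2],[z_3:z_4])$, and $\chi:M_{\Delta_L}\simeq X_{\Delta_L}$. The natural projection $p^2:\mathcal L\to M_{\Delta_L}$ is smooth and a principal $S^1$-bundle. 8. $X_{\mathcal C_k}\setminus[0]=(\mathbb C^2\setminus0)^2/N_{\mathbb C}(\mathcal C_k)$, and $X_{\mathcal C_k}$ is a complex cone over $\mathbb{CP}^1\times\mathbb{CP}^1$: the formula $t\cdot[z]=[tz_1:tz_2:z_3:z_4]$ defines a continuous multiplication by $t\in\mathbb C$, with $0\cdot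 x=[0]$, and the natural projection $p_{\mathbb C}:X_{\mathcal C_k}\setminus[0]\to\mathbb{CP}^1\times\mathbb{CP}^1$ is a holomorphic principal $\mathbb C^*$-bundle for it. The projection $p_{\mathbb C}$ factors through the natural projection $p^1_{\mathbb C}$ onto $\mathcal L_{\mathbb C}$. Under the above identifications $p^1_{\mathbb C}$ corresponds to the cone projection $M_{\mathcal C_k}\setminus[0]\to\mathcal L$, and the projection $\mathcal L_{\mathbb C}\to\mathbb{CP}^1\times\mathbb{CP}^1$ corresponds to $p^2$. -/

import Mathlib

open Set
open scoped Manifold ContDiff Topology LinearAlgebra.Projectivization Matrix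

noncomputable section

/-! ## Smooth, symplectic and holomorphic atlases -/

/-- `A` is a `C^∞` atlas over `𝕜` (a holomorphic atlas when `𝕜 = ℂ`) of the open subset `R` of `Y`. -/
def IsAtlasOn (𝕜 : Type*) [NontriviallyNormedField 𝕜] {Y E : Type*} [TopologicalSpace Y]
    [NormedAddCommGroup E] [NormedSpace 𝕜 E]
    (A : Set (OpenPartialHomeomorph Y E)) (R : Set Y) : Prop :=
  (⋃ e ∈ A, e.source) = R ∧
    ∀ e ∈ A, ∀ e' ∈ A, e.symm ≫ₕ e' ∈ contDiffGroupoid ∞ 𝓘(𝕜, E)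

/-- The partial homeomorphism `g` is a `C^∞` diffeomorphism over `𝕜` (a biholomorphism when
`𝕜 = ℂ`) where it is read in charts of the families `A` and `B`. -/
def IsDiffeoInCharts (𝕜 : Type*) [NontriviallyNormedField 𝕜] {Y Z E F : Type*}
    [TopologicalSpace Y] [TopologicalSpace Z] [NormedAddCommGroup E] [NormedSpace 𝕜 E]
    [NormedAddCommGroup F] [NormedSpace 𝕜 F]
    (A : Set (OpenPartialHomeomorph Y E)) (B : Set (OpenPartialHomeomorph Z F))
    (g : OpenPartialHomeomorph Y Z) : Prop :=
  ∀ e ∈ A, ∀ f ∈ B,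
    ContDiffOn 𝕜 ∞ (e.symm ≫ₕ g ≫ₕ f) (e.symm ≫ₕ g ≫ₕ f).source ∧
    ContDiffOn 𝕜 ∞ (e.symm ≫ₕ g ≫ₕ f).symm (e.symm ≫ₕ g ≫ₕ f).target

/-- The products of a chart of `A` and a chart of `B`. -/
def prodCharts {Y Z E F : Type*} [TopologicalSpace Y] [TopologicalSpace Z] [TopologicalSpace E]
    [TopologicalSpace F] (A : Set (OpenPartialHomeomorph Y E))
    (B : Set (OpenPartialHomeomorph Z F)) : Set (OpenPartialHomeomorph (Y × Z) (E × F)) :=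
  {ψ | ∃ e ∈ A, ∃ f ∈ B, ψ = e.prod f}

/-- The standard form `(1 / 2πi) ∑ dz_j ∧ dz̄_j` on `ℂⁿ`. -/
def omega0 {n : ℕ} (v w : Fin n → ℂ) : ℝ :=
  (1 / Real.pi) * ∑ j, (v j * star (w j)).im

/-- A local diffeomorphism of `ℂⁿ` preserves the standard symplectic form. -/
def PreservesOmega {n : ℕ} (T : OpenPartialHomeomorph (Fin n → ℂ) (Fin n → ℂ)) : Prop :=
  ∀ u ∈ T.source, ∀ v w, omega0 (fderiv ℝ T u v) (fderiv ℝ T u w) = omega0 v w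

/-- `A` is an atlas of the open set `R` by symplectic (Darboux) charts. -/
def IsSymplecticAtlasOn {n : ℕ} {Y : Type*} [TopologicalSpace Y]
    (A : Set (OpenPartialHomeomorph Y (Fin n → ℂ))) (R : Set Y) : Prop :=
  IsAtlasOn ℝ A R ∧ ∀ e ∈ A, ∀ e' ∈ A, PreservesOmega (e.symm ≫ₕ e')

/-- `g` is a symplectomorphism where it is read in symplectic charts of `A` and `B`. -/
def IsSymplectoInCharts {n : ℕ} {Y Z : Type*} [TopologicalSpace Y] [TopologicalSpace Z]
    (A : Set (OpenPartialHomeomorph Y (Fin n → ℂ)))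
    (B : Set (OpenPartialHomeomorph Z (Fin n → ℂ))) (g : OpenPartialHomeomorph Y Z) : Prop :=
  IsDiffeoInCharts ℝ A B g ∧ ∀ e ∈ A, ∀ f ∈ B, PreservesOmega (e.symm ≫ₕ g ≫ₕ f)

/-- Let `A` consist of symplectic charts and `B` of complex charts. The complex structure `J`
transported by `g` from the charts of `B` to the charts of `A` is compatible with the symplectic
form: `ω(Jv, Jw) = ω(v, w)` and `ω(Jv, v) > 0` for `v ≠ 0`
(with the sign of `omega0`, the flat Kähler metric of `ℂⁿ` is `ω(J·, ·)`).
Here `v'` stands for `Jv` and `w'` for `Jw`. -/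
def IsKahlerCompatible {n : ℕ} {Y Z : Type*} [TopologicalSpace Y] [TopologicalSpace Z]
    (A : Set (OpenPartialHomeomorph Y (Fin n → ℂ)))
    (B : Set (OpenPartialHomeomorph Z (Fin n → ℂ))) (g : OpenPartialHomeomorph Y Z) : Prop :=
  ∀ e ∈ A, ∀ f ∈ B, ∀ u ∈ (e.symm ≫ₕ g ≫ₕ f).source, ∀ v w v' w' : Fin n → ℂ,
    fderiv ℝ (e.symm ≫ₕ g ≫ₕ f) u v' = Complex.I • fderiv ℝ (e.symm ≫ₕ g ≫ₕ f) u v →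
    fderiv ℝ (e.symm ≫ₕ g ≫ₕ f) u w' = Complex.I • fderiv ℝ (e.symm ≫ₕ g ≫ₕ f) u w →
    omega0 v' w' = omega0 v w ∧ (v ≠ 0 → 0 < omega0 v' v)

/-! ## The symplectic and the complex quotient attached to `(Δ, Q, {X_j})` -/

/-- A triple `(Δ, Q, {X_1, …, X_d})`: the polyhedron is `{μ | ⟨μ, X_j⟩ ≥ bound j}`
and the vectors `X_j` lie in the subgroup `Q` of `ℝⁿ`. -/
structure ToricData (n d : ℕ) where
  normal : Fin d → Fin n → ℝ
  bound : Fin d → ℝ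
  lattice : Submodule ℤ (Fin n → ℝ)
  normal_mem : ∀ j, normal j ∈ lattice

namespace ToricData

variable {n d : ℕ} (D : ToricData n d)

/-- The polyhedron `Δ` (the dual of `ℝⁿ` is identified with `ℝⁿ` by the dot product). -/
def polyhedron : Set (Fin n → ℝ) := {μ | ∀ j, D.bound j ≤ μ ⬝ᵥ D.normal j}

/-- The indices `j` of the planes `⟨μ, X_j⟩ = λ_j` that contain `μ`. -/
def active (μ : Fin n → ℝ) : Set (Fin d) := {j | μ ⬝ᵥ D.normal j = D.bound j}

/-- The part of `Δ` on the `j`-th plane. -/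
def face (j : Fin d) : Set (Fin n → ℝ) := {μ ∈ D.polyhedron | j ∈ D.active μ}

/-- The facets: the faces of dimension `n - 1`. -/
def facets : Set (Set (Fin n → ℝ)) :=
  {F | (∃ j, F = D.face j) ∧ F.Nonempty ∧ Module.finrank ℝ (vectorSpan ℝ F) + 1 = n}

/-- Every vertex lies in exactly `n` facets. -/
def IsSimple : Prop :=
  ∀ μ ∈ D.polyhedron.extremePoints ℝ, {F | F ∈ D.facets ∧ μ ∈ F}.ncard = n

/-- `π : ℝᵈ → ℝⁿ`, `e_j ↦ X_j`; its kernel is the Lie algebra `𝔫`. -/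
def proj : (Fin d → ℝ) →ₗ[ℝ] (Fin n → ℝ) := Fintype.linearCombination ℝ D.normal

/-- `θ ↦ (e^{2πiθ_1}, …, e^{2πiθ_d})`. -/
def expT (θ : Fin d → ℝ) : Fin d → Circle := fun j => Circle.exp (2 * Real.pi * θ j)

/-- The group `N`, the kernel of `Π : Tᵈ = ℝᵈ/ℤᵈ → ℝⁿ/Q`. -/
def N : Subgroup (Fin d → Circle) where
  carrier := {t | ∃ θ : Fin d → ℝ, t = expT θ ∧ D.proj θ ∈ D.lattice}
  one_mem' := ⟨0, by ext j; simp [expT], by simp⟩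
  mul_mem' := by
    rintro _ _ ⟨θ, rfl, h⟩ ⟨η, rfl, h'⟩
    refine ⟨θ + η, ?_, by rw [map_add]; exact add_mem h h'⟩
    funext j
    simp [expT, mul_add, Circle.exp_add]
  inv_mem' := by
    rintro _ ⟨θ, rfl, h⟩
    refine ⟨-θ, ?_, by rw [map_neg]; exact neg_mem h⟩
    funext j
    simp [expT, Circle.exp_neg]

/-- Multiplication of `z` by an element of the compact torus. -/
def rot (t : Fin d → Circle) (z : Fin d → ℂ) : Fin d → ℂ := fun j => (t j : ℂ) * z j

/-- The level set `Ψ⁻¹(0)` of `Ψ = i^* ∘ J`, `J(z) = ∑ (|z_j|² + λ_j) e_j^*`, `i : 𝔫 → ℝᵈ`. -/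
def levelSet : Set (Fin d → ℂ) :=
  {z | ∀ θ : Fin d → ℝ, D.proj θ = 0 → ∑ j, θ j * (‖z j‖ ^ 2 + D.bound j) = 0}

/-- Points of the level set on the same `N`-orbit. -/
def orbitSetoid : Setoid D.levelSet where
  r z w := ∃ t ∈ D.N, (w : Fin d → ℂ) = rot t z
  iseqv :=
    { refl := fun z => ⟨1, D.N.one_mem, by funext j; simp [rot]⟩
      symm := by
        rintro z w ⟨t, ht, h⟩
        refine ⟨t⁻¹, D.N.inv_mem ht, ?_⟩
        funext j
        simp [h, rot]
      trans := by
        rintro z w y ⟨t, ht, h⟩ ⟨s, hs, h'⟩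
        refine ⟨s * t, D.N.mul_mem hs ht, ?_⟩
        funext j
        simp [h, h', rot, mul_assoc] }

/-- The symplectic quotient `M_Δ = Ψ⁻¹(0)/N`, with the quotient topology. -/
def M : Type := Quotient D.orbitSetoid

instance : TopologicalSpace D.M := inferInstanceAs (TopologicalSpace (Quotient D.orbitSetoid))

/-- `m = [z]` in `M_Δ`. -/
def RepM (z : Fin d → ℂ) (m : D.M) : Prop :=
  ∃ h : z ∈ D.levelSet, m = Quotient.mk D.orbitSetoid ⟨z, h⟩

/-- The union of the torus orbits `ℂᵈ_F = {z | z_j = 0 iff j ∈ I_F}` over the faces `F` of `Δ`. -/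
def polystable : Set (Fin d → ℂ) := {z | ∃ μ ∈ D.polyhedron, ∀ j, z j = 0 ↔ j ∈ D.active μ}

/-- The open set `ℂᵈ_Δ = ⋃_F {z | z_j ≠ 0 if j ∉ I_F}`. -/
def stable : Set (Fin d → ℂ) := {z | ∃ μ ∈ D.polyhedron, ∀ j, j ∉ D.active μ → z j ≠ 0}

/-- The orbit of `z` in `ℂᵈ_Δ` under `A = exp(i𝔫)`. -/
def orbitA (z : D.stable) : Set D.stable :=
  {w | ∃ θ : Fin d → ℝ, D.proj θ = 0 ∧
    ∀ j, (w : Fin d → ℂ) j =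
      Complex.exp (2 * Real.pi * Complex.I * (Complex.I * (θ j : ℂ))) * (z : Fin d → ℂ) j}

/-- The relation `(N · closure (A z)) ∩ closure (A w) ≠ ∅`, closures taken in `ℂᵈ_Δ`. -/
def rel (z w : D.stable) : Prop :=
  ∃ a ∈ closure (D.orbitA z), ∃ b ∈ closure (D.orbitA w), ∃ t ∈ D.N,
    (b : Fin d → ℂ) = rot t a

/-- The complex quotient `X_Δ = ℂᵈ_Δ // N_ℂ`, with the quotient topology. -/
def X : Type := Quot D.rel

instance : TopologicalSpace D.X := inferInstanceAs (TopologicalSpace (Quot D.rel))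

/-- `x = [z]` in `X_Δ`. -/
def RepX (z : Fin d → ℂ) (x : D.X) : Prop :=
  ∃ h : z ∈ D.stable, x = Quot.mk D.rel ⟨z, h⟩

theorem dot_proj (μ : Fin n → ℝ) (θ : Fin d → ℝ) :
    μ ⬝ᵥ D.proj θ = ∑ j, θ j * (μ ⬝ᵥ D.normal j) := by
  simp [proj, Fintype.linearCombination_apply, dotProduct_sum, dotProduct_smul]

theorem level_sub_polystable : D.levelSet ⊆ D.polystable := by
  intro z hz
  let c : Module.Dual ℝ (Fin d → ℝ) :=
    Fintype.linearCombination ℝ (fun j => ‖z j‖ ^ 2 + D.bound j)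
  have hc : c ∈ (LinearMap.ker D.proj).dualAnnihilator := by
    rw [Submodule.mem_dualAnnihilator]
    intro θ hθ
    simpa [c, Fintype.linearCombination_apply] using hz θ hθ
  rw [← LinearMap.range_dualMap_eq_dualAnnihilator_ker] at hc
  obtain ⟨φ, hφ⟩ := hc
  have key : ∀ j, (fun i => φ (Pi.single i 1)) ⬝ᵥ D.normal j = ‖z j‖ ^ 2 + D.bound j := by
    intro j
    have h1 : c (Pi.single j 1) = φ (D.proj (Pi.single j 1)) := by rw [← hφ]; rfl
    have h2 : c (Pi.single j 1) = ‖z j‖ ^ 2 + D.bound j := by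
      simp [c, Fintype.linearCombination_apply_single]
    have h3 : D.proj (Pi.single j 1) = D.normal j := by
      simp [proj, Fintype.linearCombination_apply_single]
    rw [← h2, h1, h3, LinearMap.pi_apply_eq_sum_univ φ (D.normal j)]
    simp only [dotProduct, smul_eq_mul]
    refine Finset.sum_congr rfl fun i _ => ?_
    rw [mul_comm]
    congr 2
    funext k
    simp [Pi.single_apply, eq_comm]
  refine ⟨fun i => φ (Pi.single i 1), fun j => ?_, fun j => ?_⟩
  · rw [key]; nlinarith [sq_nonneg ‖z j‖]
  · simp [active, key]

theorem polystable_sub_stable : D.polystable ⊆ D.stable := by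
  rintro z ⟨μ, hμ, h⟩
  exact ⟨μ, hμ, fun j hj hz => hj ((h j).1 hz)⟩

/-- The map `χ : M_Δ → X_Δ` induced by the inclusion `Ψ⁻¹(0) ⊆ ℂᵈ_Δ`. -/
def chi : D.M → D.X :=
  Quotient.lift
    (fun z : D.levelSet => (Quot.mk D.rel
      ⟨z, D.polystable_sub_stable (D.level_sub_polystable z.2)⟩ : D.X))
    (by
      rintro z w ⟨t, ht, h⟩
      refine Quot.sound ⟨⟨z, D.polystable_sub_stable (D.level_sub_polystable z.2)⟩,
        subset_closure ⟨0, by simp, fun j => by simp⟩,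
        ⟨w, D.polystable_sub_stable (D.level_sub_polystable w.2)⟩,
        subset_closure ⟨0, by simp, fun j => by simp⟩, t, ht, h⟩)

theorem point_mem (μ : Fin n → ℝ) (hμ : μ ∈ D.polyhedron) :
    (fun j => ((Real.sqrt (μ ⬝ᵥ D.normal j - D.bound j) : ℝ) : ℂ)) ∈ D.levelSet := by
  intro θ hθ
  have h : ∀ j, θ j * (‖((Real.sqrt (μ ⬝ᵥ D.normal j - D.bound j) : ℝ) : ℂ)‖ ^ 2 + D.bound j)
      = θ j * (μ ⬝ᵥ D.normal j) := by
    intro j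
    rw [Complex.norm_real, Real.norm_eq_abs, sq_abs, Real.sq_sqrt (sub_nonneg.2 (hμ j))]
    ring
  rw [Finset.sum_congr rfl fun j _ => h j, ← D.dot_proj, hθ, dotProduct_zero]

/-- The class of the point of the level set with coordinates `√(⟨μ, X_j⟩ - λ_j)`. -/
def point (μ : Fin n → ℝ) (hμ : μ ∈ D.polyhedron) : D.M :=
  Quotient.mk D.orbitSetoid ⟨_, D.point_mem μ hμ⟩

/-- Index tuples for charts: `n` planes with independent normals through one point of `Δ`. -/
def Admissible (a : Fin n ↪ Fin d) : Prop :=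
  (∃ μ ∈ D.polyhedron, ∀ i, a i ∈ D.active μ) ∧ LinearIndependent ℝ (fun i => D.normal (a i))

/-- The symplectic chart for the indices `a`: on the classes `[z]` with `z_j ≠ 0` for `j ∉ a`,
choose the representative with `z_j > 0` for `j ∉ a` and read off the coordinates in `a`. -/
def IsSymplecticChart (a : Fin n ↪ Fin d) (e : OpenPartialHomeomorph D.M (Fin n → ℂ)) : Prop :=
  e.source = {m | ∃ z, D.RepM z m ∧ ∀ j ∉ range a, z j ≠ 0} ∧
  ∀ m ∈ e.source, ∃ z, D.RepM z m ∧ (∀ j ∉ range a, ∃ r : ℝ, 0 < r ∧ z j = (r : ℂ)) ∧ e m = z ∘ a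

/-- The complex chart for the indices `a`: on the classes `[z]`, `z ∈ ⋃_F ℂᵈ_F`, with `z_j ≠ 0`
for `j ∉ a`, choose the representative with `z_j = 1` for `j ∉ a` and read off the coordinates
in `a`. -/
def IsComplexChart (a : Fin n ↪ Fin d) (f : OpenPartialHomeomorph D.X (Fin n → ℂ)) : Prop :=
  f.source = {x | ∃ z ∈ D.polystable, D.RepX z x ∧ ∀ j ∉ range a, z j ≠ 0} ∧
  ∀ x ∈ f.source, ∃ z ∈ D.polystable, D.RepX z x ∧ (∀ j ∉ range a, z j = 1) ∧ f x = z ∘ a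

def symplecticCharts : Set (OpenPartialHomeomorph D.M (Fin n → ℂ)) :=
  {e | ∃ a, D.Admissible a ∧ D.IsSymplecticChart a e}

def complexCharts : Set (OpenPartialHomeomorph D.X (Fin n → ℂ)) :=
  {f | ∃ a, D.Admissible a ∧ D.IsComplexChart a f}

/-- `χ` is a homeomorphism `M_Δ ≃ X_Δ`; every admissible tuple defines a symplectic and a complex
chart; these charts are atlases of the complement of the singular set `S` and of its image, on
which `χ` is a diffeomorphism making the symplectic and the complex structure a Kähler
structure. The first field says that the relation defining `X_Δ` is an equivalence relation. -/
structure IsKahlerOff (S : Set D.M) : Prop where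
  equivalence : Equivalence D.rel
  exists_symplectic : ∀ a, D.Admissible a → ∃ e, D.IsSymplecticChart a e
  exists_complex : ∀ a, D.Admissible a → ∃ f, D.IsComplexChart a f
  symplectic_atlas : IsSymplecticAtlasOn D.symplecticCharts Sᶜ
  complex_atlas : IsAtlasOn ℂ D.complexCharts (D.chi '' S)ᶜ
  kahler : ∃ χ : D.M ≃ₜ D.X, (∀ m, χ m = D.chi m) ∧
    IsDiffeoInCharts ℝ D.symplecticCharts D.complexCharts χ.toOpenPartialHomeomorph ∧
    IsKahlerCompatible D.symplecticCharts D.complexCharts χ.toOpenPartialHomeomorph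

/-- `ρ` is an effective continuous action of the torus `ℝⁿ/Q` on `M_Δ`, induced by the action of
`Tᵈ`. -/
structure IsTorusAction (ρ : (Fin n → ℝ) ⧸ D.lattice → D.M → D.M) : Prop where
  zero : ∀ m, ρ 0 m = m
  add : ∀ s t m, ρ (s + t) m = ρ s (ρ t m)
  induced : ∀ θ z m, D.RepM z m →
    D.RepM (rot (expT θ) z) (ρ (Submodule.Quotient.mk (D.proj θ)) m)
  continuous : Continuous fun p : ((Fin n → ℝ) ⧸ D.lattice) × D.M => ρ p.1 p.2
  effective : ∀ s, (∀ m, ρ s m = m) → s = 0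

/-- In the symplectic charts, the action `ρ` is smooth and Hamiltonian with moment mapping `Φ`. -/
structure IsHamiltonianInCharts (ρ : (Fin n → ℝ) ⧸ D.lattice → D.M → D.M)
    (Φ : D.M → Fin n → ℝ) : Prop where
  smooth : ∀ e ∈ D.symplecticCharts, ∀ e' ∈ D.symplecticCharts,
    ContDiffOn ℝ ∞
      (fun p : (Fin n → ℝ) × (Fin n → ℂ) => e' (ρ (Submodule.Quotient.mk p.1) (e.symm p.2)))
      {p | p.2 ∈ e.target ∧ ρ (Submodule.Quotient.mk p.1) (e.symm p.2) ∈ e'.source}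
  moment : ∀ e ∈ D.symplecticCharts, ∀ u ∈ e.target, ∀ ξ : Fin n → ℝ,
    ∃ (v : Fin n → ℂ) (F : (Fin n → ℂ) →L[ℝ] ℝ),
      HasDerivAt (fun s : ℝ => e (ρ (Submodule.Quotient.mk (s • ξ)) (e.symm u))) v 0 ∧
      HasFDerivAt (fun u' => Φ (e.symm u') ⬝ᵥ ξ) F u ∧ ∀ w, F w = omega0 v w

end ToricData

/-! ## The octahedron, the cones at its vertices, and the square -/

namespace Octahedron

open ToricData

/-- The vectors `Y_1, …, Y_4`. -/
def Y : Fin 4 → Fin 3 → ℝ := ![![1, 1, 1], ![1, -1, -1], ![-1, 1, -1], ![-1, -1, 1]]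

/-- The lattice generated by `Y_1, …, Y_4`. -/
def L : Submodule ℤ (Fin 3 → ℝ) := Submodule.span ℤ (range Y)

/-- `(Δ, L, {X_j})` with `X_i = Y_i`, `X_{4+i} = -Y_i`, and all bounds equal to `-1`. -/
def octa : ToricData 3 8 where
  normal := ![Y 0, Y 1, Y 2, Y 3, -Y 0, -Y 1, -Y 2, -Y 3]
  bound := fun _ => -1
  lattice := L
  normal_mem := by
    have h : ∀ i, Y i ∈ L := fun i => Submodule.subset_span ⟨i, rfl⟩
    intro j
    fin_cases j
    · exact h 0
    · exact h 1
    · exact h 2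
    · exact h 3
    · exact neg_mem (h 0)
    · exact neg_mem (h 1)
    · exact neg_mem (h 2)
    · exact neg_mem (h 3)

/-- The vertices `e_1, -e_1, e_2, -e_2, e_3, -e_3`. -/
def vertex : Fin 6 → Fin 3 → ℝ :=
  ![![1, 0, 0], ![-1, 0, 0], ![0, 1, 0], ![0, -1, 0], ![0, 0, 1], ![0, 0, -1]]

/-- The four planes through each vertex (planes are numbered from `0` here); the first two and the
last two of each row are opposite to each other at the vertex. -/
def idx : Fin 6 → Fin 4 → Fin 8 :=
  ![![2, 3, 4, 5], ![0, 1, 6, 7], ![1, 3, 4, 6], ![0, 2, 5, 7], ![1, 2, 4, 7], ![0, 3, 5, 6]]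

/-- The cone stemming from the `k`-th vertex. -/
def cone (k : Fin 6) : ToricData 3 4 where
  normal := fun i => octa.normal (idx k i)
  bound := fun _ => -1
  lattice := L
  normal_mem := fun i => octa.normal_mem (idx k i)

/-- The square with vertices `(±1, ±1)`, with the normal vectors `e_1, -e_1, e_2, -e_2` and the
lattice `ℤ²`. -/
def square : ToricData 2 4 where
  normal := ![![1, 0], ![-1, 0], ![0, 1], ![0, -1]]
  bound := fun _ => -1
  lattice := Submodule.span ℤ (range ![![1, 0], ![-1, 0], ![0, 1], ![0, -1]])
  normal_mem := fun j => Submodule.subset_span ⟨j, rfl⟩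

theorem vertex_mem (k : Fin 6) : vertex k ∈ octa.polyhedron := by
  intro j
  fin_cases k <;> fin_cases j <;> simp [vertex, octa, Y, dotProduct, Fin.sum_univ_succ]

/-- The point `m_k` of `M_Δ` over the `k`-th vertex. -/
def singularPoint (k : Fin 6) : octa.M := octa.point (vertex k) (vertex_mem k)

/-- The apex of `M_C` for the cone at the `k`-th vertex. -/
def apex (k : Fin 6) : (cone k).M :=
  (cone k).point (vertex k) fun i => vertex_mem k (idx k i)

/-- The facet opposite to the `j`-th one: `X_{opp j} = -X_j`. -/
def opp (j : Fin 8) : Fin 8 := j + 4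

/-- The symplectic chart domain `U`. -/
def U : Set (Fin 3 → ℂ) :=
  {u | u ≠ 0 ∧ ‖u 2‖ ^ 2 < ‖u 0‖ ^ 2 + ‖u 1‖ ^ 2 ∧ ‖u 0‖ ^ 2 + ‖u 1‖ ^ 2 < 2 + ‖u 2‖ ^ 2 ∧
    ∀ i, ‖u i‖ ^ 2 < 2}

def tau (u : Fin 3 → ℂ) : Fin 8 → ℂ :=
  ![(Real.sqrt (2 - ‖u 2‖ ^ 2) : ℝ), (Real.sqrt (2 - ‖u 0‖ ^ 2 - ‖u 1‖ ^ 2 + ‖u 2‖ ^ 2) : ℝ),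
    u 0, u 1, u 2, (Real.sqrt (‖u 0‖ ^ 2 + ‖u 1‖ ^ 2 - ‖u 2‖ ^ 2) : ℝ),
    (Real.sqrt (2 - ‖u 0‖ ^ 2) : ℝ), (Real.sqrt (2 - ‖u 1‖ ^ 2) : ℝ)]

/-- The complex chart domain `(ℂ² ∖ {0}) × ℂ`. -/
def V : Set (Fin 3 → ℂ) := {u | ¬ (u 0 = 0 ∧ u 1 = 0)}

def tauC (u : Fin 3 → ℂ) : Fin 8 → ℂ := ![1, 1, u 0, u 1, u 2, 1, 1, 1]

/-- The index triple `{3, 4, 5}` (numbered from `1`). -/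
def triple345 : Fin 3 ↪ Fin 8 := ⟨![2, 3, 4], by decide⟩

/-! ## Links -/

/-- The sphere `S³` of radius `√2` in `ℂ²`. -/
abbrev S3 : Type := Metric.sphere (0 : EuclideanSpace ℂ (Fin 2)) (Real.sqrt 2)

/-- The unit sphere `S²` in `ℝ³`. -/
abbrev S2 : Type := Metric.sphere (0 : EuclideanSpace ℝ (Fin 3)) 1

/-- The action of `S¹` on `S³ × S³` with weight `+1` on the first factor and `-1` on the second. -/
def linkSetoid : Setoid (S3 × S3) where
  r p q := ∃ c : Circle, (q.1 : EuclideanSpace ℂ (Fin 2)) = (c : ℂ) • p.1.1 ∧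
    (q.2 : EuclideanSpace ℂ (Fin 2)) = ((c⁻¹ : Circle) : ℂ) • p.2.1
  iseqv :=
    { refl := fun p => ⟨1, by simp⟩
      symm := by
        rintro p q ⟨c, h, h'⟩
        refine ⟨c⁻¹, ?_, ?_⟩
        · rw [h, smul_smul, ← Circle.coe_mul]; simp
        · rw [h', smul_smul, ← Circle.coe_mul]; simp
      trans := by
        rintro p q s ⟨c, h, h'⟩ ⟨b, g, g'⟩
        refine ⟨b * c, ?_, ?_⟩
        · rw [g, h, smul_smul, ← Circle.coe_mul]
        · rw [g', h', smul_smul, ← Circle.coe_mul, mul_inv] }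

/-- The real link `(S³ × S³)/S¹`. -/
def RealLink : Type := Quotient linkSetoid

instance : TopologicalSpace RealLink := inferInstanceAs (TopologicalSpace (Quotient linkSetoid))

/-- `l = [x : y]` in the real link. -/
def RepL (x y : EuclideanSpace ℂ (Fin 2)) (l : RealLink) : Prop :=
  ∃ (hx : x ∈ Metric.sphere 0 (Real.sqrt 2)) (hy : y ∈ Metric.sphere 0 (Real.sqrt 2)),
    l = Quotient.mk linkSetoid (⟨x, hx⟩, ⟨y, hy⟩)

/-- `ℂ² ∖ {0}`. -/
abbrev C2star : Type := {v : Fin 2 → ℂ // v ≠ 0}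

/-- The action on `(ℂ² ∖ {0})²` of the group of all `(s c, s c⁻¹)`, `c ∈ ℂ^*`, `s ∈ ℝ_{>0}`. -/
def linkCSetoid : Setoid (C2star × C2star) where
  r p q := ∃ (c : ℂˣ) (s : ℝ), 0 < s ∧ (q.1 : Fin 2 → ℂ) = ((s : ℂ) * c) • p.1.1 ∧
    (q.2 : Fin 2 → ℂ) = ((s : ℂ) * ((c⁻¹ : ℂˣ) : ℂ)) • p.2.1
  iseqv :=
    { refl := fun p => ⟨1, 1, by simp⟩
      symm := by
        rintro p q ⟨c, s, hs, h, h'⟩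
        have hs' : (s : ℂ) ≠ 0 := by exact_mod_cast hs.ne'
        refine ⟨c⁻¹, s⁻¹, inv_pos.2 hs, ?_, ?_⟩
        · rw [h, smul_smul]; simp; field_simp; simp
        · rw [h', smul_smul]; simp; field_simp; simp
      trans := by
        rintro p q t ⟨c, s, hs, h, h'⟩ ⟨b, r, hr, g, g'⟩
        refine ⟨b * c, r * s, mul_pos hr hs, ?_, ?_⟩
        · rw [g, h, smul_smul]; congr 1; push_cast; ring
        · rw [g', h', smul_smul]; congr 1; rw [mul_inv]; push_cast; ring }

/-- The link in its complex description: the quotient of `(ℂ² ∖ {0})²` by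
`N_ℂ(C) · exp{i(s,s,s,s)}`. -/
def RealLinkC : Type := Quotient linkCSetoid

instance : TopologicalSpace RealLinkC := inferInstanceAs (TopologicalSpace (Quotient linkCSetoid))

def RepLC (v w : Fin 2 → ℂ) (l : RealLinkC) : Prop :=
  ∃ (hv : v ≠ 0) (hw : w ≠ 0), l = Quotient.mk linkCSetoid (⟨v, hv⟩, ⟨w, hw⟩)

/-- The complex projective line. -/
abbrev CP1 : Type := ℙ ℂ (Fin 2 → ℂ)

/-- The quotient topology on the projective line. -/
instance : TopologicalSpace CP1 :=
  inferInstanceAs (TopologicalSpace (Quotient (projectivizationSetoid ℂ (Fin 2 → ℂ))))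

/-- The two affine charts `[v_0 : v_1] ↦ v_1/v_0` and `[v_0 : v_1] ↦ v_0/v_1`. -/
def affineCharts : Set (OpenPartialHomeomorph CP1 ℂ) :=
  {c | ∃ i : Fin 2,
    c.source = {p | ∃ (v : Fin 2 → ℂ) (hv : v ≠ 0), p = Projectivization.mk ℂ v hv ∧ v i ≠ 0} ∧
    ∀ (v : Fin 2 → ℂ) (hv : v ≠ 0), v i ≠ 0 → c (Projectivization.mk ℂ v hv) = v (i + 1) / v i}

/-- The open cone over `Z`: `Z × [0, ∞)` with `Z × {0}` collapsed to a point. -/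
def RealCone (Z : Type) [TopologicalSpace Z] : Type :=
  Quot fun p q : Z × Set.Ici (0 : ℝ) => (p.2 : ℝ) = 0 ∧ (q.2 : ℝ) = 0

instance (Z : Type) [TopologicalSpace Z] : TopologicalSpace (RealCone Z) :=
  inferInstanceAs (TopologicalSpace (Quot _))

def RealCone.mk {Z : Type} [TopologicalSpace Z] (z : Z) (r : ℝ) (hr : 0 ≤ r) : RealCone Z :=
  Quot.mk _ (z, ⟨r, hr⟩)

/-- The vector `(v_0, v_1, w_0, w_1)`. -/
def join (v w : Fin 2 → ℂ) : Fin 4 → ℂ := ![v 0, v 1, w 0, w 1]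

def fst2 (z : Fin 4 → ℂ) : Fin 2 → ℂ := ![z 0, z 1]

def snd2 (z : Fin 4 → ℂ) : Fin 2 → ℂ := ![z 2, z 3]

/-! ## Links, local models and cones -/

/-- `p : L → M_{Δ_L}`, `[x : y] ↦ [x : y]`, is a smooth map and a principal circle bundle, for the
circle action `c · [x : y] = [c x : y]`; `A` is an atlas of `L`. -/
structure IsCircleBundle (A : Set (OpenPartialHomeomorph RealLink (EuclideanSpace ℝ (Fin 5))))
    (p : RealLink → square.M) (α : Circle → RealLink → RealLink) : Prop where
  continuous : Continuous p
  formula : ∀ x y l, RepL x y l → square.RepM (join x y) (p l)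
  smooth : ∀ c ∈ A, ∀ e ∈ square.symplecticCharts,
    ContDiffOn ℝ ∞ (fun u => e (p (c.symm u))) {u | u ∈ c.target ∧ p (c.symm u) ∈ e.source}
  surjective : Function.Surjective p
  action_continuous : Continuous fun q : Circle × RealLink => α q.1 q.2
  action_formula : ∀ (c : Circle) x y l, RepL x y l → RepL ((c : ℂ) • x) y (α c l)
  free : ∀ c l, α c l = l → c = 1
  fiber : ∀ l l', p l = p l' ↔ ∃ c, l' = α c l
  locally_trivial : ∀ q, ∃ T : Bundle.Trivialization Circle p, q ∈ T.baseSet ∧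
    ∀ c l, p l ∈ T.baseSet → (T (α c l)).2 = c * (T l).2

/-- The data of the cone at the `k`-th vertex: `N(C)`, the level set, the section of the cone by
the plane through the origin orthogonal to the vertex (which is the square), the Kähler structure
off the apex, and `X_C ∖ [0] = (ℂ² ∖ {0})² / N_ℂ(C)`. -/
structure ConeDescription (k : Fin 6) : Prop where
  group : ∀ t, t ∈ (cone k).N ↔ ∃ s : ℝ, t = expT ![s, s, -s, -s]
  level : ∀ z, z ∈ (cone k).levelSet ↔ ‖z 0‖ ^ 2 + ‖z 1‖ ^ 2 = ‖z 2‖ ^ 2 + ‖z 3‖ ^ 2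
  stable : (cone k).stable = univ
  apex_rep : (cone k).RepM 0 (apex k)
  link_polygon : BijOn (fun μ => ![μ ⬝ᵥ (cone k).normal 0, μ ⬝ᵥ (cone k).normal 2])
    ((cone k).polyhedron ∩ {μ | μ ⬝ᵥ vertex k = 0}) square.polyhedron
  kahler : (cone k).IsKahlerOff {apex k}
  ne_apex : ∀ z x, (cone k).RepX z x → (x ≠ (cone k).chi (apex k) ↔ fst2 z ≠ 0 ∧ snd2 z ≠ 0)
  eq_iff : ∀ z w x y, (cone k).RepX z x → (cone k).RepX w y → x ≠ (cone k).chi (apex k) →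
    (x = y ↔ ∃ c : ℂˣ, w = join ((c : ℂ) • fst2 z) (((c⁻¹ : ℂˣ) : ℂ) • snd2 z))

/-- `Θ` maps the neighborhood `|z_i|² < 2` of the apex of `M_C` onto a neighborhood of `m_k`,
symplectically on the regular part, by filling in `√(2 - |z_{opp j}|²)` at the other indices. -/
structure IsSymplecticLocalModel (k : Fin 6)
    (Θ : OpenPartialHomeomorph (cone k).M octa.M) : Prop where
  source : Θ.source = {m | ∃ z, (cone k).RepM z m ∧ ∀ i, ‖z i‖ ^ 2 < 2}
  target : Θ.target = {m | ∃ z, octa.RepM z m ∧ ∀ j ∉ range (idx k), z j ≠ 0}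
  apex : Θ (apex k) = singularPoint k
  formula : ∀ z m, (cone k).RepM z m → (∀ i, ‖z i‖ ^ 2 < 2) →
    ∃ w, octa.RepM w (Θ m) ∧ (∀ i, w (idx k i) = z i) ∧
      ∀ j ∉ range (idx k), w j = (Real.sqrt (2 - ‖w (opp j)‖ ^ 2) : ℝ)
  symplecto : IsSymplectoInCharts (cone k).symplecticCharts octa.symplecticCharts Θ

/-- `Ξ` maps `X_C` onto a neighborhood of the singular point of `X_Δ`, biholomorphically on the
regular part, by filling in `1` at the other indices. -/
structure IsComplexLocalModel (k : Fin 6)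
    (Ξ : OpenPartialHomeomorph (cone k).X octa.X) : Prop where
  source : Ξ.source = univ
  target : Ξ.target = {x | ∃ z, octa.RepX z x ∧ ∀ j ∉ range (idx k), z j ≠ 0}
  apex : Ξ ((cone k).chi (apex k)) = octa.chi (singularPoint k)
  formula : ∀ z x, (cone k).RepX z x →
    ∃ w, octa.RepX w (Ξ x) ∧ (∀ i, w (idx k i) = z i) ∧ ∀ j ∉ range (idx k), w j = 1
  biholo : IsDiffeoInCharts ℂ (cone k).complexCharts octa.complexCharts Ξ

/-- `h` identifies the open cone over the real link with `M_C` by `([x : y], r) ↦ [r x : r y]`,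
and restricts to a diffeomorphism `g` from `L × ℝ_{>0}` onto the complement of the apex. -/
structure IsRealConeModel (k : Fin 6)
    (A : Set (OpenPartialHomeomorph RealLink (EuclideanSpace ℝ (Fin 5))))
    (h : RealCone RealLink ≃ₜ (cone k).M)
    (g : OpenPartialHomeomorph (RealLink × ℝ) (cone k).M) : Prop where
  formula : ∀ x y l (r : ℝ) (hr : 0 ≤ r), RepL x y l →
    (cone k).RepM (join ((r : ℂ) • x) ((r : ℂ) • y)) (h (RealCone.mk l r hr))
  source : g.source = {p | 0 < p.2}
  target : g.target = {apex k}ᶜ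
  restrict : ∀ l r (hr : 0 < r), g (l, r) = h (RealCone.mk l r hr.le)
  diffeo : IsDiffeoInCharts ℝ (prodCharts A {OpenPartialHomeomorph.refl ℝ})
    (cone k).symplecticCharts g

/-- `X_C` is a complex cone over `ℂℙ¹ × ℂℙ¹` with projection `p`, defined off the apex by
`[z] ↦ ([z_0 : z_1], [z_2 : z_3])`: multiplication by complex scalars `σ`, given by
`t · [z] = [t z_0 : t z_1 : z_2 : z_3]`, contracts everything to the apex for `t = 0`, and makes
the complement of the apex a holomorphic principal `ℂ^*`-bundle. -/
structure IsComplexCone (k : Fin 6) (p : (cone k).X → CP1 × CP1)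
    (σ : ℂ → (cone k).X → (cone k).X) : Prop where
  proj_continuous : ContinuousOn p {(cone k).chi (apex k)}ᶜ
  proj_formula : ∀ z x (hv : fst2 z ≠ 0) (hw : snd2 z ≠ 0), (cone k).RepX z x →
    p x = (Projectivization.mk ℂ (fst2 z) hv, Projectivization.mk ℂ (snd2 z) hw)
  scale_continuous : Continuous fun q : ℂ × (cone k).X => σ q.1 q.2
  scale_formula : ∀ t z x, (cone k).RepX z x → (cone k).RepX (join (t • fst2 z) (snd2 z)) (σ t x)
  scale_zero : ∀ x, σ 0 x = (cone k).chi (apex k)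
  free : ∀ t x, x ≠ (cone k).chi (apex k) → σ t x = x → t = 1
  fiber : ∀ x y, x ≠ (cone k).chi (apex k) → y ≠ (cone k).chi (apex k) →
    (p x = p y ↔ ∃ t, t ≠ 0 ∧ y = σ t x)
  locally_trivial : ∀ q, ∃ (W : Set (CP1 × CP1))
    (T : OpenPartialHomeomorph (cone k).X ((CP1 × CP1) × ℂ)),
    IsOpen W ∧ q ∈ W ∧ T.target = W ×ˢ {0}ᶜ ∧
    T.source = {x | x ≠ (cone k).chi (apex k) ∧ p x ∈ W} ∧
    (∀ x ∈ T.source, (T x).1 = p x ∧ ∀ t, t ≠ 0 → (T (σ t x)).2 = t * (T x).2) ∧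
    IsDiffeoInCharts ℂ (cone k).complexCharts
      (prodCharts (prodCharts affineCharts affineCharts) {OpenPartialHomeomorph.refl ℂ}) T

/-- The diagram relating the cone, the real link and the complex link: off the apex, `[z] ↦ [z]` is
a continuous map `p₁C` from `X_C` to the complex description of the real link; it corresponds
under `χ` and `ℓ` to the projection `[r x : r y] ↦ [x : y]` of the cone, and `p₂C ∘ p₁C = pC`. -/
structure IsConeDiagram (k : Fin 6) (ℓ : RealLink ≃ₜ RealLinkC) (p₂C : RealLinkC → CP1 × CP1)
    (h : RealCone RealLink ≃ₜ (cone k).M) (p₁C : (cone k).X → RealLinkC)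
    (pC : (cone k).X → CP1 × CP1) : Prop where
  continuous : ContinuousOn p₁C {(cone k).chi (apex k)}ᶜ
  formula : ∀ z x, (cone k).RepX z x → x ≠ (cone k).chi (apex k) →
    RepLC (fst2 z) (snd2 z) (p₁C x)
  real : ∀ l r (hr : 0 < r), p₁C ((cone k).chi (h (RealCone.mk l r hr.le))) = ℓ l
  complex : ∀ x, x ≠ (cone k).chi (apex k) → pC x = p₂C (p₁C x)

end Octahedron

end

open ToricData Octahedron

open Set
open scoped Manifold ContDiff Topology LinearAlgebra.Projectivization Matrix

noncomputable section

open Complex Real Function Submodule OpenPartialHomeomorph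

notation:max "ℂ^" d:max => Fin d → ℂ
notation:max "ℝ^" d:max => Fin d → ℝ
notation:max "𝔼^" d:max => EuclideanSpace ℝ (Fin d)
notation "ℙmk" => Projectivization.mk ℂ

namespace ToricData

variable {n d : ℕ} (D : ToricData n d)
variable {m : D.M} {t : Fin d → Circle} {z : ℂ^d} {θ : ℝ^d}

/-! ## The quotient `M` -/

lemma mem_levelSet_iff :
    z ∈ D.levelSet ↔ ∃ μ : ℝ^n, ∀ j, μ ⬝ᵥ D.normal j = ‖z j‖ ^ 2 + D.bound j := by
  constructor
  · intro hz
    let c : Module.Dual ℝ ℝ^d :=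
      Fintype.linearCombination ℝ (fun j => ‖z j‖ ^ 2 + D.bound j)
    have hc : c ∈ (LinearMap.ker D.proj).dualAnnihilator := by
      rw [mem_dualAnnihilator]
      intro θ hθ
      simpa [c, Fintype.linearCombination_apply] using hz θ hθ
    rw [← LinearMap.range_dualMap_eq_dualAnnihilator_ker] at hc
    obtain ⟨φ, hφ⟩ := hc
    refine ⟨fun i => φ (Pi.single i 1), fun j => ?_⟩
    have h1 : c (Pi.single j 1) = φ (D.proj (Pi.single j 1)) := by rw [← hφ]; rfl
    have h2 : c (Pi.single j 1) = ‖z j‖ ^ 2 + D.bound j := by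
      simp [c, Fintype.linearCombination_apply_single]
    have h3 : D.proj (Pi.single j 1) = D.normal j := by
      simp [proj, Fintype.linearCombination_apply_single]
    rw [← h2, h1, h3, LinearMap.pi_apply_eq_sum_univ φ (D.normal j)]
    simp only [dotProduct, smul_eq_mul]
    refine Finset.sum_congr rfl fun i _ => ?_
    rw [mul_comm]
    congr 2
    funext k
    simp [Pi.single_apply, eq_comm]
  · rintro ⟨μ, hμ⟩ θ hθ
    simp only [← hμ]
    rw [← D.dot_proj, hθ, dotProduct_zero]

lemma norm_rot (t) (z) (j : Fin d) : ‖rot t z j‖ = ‖z j‖ := by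
  simp [rot, Circle.norm_coe]

lemma rot_mul (s t : Fin d → Circle) (z : ℂ^d) : rot (s * t) z = rot s (rot t z) := by
  funext j; simp [rot, mul_assoc]

lemma rot_one (z : ℂ^d) : rot 1 z = z := by
  funext j; simp [rot]

lemma rot_mem_levelSet : rot t z ∈ D.levelSet ↔ z ∈ D.levelSet := by
  simp [levelSet, norm_rot]

lemma continuous_rot : Continuous fun p : (Fin d → Circle) × ℂ^d => rot p.1 p.2 := by
  unfold rot; fun_prop

lemma isClosed_levelSet : IsClosed D.levelSet := by
  have : D.levelSet = ⋂ θ : ℝ^d, ⋂ _ : D.proj θ = 0,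
      {z : ℂ^d | ∑ j, θ j * (‖z j‖ ^ 2 + D.bound j) = 0} := by
    ext z; simp [levelSet]
  rw [this]
  exact isClosed_iInter fun θ => isClosed_iInter fun _ => isClosed_eq (by fun_prop) (by fun_prop)

/-- The quotient map of `M`. -/
def cls (z : D.levelSet) : D.M := Quotient.mk D.orbitSetoid z

variable {D} in
lemma cls_eq_iff {z w : D.levelSet} : D.cls z = D.cls w ↔ ∃ t ∈ D.N, (w : ℂ^d) = rot t z :=
  Quotient.eq (r := D.orbitSetoid)

lemma continuous_cls : Continuous D.cls := continuous_quotient_mk'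

lemma cls_surjective : Surjective D.cls := Quotient.mk_surjective

lemma isOpenQuotientMap_cls : IsOpenQuotientMap D.cls := by
  refine ⟨D.cls_surjective, D.continuous_cls, ?_⟩
  intro V hV
  have : D.cls ⁻¹' (D.cls '' V) = ⋃ t ∈ D.N, (fun z : D.levelSet =>
        (⟨rot t z, D.rot_mem_levelSet.2 z.2⟩ : D.levelSet)) ⁻¹' V := by
    ext z
    simp only [mem_preimage, mem_image, mem_iUnion, exists_prop]
    constructor
    · rintro ⟨w, hw, h⟩
      obtain ⟨t, ht, h'⟩ := cls_eq_iff.1 h.symm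
      exact ⟨t, ht, by convert hw; exact h'.symm⟩
    · rintro ⟨t, ht, h⟩
      exact ⟨_, h, (cls_eq_iff.2 ⟨t, ht, rfl⟩).symm⟩
  have key : IsOpen (D.cls ⁻¹' (D.cls '' V)) := by
    rw [this]
    refine isOpen_biUnion fun t _ => hV.preimage ?_
    refine Continuous.subtype_mk ?_ _
    exact continuous_rot.comp (continuous_const.prodMk continuous_subtype_val)
  exact key

lemma RepM.unique {m'} (h : D.RepM z m) (h' : D.RepM z m') : m = m' := by
  obtain ⟨_, rfl⟩ := h
  obtain ⟨_, rfl⟩ := h'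
  rfl

lemma exists_repM (m) : ∃ z, D.RepM z m := by
  obtain ⟨z, hz⟩ := Quotient.exists_rep m
  exact ⟨z, z.2, hz.symm⟩

lemma RepM.rot (h : D.RepM z m) (ht : t ∈ D.N) : D.RepM (rot t z) m := by
  obtain ⟨hz, rfl⟩ := h
  exact ⟨D.rot_mem_levelSet.2 hz, Quotient.sound ⟨t, ht, rfl⟩⟩

lemma RepM.exists_rot {w} (h : D.RepM z m) (h' : D.RepM w m) :
    ∃ t ∈ D.N, w = ToricData.rot t z := by
  obtain ⟨hz, rfl⟩ := h
  obtain ⟨hw, e⟩ := h'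
  exact Quotient.exact e

/-- A representative of a class in `M`. -/
def outM (m : D.M) : ℂ^d := (D.exists_repM m).choose

lemma repM_outM (m) : D.RepM (D.outM m) m := (D.exists_repM m).choose_spec

lemma outM_mem (m) : D.outM m ∈ D.levelSet := (D.repM_outM m).1

lemma nonempty_levelSet_iff : D.levelSet.Nonempty ↔ Nonempty D.M :=
  ⟨fun ⟨z, hz⟩ => ⟨Quotient.mk D.orbitSetoid ⟨z, hz⟩⟩, fun ⟨m⟩ => ⟨_, D.outM_mem m⟩⟩

lemma isOpen_image_mk {V : Set ℂ^d} (hV : IsOpen V) :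
    IsOpen {m | ∃ z, D.RepM z m ∧ z ∈ V} := by
  have := D.isOpenQuotientMap_cls.isOpenMap _ (hV.preimage continuous_subtype_val)
  convert this using 1
  refine Set.ext fun m => ?_
  constructor
  · rintro ⟨z, ⟨hz, rfl⟩, h⟩
    exact ⟨⟨z, hz⟩, h, rfl⟩
  · rintro ⟨z, h, rfl⟩
    exact ⟨z, ⟨z.2, rfl⟩, h⟩

lemma secondCountable_M : SecondCountableTopology D.M := by
  have := D.isOpenQuotientMap_cls
  exact this.isQuotientMap.secondCountableTopology this.isOpenMap

lemma compactSpace_M (h : IsCompact D.levelSet) : CompactSpace D.M := by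
  have := isCompact_iff_compactSpace.1 h
  exact D.isOpenQuotientMap_cls.surjective.compactSpace D.isOpenQuotientMap_cls.continuous

lemma t2Space_M (hN : IsClosed (D.N : Set (Fin d → Circle))) : T2Space D.M := by
  rw [t2Space_iff_of_isOpenQuotientMap D.isOpenQuotientMap_cls]
  have hc : IsCompact (D.N : Set (Fin d → Circle)) := hN.isCompact
  have : {q : D.levelSet × D.levelSet |
      D.cls q.1 = D.cls q.2} =
      Prod.snd '' {p : (Fin d → Circle) × (D.levelSet × D.levelSet) |
        p.1 ∈ D.N ∧ (p.2.2 : ℂ^d) = rot p.1 p.2.1} := by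
    ext q
    constructor
    · intro h
      obtain ⟨t, ht, h'⟩ := cls_eq_iff.1 h
      exact ⟨(t, q), ⟨ht, h'⟩, rfl⟩
    · rintro ⟨⟨t, q'⟩, ⟨ht, h'⟩, rfl⟩
      exact cls_eq_iff.2 ⟨t, ht, h'⟩
  rw [this]
  refine isClosedMap_snd_of_compactSpace _ ?_
  refine IsClosed.inter (hN.preimage continuous_fst) (isClosed_eq (by fun_prop) ?_)
  exact continuous_rot.comp (continuous_fst.prodMk
    (continuous_subtype_val.comp (continuous_fst.comp continuous_snd)))

section Nonempty

variable [Nonempty D.M]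

open Classical in
/-- The class of `z`, with an arbitrary value off the level set. -/
def mkM (z : ℂ^d) : D.M :=
  if h : z ∈ D.levelSet then D.cls ⟨z, h⟩ else Classical.arbitrary _

lemma repM_mkM (h : z ∈ D.levelSet) : D.RepM z (D.mkM z) :=
  ⟨h, by simp only [mkM, h]; rfl⟩

lemma RepM.eq_mkM (h : D.RepM z m) : m = D.mkM z :=
  RepM.unique D h (D.repM_mkM h.1)

lemma mkM_outM (m) : D.mkM (D.outM m) = m := ((D.repM_outM m).eq_mkM).symm

lemma mkM_rot (h : z ∈ D.levelSet) (ht : t ∈ D.N) : D.mkM (rot t z) = D.mkM z :=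
  (((D.repM_mkM h).rot D ht).eq_mkM).symm

lemma exists_outM_mkM (hz : z ∈ D.levelSet) : ∃ t ∈ D.N, D.outM (D.mkM z) = rot t z :=
  (D.repM_mkM hz).exists_rot D (D.repM_outM _)

lemma continuousOn_mkM : ContinuousOn D.mkM D.levelSet := by
  rw [continuousOn_iff_continuous_domRestrict]
  have : D.levelSet.domRestrict D.mkM = D.cls := by
    funext z; exact dif_pos z.2
  rw [this]
  exact D.continuous_cls

/-- Continuity of a map on an open part of `M` given by an `N`-invariant formula. -/
lemma continuousOn_comp_outM {Y : Type*} [TopologicalSpace Y] {g : ℂ^d → Y} {S : Set D.M}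
    (hS : IsOpen S) (hg : ContinuousOn g {z ∈ D.levelSet | D.mkM z ∈ S}) (hr : ∀ z ∈ D.levelSet,
    D.mkM z ∈ S → ∀ t ∈ D.N, g (rot t z) = g z) : ContinuousOn (fun m => g (D.outM m)) S := by
  intro m hm
  refine ContinuousAt.continuousWithinAt ?_
  obtain ⟨hz, hmz⟩ := D.repM_outM m
  have hmz' : m = D.cls ⟨_, hz⟩ := hmz
  rw [hmz', ← D.isOpenQuotientMap_cls.continuousAt_comp_iff]
  have hmk : ∀ w : D.levelSet, D.cls w = D.mkM w := fun w => by simp [mkM]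
  have ho : IsOpen {w : D.levelSet | D.mkM w ∈ S} := by
    have := hS.preimage D.isOpenQuotientMap_cls.continuous
    convert this using 1
    ext w; simp [hmk]
  have hc : ContinuousOn (fun w : D.levelSet => g w) {w : D.levelSet | D.mkM w ∈ S} :=
    hg.comp continuous_subtype_val.continuousOn fun w hw => ⟨w.2, hw⟩
  have hz' : (⟨D.outM m, hz⟩ : D.levelSet) ∈ {w : D.levelSet | D.mkM w ∈ S} := by
    simpa [D.mkM_outM] using hm
  refine (hc.continuousAt (ho.mem_nhds hz')).congr ?_
  filter_upwards [ho.mem_nhds hz'] with w hw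
  obtain ⟨t, ht, h⟩ := D.exists_outM_mkM w.2
  simp only [Function.comp, hmk]
  rw [h, hr _ w.2 hw t ht]

end Nonempty

/-! ## Unimodular index tuples -/

/-- The normals with indices in `a` are linearly independent and generate the lattice. -/
structure Unimodular (a : Fin n ↪ Fin d) : Prop where
  indep : LinearIndependent ℝ fun i => D.normal (a i)
  span : D.lattice ≤ span ℤ (range fun i => D.normal (a i))

open Classical in
/-- The integral coordinates of `X_j` with respect to the normals with indices in `a`. -/
def coef (a : Fin n ↪ Fin d) (j : Fin d) : Fin n → ℤ :=
  if h : ∃ c : Fin n → ℤ, ∑ i, c i • D.normal (a i) = D.normal j then h.choose else 0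

variable {D} {a : Fin n ↪ Fin d}

lemma Unimodular.sum_coef (h : D.Unimodular a) (j : Fin d) :
    ∑ i, (D.coef a j i : ℝ) • D.normal (a i) = D.normal j := by
  have hex : ∃ c : Fin n → ℤ, ∑ i, c i • D.normal (a i) = D.normal j :=
    mem_span_range_iff_exists_fun ℤ |>.1 (h.span (D.normal_mem j))
  have := hex.choose_spec
  simp only [coef, dif_pos hex]
  simpa only [Int.cast_smul_eq_zsmul] using this

lemma Unimodular.coef_eq (h : D.Unimodular a) {j : Fin d} {c : Fin n → ℤ}
    (hc : ∑ i, (c i : ℝ) • D.normal (a i) = D.normal j) : D.coef a j = c := by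
  have := h.indep
  rw [Fintype.linearIndependent_iff] at this
  funext i
  have h2 := this (fun i => (D.coef a j i : ℝ) - c i) (by
    simp only [sub_smul, Finset.sum_sub_distrib, h.sum_coef, hc, sub_self]) i
  have h3 : (D.coef a j i : ℝ) = c i := by linarith
  exact_mod_cast h3

lemma Unimodular.coef_self (h : D.Unimodular a) (k : Fin n) :
    D.coef a (a k) = fun i => if k = i then 1 else 0 := by
  apply h.coef_eq
  simp

lemma Unimodular.proj_eq (h : D.Unimodular a) (θ : ℝ^d) :
    D.proj θ = ∑ i, (∑ j, θ j * D.coef a j i) • D.normal (a i) := by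
  simp only [proj, Fintype.linearCombination_apply, Finset.sum_smul]
  rw [Finset.sum_comm]
  refine Finset.sum_congr rfl fun j _ => ?_
  conv_lhs => rw [← h.sum_coef j]
  simp only [Finset.smul_sum, smul_smul]

lemma Unimodular.proj_eq_zero_iff (h : D.Unimodular a) :
    D.proj θ = 0 ↔ ∀ i, ∑ j, θ j * D.coef a j i = 0 := by
  rw [h.proj_eq]
  constructor
  · exact Fintype.linearIndependent_iff.1 h.indep _
  · intro h'
    simp [h']

lemma Unimodular.proj_mem_iff (h : D.Unimodular a) :
    D.proj θ ∈ D.lattice ↔ ∀ i, ∃ m : ℤ, ∑ j, θ j * D.coef a j i = m := by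
  rw [h.proj_eq]
  constructor
  · intro h'
    obtain ⟨c, hc⟩ := mem_span_range_iff_exists_fun ℤ |>.1 (h.span h')
    intro i
    refine ⟨c i, ?_⟩
    have := Fintype.linearIndependent_iff.1 h.indep
      (fun i => (∑ j, θ j * D.coef a j i) - c i) (by
        simp only [sub_smul, Finset.sum_sub_distrib, Int.cast_smul_eq_zsmul, hc, sub_self]) i
    linarith
  · intro h'
    choose m hm using h'
    simp only [hm, Int.cast_smul_eq_zsmul]
    exact Submodule.sum_mem _ fun i _ => smul_mem _ _ (D.normal_mem _)

lemma expT_eq_one_iff {x : ℝ} : Circle.exp (2 * Real.pi * x) = 1 ↔ ∃ m : ℤ, x = m := by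
  rw [Circle.exp_eq_one]
  constructor
  · rintro ⟨m, hm⟩
    refine ⟨m, ?_⟩
    have := pi_pos
    field_simp at hm
    linarith
  · rintro ⟨m, rfl⟩
    exact ⟨m, by ring⟩

lemma exists_expT (t : Fin d → Circle) : ∃ θ, t = expT θ := by
  refine ⟨fun j => (t j : ℂ).arg / (2 * Real.pi), ?_⟩
  funext j
  have := pi_pos
  simp only [expT]
  rw [mul_div_cancel₀ _ (by positivity)]
  exact (Circle.exp_arg _).symm

lemma prod_expT_zpow (θ : ℝ^d) (c : Fin d → ℤ) :
    ∏ j, expT θ j ^ c j = Circle.exp (2 * Real.pi * ∑ j, θ j * c j) := by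
  classical
  have : ∀ s : Finset (Fin d), ∏ j ∈ s, expT θ j ^ c j =
      Circle.exp (2 * Real.pi * ∑ j ∈ s, θ j * c j) := by
    intro s
    induction s using Finset.induction_on with
    | empty => simp
    | insert j s hj ih =>
      rw [Finset.prod_insert hj, Finset.sum_insert hj, mul_add, Circle.exp_add, ih, expT]
      congr 1
      rw [← Circle.exp_zsmul]
      congr 1
      simp; ring
  exact this _

lemma Unimodular.mem_N_iff (h : D.Unimodular a) : t ∈ D.N ↔ ∀ i, ∏ j, t j ^ D.coef a j i = 1 := by
  constructor
  · rintro ⟨θ, rfl, hθ⟩ i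
    rw [prod_expT_zpow, expT_eq_one_iff]
    exact h.proj_mem_iff.1 hθ i
  · intro h'
    obtain ⟨θ, rfl⟩ := exists_expT t
    refine ⟨θ, rfl, h.proj_mem_iff.2 fun i => ?_⟩
    rw [← expT_eq_one_iff, ← prod_expT_zpow, h' i]

lemma Unimodular.isClosed_N (h : D.Unimodular a) : IsClosed (D.N : Set (Fin d → Circle)) := by
  have : (D.N : Set (Fin d → Circle)) = ⋂ i, {t | ∏ j, t j ^ D.coef a j i = 1} := by
    ext t; simp [h.mem_N_iff]
  rw [this]
  exact isClosed_iInter fun i => isClosed_eq (by fun_prop) continuous_const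

lemma Unimodular.eq_one_of_mem_N (h : D.Unimodular a) (ht : t ∈ D.N)
    (h1 : ∀ j ∉ range a, t j = 1) : t = 1 := by
  have key : ∀ i, t (a i) = 1 := by
    intro i
    rw [← h.mem_N_iff.1 ht i, Finset.prod_eq_single (a i)]
    · simp [h.coef_self]
    · intro j _ hj
      by_cases hja : j ∈ range a
      · obtain ⟨k, rfl⟩ := hja
        have : k ≠ i := fun e => hj (by rw [e])
        simp [h.coef_self, this]
      · simp [h1 j hja]
    · simp
  funext j
  by_cases hja : j ∈ range a
  · obtain ⟨k, rfl⟩ := hja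
    exact key k
  · exact h1 j hja

lemma Unimodular.eq_zero_of_proj (h : D.Unimodular a) (ht : D.proj θ = 0)
    (h1 : ∀ j ∉ range a, θ j = 0) : θ = 0 := by
  have key : ∀ i, θ (a i) = 0 := by
    intro i
    rw [← h.proj_eq_zero_iff.1 ht i, Finset.sum_eq_single (a i)]
    · simp [h.coef_self]
    · intro j _ hj
      by_cases hja : j ∈ range a
      · obtain ⟨k, rfl⟩ := hja
        have : k ≠ i := fun e => hj (by rw [e])
        simp [h.coef_self, this]
      · simp [h1 j hja]
    · simp
  funext j
  by_cases hja : j ∈ range a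
  · obtain ⟨k, rfl⟩ := hja
    exact key k
  · exact h1 j hja

/-- Dual coordinates. -/
lemma Unimodular.exists_dot (h : D.Unimodular a) (s : ℝ^n) :
    ∃ μ : ℝ^n, ∀ i, μ ⬝ᵥ D.normal (a i) = s i := by
  let b := basisOfLinearIndependentOfCardEqFinrank' _ h.indep (by simp)
  let f : ℝ^n →ₗ[ℝ] ℝ := b.constr ℝ s
  refine ⟨fun i => f (Pi.single i 1), fun i => ?_⟩
  have h1 : f (D.normal (a i)) = s i := by
    have : D.normal (a i) = b i := by simp [b]
    rw [this, Module.Basis.constr_basis]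
  rw [← h1, LinearMap.pi_apply_eq_sum_univ f (D.normal (a i))]
  simp only [dotProduct, smul_eq_mul]
  refine Finset.sum_congr rfl fun i _ => ?_
  rw [mul_comm]
  congr 2
  funext k
  simp [Pi.single_apply, eq_comm]

lemma Unimodular.ext_dot (h : D.Unimodular a) {μ ν : ℝ^n}
    (hμ : ∀ i, μ ⬝ᵥ D.normal (a i) = ν ⬝ᵥ D.normal (a i)) : μ = ν := by
  have hs : Submodule.span ℝ (range fun i => D.normal (a i)) = ⊤ :=
    h.indep.span_eq_top_of_card_eq_finrank' (by simp)
  have : ∀ x : ℝ^n, (μ - ν) ⬝ᵥ x = 0 := by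
    intro x
    have hx : x ∈ Submodule.span ℝ (range fun i => D.normal (a i)) := by rw [hs]; trivial
    induction hx using span_induction with
    | mem x hx => obtain ⟨i, rfl⟩ := hx; simp [sub_dotProduct, hμ]
    | zero => simp
    | add x y _ _ hx hy => simp [dotProduct_add, hx, hy]
    | smul c x _ hx => simp [dotProduct_smul, hx]
  have := this (μ - ν)
  rw [dotProduct_self_eq_zero] at this
  exact sub_eq_zero.1 this

lemma Unimodular.dot_normal (h : D.Unimodular a) (μ : ℝ^n) (j : Fin d) :
    μ ⬝ᵥ D.normal j = ∑ i, D.coef a j i * (μ ⬝ᵥ D.normal (a i)) := by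
  conv_lhs => rw [← h.sum_coef j]
  simp [dotProduct_sum, dotProduct_smul]

/-- `|z_j|²` in terms of the coordinates with indices in `a`, on the level set. -/
def height (D : ToricData n d) (a : Fin n ↪ Fin d) (u : ℂ^n) (j : Fin d) : ℝ :=
  ∑ i, D.coef a j i * (‖u i‖ ^ 2 + D.bound (a i)) - D.bound j

lemma Unimodular.height_self (h : D.Unimodular a) (u : ℂ^n) (k : Fin n) :
    D.height a u (a k) = ‖u k‖ ^ 2 := by
  simp [height, h.coef_self]

lemma Unimodular.norm_sq_eq (h : D.Unimodular a) (hz : z ∈ D.levelSet)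
    (j : Fin d) : ‖z j‖ ^ 2 = D.height a (z ∘ a) j := by
  obtain ⟨μ, hμ⟩ := D.mem_levelSet_iff.1 hz
  have := h.dot_normal μ j
  simp only [hμ] at this
  simp only [height, Function.comp]
  linarith

lemma Unimodular.mem_levelSet_of (h : D.Unimodular a)
    (hz : ∀ j, ‖z j‖ ^ 2 = D.height a (z ∘ a) j) : z ∈ D.levelSet := by
  rw [mem_levelSet_iff]
  obtain ⟨μ, hμ⟩ := h.exists_dot fun i => ‖z (a i)‖ ^ 2 + D.bound (a i)
  refine ⟨μ, fun j => ?_⟩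
  rw [h.dot_normal, hz j]
  simp only [hμ, height, Function.comp]
  ring

end ToricData

namespace ToricData

variable {n d : ℕ} {D : ToricData n d} {a : Fin n ↪ Fin d}
variable {j : Fin d} {t : Fin d → Circle} {G s z : ℂ^d} {θ : ℝ^d}

/-! ## Normal forms -/

/-- Exponents of the monomial one-parameter families in `𝔫` attached to `a`. -/
def scalExp (D : ToricData n d) (a : Fin n ↪ Fin d) (k j : Fin d) : ℤ :=
  ∑ i, D.coef a k i * (if a i = j then 1 else 0) - if k = j then 1 else 0

lemma Unimodular.proj_scalExp (h : D.Unimodular a) (k : Fin d) :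
    D.proj (fun j => (D.scalExp a k j : ℝ)) = 0 := by
  simp only [proj, Fintype.linearCombination_apply, scalExp]
  push_cast
  simp only [sub_smul, Finset.sum_sub_distrib, Finset.sum_smul]
  rw [Finset.sum_comm]
  simp [h.sum_coef]

/-- The monomial map from `(ℂ^*)ᵈ` to `N_ℂ` attached to `a`. -/
def scal (D : ToricData n d) (a : Fin n ↪ Fin d) (G : ℂ^d) (j : Fin d) : ℂ :=
  ∏ k, G k ^ D.scalExp a k j

lemma scal_ne_zero (hG : ∀ k, G k ≠ 0) (j : Fin d) : D.scal a G j ≠ 0 :=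
  Finset.prod_ne_zero_iff.2 fun k _ => zpow_ne_zero _ (hG k)

lemma scal_of_notMem (hG : ∀ k ∈ range a, G k = 1) (hj : j ∉ range a) : D.scal a G j = (G j)⁻¹ := by
  have h0 : ∀ i, a i ≠ j := fun i hi => hj ⟨i, hi⟩
  rw [scal, Finset.prod_eq_single j]
  · simp [scalExp, h0]
  · intro k _ hk
    simp [scalExp, h0, hk]
  · simp

/-- Elements of `N_ℂ = N · exp(i𝔫)`. -/
def IsNC (D : ToricData n d) (s : ℂ^d) : Prop :=
  ∃ t ∈ D.N, ∃ θ : ℝ^d, D.proj θ = 0 ∧ ∀ j, s j = t j * (Real.exp (θ j) : ℂ)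

lemma IsNC.ne_zero (hs : D.IsNC s) (j : Fin d) : s j ≠ 0 := by
  obtain ⟨t, _, θ, _, h⟩ := hs
  rw [h]
  exact mul_ne_zero (Circle.coe_ne_zero _) (by exact_mod_cast (exp_pos _).ne')

lemma IsNC.mul {s' : ℂ^d} (hs : D.IsNC s) (hs' : D.IsNC s') : D.IsNC fun j => s j * s' j := by
  obtain ⟨t, ht, θ, hθ, h⟩ := hs
  obtain ⟨t', ht', θ', hθ', h'⟩ := hs'
  refine ⟨t * t', D.N.mul_mem ht ht', θ + θ', by rw [map_add, hθ, hθ', add_zero], fun j => ?_⟩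
  simp only [h, h', Pi.mul_apply, Pi.add_apply, Real.exp_add, Circle.coe_mul]
  push_cast; ring

lemma IsNC.inv (hs : D.IsNC s) : D.IsNC fun j => (s j)⁻¹ := by
  obtain ⟨t, ht, θ, hθ, h⟩ := hs
  refine ⟨t⁻¹, D.N.inv_mem ht, -θ, by rw [map_neg, hθ, neg_zero], fun j => ?_⟩
  simp only [h, Pi.inv_apply, Pi.neg_apply, Real.exp_neg, Circle.coe_inv]
  push_cast; rw [mul_inv]

lemma isNC_of_mem_N (ht : t ∈ D.N) : D.IsNC fun j => (t j : ℂ) :=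
  ⟨t, ht, 0, map_zero _, fun j => by simp⟩

lemma isNC_exp (hθ : D.proj θ = 0) : D.IsNC fun j => (Real.exp (θ j) : ℂ) :=
  ⟨1, D.N.one_mem, θ, hθ, fun j => by simp⟩

lemma mem_N_of_proj_eq_zero (hθ : D.proj θ = 0) : (fun j => Circle.exp (θ j)) ∈ D.N := by
  refine ⟨(2 * Real.pi)⁻¹ • θ, ?_, by rw [map_smul, hθ, smul_zero]; exact zero_mem _⟩
  funext j
  simp only [expT, Pi.smul_apply, smul_eq_mul]
  rw [mul_inv_cancel_left₀ (by positivity)]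

lemma scal_eq (D : ToricData n d) (a : Fin n ↪ Fin d) (hG : ∀ k, G k ≠ 0) (j : Fin d) : D.scal a G j
    = (Circle.exp (∑ k, (G k).arg * D.scalExp a k j) : ℂ) * (Real.exp (∑ k, Real.log ‖G k‖ *
    D.scalExp a k j) : ℂ) := by
  rw [Circle.coe_exp, ofReal_exp, ← Complex.exp_add, scal]
  push_cast
  rw [Finset.sum_mul, ← Finset.sum_add_distrib, Complex.exp_sum]
  refine Finset.prod_congr rfl fun k _ => ?_
  rw [mul_right_comm, ← add_mul, mul_comm _ (D.scalExp a k j : ℂ), exp_int_mul]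
  congr 1
  rw [Complex.exp_add, ← ofReal_exp, Real.exp_log (norm_pos_iff.2 (hG k)), mul_comm]
  exact (norm_mul_exp_arg_mul_I _).symm

lemma Unimodular.proj_sum_scalExp (h : D.Unimodular a) (x : ℝ^d) :
    D.proj (fun j => ∑ k, x k * D.scalExp a k j) = 0 := by
  have : (fun j => ∑ k, x k * (D.scalExp a k j : ℝ)) =
      ∑ k, x k • fun j => (D.scalExp a k j : ℝ) := by
    funext j; simp
  rw [this, map_sum]
  simp [h.proj_scalExp]

lemma Unimodular.isNC_scal (h : D.Unimodular a) (hG : ∀ k, G k ≠ 0) : D.IsNC (D.scal a G) :=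
  ⟨_, mem_N_of_proj_eq_zero (h.proj_sum_scalExp fun k => (G k).arg), _,
    h.proj_sum_scalExp fun k => Real.log ‖G k‖, D.scal_eq a hG⟩

lemma Unimodular.scal_mem_N (h : D.Unimodular a) (hG : ∀ k, ‖G k‖ = 1) :
    ∃ t ∈ D.N, ∀ j, D.scal a G j = t j := by
  refine ⟨_, mem_N_of_proj_eq_zero (h.proj_sum_scalExp fun k => (G k).arg), fun j => ?_⟩
  rw [D.scal_eq a fun k hk => by simpa [hk] using hG k]
  simp [hG]

lemma Unimodular.eq_one_of_isNC (h : D.Unimodular a) (hs : D.IsNC s)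
    (h1 : ∀ j ∉ range a, s j = 1) : s = 1 := by
  obtain ⟨t, ht, θ, hθ, hs⟩ := hs
  have key : ∀ j ∉ range a, θ j = 0 ∧ t j = 1 := by
    intro j hj
    have h2 := h1 j hj
    rw [hs] at h2
    have h3 := congrArg norm h2
    rw [norm_mul, Circle.norm_coe, one_mul, norm_real, norm_one, norm_eq_abs,
      abs_of_pos (exp_pos _), Real.exp_eq_one_iff] at h3
    refine ⟨h3, ?_⟩
    rw [h3] at h2
    ext
    simpa using h2
  have hθ0 := h.eq_zero_of_proj hθ fun j hj => (key j hj).1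
  have ht1 := h.eq_one_of_mem_N ht fun j hj => (key j hj).2
  funext j
  simp [hs, hθ0, ht1]

/-- The points with nonzero coordinates off `a`. -/
def nz (a : Fin n ↪ Fin d) : Set ℂ^d := {z | ∀ j ∉ range a, z j ≠ 0}

lemma isOpen_nz (a : Fin n ↪ Fin d) : IsOpen (nz a) := by
  have : nz a = ⋂ j, ⋂ _ : j ∉ range a, {z : ℂ^d | z j ≠ 0} := by ext; simp [nz]
  rw [this]
  exact isOpen_iInter_of_finite fun j => isOpen_iInter_of_finite fun _ =>
    isOpen_ne_fun (by fun_prop) continuous_const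

lemma rot_mem_nz : rot t z ∈ nz a ↔ z ∈ nz a := by
  simp [nz, rot]

open Classical in
def gaugeC (a : Fin n ↪ Fin d) (z : ℂ^d) (k : Fin d) : ℂ := if k ∈ range a then 1 else z k

open Classical in
def gaugeS (a : Fin n ↪ Fin d) (z : ℂ^d) (k : Fin d) : ℂ :=
  if k ∈ range a then 1 else z k / (‖z k‖ : ℂ)

lemma gaugeC_ne_zero (hz : z ∈ nz a) (k : Fin d) : gaugeC a z k ≠ 0 := by
  unfold gaugeC
  split_ifs with h
  · exact one_ne_zero
  · exact hz k h

lemma norm_gaugeS (hz : z ∈ nz a) (k : Fin d) : ‖gaugeS a z k‖ = 1 := by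
  unfold gaugeS
  split_ifs with h
  · exact norm_one
  · have := hz k h
    simp [this]

lemma gaugeS_ne_zero (hz : z ∈ nz a) (k : Fin d) : gaugeS a z k ≠ 0 :=
  fun h => by simpa [h] using norm_gaugeS hz k

/-- The representative of the `N_ℂ`-orbit of `z` with coordinates `1` off `a`. -/
def normC (D : ToricData n d) (a : Fin n ↪ Fin d) (z : ℂ^d) (j : Fin d) : ℂ :=
  D.scal a (gaugeC a z) j * z j

/-- The representative of the `N`-orbit of `z` with positive coordinates off `a`. -/
def normS (D : ToricData n d) (a : Fin n ↪ Fin d) (z : ℂ^d) (j : Fin d) : ℂ :=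
  D.scal a (gaugeS a z) j * z j

lemma normC_of_notMem (hz : z ∈ nz a) (hj : j ∉ range a) : D.normC a z j = 1 := by
  rw [normC, scal_of_notMem (fun k hk => by simp only [gaugeC, hk, if_true]) hj]
  simp only [gaugeC, hj, if_false]
  exact inv_mul_cancel₀ (hz j hj)

lemma normS_of_notMem (hz : z ∈ nz a) (hj : j ∉ range a) : D.normS a z j = (‖z j‖ : ℂ) := by
  rw [normS, scal_of_notMem (fun k hk => by simp only [gaugeS, hk, if_true]) hj]
  simp only [gaugeS, hj, if_false]
  have := hz j hj
  have h2 : (‖z j‖ : ℂ) ≠ 0 := by simpa using this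
  field_simp

lemma Unimodular.exists_normS (h : D.Unimodular a) (hz : z ∈ nz a) :
    ∃ t ∈ D.N, D.normS a z = rot t z := by
  obtain ⟨t, ht, h'⟩ := h.scal_mem_N (norm_gaugeS hz)
  exact ⟨t, ht, by funext j; simp [normS, rot, h']⟩

lemma Unimodular.exists_normC (h : D.Unimodular a) (hz : z ∈ nz a) :
    ∃ s, D.IsNC s ∧ D.normC a z = fun j => s j * z j :=
  ⟨_, h.isNC_scal (gaugeC_ne_zero hz), rfl⟩

lemma Unimodular.normC_unique (h : D.Unimodular a)
    (hs : D.IsNC s) (h1 : ∀ j ∉ range a, s j * z j = 1) : D.normC a z = fun j => s j * z j := by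
  have hz : z ∈ nz a := fun j hj h0 => by simpa [h0] using h1 j hj
  obtain ⟨s', hs', h'⟩ := h.exists_normC hz
  have h2 := h.eq_one_of_isNC (hs.inv.mul hs') fun j hj => by
    have h3 := congrFun h' j
    rw [normC_of_notMem hz hj] at h3
    have h4 : s' j = s j := mul_right_cancel₀ (hz j hj) (h3.symm.trans (h1 j hj).symm)
    rw [h4, inv_mul_cancel₀ (hs.ne_zero j)]
  rw [h']
  funext j
  have h3 := congrFun h2 j
  simp only [Pi.one_apply] at h3
  have h4 : s' j = s j := by
    have := hs.ne_zero j
    field_simp at h3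
    exact h3
  rw [h4]

lemma Unimodular.normC_smul (h : D.Unimodular a) (hz : z ∈ nz a)
    (hs : D.IsNC s) : D.normC a (fun j => s j * z j) = D.normC a z := by
  obtain ⟨s', hs', h'⟩ := h.exists_normC hz
  have e : ∀ j, s' j * (s j)⁻¹ * (s j * z j) = s' j * z j := by
    intro j
    have := hs.ne_zero j
    field_simp
  rw [h.normC_unique (hs'.mul hs.inv) fun j hj => ?_]
  · simp only [e, h']
  · rw [e, ← normC_of_notMem hz hj, h']

lemma Unimodular.normS_unique (h : D.Unimodular a) (ht : t ∈ D.N) (h1 : ∀ j ∉ range a, ∃ r : ℝ, 0 <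
    r ∧ rot t z j = r) : D.normS a z = rot t z := by
  have hz : z ∈ nz a := rot_mem_nz.1 fun j hj h0 => by
    obtain ⟨r, hr, h2⟩ := h1 j hj
    rw [h2] at h0
    exact hr.ne' (by exact_mod_cast h0)
  have h1' : ∀ j ∉ range a, rot t z j = (‖z j‖ : ℂ) := by
    intro j hj
    obtain ⟨r, hr, h2⟩ := h1 j hj
    rw [← norm_rot t z j, h2, norm_real, norm_eq_abs, abs_of_pos hr]
  obtain ⟨t', ht', h'⟩ := h.exists_normS hz
  have h2 := h.eq_one_of_mem_N (D.N.mul_mem (D.N.inv_mem ht) ht') fun j hj => by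
    have h3 := congrFun h' j
    rw [normS_of_notMem hz hj, ← h1' j hj] at h3
    have h4 : t j = t' j := Circle.coe_injective (mul_right_cancel₀ (hz j hj) h3)
    simp [h4]
  rw [h', inv_mul_eq_one.1 h2]

lemma Unimodular.normS_rot (h : D.Unimodular a) (hz : z ∈ nz a)
    (ht : t ∈ D.N) : D.normS a (rot t z) = D.normS a z := by
  obtain ⟨t', ht', h'⟩ := h.exists_normS hz
  have e : rot (t' * t⁻¹) (rot t z) = rot t' z := by rw [← rot_mul]; simp
  rw [h.normS_unique (D.N.mul_mem ht' (D.N.inv_mem ht)) fun j hj => ?_, e, h']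
  rw [e, ← h', normS_of_notMem hz hj]
  exact ⟨_, norm_pos_iff.2 (hz j hj), rfl⟩

lemma Unimodular.normS_eq_self (h : D.Unimodular a)
    (h1 : ∀ j ∉ range a, ∃ r : ℝ, 0 < r ∧ z j = r) : D.normS a z = z := by
  have := h.normS_unique (z := z) D.N.one_mem (by simpa [rot_one] using h1)
  rwa [rot_one] at this

lemma Unimodular.normC_eq_self (h : D.Unimodular a)
    (h1 : ∀ j ∉ range a, z j = 1) : D.normC a z = z := by
  have := h.normC_unique (z := z) (isNC_of_mem_N D.N.one_mem) (by simpa using h1)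
  simpa using this

/-! ## Smoothness -/

lemma contDiffAt_zpow {𝕜 E : Type*} [NontriviallyNormedField 𝕜] [NormedAddCommGroup E] [NormedSpace
    𝕜 E] [NormedAlgebra 𝕜 ℂ] {f : E → ℂ} {x : E} {N : WithTop ℕ∞} (hf : ContDiffAt 𝕜 N f x) (h0 : f
    x ≠ 0) (m : ℤ) : ContDiffAt 𝕜 N (fun y => f y ^ m) x := by
  cases m with
  | ofNat m => simpa using hf.pow m
  | negSucc m =>
    simp only [zpow_negSucc]
    exact (hf.pow (m + 1)).inv (pow_ne_zero _ h0)

lemma contDiffAt_scal {𝕜 E : Type*} [NontriviallyNormedField 𝕜] [NormedAddCommGroup E]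
    [NormedSpace 𝕜 E] [NormedAlgebra 𝕜 ℂ] {G : E → ℂ^d} {x : E} {N : WithTop ℕ∞}
    (hf : ∀ k, ContDiffAt 𝕜 N (fun y => G y k) x) (h0 : ∀ k, G x k ≠ 0) (j : Fin d) :
    ContDiffAt 𝕜 N (fun y => D.scal a (G y) j) x :=
  contDiffAt_prod fun k _ => contDiffAt_zpow (hf k) (h0 k) _

lemma contDiffAt_normC (hz : z ∈ nz a) : ContDiffAt ℂ ∞ (D.normC a) z := by
  refine contDiffAt_pi.2 fun j => ContDiffAt.mul ?_ (by fun_prop)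
  refine contDiffAt_scal (fun k => ?_) (gaugeC_ne_zero hz) j
  unfold gaugeC
  split_ifs
  · exact contDiffAt_const
  · fun_prop

lemma contDiffAt_gaugeS (hz : z ∈ nz a) (k : Fin d) : ContDiffAt ℝ ∞ (fun z => gaugeS a z k) z := by
  unfold gaugeS
  split_ifs with h
  · exact contDiffAt_const
  · have hk := hz k h
    have hk' : ContDiffAt ℝ ∞ (fun z : ℂ^d => z k) z := by fun_prop
    simp only [div_eq_mul_inv]
    refine hk'.mul (ContDiffAt.inv ?_ (by simpa using hk))
    refine ofRealCLM.contDiff.contDiffAt.comp z ?_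
    exact ContDiffAt.norm ℝ hk' hk

lemma contDiffAt_normS (hz : z ∈ nz a) : ContDiffAt ℝ ∞ (D.normS a) z := by
  refine contDiffAt_pi.2 fun j => ContDiffAt.mul ?_ (by fun_prop)
  exact contDiffAt_scal (contDiffAt_gaugeS hz) (gaugeS_ne_zero hz) j

section deriv

variable {E : Type*} [NormedAddCommGroup E] [NormedSpace ℝ E]

lemma hasFDerivAt_zpow {f : E → ℂ} {f' : E →L[ℝ] ℂ} {x : E} (hf : HasFDerivAt f f' x) (h0 : f x ≠ 0)
    (m : ℤ) : HasFDerivAt (fun y => f y ^ m) (f x ^ m • ((m / f x : ℂ) • f')) x := by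
  have h1 := (hasDerivAt_zpow m (f x) (Or.inl h0)).hasFDerivAt.restrictScalars ℝ
  refine (h1.comp x hf).congr_fderiv ?_
  ext v
  simp only [ContinuousLinearMap.smul_apply, smul_eq_mul, ContinuousLinearMap.comp_apply,
    ContinuousLinearMap.coe_restrictScalars', ContinuousLinearMap.toSpanSingleton_apply]
  rw [zpow_sub_one₀ h0]
  field_simp

lemma hasFDerivAt_scal {G : E → ℂ^d} {G' : Fin d → E →L[ℝ] ℂ} {x : E} (hG : ∀ k, HasFDerivAt
    (fun y => G y k) (G' k) x) (h0 : ∀ k, G x k ≠ 0) (j : Fin d) : HasFDerivAt (fun y => D.scal a (G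
    y) j) (D.scal a (G x) j • ∑ k, (D.scalExp a k j / G x k : ℂ) • G' k) x := by
  classical
  have : ∀ s : Finset (Fin d), HasFDerivAt (fun y => ∏ k ∈ s, G y k ^ D.scalExp a k j)
      ((∏ k ∈ s, G x k ^ D.scalExp a k j) • ∑ k ∈ s, (D.scalExp a k j / G x k : ℂ) • G' k) x := by
    intro s
    induction s using Finset.induction_on with
    | empty => simpa using hasFDerivAt_const (1 : ℂ) x
    | insert k s hk ih =>
      simp only [Finset.prod_insert hk, Finset.sum_insert hk]
      refine ((hasFDerivAt_zpow (hG k) (h0 k) (D.scalExp a k j)).mul ih).congr_fderiv ?_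
      ext v
      simp
      ring
  exact this _

/-- The derivative of a family moved by a family in the complex torus. -/
lemma Unimodular.hasFDerivAt_scal_mul (h : D.Unimodular a) {G : E → ℂ^d} {x : E} (hG : ∀ k,
    DifferentiableAt ℝ (fun y => G y k) x) (h0 : ∀ k, G x k ≠ 0) {z : E → ℂ^d} {Z : E →L[ℝ]
    ℂ^d} (hz : HasFDerivAt z Z x) : ∃ W : E →L[ℝ] ℂ^d, HasFDerivAt (fun y j =>
    D.scal a (G y) j * z y j) W x ∧ ∀ v, ∃ α β : ℝ^d, D.proj α = 0 ∧ D.proj β = 0 ∧ (∀ j, W v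
    j = D.scal a (G x) j * (Z v j + (α j + I * β j) * z x j)) ∧ ((∀ k, (fderiv ℝ (fun y => G
    y k) x v / G x k).re = 0) → α = 0) := by
  have hz' := hasFDerivAt_pi'.1 hz
  have key := fun j => (hasFDerivAt_scal (D := D) (a := a)
    (fun k => (hG k).hasFDerivAt) h0 j).mul (hz' j)
  refine ⟨_, hasFDerivAt_pi.2 key, fun v => ⟨_, _,
    h.proj_sum_scalExp fun k => (fderiv ℝ (fun y => G y k) x v / G x k).re,
    h.proj_sum_scalExp fun k => (fderiv ℝ (fun y => G y k) x v / G x k).im, fun j => ?_, ?_⟩⟩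
  · simp only [ContinuousLinearMap.coe_pi', ContinuousLinearMap.add_apply,
      ContinuousLinearMap.smul_apply, smul_eq_mul, ContinuousLinearMap.comp_apply,
      ContinuousLinearMap.proj_apply]
    have e : ((∑ k, (fderiv ℝ (fun y => G y k) x v / G x k).re * (D.scalExp a k j : ℝ) : ℝ) : ℂ) +
        I *
          ((∑ k, (fderiv ℝ (fun y => G y k) x v / G x k).im * (D.scalExp a k j : ℝ) : ℝ) : ℂ) =
        ∑ k, (D.scalExp a k j : ℂ) / G x k * fderiv ℝ (fun y => G y k) x v := by
      push_cast
      rw [Finset.mul_sum, ← Finset.sum_add_distrib]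
      refine Finset.sum_congr rfl fun k _ => ?_
      conv_rhs => rw [div_mul_eq_mul_div, mul_div_assoc,
        ← re_add_im (fderiv ℝ (fun y => G y k) x v / G x k)]
      ring
    rw [e]
    simp only [ContinuousLinearMap.sum_apply, ContinuousLinearMap.smul_apply, smul_eq_mul]
    ring
  · intro h1
    funext j
    simp [h1]

lemma im_eq_zero_of_eventually {f : E → ℂ} {f' : E →L[ℝ] ℂ} {x : E} (hf : HasFDerivAt f f' x)
    (h : ∀ᶠ y in 𝓝 x, (f y).im = 0) (v : E) : (f' v).im = 0 := by
  have h1 := imCLM.hasFDerivAt.comp x hf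
  have h2 : HasFDerivAt (imCLM ∘ f) (0 : E →L[ℝ] ℝ) x :=
    (hasFDerivAt_const (0 : ℝ) x).congr_of_eventuallyEq (by filter_upwards [h] with y hy; simpa)
  have := DFunLike.congr_fun (h1.unique h2) v
  simpa using this

lemma re_eq_zero_of_norm_eq_one {f : E → ℂ} {f' : E →L[ℝ] ℂ} {x : E} (hf : HasFDerivAt f f' x)
    (h : ∀ᶠ y in 𝓝 x, ‖f y‖ = 1) (v : E) : (f' v / f x).re = 0 := by
  have h1 := hf.norm_sq
  have h2 : HasFDerivAt (fun y => ‖f y‖ ^ 2) (0 : E →L[ℝ] ℝ) x :=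
    (hasFDerivAt_const (1 : ℝ) x).congr_of_eventuallyEq (by
      filter_upwards [h] with y hy; simp [hy])
  have h3 := DFunLike.congr_fun (h1.unique h2) v
  have h4 : ‖f x‖ = 1 := h.self_of_nhds
  have h5 : f x ≠ 0 := fun h0 => by simp [h0] at h4
  simp [Complex.inner] at h3
  rw [div_re]
  have h6 : normSq (f x) = 1 := by rw [normSq_eq_norm_sq, h4]; norm_num
  rw [h6]
  linarith

/-- Tangent vectors of the level set. -/
lemma tangent_levelSet {z : E → ℂ^d} {Z : E →L[ℝ] ℂ^d} {x : E}
    (hz : HasFDerivAt z Z x) (hl : ∀ᶠ y in 𝓝 x, z y ∈ D.levelSet)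
    (hθ : D.proj θ = 0) (v : E) : ∑ j, θ j * (z x j * star (Z v j)).re = 0 := by
  have hz' := hasFDerivAt_pi'.1 hz
  have h1 : HasFDerivAt (fun y => ∑ j, θ j * (‖z y j‖ ^ 2 + D.bound j)) _ x :=
    HasFDerivAt.fun_sum fun j _ => ((hz' j).norm_sq.add_const (D.bound j)).const_mul (θ j)
  have h2 : HasFDerivAt (fun y => ∑ j, θ j * (‖z y j‖ ^ 2 + D.bound j)) (0 : E →L[ℝ] ℝ) x :=
    (hasFDerivAt_const (0 : ℝ) x).congr_of_eventuallyEq (by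
      filter_upwards [hl] with y hy; exact hy θ hθ)
  have h3 := DFunLike.congr_fun (h1.unique h2) v
  simp only [ContinuousLinearMap.sum_apply, ContinuousLinearMap.smul_apply, smul_eq_mul,
    ContinuousLinearMap.comp_apply, ContinuousLinearMap.proj_apply, innerSL_apply_apply,
    ContinuousLinearMap.zero_apply, Complex.inner, nsmul_eq_mul] at h3
  have h4 : ∑ j, θ j * (z x j * star (Z v j)).re =
      (1 / 2) * ∑ j, θ j * ((2 : ℕ) * (Z v j * (starRingEnd ℂ) (z x j)).re) := by
    rw [Finset.mul_sum]
    refine Finset.sum_congr rfl fun j _ => ?_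
    simp
    ring
  rw [h4, h3, mul_zero]

end deriv

end ToricData

namespace ToricData

variable {n d : ℕ} {D : ToricData n d} {a : Fin n ↪ Fin d}
variable {z p p' : ℂ^d} {u : ℂ^n} {e : OpenPartialHomeomorph D.M ℂ^n}

/-! ## The symplectic form and compatibility -/

lemma omega0_comp {x y} (hx : ∀ j ∉ range a, (x j).im = 0)
    (hy : ∀ j ∉ range a, (y j).im = 0) : omega0 (x ∘ a) (y ∘ a) = omega0 x y := by
  simp only [omega0, Function.comp]
  congr 1
  exact Fintype.sum_of_injective a a.injective (fun i => (x (a i) * star (y (a i))).im)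
    (fun j => (x j * star (y j)).im)
    (fun j hj => by simp [mul_im, hx j hj, hy j hj]) fun i => rfl

/-- Vectors tangent to the level set at `z`. -/
def Tangent (D : ToricData n d) (z x : ℂ^d) : Prop :=
  ∀ θ : ℝ^d, D.proj θ = 0 → ∑ j, θ j * (z j * star (x j)).re = 0

lemma omega0_rotated {x x' s : ℂ^d} {τ τ' : ℝ^d} (hs : ∀ j, ‖s j‖ = 1)
    (hp : D.Tangent z p) (hp' : D.Tangent z p') (hτ : D.proj τ = 0) (hτ' : D.proj τ' = 0)
    (hx : ∀ j, x j = s j * (p j + I * τ j * z j))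
    (hx' : ∀ j, x' j = s j * (p' j + I * τ' j * z j)) : omega0 x x' = omega0 p p' := by
  simp only [omega0]
  congr 1
  have key : ∀ j, (x j * star (x' j)).im = (p j * star (p' j)).im +
      τ j * (z j * star (p' j)).re - τ' j * (z j * star (p j)).re := by
    intro j
    have h1 : x j * star (x' j) = (p j + I * τ j * z j) *
        star (p' j + I * τ' j * z j) := by
      rw [hx, hx', star_mul]
      have : s j * star (s j) = 1 := by
        have := mul_conj (s j)
        rw [normSq_eq_norm_sq, hs] at this
        simpa using this
      linear_combination ((p j + I * τ j * z j) *
        star (p' j + I * τ' j * z j)) * this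
    rw [h1]
    simp
    ring
  simp only [key, Finset.sum_sub_distrib, Finset.sum_add_distrib, hp' τ hτ, hp τ' hτ']
  ring

lemma omega0_complex {q q' : ℂ^d} {α β α' β' : ℝ^d} (hp : D.Tangent z p) (hp' :
    D.Tangent z p') (hq : D.Tangent z q) (hq' : D.Tangent z q') (hα : D.proj α = 0) (hβ : D.proj β =
    0) (hα' : D.proj α' = 0) (hβ' : D.proj β' = 0) (h : ∀ j, p' j = I * p j + (α j +
    I * β j) * z j) (h' : ∀ j, q' j = I * q j + (α' j + I * β' j) * z j) :
    omega0 p' q' = omega0 p q := by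
  simp only [omega0]
  congr 1
  have key : ∀ j, (p' j * star (q' j)).im = (p j * star (q j)).im +
      α' j * (z j * star (p j)).re - α j * (z j * star (q j)).re + β j * (z j * star (q' j)).re -
      β' j * (z j * star (p' j)).re := by
    intro j
    rw [h, h']
    simp
    ring
  simp only [key, Finset.sum_sub_distrib, Finset.sum_add_distrib, hp α' hα', hq α hα, hq' β hβ,
    hp' β' hβ']
  ring

lemma omega0_complex_self {α β : ℝ^d} (hp : D.Tangent z p) (hp' : D.Tangent z p') (hα : D.proj
    α = 0) (hβ : D.proj β = 0) (h : ∀ j, p' j = I * p j + (α j + I * β j) * z j) :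
    omega0 p' p = (1 / Real.pi) * ∑ j, ‖p j - I * α j * z j‖ ^ 2 := by
  simp only [omega0]
  congr 1
  have key : ∀ j, (p' j * star (p j)).im = ‖p j - I * α j * z j‖ ^ 2 +
      β j * (z j * star (p j)).re - α j * (z j * star (p' j)).re := by
    intro j
    rw [← normSq_eq_norm_sq, normSq_apply, h]
    simp
    ring
  simp only [key, Finset.sum_sub_distrib, Finset.sum_add_distrib, hp β hβ, hp' α hα]
  ring

lemma eventually_nz {E : Type*} [TopologicalSpace E] {z : E → ℂ^d} {x : E} (hz : ContinuousAt
    z x) (hx : z x ∈ nz a) : ∀ᶠ y in 𝓝 x, z y ∈ nz a :=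
  hz.eventually_mem ((isOpen_nz a).mem_nhds hx)

section deriv

variable {E : Type*} [NormedAddCommGroup E] [NormedSpace ℝ E]

lemma Unimodular.hasFDerivAt_normS (h : D.Unimodular a) {z : E → ℂ^d} {Z : E →L[ℝ] (Fin d →
    ℂ)} {x : E} (hz : HasFDerivAt z Z x) (hl : ∀ᶠ y in 𝓝 x, z y ∈ D.levelSet) (hx : z x ∈ nz a) : ∃
    T : E →L[ℝ] ℂ^n, HasFDerivAt (fun y => D.normS a (z y) ∘ a) T x ∧ ∀ v v', omega0 (T v)
    (T v') = omega0 (Z v) (Z v') := by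
  have hdiff : ∀ k, DifferentiableAt ℝ (fun y => gaugeS a (z y) k) x := fun k =>
    ((contDiffAt_gaugeS hx k).differentiableAt (by simp)).comp x hz.differentiableAt
  obtain ⟨W, hW, hW'⟩ := h.hasFDerivAt_scal_mul hdiff (gaugeS_ne_zero hx) hz
  have hW₀ := hasFDerivAt_pi'.1 hW
  refine ⟨_, hasFDerivAt_pi.2 fun i => hW₀ (a i), fun v v' => ?_⟩
  have him : ∀ v, ∀ j ∉ range a, (W v j).im = 0 := by
    intro v j hj
    refine im_eq_zero_of_eventually (hW₀ j) ?_ v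
    filter_upwards [eventually_nz hz.continuousAt hx] with y hy
    change (D.normS a (z y) j).im = 0
    rw [normS_of_notMem hy hj, ofReal_im]
  have hre : ∀ v k, (fderiv ℝ (fun y => gaugeS a (z y) k) x v / gaugeS a (z x) k).re = 0 := by
    intro v k
    refine re_eq_zero_of_norm_eq_one (hdiff k).hasFDerivAt ?_ v
    filter_upwards [eventually_nz hz.continuousAt hx] with y hy
    exact norm_gaugeS hy k
  have h1 : ∀ v, (ContinuousLinearMap.pi fun i => ContinuousLinearMap.proj (a i) ∘SL W) v =
      (W v) ∘ a := fun v => rfl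
  rw [h1, h1, omega0_comp (him v) (him v')]
  obtain ⟨t, _, ht⟩ := h.scal_mem_N (norm_gaugeS hx)
  obtain ⟨α, β, hα, hβ, e, e'⟩ := hW' v
  obtain ⟨γ, δ, hγ, hδ, f, f'⟩ := hW' v'
  have hα0 := e' (hre v)
  have hγ0 := f' (hre v')
  refine omega0_rotated (D := D) (z := z x) (s := fun j => (t j : ℂ))
    (fun j => Circle.norm_coe _) (fun θ hθ => tangent_levelSet hz hl hθ v)
    (fun θ hθ => tangent_levelSet hz hl hθ v') hβ hδ (fun j => ?_) (fun j => ?_)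
  · rw [e, ht, hα0]; simp
  · rw [f, ht, hγ0]; simp

end deriv

/-! ## Symplectic charts -/

/-- The image of the symplectic chart attached to `a`. -/
def symTarget (D : ToricData n d) (a : Fin n ↪ Fin d) : Set ℂ^n :=
  {u | ∀ j ∉ range a, 0 < D.height a u j}

/-- The slice parametrized by the symplectic chart attached to `a`. -/
def sig (D : ToricData n d) (a : Fin n ↪ Fin d) (u : ℂ^n) : ℂ^d :=
  extend a u fun j => ((√(D.height a u j) : ℝ) : ℂ)

lemma sig_self (D : ToricData n d) (a : Fin n ↪ Fin d) (u : ℂ^n) (i : Fin n) :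
    D.sig a u (a i) = u i :=
  a.injective.extend_apply _ _ _

lemma sig_comp (D : ToricData n d) (a) (u) : D.sig a u ∘ a = u :=
  funext fun i => D.sig_self a u i

lemma sig_of_notMem (u : ℂ^n) {j : Fin d} (hj : j ∉ range a) :
    D.sig a u j = (√(D.height a u j) : ℝ) :=
  extend_apply' _ _ _ fun ⟨i, hi⟩ => hj ⟨i, hi⟩

lemma sig_mem_nz (hu : u ∈ D.symTarget a) : D.sig a u ∈ nz a := by
  intro j hj
  rw [sig_of_notMem u hj]
  exact_mod_cast (sqrt_pos.2 (hu j hj)).ne'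

lemma Unimodular.sig_mem_levelSet (h : D.Unimodular a)
    (hu : u ∈ D.symTarget a) : D.sig a u ∈ D.levelSet := by
  refine h.mem_levelSet_of fun j => ?_
  rw [sig_comp]
  by_cases hj : j ∈ range a
  · obtain ⟨k, rfl⟩ := hj
    rw [h.height_self, sig_self]
  · rw [sig_of_notMem u hj, norm_real, norm_eq_abs, sq_abs,
      sq_sqrt (hu j hj).le]

lemma Unimodular.normS_sig (h : D.Unimodular a)
    (hu : u ∈ D.symTarget a) : D.normS a (D.sig a u) = D.sig a u :=
  h.normS_eq_self fun j hj => ⟨_, sqrt_pos.2 (hu j hj), sig_of_notMem u hj⟩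

lemma Unimodular.comp_mem_symTarget (h : D.Unimodular a)
    (hz : z ∈ D.levelSet) (hz' : z ∈ nz a) : z ∘ a ∈ D.symTarget a := by
  intro j hj
  rw [← h.norm_sq_eq hz]
  exact pow_pos (norm_pos_iff.2 (hz' j hj)) 2

lemma Unimodular.sig_comp_self (h : D.Unimodular a) (hz : z ∈ D.levelSet) (h1 : ∀ j ∉ range a, ∃ r :
    ℝ, 0 < r ∧ z j = r) : D.sig a (z ∘ a) = z := by
  funext j
  by_cases hj : j ∈ range a
  · obtain ⟨k, rfl⟩ := hj
    rw [sig_self]; rfl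
  · obtain ⟨r, hr, h2⟩ := h1 j hj
    rw [sig_of_notMem _ hj, ← h.norm_sq_eq hz, sqrt_sq (norm_nonneg _), h2,
      norm_real, norm_eq_abs, abs_of_pos hr]

lemma Unimodular.sig_normS (h : D.Unimodular a)
    (hz : z ∈ D.levelSet) (hz' : z ∈ nz a) : D.sig a (D.normS a z ∘ a) = D.normS a z := by
  refine h.sig_comp_self ?_ fun j hj => ⟨_, norm_pos_iff.2 (hz' j hj), normS_of_notMem hz' hj⟩
  obtain ⟨t, _, ht⟩ := h.exists_normS hz'
  rw [ht]
  exact D.rot_mem_levelSet.2 hz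

lemma Unimodular.normS_mem_levelSet (h : D.Unimodular a)
    (hz : z ∈ D.levelSet) (hz' : z ∈ nz a) : D.normS a z ∈ D.levelSet := by
  obtain ⟨t, _, ht⟩ := h.exists_normS hz'
  rw [ht]
  exact D.rot_mem_levelSet.2 hz

lemma Unimodular.normS_mem_nz (h : D.Unimodular a) (hz' : z ∈ nz a) : D.normS a z ∈ nz a := by
  obtain ⟨t, _, ht⟩ := h.exists_normS hz'
  rw [ht]
  exact rot_mem_nz.2 hz'

lemma contDiff_height (D : ToricData n d) (a) (j : Fin d) :
    ContDiff ℝ ∞ fun u => D.height a u j := by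
  unfold height
  refine ContDiff.sub (ContDiff.sum fun i _ => ContDiff.mul contDiff_const
    (ContDiff.add ?_ contDiff_const)) contDiff_const
  exact ContDiff.norm_sq ℝ (by fun_prop)

lemma isOpen_symTarget (D : ToricData n d) (a : Fin n ↪ Fin d) : IsOpen (D.symTarget a) := by
  have : D.symTarget a = ⋂ j, ⋂ _ : j ∉ range a, {u : ℂ^n | 0 < D.height a u j} := by
    ext; simp [symTarget]
  rw [this]
  exact isOpen_iInter_of_finite fun j => isOpen_iInter_of_finite fun _ =>
    isOpen_lt continuous_const (D.contDiff_height a j).continuous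

lemma contDiffAt_sig (hu : u ∈ D.symTarget a) : ContDiffAt ℝ ∞ (D.sig a) u := by
  refine contDiffAt_pi.2 fun j => ?_
  by_cases hj : j ∈ range a
  · obtain ⟨k, rfl⟩ := hj
    simp only [sig_self]
    fun_prop
  · simp only [sig_of_notMem _ hj]
    refine ofRealCLM.contDiff.contDiffAt.comp u ?_
    exact (D.contDiff_height a j).contDiffAt.sqrt (hu j hj).ne'

section charts

variable [Nonempty D.M]

/-- The symplectic chart attached to `a`. -/
def Unimodular.symChart (h : D.Unimodular a) : OpenPartialHomeomorph D.M ℂ^n where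
  toFun m := D.normS a (D.outM m) ∘ a
  invFun u := D.mkM (D.sig a u)
  source := {m | ∃ z, D.RepM z m ∧ ∀ j ∉ range a, z j ≠ 0}
  target := D.symTarget a
  map_source' := by
    rintro m ⟨z, hm, hz⟩
    obtain ⟨t, ht, ho⟩ := hm.exists_rot D (D.repM_outM m)
    have hn : D.outM m ∈ nz a := by rw [ho]; exact rot_mem_nz.2 hz
    exact h.comp_mem_symTarget (h.normS_mem_levelSet (D.outM_mem m) hn) (h.normS_mem_nz hn)
  map_target' := fun u hu => ⟨_, D.repM_mkM (h.sig_mem_levelSet hu), sig_mem_nz hu⟩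
  left_inv' := by
    rintro m ⟨z, hm, hz⟩
    obtain ⟨t, ht, ho⟩ := hm.exists_rot D (D.repM_outM m)
    have hn : D.outM m ∈ nz a := by rw [ho]; exact rot_mem_nz.2 hz
    rw [h.sig_normS (D.outM_mem m) hn]
    obtain ⟨t, ht, h'⟩ := h.exists_normS hn
    rw [h', D.mkM_rot (D.outM_mem m) ht, D.mkM_outM]
  right_inv' := by
    intro u hu
    obtain ⟨t, ht, h'⟩ := D.exists_outM_mkM (h.sig_mem_levelSet hu)
    rw [h', h.normS_rot (sig_mem_nz hu) ht, h.normS_sig hu, sig_comp]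
  open_source := D.isOpen_image_mk (isOpen_nz a)
  open_target := D.isOpen_symTarget a
  continuousOn_toFun := by
    have hnz : ∀ z ∈ D.levelSet,
        D.mkM z ∈ {m | ∃ z, D.RepM z m ∧ ∀ j ∉ range a, z j ≠ 0} → z ∈ nz a := by
      rintro z hz ⟨w, hw, hw'⟩
      obtain ⟨t, ht, ho⟩ := hw.exists_rot D (D.repM_mkM hz)
      rw [ho]
      exact rot_mem_nz.2 hw'
    refine D.continuousOn_comp_outM (g := fun z => D.normS a z ∘ a)
      (D.isOpen_image_mk (isOpen_nz a)) ?_ ?_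
    · intro z hz
      have := (contDiffAt_normS (D := D) (hnz z hz.1 hz.2)).continuousAt
      refine ContinuousAt.continuousWithinAt ?_
      exact continuousAt_pi.2 fun i => (continuous_apply (a i)).continuousAt.comp this
    · intro z hz hm t ht
      rw [h.normS_rot (hnz z hz hm) ht]
  continuousOn_invFun := D.continuousOn_mkM.comp
    (fun u hu => (contDiffAt_sig hu).continuousAt.continuousWithinAt)
    fun u hu => h.sig_mem_levelSet hu

lemma Unimodular.isSymplecticChart_symChart (h : D.Unimodular a) :
    D.IsSymplecticChart a h.symChart := by
  refine ⟨rfl, ?_⟩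
  rintro m ⟨z, hm, hz⟩
  obtain ⟨t, ht, ho⟩ := hm.exists_rot D (D.repM_outM m)
  have hn : D.outM m ∈ nz a := by rw [ho]; exact rot_mem_nz.2 hz
  refine ⟨D.normS a (D.outM m), ?_, fun j hj => ?_, rfl⟩
  · obtain ⟨t, ht, h'⟩ := h.exists_normS hn
    rw [h']
    exact (D.repM_outM m).rot D ht
  · exact ⟨_, norm_pos_iff.2 (hn j hj), normS_of_notMem hn hj⟩

end charts

section charts

variable {e : OpenPartialHomeomorph D.M ℂ^n}

lemma IsSymplecticChart.mem_source (he : D.IsSymplecticChart a e) {m}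
    (hm : D.RepM z m) : m ∈ e.source ↔ z ∈ nz a := by
  rw [he.1]
  constructor
  · rintro ⟨w, hw, hw'⟩
    obtain ⟨t, ht, ho⟩ := hw.exists_rot D hm
    rw [ho]
    exact rot_mem_nz.2 hw'
  · exact fun h => ⟨z, hm, h⟩

lemma IsSymplecticChart.apply (he : D.IsSymplecticChart a e) (h : D.Unimodular a)
    {m} (hm : D.RepM z m) (hz : z ∈ nz a) : e m = D.normS a z ∘ a := by
  obtain ⟨w, hw, hw', hwe⟩ := he.2 m ((he.mem_source hm).2 hz)
  obtain ⟨t, ht, ho⟩ := hm.exists_rot D hw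
  rw [hwe, h.normS_unique ht fun j hj => by rw [← ho]; exact hw' j hj, ho]

lemma IsSymplecticChart.target_eq (he : D.IsSymplecticChart a e) (h : D.Unimodular a) :
    e.target = D.symTarget a := by
  ext u
  constructor
  · intro hu
    obtain ⟨w, hw, hw', hwe⟩ := he.2 _ (e.map_target hu)
    rw [e.right_inv hu] at hwe
    rw [hwe]
    exact h.comp_mem_symTarget hw.1 ((he.mem_source hw).1 (e.map_target hu))
  · intro hu
    have : Nonempty D.M := D.nonempty_levelSet_iff.1 ⟨_, h.sig_mem_levelSet hu⟩
    have h1 := D.repM_mkM (h.sig_mem_levelSet hu)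
    have h2 := e.map_source ((he.mem_source h1).2 (sig_mem_nz hu))
    rwa [he.apply h h1 (sig_mem_nz hu), h.normS_sig hu, sig_comp] at h2

lemma IsSymplecticChart.symm_apply (he : D.IsSymplecticChart a e) (h : D.Unimodular a)
    (hu : u ∈ e.target) : D.RepM (D.sig a u) (e.symm u) := by
  obtain ⟨w, hw, hw', hwe⟩ := he.2 _ (e.map_target hu)
  rw [e.right_inv hu] at hwe
  have h1 : D.sig a u = w := by rw [hwe]; exact h.sig_comp_self hw.1 hw'
  rw [h1]
  exact hw

end charts

/-- Symplectic charts are compatible with maps of the ambient space: the derivative of a family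
of classes read in a chart. -/
lemma IsSymplecticChart.contDiffAt_apply (he : D.IsSymplecticChart a e) (h : D.Unimodular a) {E :
    Type*} [NormedAddCommGroup E] [NormedSpace ℝ E] {z : E → ℂ^d} {x : E} {F : E → D.M} (hz :
    ContDiffAt ℝ ∞ z x) (hF : ∀ᶠ y in 𝓝 x, D.RepM (z y) (F y)) (hx : z x ∈ nz a) : ContDiffAt ℝ ∞
    (fun y => e (F y)) x := by
  have h1 : ContDiffAt ℝ ∞ (fun y => D.normS a (z y)) x := (contDiffAt_normS hx).comp x hz
  refine (contDiffAt_pi.2 fun i => (contDiffAt_pi.1 h1 (a i))).congr_of_eventuallyEq ?_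
  filter_upwards [hF, eventually_nz hz.continuousAt hx] with y hy hy'
  rw [he.apply h hy hy']
  rfl

lemma IsSymplecticChart.omega_apply (he : D.IsSymplecticChart a e) (h : D.Unimodular a) {E : Type*}
    [NormedAddCommGroup E] [NormedSpace ℝ E] {z : E → ℂ^d} {x : E} {F : E → D.M} {Z : E →L[ℝ]
    ℂ^d} (hz : HasFDerivAt z Z x) (hF : ∀ᶠ y in 𝓝 x, D.RepM (z y) (F y)) (hx : z x ∈ nz a)
    (v v' : E) : omega0 (fderiv ℝ (fun y => e (F y)) x v) (fderiv ℝ (fun y => e (F y)) x v') =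
    omega0 (Z v) (Z v') := by
  obtain ⟨T, hT, hT'⟩ := h.hasFDerivAt_normS hz (hF.mono fun y hy => hy.1) hx
  have : HasFDerivAt (fun y => e (F y)) T x := by
    refine hT.congr_of_eventuallyEq ?_
    filter_upwards [hF, eventually_nz hz.continuousAt hx] with y hy hy'
    exact he.apply h hy hy'
  rw [this.fderiv, hT']

lemma hasFDerivAt_sig (hu : u ∈ D.symTarget a) : ∃ Z : ℂ^n →L[ℝ] ℂ^d, HasFDerivAt
    (D.sig a) Z u ∧ (∀ v i, Z v (a i) = v i) ∧ (∀ v, ∀ j ∉ range a, (Z v j).im = 0) ∧ ∀ v v', omega0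
    (Z v) (Z v') = omega0 v v' := by
  have hd := ((contDiffAt_sig hu).differentiableAt (by simp)).hasFDerivAt
  have hd' := hasFDerivAt_pi'.1 hd
  have him : ∀ v, ∀ j ∉ range a, (fderiv ℝ (D.sig a) u v j).im = 0 := fun v j hj =>
    im_eq_zero_of_eventually (hd' j)
      (Filter.Eventually.of_forall fun y => by rw [sig_of_notMem _ hj, ofReal_im]) v
  have hself : ∀ v i, fderiv ℝ (D.sig a) u v (a i) = v i := by
    intro v i
    have h1 : HasFDerivAt (fun y : ℂ^n => D.sig a y (a i))
        (ContinuousLinearMap.proj (R := ℝ) i) u := by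
      simp only [sig_self]
      exact (ContinuousLinearMap.proj (R := ℝ) (φ := fun _ : Fin n => ℂ) i).hasFDerivAt
    exact DFunLike.congr_fun ((hd' (a i)).unique h1) v
  refine ⟨_, hd, hself, him, fun v v' => ?_⟩
  rw [← omega0_comp (him v) (him v')]
  congr 1
  · funext i; exact hself v i
  · funext i; exact hself v' i

lemma IsSymplecticChart.eventually_symm (he : D.IsSymplecticChart a e) (h : D.Unimodular a) (hu : u
    ∈ e.target) : ∀ᶠ y in 𝓝 u, D.RepM (D.sig a y) (e.symm y) := by
  filter_upwards [e.open_target.mem_nhds hu] with y hy using he.symm_apply h hy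

lemma isSymplecticAtlasOn (hU : ∀ a, D.Admissible a → D.Unimodular a) {S : Set D.M}
    (hS : ∀ z m, D.RepM z m → (m ∉ S ↔ ∃ a, D.Admissible a ∧ z ∈ nz a)) :
    IsSymplecticAtlasOn D.symplecticCharts Sᶜ := by
  have hmem : ∀ {a b} {e e' : OpenPartialHomeomorph D.M ℂ^n}, D.Admissible a →
      D.Admissible b → D.IsSymplecticChart a e → D.IsSymplecticChart b e' →
      ∀ u ∈ (e.symm ≫ₕ e').source, u ∈ e.target ∧ u ∈ D.symTarget a ∧ D.sig a u ∈ nz b := by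
    intro a b e e' ha hb he he' u hu
    rw [trans_source] at hu
    have h1 : u ∈ e.target := hu.1
    exact ⟨h1, (he.target_eq (hU a ha)) ▸ h1,
      (he'.mem_source (he.symm_apply (hU a ha) h1)).1 hu.2⟩
  have hsm : ∀ e ∈ D.symplecticCharts, ∀ e' ∈ D.symplecticCharts,
      ContDiffOn ℝ ∞ (e.symm ≫ₕ e') (e.symm ≫ₕ e').source := by
    rintro e ⟨a, ha, he⟩ e' ⟨b, hb, he'⟩ u hu
    obtain ⟨h1, h2, h3⟩ := hmem ha hb he he' u hu
    exact (he'.contDiffAt_apply (hU b hb) (contDiffAt_sig h2)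
      (he.eventually_symm (hU a ha) h1) h3).contDiffWithinAt
  refine ⟨⟨?_, ?_⟩, ?_⟩
  · refine Set.ext fun m => ?_
    obtain ⟨z, hz⟩ := D.exists_repM m
    simp only [mem_iUnion, mem_compl_iff, exists_prop]
    rw [hS z m hz]
    constructor
    · rintro ⟨e, ⟨a, ha, he⟩, hm⟩
      exact ⟨a, ha, (he.mem_source hz).1 hm⟩
    · rintro ⟨a, ha, hza⟩
      have : Nonempty D.M := ⟨m⟩
      exact ⟨_, ⟨a, ha, (hU a ha).isSymplecticChart_symChart⟩,
        ((hU a ha).isSymplecticChart_symChart.mem_source hz).2 hza⟩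
  · intro e he e' he'
    rw [contDiffGroupoid, mem_groupoid_of_pregroupoid]
    simp only [contDiffPregroupoid, modelWithCornersSelf_coe, modelWithCornersSelf_coe_symm,
      comp_id, id_comp, range_id, inter_univ, preimage_id]
    exact ⟨hsm e he e' he', hsm e' he' e he⟩
  · rintro e ⟨a, ha, he⟩ e' ⟨b, hb, he'⟩ u hu v w
    obtain ⟨h1, h2, h3⟩ := hmem ha hb he he' u hu
    obtain ⟨Z, hZ, -, -, hω⟩ := hasFDerivAt_sig h2
    exact (he'.omega_apply (hU b hb) hZ (he.eventually_symm (hU a ha) h1) h3 v w).trans (hω v w)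

end ToricData

namespace ToricData

variable {n d : ℕ} {D : ToricData n d} {a : Fin n ↪ Fin d}
variable {m : D.M} {x : D.X} {z w s : ℂ^d}

/-! ## The complex quotient -/

/-- Scaling by `exp θ`. -/
def dil (θ : ℝ^d) (z : ℂ^d) : ℂ^d := fun j => (Real.exp (θ j) : ℂ) * z j

lemma dil_zero (z : ℂ^d) : dil 0 z = z := by funext j; simp [dil]

/-- The orbit of `z` under `exp(i𝔫)` in `ℂᵈ`. -/
def orbit (D : ToricData n d) (z : ℂ^d) : Set ℂ^d :=
  {w | ∃ θ, D.proj θ = 0 ∧ w = dil θ z}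

lemma mem_orbit_self (D : ToricData n d) (z : ℂ^d) : z ∈ D.orbit z :=
  ⟨0, map_zero _, (dil_zero z).symm⟩

lemma isOpen_stable (D : ToricData n d) : IsOpen D.stable := by
  have : D.stable = ⋃ μ ∈ D.polyhedron, ⋂ j, ⋂ _ : j ∉ D.active μ, {z : ℂ^d | z j ≠ 0} := by
    ext; simp [stable]
  rw [this]
  exact isOpen_biUnion fun μ _ => isOpen_iInter_of_finite fun j => isOpen_iInter_of_finite fun _ =>
    isOpen_ne_fun (by fun_prop) continuous_const

lemma image_orbitA (z : D.stable) : Subtype.val '' D.orbitA z = D.orbit z := by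
  have hs : ∀ x : ℝ, Complex.exp (2 * Real.pi * I * (I * (x : ℂ))) =
      (Real.exp (-(2 * Real.pi * x)) : ℂ) := by
    intro x
    rw [ofReal_exp]
    congr 1
    push_cast
    linear_combination (2 * Real.pi * x : ℂ) * I_mul_I
  ext w
  constructor
  · rintro ⟨w, ⟨θ, hθ, h⟩, rfl⟩
    refine ⟨-((2 * Real.pi) • θ), by simp [hθ], ?_⟩
    funext j
    rw [h, hs]
    simp [dil]
  · rintro ⟨θ, hθ, rfl⟩
    obtain ⟨μ, hμ, h⟩ := z.2
    refine ⟨⟨dil θ z, μ, hμ, fun j hj => mul_ne_zero (by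
      exact_mod_cast (exp_pos _).ne') (h j hj)⟩, ⟨-((2 * Real.pi)⁻¹ • θ), by simp [hθ], ?_⟩,
      rfl⟩
    intro j
    rw [hs]
    simp only [dil, Pi.neg_apply, Pi.smul_apply, smul_eq_mul]
    congr 3
    field_simp

lemma mem_closure_orbitA {z w : D.stable} :
    w ∈ closure (D.orbitA z) ↔ (w : ℂ^d) ∈ closure (D.orbit z) := by
  rw [closure_subtype, image_orbitA]

lemma rel_iff_closure {z w : D.stable} : D.rel z w ↔ ∃ a ∈ D.stable, ∃ b ∈ D.stable, ∃ t ∈ D.N,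
    a ∈ closure (D.orbit z) ∧ b ∈ closure (D.orbit w) ∧ b = rot t a := by
  constructor
  · rintro ⟨a, ha, b, hb, t, ht, h⟩
    exact ⟨a, a.2, b, b.2, t, ht, mem_closure_orbitA.1 ha, mem_closure_orbitA.1 hb, h⟩
  · rintro ⟨a, ha, b, hb, t, ht, h1, h2, h⟩
    exact ⟨⟨a, ha⟩, mem_closure_orbitA.2 h1, ⟨b, hb⟩, mem_closure_orbitA.2 h2, t, ht, h⟩

lemma IsNC.mul_mem_stable (hs : D.IsNC s) (hz : z ∈ D.stable) :
    (fun j => s j * z j) ∈ D.stable := by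
  obtain ⟨μ, hμ, h⟩ := hz
  exact ⟨μ, hμ, fun j hj => mul_ne_zero (hs.ne_zero j) (h j hj)⟩

lemma IsNC.mul_mem_polystable (hs : D.IsNC s) (hz : z ∈ D.polystable) :
    (fun j => s j * z j) ∈ D.polystable := by
  obtain ⟨μ, hμ, h⟩ := hz
  exact ⟨μ, hμ, fun j => by rw [← h j]; simp [hs.ne_zero j]⟩

/-- A retraction of the stable points to the level set along closures of `exp(i𝔫)`-orbits. -/
structure IsRetraction (D : ToricData n d) (r : ℂ^d → ℂ^d) : Prop where
  continuousOn : ContinuousOn r D.stable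
  mem : ∀ z ∈ D.stable, r z ∈ D.levelSet
  closure : ∀ z ∈ D.stable, r z ∈ closure (D.orbit z)
  dil : ∀ z ∈ D.stable, ∀ θ, D.proj θ = 0 → r (dil θ z) = r z
  rot : ∀ z ∈ D.stable, ∀ t ∈ D.N, r (rot t z) = rot t (r z)
  self : ∀ z ∈ D.levelSet, r z = z
  ne_zero : ∀ z ∈ D.polystable, ∀ j, z j ≠ 0 → r z j ≠ 0

lemma levelSet_subset_stable (D : ToricData n d) : D.levelSet ⊆ D.stable :=
  D.level_sub_polystable.trans D.polystable_sub_stable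

variable {r : ℂ^d → ℂ^d}

lemma IsRetraction.closure_eq (hr : D.IsRetraction r) (hz : z ∈ D.stable)
    (hw : w ∈ D.stable) (h : w ∈ _root_.closure (D.orbit z)) : r w = r z := by
  have h1 : ContinuousAt r w := hr.continuousOn.continuousAt (D.isOpen_stable.mem_nhds hw)
  have h2 : r w ∈ _root_.closure (r '' D.orbit z) :=
    mem_closure_image h1 h
  have h3 : r '' D.orbit z ⊆ {r z} := by
    rintro _ ⟨_, ⟨θ, hθ, rfl⟩, rfl⟩
    exact hr.dil z hz θ hθ
  simpa using closure_mono h3 h2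

lemma IsRetraction.rel_iff (hr : D.IsRetraction r) {z w : D.stable} :
    D.rel z w ↔ ∃ t ∈ D.N, r w = ToricData.rot t (r z) := by
  rw [rel_iff_closure]
  constructor
  · rintro ⟨x, hx, y, hy, t, ht, h1, h2, h⟩
    refine ⟨t, ht, ?_⟩
    rw [← hr.closure_eq z.2 hx h1, ← hr.closure_eq w.2 hy h2, h, hr.rot x hx t ht]
  · rintro ⟨t, ht, h⟩
    exact ⟨r z, D.levelSet_subset_stable (hr.mem _ z.2), r w,
      D.levelSet_subset_stable (hr.mem _ w.2), t, ht, hr.closure _ z.2, hr.closure _ w.2, h⟩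

lemma IsRetraction.equivalence (hr : D.IsRetraction r) : Equivalence D.rel := by
  constructor
  · intro z
    rw [hr.rel_iff]
    exact ⟨1, D.N.one_mem, by rw [rot_one]⟩
  · intro z w
    rw [hr.rel_iff, hr.rel_iff]
    rintro ⟨t, ht, h⟩
    exact ⟨t⁻¹, D.N.inv_mem ht, by rw [h, ← rot_mul]; simp [rot_one]⟩
  · intro z w y
    rw [hr.rel_iff, hr.rel_iff, hr.rel_iff]
    rintro ⟨t, ht, h⟩ ⟨s, hs, h'⟩
    exact ⟨s * t, D.N.mul_mem hs ht, by rw [h', h, rot_mul]⟩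

/-- The quotient map of `X`. -/
def clsX (D : ToricData n d) (z : D.stable) : D.X := Quot.mk D.rel z

lemma IsRetraction.clsX_eq_iff (hr : D.IsRetraction r) {z w : D.stable} :
    D.clsX z = D.clsX w ↔ ∃ t ∈ D.N, r w = ToricData.rot t (r z) := by
  rw [← hr.rel_iff]
  exact Quot.eq.trans hr.equivalence.eqvGen_iff

lemma continuous_clsX (D : ToricData n d) : Continuous D.clsX := continuous_quot_mk

lemma chi_cls (z : D.levelSet) : D.chi (D.cls z) = D.clsX ⟨z, D.levelSet_subset_stable z.2⟩ :=
  rfl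

lemma continuous_chi (D : ToricData n d) : Continuous D.chi := by
  rw [D.isOpenQuotientMap_cls.continuous_comp_iff.symm]
  exact D.continuous_clsX.comp (continuous_subtype_val.subtype_mk _)

/-- The inverse of `χ`. -/
def IsRetraction.chiInv (hr : D.IsRetraction r) : D.X → D.M :=
  Quot.lift (fun z : D.stable => D.cls ⟨r z, hr.mem z z.2⟩) fun z w h => by
    obtain ⟨t, ht, h'⟩ := hr.rel_iff.1 h
    exact cls_eq_iff.2 ⟨t, ht, h'⟩

lemma IsRetraction.chiInv_clsX (hr : D.IsRetraction r) (z : D.stable) :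
    hr.chiInv (D.clsX z) = D.cls ⟨r z, hr.mem z z.2⟩ := rfl

lemma clsX_surjective (D : ToricData n d) : Surjective D.clsX := Quot.mk_surjective

/-- The homeomorphism `χ : M ≃ X`. -/
def IsRetraction.homeo (hr : D.IsRetraction r) : D.M ≃ₜ D.X where
  toFun := D.chi
  invFun := hr.chiInv
  left_inv m := by
    obtain ⟨z, rfl⟩ := D.cls_surjective m
    rw [chi_cls, hr.chiInv_clsX]
    congr 1
    exact Subtype.ext (hr.self z z.2)
  right_inv x := by
    obtain ⟨z, rfl⟩ := D.clsX_surjective x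
    rw [hr.chiInv_clsX, chi_cls, hr.clsX_eq_iff]
    exact ⟨1, D.N.one_mem, by rw [rot_one, hr.self _ (hr.mem z z.2)]⟩
  continuous_toFun := D.continuous_chi
  continuous_invFun := by
    refine continuous_quot_lift _ (D.continuous_cls.comp ?_)
    exact (continuousOn_iff_continuous_domRestrict.1 hr.continuousOn).subtype_mk _

lemma IsRetraction.homeo_apply (hr : D.IsRetraction r) (m) : hr.homeo m = D.chi m := rfl

lemma RepM.repX (h : D.RepM z m) : D.RepX z (D.chi m) := by
  obtain ⟨hz, rfl⟩ := h
  exact ⟨D.levelSet_subset_stable hz, rfl⟩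

lemma exists_repX (x) : ∃ z, D.RepX z x := by
  obtain ⟨z, rfl⟩ := D.clsX_surjective x
  exact ⟨z, z.2, rfl⟩

lemma IsRetraction.repM_symm (hr : D.IsRetraction r)
    (h : D.RepX z x) : D.RepM (r z) (hr.homeo.symm x) := by
  obtain ⟨hz, rfl⟩ := h
  exact ⟨hr.mem z hz, rfl⟩

lemma IsRetraction.repX_iff (hr : D.IsRetraction r)
    (h : D.RepX z x) : D.RepX w x ↔ w ∈ D.stable ∧ ∃ t ∈ D.N, r w = ToricData.rot t (r z) := by
  obtain ⟨hz, rfl⟩ := h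
  constructor
  · rintro ⟨hw, e⟩
    exact ⟨hw, hr.clsX_eq_iff.1 e⟩
  · rintro ⟨hw, e⟩
    exact ⟨hw, (hr.clsX_eq_iff (z := ⟨z, hz⟩) (w := ⟨w, hw⟩)).2 e⟩

lemma RepX.mul (h : D.RepX z x) (hs : D.IsNC s) : D.RepX (fun j => s j * z j) x := by
  obtain ⟨hz, rfl⟩ := h
  refine ⟨hs.mul_mem_stable hz, Quot.sound (rel_iff_closure.2 ?_)⟩
  obtain ⟨t, ht, θ, hθ, h⟩ := hs
  refine ⟨ToricData.dil θ z, (isNC_exp hθ).mul_mem_stable hz, _,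
    IsNC.mul_mem_stable ⟨t, ht, θ, hθ, h⟩ hz, t, ht, subset_closure ⟨θ, hθ, rfl⟩,
    subset_closure (D.mem_orbit_self _), ?_⟩
  funext j
  simp only [h, ToricData.dil, ToricData.rot]
  ring

lemma RepX.closure (h : D.RepX z x) (hw : w ∈ D.stable)
    (hc : w ∈ closure (D.orbit z)) : D.RepX w x := by
  obtain ⟨hz, rfl⟩ := h
  exact ⟨hw, Quot.sound (rel_iff_closure.2 ⟨w, hw, w, hw, 1, D.N.one_mem, hc,
    subset_closure (D.mem_orbit_self _), (rot_one w).symm⟩)⟩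

lemma RepX.unique {y} (h : D.RepX z x) (h' : D.RepX z y) : x = y := by
  obtain ⟨_, rfl⟩ := h
  obtain ⟨_, rfl⟩ := h'
  rfl

/-- A continuous `exp(i𝔫)`-invariant function takes the same value at `z` and `r z`. -/
lemma eq_of_mem_closure_orbit {Y : Type*} [TopologicalSpace Y] [T1Space Y]
    {g : ℂ^d → Y} (hw : w ∈ closure (D.orbit z))
    (hg : ContinuousAt g w) (hi : ∀ θ, D.proj θ = 0 → g (dil θ z) = g z) : g w = g z := by
  have h2 : g w ∈ _root_.closure (g '' D.orbit z) := mem_closure_image hg hw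
  have h3 : g '' D.orbit z ⊆ {g z} := by
    rintro _ ⟨_, ⟨θ, hθ, rfl⟩, rfl⟩
    exact hi θ hθ
  simpa using closure_mono h3 h2

lemma Unimodular.normC_closure (h : D.Unimodular a) (hw : w ∈ closure (D.orbit z)) (hz : z ∈ nz a)
    (hw' : w ∈ nz a) : D.normC a w = D.normC a z :=
  eq_of_mem_closure_orbit hw (contDiffAt_normC hw').continuousAt fun θ hθ =>
    h.normC_smul hz (isNC_exp hθ)

lemma IsRetraction.mem_nz (hr : D.IsRetraction r) (hz : z ∈ D.polystable)
    (hz' : z ∈ nz a) : r z ∈ nz a := fun j hj => hr.ne_zero z hz j (hz' j hj)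

lemma IsRetraction.normC_eq (hr : D.IsRetraction r) (h : D.Unimodular a)
    (hz : z ∈ D.stable) (hz' : z ∈ nz a) (hn : r z ∈ nz a) : D.normC a (r z) = D.normC a z :=
  h.normC_closure (hr.closure z hz) hz' hn

lemma IsRetraction.mem_polystable (hr : D.IsRetraction r) (h : D.Unimodular a)
    (hz' : z ∈ nz a) : z ∈ D.polystable ↔ z ∈ D.stable ∧ r z ∈ nz a := by
  constructor
  · exact fun hz => ⟨D.polystable_sub_stable hz, hr.mem_nz hz hz'⟩
  · rintro ⟨hz, hn⟩
    obtain ⟨s, hs, e⟩ := h.exists_normC hz'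
    obtain ⟨s', hs', e'⟩ := h.exists_normC hn
    have h1 := hr.normC_eq h hz hz' hn
    rw [e, e'] at h1
    have h2 : z = fun j => (s j)⁻¹ * (s' j * r z j) := by
      funext j
      rw [congrFun h1 j, inv_mul_cancel_left₀ (hs.ne_zero j)]
    rw [h2]
    exact hs.inv.mul_mem_polystable (hs'.mul_mem_polystable (D.level_sub_polystable (hr.mem z hz)))

/-- The slice parametrized by the complex chart attached to `a`. -/
def iot (a : Fin n ↪ Fin d) (u : ℂ^n) : ℂ^d := extend a u 1

lemma iot_self (a : Fin n ↪ Fin d) (u : ℂ^n) (i : Fin n) : iot a u (a i) = u i :=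
  a.injective.extend_apply _ _ _

lemma iot_comp (a : Fin n ↪ Fin d) (u : ℂ^n) : iot a u ∘ a = u :=
  funext fun i => iot_self a u i

lemma iot_of_notMem (u : ℂ^n) {j : Fin d} (hj : j ∉ range a) : iot a u j = 1 :=
  extend_apply' _ _ _ fun ⟨i, hi⟩ => hj ⟨i, hi⟩

lemma iot_mem_nz (u : ℂ^n) : iot a u ∈ nz a := by
  intro j hj
  rw [iot_of_notMem u hj]
  exact one_ne_zero

lemma iot_comp_self (h1 : ∀ j ∉ range a, z j = 1) : iot a (z ∘ a) = z := by
  funext j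
  by_cases hj : j ∈ range a
  · obtain ⟨k, rfl⟩ := hj
    rw [iot_self]; rfl
  · rw [iot_of_notMem _ hj, h1 j hj]

lemma contDiff_iot (a : Fin n ↪ Fin d) : ContDiff ℂ ∞ (iot a) := by
  refine contDiff_pi.2 fun j => ?_
  by_cases hj : j ∈ range a
  · obtain ⟨k, rfl⟩ := hj
    simp only [iot_self]
    fun_prop
  · simp only [iot_of_notMem _ hj]
    exact contDiff_const

lemma Unimodular.normC_iot (h : D.Unimodular a) (u : ℂ^n) : D.normC a (iot a u) = iot a u :=
  h.normC_eq_self fun j hj => iot_of_notMem u hj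

lemma Unimodular.iot_normC (h : D.Unimodular a) (hz : z ∈ nz a) :
    iot a (D.normC a z ∘ a) = D.normC a z :=
  iot_comp_self fun j hj => normC_of_notMem hz hj

lemma Unimodular.normC_mem_polystable (h : D.Unimodular a) (hz : z ∈ nz a)
    (hp : z ∈ D.polystable) : D.normC a z ∈ D.polystable := by
  obtain ⟨s, hs, e⟩ := h.exists_normC hz
  rw [e]
  exact hs.mul_mem_polystable hp

lemma Unimodular.repX_normC (h : D.Unimodular a) (hz : z ∈ nz a)
    (hx : D.RepX z x) : D.RepX (D.normC a z) x := by
  obtain ⟨s, hs, e⟩ := h.exists_normC hz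
  rw [e]
  exact hx.mul hs

open Classical in
/-- The class of `z` in `X`, with an arbitrary value off the stable set. -/
def mkX (D : ToricData n d) [Nonempty D.M] (z : ℂ^d) : D.X :=
  if h : z ∈ D.stable then D.clsX ⟨z, h⟩ else D.chi (Classical.arbitrary _)

lemma repX_mkX [Nonempty D.M] (h : z ∈ D.stable) : D.RepX z (D.mkX z) :=
  ⟨h, by simp only [mkX, h]; rfl⟩

lemma RepX.eq_mkX [Nonempty D.M] (h : D.RepX z x) : x = D.mkX z :=
  RepX.unique h (repX_mkX h.1)

lemma continuousOn_mkX [Nonempty D.M] : ContinuousOn D.mkX D.stable := by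
  rw [continuousOn_iff_continuous_domRestrict]
  have : D.stable.domRestrict D.mkX = D.clsX := by
    funext z; exact dif_pos z.2
  rw [this]
  exact D.continuous_clsX

lemma IsRetraction.nonzero_iff (hr : D.IsRetraction r) (hz : z ∈ D.polystable) (hm : D.RepX z (D.chi
    m)) (hw : D.RepM w m) (hz' : z ∈ nz a) : w ∈ nz a := by
  have h1 := hr.repM_symm hm
  rw [← hr.homeo_apply, Homeomorph.symm_apply_apply] at h1
  obtain ⟨t, ht, e⟩ := h1.exists_rot D hw
  rw [e]
  exact rot_mem_nz.2 (hr.mem_nz hz hz')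

lemma IsRetraction.source_eq (hr : D.IsRetraction r) (a : Fin n ↪ Fin d) : {x | ∃ z ∈ D.polystable,
    D.RepX z x ∧ ∀ j ∉ range a, z j ≠ 0} = hr.homeo.symm ⁻¹' {m | ∃ z, D.RepM z m ∧ ∀ j ∉ range a, z
    j ≠ 0} := by
  ext x
  constructor
  · rintro ⟨z, hz, hx, hz'⟩
    exact ⟨_, hr.repM_symm hx, hr.mem_nz hz hz'⟩
  · rintro ⟨z, hz, hz'⟩
    refine ⟨z, D.level_sub_polystable hz.1, ?_, hz'⟩
    have := hz.repX
    rwa [← hr.homeo_apply, Homeomorph.apply_symm_apply] at this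

/-- The complex chart attached to `a`. -/
def Unimodular.complexChart [Nonempty D.M] (h : D.Unimodular a) (hr : D.IsRetraction r) :
    OpenPartialHomeomorph D.X ℂ^n where
  toFun x := D.normC a (D.outM (hr.homeo.symm x)) ∘ a
  invFun u := D.mkX (iot a u)
  source := {x | ∃ z ∈ D.polystable, D.RepX z x ∧ ∀ j ∉ range a, z j ≠ 0}
  target := {u | iot a u ∈ D.polystable}
  map_source' := by
    intro x hx
    rw [hr.source_eq] at hx
    obtain ⟨z, hz, hz'⟩ := hx
    obtain ⟨t, ht, ho⟩ := hz.exists_rot D (D.repM_outM _)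
    have hn : D.outM (hr.homeo.symm x) ∈ nz a := by rw [ho]; exact rot_mem_nz.2 hz'
    change iot a (D.normC a _ ∘ a) ∈ D.polystable
    rw [h.iot_normC hn]
    exact h.normC_mem_polystable hn (D.level_sub_polystable (D.outM_mem _))
  map_target' := fun u hu => ⟨_, hu, repX_mkX (D.polystable_sub_stable hu), iot_mem_nz u⟩
  left_inv' := by
    intro x hx
    rw [hr.source_eq] at hx
    obtain ⟨z, hz, hz'⟩ := hx
    obtain ⟨t, ht, ho⟩ := hz.exists_rot D (D.repM_outM _)
    have hn : D.outM (hr.homeo.symm x) ∈ nz a := by rw [ho]; exact rot_mem_nz.2 hz'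
    rw [h.iot_normC hn]
    have h1 := (D.repM_outM (hr.homeo.symm x)).repX
    rw [← hr.homeo_apply, Homeomorph.apply_symm_apply] at h1
    exact ((h.repX_normC hn h1).eq_mkX).symm
  right_inv' := by
    intro u hu
    have h1 := hr.repM_symm (repX_mkX (D.polystable_sub_stable hu))
    obtain ⟨t, ht, ho⟩ := h1.exists_rot D (D.repM_outM _)
    have hn := hr.mem_nz hu (iot_mem_nz u)
    have h2 : D.normC a (rot t (r (iot a u))) = D.normC a (r (iot a u)) :=
      h.normC_smul hn (isNC_of_mem_N ht)
    rw [ho, h2, hr.normC_eq h (D.polystable_sub_stable hu) (iot_mem_nz u) hn, h.normC_iot,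
      iot_comp]
  open_source := by
    rw [hr.source_eq]
    exact (D.isOpen_image_mk (isOpen_nz a)).preimage hr.homeo.symm.continuous
  open_target := by
    have h1 : IsOpen (D.stable ∩ r ⁻¹' nz a) :=
      hr.continuousOn.isOpen_inter_preimage D.isOpen_stable (isOpen_nz a)
    have h2 := h1.preimage (contDiff_iot a).continuous
    have h3 : {u | iot a u ∈ D.polystable} = iot a ⁻¹' (D.stable ∩ r ⁻¹' nz a) :=
      Set.ext fun u => hr.mem_polystable h (iot_mem_nz u)
    rw [h3]
    exact h2
  continuousOn_toFun := by
    rw [hr.source_eq]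
    have hnz : ∀ z ∈ D.levelSet,
        D.mkM z ∈ {m | ∃ z, D.RepM z m ∧ ∀ j ∉ range a, z j ≠ 0} → z ∈ nz a := by
      rintro z hz ⟨w, hw, hw'⟩
      obtain ⟨t, ht, ho⟩ := hw.exists_rot D (D.repM_mkM hz)
      rw [ho]
      exact rot_mem_nz.2 hw'
    refine ContinuousOn.comp (D.continuousOn_comp_outM (g := fun z => D.normC a z ∘ a)
      (D.isOpen_image_mk (isOpen_nz a)) ?_ ?_) hr.homeo.symm.continuous.continuousOn
      (fun x hx => hx)
    · intro z hz
      have := (contDiffAt_normC (D := D) (hnz z hz.1 hz.2)).continuousAt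
      refine ContinuousAt.continuousWithinAt ?_
      exact continuousAt_pi.2 fun i => (continuous_apply (a i)).continuousAt.comp this
    · intro z hz hm t ht
      have h2 : D.normC a (rot t z) = D.normC a z :=
        h.normC_smul (hnz z hz hm) (isNC_of_mem_N ht)
      rw [h2]
  continuousOn_invFun := continuousOn_mkX.comp (contDiff_iot a).continuous.continuousOn
    fun u hu => D.polystable_sub_stable hu

lemma Unimodular.isComplexChart_complexChart [Nonempty D.M] (h : D.Unimodular a)
    (hr : D.IsRetraction r) : D.IsComplexChart a (h.complexChart hr) := by
  refine ⟨rfl, fun x hx => ?_⟩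
  change x ∈ {x | ∃ z ∈ D.polystable, D.RepX z x ∧ ∀ j ∉ range a, z j ≠ 0} at hx
  rw [hr.source_eq] at hx
  obtain ⟨z, hz, hz'⟩ := hx
  obtain ⟨t, ht, ho⟩ := hz.exists_rot D (D.repM_outM _)
  have hn : D.outM (hr.homeo.symm x) ∈ nz a := by rw [ho]; exact rot_mem_nz.2 hz'
  have h1 := (D.repM_outM (hr.homeo.symm x)).repX
  rw [← hr.homeo_apply, Homeomorph.apply_symm_apply] at h1
  exact ⟨_, h.normC_mem_polystable hn (D.level_sub_polystable (D.outM_mem _)),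
    h.repX_normC hn h1, fun j hj => normC_of_notMem hn hj, rfl⟩

section charts

variable {f : OpenPartialHomeomorph D.X ℂ^n}

lemma IsComplexChart.mem_source (hf : D.IsComplexChart a f) (hr : D.IsRetraction r)
    (hm : D.RepM z m) : D.chi m ∈ f.source ↔ z ∈ nz a := by
  rw [hf.1]
  constructor
  · rintro ⟨w, hw, hx, hw'⟩
    exact hr.nonzero_iff hw hx hm hw'
  · exact fun h => ⟨z, D.level_sub_polystable hm.1, hm.repX, h⟩

lemma IsComplexChart.apply_repX (hf : D.IsComplexChart a f) (hr : D.IsRetraction r)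
    (h : D.Unimodular a) (hx : D.RepX z x) (hz : z ∈ D.polystable)
    (hz' : z ∈ nz a) : f x = D.normC a z ∘ a := by
  obtain ⟨w, hw, hx', h1, e⟩ := hf.2 x (hf.1 ▸ ⟨z, hz, hx, hz'⟩)
  have hwn : w ∈ nz a := fun j hj => by rw [h1 j hj]; exact one_ne_zero
  obtain ⟨-, t, ht, e'⟩ := (hr.repX_iff hx).1 hx'
  have h2 := hr.normC_eq h (D.polystable_sub_stable hw) hwn (hr.mem_nz hw hwn)
  have h3 := hr.normC_eq h (D.polystable_sub_stable hz) hz' (hr.mem_nz hz hz')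
  have h4 : D.normC a (rot t (r z)) = D.normC a (r z) :=
    h.normC_smul (hr.mem_nz hz hz') (isNC_of_mem_N ht)
  rw [e, ← h3, ← h4, ← e', h2, h.normC_eq_self h1]

lemma IsComplexChart.apply_chi (hf : D.IsComplexChart a f) (hr : D.IsRetraction r) (h : D.Unimodular
    a) (hm : D.RepM z m) (hz : z ∈ nz a) : f (D.chi m) = D.normC a z ∘ a :=
  hf.apply_repX hr h hm.repX (D.level_sub_polystable hm.1) hz

lemma IsComplexChart.symm_apply (hf : D.IsComplexChart a f) {u}
    (hu : u ∈ f.target) : iot a u ∈ D.polystable ∧ D.RepX (iot a u) (f.symm u) := by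
  obtain ⟨w, hw, hx, h1, e⟩ := hf.2 _ (f.map_target hu)
  rw [f.right_inv hu] at e
  have : iot a u = w := by rw [e]; exact iot_comp_self h1
  rw [this]
  exact ⟨hw, hx⟩

lemma IsComplexChart.target_eq (hf : D.IsComplexChart a f) (hr : D.IsRetraction r)
    (h : D.Unimodular a) : f.target = {u | iot a u ∈ D.polystable} := by
  ext u
  constructor
  · exact fun hu => (hf.symm_apply hu).1
  · intro hu
    have hs := D.polystable_sub_stable hu
    have h0 : D.RepX (iot a u) (D.clsX ⟨_, hs⟩) := ⟨hs, rfl⟩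
    have h1 : D.clsX ⟨_, hs⟩ ∈ f.source := by
      rw [hf.1]
      exact ⟨_, hu, h0, iot_mem_nz u⟩
    have h2 := f.map_source h1
    rwa [hf.apply_repX hr h h0 hu (iot_mem_nz u), h.normC_iot, iot_comp] at h2

/-- Smoothness of a family of classes read in a complex chart. -/
lemma IsComplexChart.contDiffAt_apply (hf : D.IsComplexChart a f) (hr : D.IsRetraction r) (h :
    D.Unimodular a) {𝕜 E : Type*} [NontriviallyNormedField 𝕜] [NormedAlgebra 𝕜 ℂ]
    [NormedAddCommGroup E] [NormedSpace 𝕜 E] {z : E → ℂ^d} {x : E} {F : E → D.X} (hz :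
    ContDiffAt 𝕜 ∞ z x) (hF : ∀ᶠ y in 𝓝 x, D.RepX (z y) (F y)) (hp : ∀ᶠ y in 𝓝 x, z y ∈
    D.polystable) (hx : z x ∈ nz a) : ContDiffAt 𝕜 ∞ (fun y => f (F y)) x := by
  have h1 : ContDiffAt 𝕜 ∞ (fun y => D.normC a (z y)) x :=
    ((contDiffAt_normC hx).restrict_scalars 𝕜).comp x hz
  refine (contDiffAt_pi.2 fun i => (contDiffAt_pi.1 h1 (a i))).congr_of_eventuallyEq ?_
  filter_upwards [hF, hp, eventually_nz hz.continuousAt hx] with y hy hy' hy''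
  rw [hf.apply_repX hr h hy hy' hy'']
  rfl

end charts

lemma isAtlasOn_complexCharts (hU : ∀ a, D.Admissible a → D.Unimodular a) (hr : D.IsRetraction r) {S
    : Set D.M} (hS : ∀ z m, D.RepM z m → (m ∉ S ↔ ∃ a, D.Admissible a ∧ z ∈ nz a)) : IsAtlasOn ℂ
    D.complexCharts (D.chi '' S)ᶜ := by
  have hsm : ∀ e ∈ D.complexCharts, ∀ e' ∈ D.complexCharts,
      ContDiffOn ℂ ∞ (e.symm ≫ₕ e') (e.symm ≫ₕ e').source := by
    rintro e ⟨a, ha, he⟩ e' ⟨b, hb, he'⟩ u hu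
    rw [trans_source] at hu
    have h1 : u ∈ e.target := hu.1
    have hev : ∀ᶠ y in 𝓝 u, iot a y ∈ D.polystable ∧ D.RepX (iot a y) (e.symm y) := by
      filter_upwards [e.open_target.mem_nhds h1] with y hy using he.symm_apply hy
    refine (he'.contDiffAt_apply hr (hU b hb) (contDiff_iot a).contDiffAt
      (hev.mono fun y hy => hy.2) (hev.mono fun y hy => hy.1) ?_).contDiffWithinAt
    have h2 : e.symm u ∈ e'.source := hu.2
    rw [he'.1, hr.source_eq] at h2
    obtain ⟨z, hz, hz'⟩ := h2
    obtain ⟨hp, hx⟩ := he.symm_apply h1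
    obtain ⟨t, ht, e⟩ := (hr.repM_symm hx).exists_rot D hz
    have h3 : r (iot a u) ∈ nz b := rot_mem_nz.1 (e ▸ hz')
    have hc := hx.1
    intro j hj h0
    refine h3 j hj ?_
    exact eq_of_mem_closure_orbit (g := fun z => z j) (hr.closure _ hc)
      (continuous_apply j).continuousAt (fun θ _ => by simp [dil, h0]) |>.trans h0
  refine ⟨?_, ?_⟩
  · ext x
    obtain ⟨m, rfl⟩ := hr.homeo.surjective x
    obtain ⟨z, hz⟩ := D.exists_repM m
    rw [hr.homeo_apply]
    have hinj : D.chi m ∈ D.chi '' S ↔ m ∈ S := hr.homeo.injective.mem_set_image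
    simp only [mem_iUnion, mem_compl_iff, exists_prop, hinj]
    rw [hS z m hz]
    constructor
    · rintro ⟨e, ⟨a, ha, he⟩, hm⟩
      exact ⟨a, ha, (he.mem_source hr hz).1 hm⟩
    · rintro ⟨a, ha, hza⟩
      have : Nonempty D.M := ⟨m⟩
      exact ⟨_, ⟨a, ha, (hU a ha).isComplexChart_complexChart hr⟩,
        ((hU a ha).isComplexChart_complexChart hr |>.mem_source hr hz).2 hza⟩
  · intro e he e' he'
    rw [contDiffGroupoid, mem_groupoid_of_pregroupoid]
    simp only [contDiffPregroupoid, modelWithCornersSelf_coe, modelWithCornersSelf_coe_symm,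
      comp_id, id_comp, range_id, inter_univ, preimage_id]
    exact ⟨hsm e he e' he', hsm e' he' e he⟩

/-! ## The Kähler structure -/

lemma isKahlerCompatible (hU : ∀ a, D.Admissible a → D.Unimodular a) (hr : D.IsRetraction r) :
    IsKahlerCompatible D.symplecticCharts D.complexCharts hr.homeo.toOpenPartialHomeomorph := by
  rintro e ⟨a, ha, he⟩ f ⟨b, hb, hf⟩ u hu v w v' w' hv hw
  have h := hU a ha
  have h' := hU b hb
  obtain ⟨hu1, hu2⟩ : u ∈ e.target ∧ D.chi (e.symm u) ∈ f.source := by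
    simpa [hr.homeo_apply] using hu
  have hua : u ∈ D.symTarget a := he.target_eq h ▸ hu1
  have hz := he.symm_apply h hu1
  have hb' : D.sig a u ∈ nz b := (hf.mem_source hr hz).1 hu2
  obtain ⟨Z, hZ, hZa, hZim, hZω⟩ := hasFDerivAt_sig hua
  have hdiff : ∀ k, DifferentiableAt ℝ (fun y => gaugeC b (D.sig a y) k) u := by
    intro k
    unfold gaugeC
    split_ifs
    · exact differentiableAt_const _
    · exact (hasFDerivAt_pi'.1 hZ k).differentiableAt
  obtain ⟨W, hW, hW'⟩ := h'.hasFDerivAt_scal_mul hdiff (gaugeC_ne_zero hb') hZ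
  have hW₀ := hasFDerivAt_pi'.1 hW
  have hev := he.eventually_symm h hu1
  have hnz := eventually_nz hZ.continuousAt hb'
  have hT : HasFDerivAt (e.symm ≫ₕ hr.homeo.toOpenPartialHomeomorph ≫ₕ f)
      (ContinuousLinearMap.pi fun i => ContinuousLinearMap.proj (b i) ∘SL W) u := by
    refine (hasFDerivAt_pi.2 fun i => hW₀ (b i)).congr_of_eventuallyEq ?_
    filter_upwards [hev, hnz] with y hy hy'
    exact hf.apply_chi hr h' hy hy'
  have hW1 : ∀ v, ∀ j ∉ range b, W v j = 0 := by
    intro v j hj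
    have h1 : HasFDerivAt (fun y => D.scal b (gaugeC b (D.sig a y)) j * D.sig a y j)
        (0 : ℂ^n →L[ℝ] ℂ) u := by
      refine (hasFDerivAt_const (1 : ℂ) u).congr_of_eventuallyEq ?_
      filter_upwards [hnz] with y hy using normC_of_notMem hy hj
    exact DFunLike.congr_fun ((hW₀ j).unique h1) v
  rw [hT.fderiv] at hv hw
  have hWI : ∀ v v', (ContinuousLinearMap.pi fun i => ContinuousLinearMap.proj (b i) ∘SL W) v' =
      I • (ContinuousLinearMap.pi fun i => ContinuousLinearMap.proj (b i) ∘SL W) v →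
      ∃ α β : ℝ^d, D.proj α = 0 ∧ D.proj β = 0 ∧
        ∀ j, Z v' j = I * Z v j + (α j + I * β j) * D.sig a u j := by
    intro v v' hv
    have hWj : ∀ j, W v' j = I * W v j := by
      intro j
      by_cases hj : j ∈ range b
      · obtain ⟨i, rfl⟩ := hj
        exact congrFun hv i
      · rw [hW1 v' j hj, hW1 v j hj, mul_zero]
    obtain ⟨α, β, hα, hβ, e, -⟩ := hW' v
    obtain ⟨γ, δ, hγ, hδ, f, -⟩ := hW' v'
    refine ⟨-β - γ, α - δ, by simp [hβ, hγ], by simp [hα, hδ], fun j => ?_⟩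
    have h1 := hWj j
    rw [e, f, mul_left_comm] at h1
    have h2 := mul_left_cancel₀ (scal_ne_zero (gaugeC_ne_zero hb') j) h1
    simp only [Pi.sub_apply, Pi.neg_apply]
    push_cast
    linear_combination h2 + β j * D.sig a u j * I_mul_I
  have htan : ∀ v, D.Tangent (D.sig a u) (Z v) := fun v θ hθ =>
    tangent_levelSet hZ (hev.mono fun y hy => hy.1) hθ v
  obtain ⟨α, β, hα, hβ, e1⟩ := hWI v v' hv
  obtain ⟨γ, δ, hγ, hδ, e2⟩ := hWI w w' hw
  refine ⟨?_, fun hv0 => ?_⟩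
  · rw [← hZω, ← hZω v w]
    exact omega0_complex (htan v) (htan v') (htan w) (htan w') hα hβ hγ hδ e1 e2
  · rw [← hZω, omega0_complex_self (htan v) (htan v') hα hβ e1]
    refine mul_pos (by positivity) ?_
    refine lt_of_le_of_ne (Finset.sum_nonneg fun j _ => by positivity) fun h0 => hv0 ?_
    have h1 := (Finset.sum_eq_zero_iff_of_nonneg fun j _ => by positivity).1 h0.symm
    have h2 : ∀ j, Z v j = I * α j * D.sig a u j := by
      intro j
      have := h1 j (Finset.mem_univ j)
      simpa [sub_eq_zero] using this
    have h3 : α = 0 := h.eq_zero_of_proj hα fun j hj => by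
      have h4 := hZim v j hj
      rw [h2, sig_of_notMem u hj] at h4
      have h5 := (sqrt_pos.2 (hua j hj)).ne'
      simpa [h5] using h4
    funext i
    rw [← hZa v i, h2, h3]
    simp

lemma IsRetraction.isKahlerOff (hr : D.IsRetraction r)
    (hU : ∀ a, D.Admissible a → D.Unimodular a) [Nonempty D.M] {S : Set D.M}
    (hS : ∀ z m, D.RepM z m → (m ∉ S ↔ ∃ a, D.Admissible a ∧ z ∈ nz a)) : D.IsKahlerOff S where
  equivalence := hr.equivalence
  exists_symplectic a ha := ⟨_, (hU a ha).isSymplecticChart_symChart⟩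
  exists_complex a ha := ⟨_, (hU a ha).isComplexChart_complexChart hr⟩
  symplectic_atlas := isSymplecticAtlasOn hU hS
  complex_atlas := isAtlasOn_complexCharts hU hr hS
  kahler := by
    refine ⟨hr.homeo, hr.homeo_apply, ?_, isKahlerCompatible hU hr⟩
    intro e he f hf
    set T := e.symm ≫ₕ hr.homeo.toOpenPartialHomeomorph ≫ₕ f with hT
    have hsm : ∀ u ∈ T.source, ContDiffAt ℝ ∞ T u := by
      intro u hu
      obtain ⟨a, ha, he⟩ := he
      obtain ⟨b, hb, hf⟩ := hf
      obtain ⟨hu1, hu2⟩ : u ∈ e.target ∧ D.chi (e.symm u) ∈ f.source := by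
        simpa [hT, hr.homeo_apply] using hu
      have hev := he.eventually_symm (hU a ha) hu1
      exact hf.contDiffAt_apply hr (hU b hb) (contDiffAt_sig (he.target_eq (hU a ha) ▸ hu1))
        (hev.mono fun y hy => hy.repX) (hev.mono fun y hy => D.level_sub_polystable hy.1)
        ((hf.mem_source hr hev.self_of_nhds).1 hu2)
    refine ⟨fun u hu => (hsm u hu).contDiffWithinAt, fun y hy => ?_⟩
    have hu := T.map_target hy
    have hinj : Injective (fderiv ℝ T (T.symm y)) := by
      rw [injective_iff_map_eq_zero]
      intro v hv
      by_contra hv0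
      have := (isKahlerCompatible hU hr e he f hf _ hu v v v v (by rw [← hT, hv, smul_zero])
        (by rw [← hT, hv, smul_zero])).2 hv0
      simp [omega0, mul_conj] at this
    let Te := (LinearEquiv.ofInjectiveEndo (fderiv ℝ T (T.symm y)).toLinearMap
      hinj).toContinuousLinearEquiv
    have hd : HasFDerivAt T (Te : ℂ^n →L[ℝ] ℂ^n) (T.symm y) := by
      have := ((hsm _ hu).differentiableAt (by simp)).hasFDerivAt
      exact this.congr_fderiv (by ext v : 1; rfl)
    exact (T.contDiffAt_symm hy hd (hsm _ hu)).contDiffWithinAt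

end ToricData

namespace ToricData

variable {n d : ℕ} {D : ToricData n d} {a : Fin n ↪ Fin d}
variable (h : D.Unimodular a)

/-! ## The torus action and the moment mapping -/

/-- The basis of normals with indices in `a`. -/
def Unimodular.basis : Module.Basis (Fin n) ℝ ℝ^n :=
  basisOfLinearIndependentOfCardEqFinrank' _ h.indep (by simp)

lemma Unimodular.basis_apply (i : Fin n) : h.basis i = D.normal (a i) := by
  simp [Unimodular.basis]

/-- The lift of a vector to `ℝᵈ` supported on `a`. -/
def Unimodular.lift (ξ : ℝ^n) : ℝ^d :=
  extend a (h.basis.repr ξ) 0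

lemma Unimodular.lift_self (ξ : ℝ^n) (i : Fin n) :
    h.lift ξ (a i) = h.basis.repr ξ i :=
  a.injective.extend_apply _ _ _

lemma Unimodular.lift_of_notMem (ξ : ℝ^n) {j : Fin d}
    (hj : j ∉ range a) : h.lift ξ j = 0 :=
  extend_apply' _ _ _ fun ⟨i, hi⟩ => hj ⟨i, hi⟩

lemma Unimodular.proj_lift (ξ : ℝ^n) : D.proj (h.lift ξ) = ξ := by
  conv_rhs => rw [← h.basis.sum_repr ξ]
  rw [proj, Fintype.linearCombination_apply]
  symm
  refine Fintype.sum_of_injective a a.injective _ _ (fun j hj => ?_) fun i => ?_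
  · rw [h.lift_of_notMem ξ hj, zero_smul]
  · rw [h.lift_self, h.basis_apply]

lemma Unimodular.contDiff_lift (j : Fin d) :
    ContDiff ℝ ∞ fun ξ => h.lift ξ j := by
  by_cases hj : j ∈ range a
  · obtain ⟨k, rfl⟩ := hj
    simp only [lift_self]
    exact (LinearMap.toContinuousLinearMap (h.basis.coord k)).contDiff
  · simp only [h.lift_of_notMem _ hj]
    exact contDiff_const

lemma expT_mul (θ η : ℝ^d) : expT (θ + η) = expT θ * expT η := by
  funext j; simp [expT, mul_add, Circle.exp_add]

lemma expT_mem_N {θ : ℝ^d} : expT θ ∈ D.N ↔ D.proj θ ∈ D.lattice := by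
  constructor
  · rintro ⟨η, h, hη⟩
    have h1 : ∀ j, ∃ m : ℤ, θ j - η j = m := by
      intro j
      rw [← expT_eq_one_iff, mul_sub, Circle.exp_sub]
      have := congrFun h j
      simp only [expT] at this
      rw [this, div_self']
    choose m hm using h1
    have h2 : D.proj θ = D.proj η + ∑ j, m j • D.normal j := by
      have : θ = η + fun j => (m j : ℝ) := by funext j; simp [← hm j]
      conv_lhs => rw [this, map_add]
      congr 1
      simp [proj, Fintype.linearCombination_apply, Int.cast_smul_eq_zsmul]
    rw [h2]
    exact add_mem hη (Submodule.sum_mem _ fun j _ => smul_mem _ _ (D.normal_mem j))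
  · exact fun h => ⟨θ, rfl, h⟩

lemma contDiff_rot_expT {E : Type*} [NormedAddCommGroup E] [NormedSpace ℝ E]
    {θ : E → ℝ^d} {z : E → ℂ^d} {x : E} (hθ : ∀ j, ContDiffAt ℝ ∞ (fun y => θ y j) x)
    (hz : ContDiffAt ℝ ∞ z x) : ContDiffAt ℝ ∞ (fun y => rot (expT (θ y)) (z y)) x := by
  refine contDiffAt_pi.2 fun j => ContDiffAt.mul ?_ (contDiffAt_pi.1 hz j)
  simp only [expT, Circle.coe_exp]
  refine ContDiffAt.cexp (ContDiffAt.mul ?_ contDiffAt_const)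
  exact ofRealCLM.contDiff.contDiffAt.comp x (contDiffAt_const.mul (hθ j))

section action

variable [Nonempty D.M]

/-- The action of `ℝⁿ/Q` on `M`. -/
def Unimodular.act (q : ℝ^n ⧸ D.lattice) (m : D.M) : D.M :=
  D.mkM (rot (expT (h.lift (Quotient.out q))) (D.outM m))

lemma Unimodular.act_mk {θ : ℝ^d} {z} {m} (hm : D.RepM
    z m) : D.RepM (rot (expT θ) z) (h.act (Submodule.Quotient.mk (D.proj θ)) m) := by
  obtain ⟨t, ht, ho⟩ := hm.exists_rot D (D.repM_outM m)
  set q : ℝ^n ⧸ D.lattice := Submodule.Quotient.mk (D.proj θ) with hq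
  have h1 : Quotient.out q - D.proj θ ∈ D.lattice := by
    rw [← Submodule.Quotient.eq]
    exact Quotient.out_eq _
  have h2 : expT (h.lift (Quotient.out q) - θ) ∈ D.N := by
    rw [expT_mem_N, map_sub, h.proj_lift]
    exact h1
  have h3 : expT (h.lift (Quotient.out q)) = expT (h.lift (Quotient.out q) - θ) * expT θ := by
    rw [← expT_mul, sub_add_cancel]
  have hz : rot (expT θ) z ∈ D.levelSet := D.rot_mem_levelSet.2 hm.1
  unfold Unimodular.act
  rw [ho, h3, ← rot_mul]
  have h4 : expT (h.lift (Quotient.out q) - θ) * expT θ * t =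
      (expT (h.lift (Quotient.out q) - θ) * t) * expT θ := by
    rw [mul_assoc, mul_assoc, mul_comm (expT θ)]
  rw [h4, rot_mul, D.mkM_rot hz (D.N.mul_mem h2 ht)]
  exact D.repM_mkM hz

lemma Unimodular.isTorusAction (hz : ∃ z ∈ D.levelSet, ∀ j, z j ≠ 0) :
    D.IsTorusAction h.act where
  zero m := by
    obtain ⟨z, hz⟩ := D.exists_repM m
    have := h.act_mk (θ := 0) hz
    rw [map_zero, Submodule.Quotient.mk_zero] at this
    have h0 : expT (0 : ℝ^d) = 1 := by funext j; simp [expT]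
    rw [h0, rot_one] at this
    exact RepM.unique D this hz
  add s t m := by
    obtain ⟨z, hz⟩ := D.exists_repM m
    obtain ⟨s, rfl⟩ := Submodule.Quotient.mk_surjective _ s
    obtain ⟨t, rfl⟩ := Submodule.Quotient.mk_surjective _ t
    have h1 := h.act_mk (θ := h.lift s) (h.act_mk (θ := h.lift t) hz)
    have h2 := h.act_mk (θ := h.lift s + h.lift t) hz
    rw [expT_mul, rot_mul] at h2
    rw [map_add, h.proj_lift, h.proj_lift, Submodule.Quotient.mk_add] at h2
    rw [h.proj_lift, h.proj_lift] at h1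
    exact RepM.unique D h2 h1
  induced θ z m hm := h.act_mk hm
  continuous := by
    have hq : IsOpenQuotientMap (Prod.map (mkQ D.lattice) D.cls) :=
      (isOpenQuotientMap_mkQ _).prodMap D.isOpenQuotientMap_cls
    rw [← hq.continuous_comp_iff]
    have : ((fun p : (ℝ^n ⧸ D.lattice) × D.M => h.act p.1 p.2) ∘
        Prod.map (mkQ D.lattice) D.cls) = fun p : ℝ^n × D.levelSet =>
        D.cls ⟨rot (expT (h.lift p.1)) p.2, D.rot_mem_levelSet.2 p.2.2⟩ := by
      funext p
      have h1 := h.act_mk (θ := h.lift p.1) (z := p.2) (m := D.cls p.2) ⟨p.2.2, rfl⟩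
      rw [h.proj_lift] at h1
      exact RepM.unique D h1 ⟨D.rot_mem_levelSet.2 p.2.2, rfl⟩
    rw [this]
    refine D.continuous_cls.comp (Continuous.subtype_mk ?_ _)
    refine continuous_rot.comp (Continuous.prodMk ?_
      (continuous_subtype_val.comp continuous_snd))
    refine continuous_pi fun j => ?_
    have := (h.contDiff_lift j).continuous.comp
      (continuous_fst : Continuous fun p : ℝ^n × D.levelSet => p.1)
    exact Circle.exp.continuous.comp (continuous_const.mul this)
  effective s hs := by
    obtain ⟨z, hz, hz0⟩ := hz
    obtain ⟨s, rfl⟩ := Submodule.Quotient.mk_surjective _ s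
    have h1 := h.act_mk (θ := h.lift s) (D.repM_mkM hz)
    rw [h.proj_lift, hs] at h1
    obtain ⟨t, ht, e⟩ := (D.repM_mkM hz).exists_rot D h1
    have h2 : expT (h.lift s) = t := by
      funext j
      exact Circle.coe_injective (mul_right_cancel₀ (hz0 j) (congrFun e j))
    rw [← h2, expT_mem_N, h.proj_lift] at ht
    exact (Submodule.Quotient.mk_eq_zero _).2 ht

end action

/-- Dual vectors in terms of their values on the normals with indices in `a`. -/
def Unimodular.dual : ℝ^n ≃L[ℝ] ℝ^n :=
  (LinearEquiv.ofInjectiveEndo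
    (LinearMap.pi fun i => (dotProductBilin ℝ ℝ).flip (D.normal (a i)) :
      ℝ^n →ₗ[ℝ] ℝ^n)
    (fun μ ν hμ => h.ext_dot fun i => congrFun hμ i)).toContinuousLinearEquiv

lemma Unimodular.dual_apply (μ : ℝ^n) (i : Fin n) :
    h.dual μ i = μ ⬝ᵥ D.normal (a i) := rfl

/-- The moment mapping. -/
def Unimodular.moment (m : D.M) : ℝ^n :=
  h.dual.symm fun i => ‖D.outM m (a i)‖ ^ 2 + D.bound (a i)

lemma Unimodular.moment_dot {z} {m} (hm : D.RepM z m)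
    (j : Fin d) : h.moment m ⬝ᵥ D.normal j = ‖z j‖ ^ 2 + D.bound j := by
  obtain ⟨t, ht, ho⟩ := hm.exists_rot D (D.repM_outM m)
  obtain ⟨μ, hμ⟩ := D.mem_levelSet_iff.1 hm.1
  have : h.moment m = μ := by
    refine h.ext_dot fun i => ?_
    rw [hμ, ← h.dual_apply, Unimodular.moment, ContinuousLinearEquiv.apply_symm_apply, ho,
      norm_rot]
  rw [this, hμ]

lemma Unimodular.continuous_moment [Nonempty D.M] : Continuous h.moment := by
  rw [← continuousOn_univ]
  refine D.continuousOn_comp_outM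
    (g := fun z => h.dual.symm fun i => ‖z (a i)‖ ^ 2 + D.bound (a i)) isOpen_univ ?_ ?_
  · refine Continuous.continuousOn (h.dual.symm.continuous.comp ?_)
    fun_prop
  · intro z _ _ t _
    simp only [norm_rot]

lemma RepM_point {μ : ℝ^n} (hμ : μ ∈ D.polyhedron) :
    D.RepM (fun j => ((√(μ ⬝ᵥ D.normal j - D.bound j) : ℝ) : ℂ)) (D.point μ hμ) :=
  ⟨D.point_mem μ hμ, rfl⟩

lemma Unimodular.moment_point {μ : ℝ^n} (hμ : μ ∈ D.polyhedron) :
    h.moment (D.point μ hμ) = μ := by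
  refine h.ext_dot fun i => ?_
  rw [h.moment_dot (RepM_point hμ), norm_real, norm_eq_abs, sq_abs,
    sq_sqrt (sub_nonneg.2 (hμ _))]
  ring

lemma Unimodular.range_moment : range h.moment = D.polyhedron := by
  ext μ
  constructor
  · rintro ⟨m, rfl⟩ j
    obtain ⟨z, hz⟩ := D.exists_repM m
    rw [h.moment_dot hz]
    nlinarith [sq_nonneg ‖z j‖]
  · exact fun hμ => ⟨_, h.moment_point hμ⟩

lemma Unimodular.isHamiltonianInCharts [Nonempty D.M]
    (hU : ∀ a, D.Admissible a → D.Unimodular a) : D.IsHamiltonianInCharts h.act h.moment where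
  smooth := by
    rintro e ⟨b, hb, he⟩ e' ⟨b', hb', he'⟩ ⟨ξ, u⟩ ⟨hu, hm⟩
    simp only at hu hm
    have hev : ∀ᶠ p : ℝ^n × ℂ^n in 𝓝 (ξ, u),
        D.RepM (rot (expT (h.lift p.1)) (D.sig b p.2))
          (h.act (Submodule.Quotient.mk p.1) (e.symm p.2)) := by
      filter_upwards [continuousAt_snd.eventually_mem (e.open_target.mem_nhds hu)] with p hp
      have := h.act_mk (θ := h.lift p.1) (he.symm_apply (hU b hb) hp)
      rwa [h.proj_lift] at this
    have hs := contDiffAt_sig (D := D) (he.target_eq (hU b hb) ▸ hu)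
    refine (he'.contDiffAt_apply (hU b' hb') (z := fun p : ℝ^n × ℂ^n =>
      rot (expT (h.lift p.1)) (D.sig b p.2)) (contDiff_rot_expT (fun j => ?_) ?_) hev
      ((he'.mem_source hev.self_of_nhds).1 hm)).contDiffWithinAt
    · exact (h.contDiff_lift j).contDiffAt.comp _ contDiffAt_fst
    · exact hs.comp (ξ, u) contDiffAt_snd
  moment := by
    rintro e ⟨b, hb, he⟩ u hu ξ
    have h' := hU b hb
    set c := h'.basis.repr ξ with hc
    have hub : u ∈ D.symTarget b := he.target_eq h' ▸ hu
    refine ⟨fun i => (2 * Real.pi * c i : ℝ) * I * u i,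
      ∑ i, c i • (2 • (innerSL ℝ (u i)).comp (ContinuousLinearMap.proj (R := ℝ) i)), ?_, ?_, ?_⟩
    · have h1 : ∀ s : ℝ, e (h.act (Submodule.Quotient.mk (s • ξ)) (e.symm u)) =
          fun i => Complex.exp ((2 * Real.pi * (s * c i) : ℝ) * I) * u i := by
        intro s
        have h2 := h.act_mk (θ := h'.lift (s • ξ)) (he.symm_apply h' hu)
        rw [h'.proj_lift] at h2
        have h3 : ∀ j ∉ range b, ∃ r : ℝ, 0 < r ∧
            rot (expT (h'.lift (s • ξ))) (D.sig b u) j = r := by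
          intro j hj
          refine ⟨_, sqrt_pos.2 (hub j hj), ?_⟩
          simp [rot, expT, h'.lift_of_notMem _ hj, sig_of_notMem u hj]
        rw [he.apply h' h2 (rot_mem_nz.2 (sig_mem_nz hub)), h'.normS_eq_self h3]
        funext i
        simp [rot, expT, h'.lift_self, sig_self, hc]
      simp only [h1]
      refine hasDerivAt_pi.2 fun i => ?_
      have h2 : HasDerivAt (fun s : ℝ => ((2 * Real.pi * (s * c i) : ℝ) : ℂ) * I)
          ((2 * Real.pi * c i : ℝ) * I) 0 := by
        have h3 : HasDerivAt (fun s : ℝ => 2 * Real.pi * (s * c i)) (2 * Real.pi * c i) 0 := by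
          simpa using ((hasDerivAt_id (0 : ℝ)).mul_const (c i)).const_mul (2 * Real.pi)
        exact h3.ofReal_comp.mul_const _
      simpa using h2.cexp.mul_const (u i)
    · have h1 : HasFDerivAt (fun u' : ℂ^n => ∑ i, c i * (‖u' i‖ ^ 2 + D.bound (b i))) _ u :=
        HasFDerivAt.fun_sum fun i _ => (((hasFDerivAt_apply (𝕜 := ℝ) i u).norm_sq).add_const
          (D.bound (b i))).const_mul (c i)
      refine h1.congr_of_eventuallyEq ?_
      filter_upwards [e.open_target.mem_nhds hu] with y hy
      have h2 := he.symm_apply h' hy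
      have h3 : ξ = ∑ i, c i • D.normal (b i) := by
        conv_lhs => rw [← h'.basis.sum_repr ξ]
        simp only [h'.basis_apply, hc]
      rw [h3]
      simp only [dotProduct_sum, dotProduct_smul, smul_eq_mul, h.moment_dot h2, sig_self]
    · intro w
      simp only [omega0]
      rw [Finset.mul_sum, ContinuousLinearMap.sum_apply]
      refine Finset.sum_congr rfl fun i _ => ?_
      have := pi_pos.ne'
      simp [Complex.inner]
      field_simp
      ring

end ToricData

namespace Octahedron

open ToricData

variable {μ : ℝ^3} {k : Fin 6}

/-! ## The octahedron -/

lemma dot_normal_octa (μ : ℝ^3) (j : Fin 8) : μ ⬝ᵥ octa.normal j = ![μ 0 + μ 1 + μ 2, μ 0 - μ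
    1 - μ 2, -μ 0 + μ 1 - μ 2, -μ 0 - μ 1 + μ 2, -(μ 0 + μ 1 + μ 2), -(μ 0 - μ 1 - μ 2), -(-μ 0 + μ
    1 - μ 2), -(-μ 0 - μ 1 + μ 2)] j := by
  fin_cases j <;> simp [octa, Y, dotProduct, Fin.sum_univ_succ] <;> ring

lemma mem_polyhedron_octa : μ ∈ octa.polyhedron ↔ |μ 0 + μ 1 + μ 2| ≤ 1 ∧ |μ 0 - μ 1 - μ 2| ≤ 1 ∧
    |-μ 0 + μ 1 - μ 2| ≤ 1 ∧ |-μ 0 - μ 1 + μ 2| ≤ 1 := by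
  have : μ ∈ octa.polyhedron ↔ ∀ j, -1 ≤ μ ⬝ᵥ octa.normal j := Iff.rfl
  rw [this]
  simp only [dot_normal_octa, Fin.forall_fin_succ, abs_le]
  simp
  constructor
  · rintro ⟨h0, h1, h2, h3, h4, h5, h6, h7⟩
    refine ⟨⟨?_, ?_⟩, ⟨?_, ?_⟩, ⟨?_, ?_⟩, ?_, ?_⟩ <;> linarith
  · rintro ⟨⟨h0, h1⟩, ⟨h2, h3⟩, ⟨h4, h5⟩, h6, h7⟩
    refine ⟨?_, ?_, ?_, ?_, ?_, ?_, ?_, ?_⟩ <;> linarith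

lemma vertex_injective : Injective vertex := by
  intro k l h
  have h0 := congrFun h 0
  have h1 := congrFun h 1
  have h2 := congrFun h 2
  fin_cases k <;> fin_cases l <;> first | rfl | (exfalso; revert h0 h1 h2; simp [vertex]; done) |
    (exfalso; revert h0 h1 h2; simp [vertex]; norm_num)

lemma abs_sum_le_one (hμ : μ ∈ octa.polyhedron) : |μ 0| + |μ 1| + |μ 2| ≤ 1 := by
  rw [mem_polyhedron_octa] at hμ
  simp only [abs_le] at hμ
  obtain ⟨⟨h0, h1⟩, ⟨h2, h3⟩, ⟨h4, h5⟩, h6, h7⟩ := hμ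
  rcases abs_cases (μ 0) with ⟨e0, -⟩ | ⟨e0, -⟩ <;> rcases abs_cases (μ 1) with ⟨e1, -⟩ | ⟨e1, -⟩ <;>
    rcases abs_cases (μ 2) with ⟨e2, -⟩ | ⟨e2, -⟩ <;> rw [e0, e1, e2] <;> linarith

lemma convex_polyhedron {n d : ℕ} (D : ToricData n d) : Convex ℝ D.polyhedron := by
  intro μ hμ ν hν s t hs ht hst j
  rw [add_dotProduct, smul_dotProduct, smul_dotProduct, smul_eq_mul, smul_eq_mul]
  have h1 := mul_le_mul_of_nonneg_left (hμ j) hs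
  have h2 := mul_le_mul_of_nonneg_left (hν j) ht
  calc D.bound j = s * D.bound j + t * D.bound j := by rw [← add_mul, hst, one_mul]
    _ ≤ _ := add_le_add h1 h2

lemma polyhedron_octa_eq : octa.polyhedron = convexHull ℝ (range vertex) := by
  refine Subset.antisymm (fun μ hμ => ?_)
    (convexHull_min (range_subset_iff.2 vertex_mem) (convex_polyhedron _))
  have h := abs_sum_le_one hμ
  set s := (1 - (|μ 0| + |μ 1| + |μ 2|)) / 6 with hs
  have hs0 : 0 ≤ s := by rw [hs]; linarith
  let w : ℝ^6 := ![max (μ 0) 0 + s, max (-μ 0) 0 + s, max (μ 1) 0 + s, max (-μ 1) 0 + s,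
    max (μ 2) 0 + s, max (-μ 2) 0 + s]
  have hm : ∀ x : ℝ, max x 0 - max (-x) 0 = x := by
    intro x
    rcases le_total x 0 with h | h
    · rw [max_eq_right h, max_eq_left (by linarith)]; ring
    · rw [max_eq_left h, max_eq_right (by linarith)]; ring
  have hm' : ∀ x : ℝ, max x 0 + max (-x) 0 = |x| := by
    intro x
    rcases le_total x 0 with h | h
    · rw [max_eq_right h, max_eq_left (by linarith), abs_of_nonpos h]; ring
    · rw [max_eq_left h, max_eq_right (by linarith), abs_of_nonneg h]; ring
  have hw : ∀ k, 0 ≤ w k := by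
    intro k
    fin_cases k <;> exact add_nonneg (le_max_right _ _) hs0
  have hw1 : ∑ k, w k = 1 := by
    simp only [w, Fin.sum_univ_succ]
    simp
    linarith [hm' (μ 0), hm' (μ 1), hm' (μ 2), hs]
  have hμ' : μ = ∑ k, w k • vertex k := by
    funext i
    simp only [w, Fin.sum_univ_succ]
    fin_cases i <;> simp [vertex] <;> linarith [hm (μ 0), hm (μ 1), hm (μ 2)]
  rw [hμ']
  exact (convex_convexHull ℝ _).sum_mem (fun k _ => hw k) hw1
    fun k _ => subset_convexHull ℝ _ ⟨k, rfl⟩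

lemma dot_vertex_le (hμ : μ ∈ octa.polyhedron) (k) :
    μ ⬝ᵥ vertex k ≤ 1 ∧ (μ ⬝ᵥ vertex k = 1 → μ = vertex k) := by
  have h := abs_sum_le_one hμ
  have h0 := abs_le.1 (le_refl |μ 0|)
  have h1 := abs_le.1 (le_refl |μ 1|)
  have h2 := abs_le.1 (le_refl |μ 2|)
  constructor
  · fin_cases k <;> simp [vertex, dotProduct, Fin.sum_univ_succ] <;>
      linarith [abs_nonneg (μ 0), abs_nonneg (μ 1), abs_nonneg (μ 2)]
  · intro e
    funext i
    fin_cases k <;> simp [vertex, dotProduct, Fin.sum_univ_succ] at e <;> fin_cases i <;>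
      simp [vertex] <;> linarith [abs_nonneg (μ 0), abs_nonneg (μ 1), abs_nonneg (μ 2)]

lemma vertex_dot_self (k) : vertex k ⬝ᵥ vertex k = 1 := by
  fin_cases k <;> simp [vertex, dotProduct, Fin.sum_univ_succ]

lemma extremePoints_octa : octa.polyhedron.extremePoints ℝ = range vertex := by
  refine Subset.antisymm ?_ ?_
  · rw [polyhedron_octa_eq]
    exact extremePoints_convexHull_subset
  · rintro _ ⟨k, rfl⟩
    refine mem_extremePoints.2 ⟨vertex_mem k, ?_⟩
    rintro x hx y hy ⟨s, t, hs, ht, hst, e⟩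
    obtain ⟨hx1, hx2⟩ := dot_vertex_le hx k
    obtain ⟨hy1, hy2⟩ := dot_vertex_le hy k
    have h1 := congrArg (fun z => z ⬝ᵥ vertex k) e
    simp only [add_dotProduct, smul_dotProduct, smul_eq_mul, vertex_dot_self] at h1
    exact ⟨hx2 (by nlinarith), hy2 (by nlinarith)⟩

/-- The values `⟨ν_k, X_j⟩`. -/
def activeTable : Fin 6 → Fin 8 → ℤ :=
  ![![1, 1, -1, -1, -1, -1, 1, 1], ![-1, -1, 1, 1, 1, 1, -1, -1], ![1, -1, 1, -1, -1, 1, -1, 1],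
    ![-1, 1, -1, 1, 1, -1, 1, -1], ![1, -1, -1, 1, -1, 1, 1, -1], ![-1, 1, 1, -1, 1, -1, -1, 1]]

lemma mem_active_vertex {j : Fin 8} : j ∈ octa.active (vertex k) ↔ ∃ i, idx k i = j := by
  have : j ∈ octa.active (vertex k) ↔ vertex k ⬝ᵥ octa.normal j = -1 := Iff.rfl
  rw [this, dot_normal_octa]
  have h : ∀ (k : Fin 6) (j : Fin 8), (∃ i, idx k i = j) ↔ activeTable k j = -1 := by decide
  rw [h]
  fin_cases k <;> fin_cases j <;> simp [vertex, activeTable] <;> norm_num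

lemma active_vertex (k) : octa.active (vertex k) = range (idx k) := by
  ext j
  rw [mem_active_vertex]
  rfl

lemma idx_injective (k) : Injective (idx k) := by
  revert k; decide

lemma ncard_active_vertex (k) : (octa.active (vertex k)).ncard = 4 := by
  rw [active_vertex, ← image_univ, ncard_image_of_injective _ (idx_injective k), ncard_univ]
  simp

lemma vertex_mem_face {j : Fin 8} : vertex k ∈ octa.face j ↔ ∃ i, idx k i = j := by
  rw [← mem_active_vertex]
  exact ⟨fun h => h.2, fun h => ⟨vertex_mem k, h⟩⟩

/-- The vertices of the facets. -/
def tri : Fin 8 → Fin 3 → Fin 6 :=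
  ![![1, 3, 5], ![1, 2, 4], ![0, 3, 4], ![0, 2, 5], ![0, 2, 4], ![0, 3, 5], ![1, 2, 5], ![1, 3, 4]]

lemma tri_spec (j : Fin 8) (k) : (∃ i, idx k i = j) ↔ ∃ i, tri j i = k := by
  revert j k; decide

lemma tri_injective (j : Fin 8) : Injective (tri j) := by
  revert j; decide

lemma setOf_mem_active (j : Fin 8) : {k | j ∈ octa.active (vertex k)} = range (tri j) := by
  ext k
  exact mem_active_vertex.trans (tri_spec j k)

lemma ncard_setOf_mem_active (j : Fin 8) : {k | j ∈ octa.active (vertex k)}.ncard = 3 := by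
  rw [setOf_mem_active, ← image_univ, ncard_image_of_injective _ (tri_injective j), ncard_univ]
  simp

lemma face_octa_eq (j : Fin 8) :
    octa.face j = convexHull ℝ (vertex '' {k | j ∈ octa.active (vertex k)}) := by
  refine Subset.antisymm (fun μ hμ => ?_) (convexHull_min ?_ ?_)
  · obtain ⟨hμ, hj⟩ := hμ
    have h := abs_sum_le_one hμ
    have h0 := abs_le.1 (le_refl |μ 0|)
    have h1 := abs_le.1 (le_refl |μ 1|)
    have h2 := abs_le.1 (le_refl |μ 2|)
    have hj' : μ ⬝ᵥ octa.normal j = -1 := hj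
    rw [dot_normal_octa] at hj'
    rw [setOf_mem_active]
    have key : ∃ w : ℝ^3, (∀ i, 0 ≤ w i) ∧ ∑ i, w i = 1 ∧
        μ = ∑ i, w i • vertex (tri j i) := by
      refine ⟨fun i => μ ⬝ᵥ vertex (tri j i), fun i => ?_, ?_, ?_⟩
      · fin_cases j <;> simp at hj' <;> fin_cases i <;>
          simp [vertex, tri, dotProduct, Fin.sum_univ_succ] <;> linarith
      · fin_cases j <;> simp [vertex, tri, dotProduct, Fin.sum_univ_succ] at hj' ⊢ <;> linarith
      · funext i; fin_cases j <;> fin_cases i <;> simp [vertex, tri, dotProduct, Fin.sum_univ_succ]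
    obtain ⟨w, hw, hw1, hμ'⟩ := key
    rw [hμ']
    exact (convex_convexHull ℝ _).sum_mem (fun k _ => hw k) hw1
      fun i _ => subset_convexHull ℝ _ ⟨_, ⟨i, rfl⟩, rfl⟩
  · rintro _ ⟨k, hk, rfl⟩
    exact ⟨vertex_mem k, hk⟩
  · intro μ hμ ν hν s t hs ht hst
    refine ⟨convex_polyhedron _ hμ.1 hν.1 hs ht hst, ?_⟩
    have h1 : μ ⬝ᵥ octa.normal j = octa.bound j := hμ.2
    have h2 : ν ⬝ᵥ octa.normal j = octa.bound j := hν.2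
    change (s • μ + t • ν) ⬝ᵥ octa.normal j = octa.bound j
    rw [add_dotProduct, smul_dotProduct, smul_dotProduct, smul_eq_mul, smul_eq_mul, h1, h2,
      ← add_mul, hst, one_mul]

lemma linearIndependent_tri (j : Fin 8) : LinearIndependent ℝ fun i => vertex (tri j i) := by
  rw [Fintype.linearIndependent_iff]
  intro g hg
  have h0 := congrFun hg 0
  have h1 := congrFun hg 1
  have h2 := congrFun hg 2
  intro i
  fin_cases j <;> simp [vertex, tri, Fin.sum_univ_succ] at h0 h1 h2 <;> fin_cases i <;> simpa

lemma face_mem_facets (j : Fin 8) : octa.face j ∈ octa.facets := by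
  refine ⟨⟨j, rfl⟩, ⟨vertex (tri j 0), vertex_mem_face.2 ((tri_spec j _).2 ⟨0, rfl⟩)⟩, ?_⟩
  have h1 : vectorSpan ℝ (octa.face j) = vectorSpan ℝ (range fun i => vertex (tri j i)) := by
    rw [face_octa_eq, setOf_mem_active, ← range_comp, ← direction_affineSpan,
      affineSpan_convexHull, direction_affineSpan]
    rfl
  rw [h1, (linearIndependent_tri j).affineIndependent.finrank_vectorSpan (n := 2) (by simp)]

lemma face_injective : Injective octa.face := by
  intro i j h
  have : ∀ k, (∃ l, idx k l = i) ↔ ∃ l, idx k l = j := by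
    intro k
    rw [← vertex_mem_face, ← vertex_mem_face, h]
  have key : ∀ i j : Fin 8, (∀ k, (∃ l, idx k l = i) ↔ ∃ l, idx k l = j) → i = j := by decide
  exact key i j this

lemma not_isSimple : ¬ octa.IsSimple := by
  intro h
  have h1 := h (vertex 0) (by rw [extremePoints_octa]; exact ⟨0, rfl⟩)
  have hfin : {F | F ∈ octa.facets ∧ vertex 0 ∈ F}.Finite :=
    (finite_range octa.face).subset fun F hF => by
      obtain ⟨j, rfl⟩ := hF.1.1
      exact ⟨j, rfl⟩
  have h2 : octa.face '' range (idx 0) ⊆ {F | F ∈ octa.facets ∧ vertex 0 ∈ F} := by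
    rintro _ ⟨j, hj, rfl⟩
    exact ⟨face_mem_facets j, vertex_mem_face.2 hj⟩
  have h3 := ncard_le_ncard h2 hfin
  rw [ncard_image_of_injective _ face_injective, ← active_vertex, ncard_active_vertex, h1] at h3
  omega

/-! ## The lattice and unimodularity -/

lemma normal_mem_span (k) (b : Fin 3 ↪ Fin 4) (m : Fin 4) :
    octa.normal (idx k m) ∈ span ℤ (range fun i => octa.normal (idx k (b i))) := by
  by_cases hm : m ∈ range b
  · obtain ⟨i, rfl⟩ := hm
    exact subset_span ⟨i, rfl⟩
  · have h1 : ∀ l, l ≠ m → octa.normal (idx k l) ∈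
        span ℤ (range fun i => octa.normal (idx k (b i))) := by
      intro l hl
      have h2 : l ∈ range b := by
        by_contra hl'
        have h3 : Finset.univ.map b ⊆ ({l, m}ᶜ : Finset (Fin 4)) := by
          intro x hx
          simp only [Finset.mem_map, Finset.mem_univ, true_and] at hx
          obtain ⟨i, rfl⟩ := hx
          simp only [Finset.mem_compl, Finset.mem_insert, Finset.mem_singleton, not_or]
          exact ⟨fun e => hl' ⟨i, e⟩, fun e => hm ⟨i, e⟩⟩
        have h4 := Finset.card_le_card h3
        rw [Finset.card_map, Finset.card_compl, Finset.card_pair hl] at h4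
        simp at h4
      obtain ⟨i, rfl⟩ := h2
      exact subset_span ⟨i, rfl⟩
    have hrel : octa.normal (idx k 0) + octa.normal (idx k 1) =
        octa.normal (idx k 2) + octa.normal (idx k 3) := by
      funext i
      fin_cases k <;> fin_cases i <;> simp [idx, octa, Y]
    fin_cases m
    · have : octa.normal (idx k 0) = octa.normal (idx k 2) + octa.normal (idx k 3) -
          octa.normal (idx k 1) := by rw [← hrel]; abel
      simp only [Fin.zero_eta, this]
      exact sub_mem (add_mem (h1 _ (by decide)) (h1 _ (by decide))) (h1 _ (by decide))
    · have : octa.normal (idx k 1) = octa.normal (idx k 2) + octa.normal (idx k 3) -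
          octa.normal (idx k 0) := by rw [← hrel]; abel
      simp only [Fin.mk_one, this]
      exact sub_mem (add_mem (h1 _ (by decide)) (h1 _ (by decide))) (h1 _ (by decide))
    · have : octa.normal (idx k 2) = octa.normal (idx k 0) + octa.normal (idx k 1) -
          octa.normal (idx k 3) := by rw [hrel]; abel
      simp only [Fin.reduceFinMk, this]
      exact sub_mem (add_mem (h1 _ (by decide)) (h1 _ (by decide))) (h1 _ (by decide))
    · have : octa.normal (idx k 3) = octa.normal (idx k 0) + octa.normal (idx k 1) -
          octa.normal (idx k 2) := by rw [hrel]; abel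
      simp only [Fin.reduceFinMk, this]
      exact sub_mem (add_mem (h1 _ (by decide)) (h1 _ (by decide))) (h1 _ (by decide))

lemma L_le_span (k) (b : Fin 3 ↪ Fin 4) :
    L ≤ span ℤ (range fun i => octa.normal (idx k (b i))) := by
  refine span_le.2 ?_
  rintro _ ⟨i, rfl⟩
  have h1 : ∀ (k : Fin 6) (i : Fin 4), (∃ m, idx k m = Fin.castAdd 4 i) ∨
      ∃ m, idx k m = Fin.natAdd 4 i := by decide
  have h2 : octa.normal (Fin.castAdd 4 i) = Y i := by fin_cases i <;> rfl
  have h3 : octa.normal (Fin.natAdd 4 i) = -Y i := by fin_cases i <;> rfl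
  rcases h1 k i with ⟨m, hm⟩ | ⟨m, hm⟩
  · rw [← h2, ← hm]
    exact normal_mem_span k b m
  · have := normal_mem_span k b m
    rw [hm, h3] at this
    simpa using neg_mem this

lemma span_L_eq_top : span ℝ (L : Set ℝ^3) = ⊤ := by
  have hY : ∀ i, Y i ∈ span ℝ (L : Set ℝ^3) := fun i =>
    subset_span (subset_span ⟨i, rfl⟩)
  rw [eq_top_iff]
  intro v _
  have : v = ((v 0 + v 1) / 2) • Y 0 + ((v 0 - v 2) / 2) • Y 1 + ((v 1 - v 2) / 2) • Y 2 := by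
    funext i
    fin_cases i <;> simp [Y] <;> ring
  rw [this]
  exact add_mem (add_mem (smul_mem _ _ (hY 0)) (smul_mem _ _ (hY 1)))
    (smul_mem _ _ (hY 2))

lemma discreteTopology_L : DiscreteTopology L := by
  have h : (L : Set ℝ^3) ⊆
      (span ℤ (range (Pi.basisFun ℝ (Fin 3))) : Set ℝ^3) := by
    refine span_le.2 ?_
    rintro _ ⟨i, rfl⟩
    have : ∀ i, ∃ c : Fin 3 → ℤ, Y i = fun j => (c j : ℝ) := by
      intro i
      fin_cases i
      · exact ⟨![1, 1, 1], by funext j; fin_cases j <;> simp [Y]⟩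
      · exact ⟨![1, -1, -1], by funext j; fin_cases j <;> simp [Y]⟩
      · exact ⟨![-1, 1, -1], by funext j; fin_cases j <;> simp [Y]⟩
      · exact ⟨![-1, -1, 1], by funext j; fin_cases j <;> simp [Y]⟩
    obtain ⟨c, hc⟩ := this i
    rw [SetLike.mem_coe, mem_span_range_iff_exists_fun]
    refine ⟨c, ?_⟩
    rw [hc]
    funext j
    simp [Finset.sum_apply, Pi.single_apply]
  exact DiscreteTopology.of_subset
    (inferInstanceAs (DiscreteTopology (span ℤ (range (Pi.basisFun ℝ (Fin 3)))))) h

lemma linearIndependent_idx (k) (b : Fin 3 ↪ Fin 4) :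
    LinearIndependent ℝ fun i => octa.normal (idx k (b i)) := by
  refine linearIndependent_of_top_le_span_of_card_eq_finrank ?_ (by simp)
  rw [← span_L_eq_top]
  refine span_le.2 fun v hv => ?_
  exact span_subset_span ℤ ℝ _ (L_le_span k b hv)

lemma unimodular_cone (k) (b : Fin 3 ↪ Fin 4) : (cone k).Unimodular b :=
  ⟨linearIndependent_idx k b, L_le_span k b⟩

lemma admissible_cone (k) (b : Fin 3 ↪ Fin 4) : (cone k).Admissible b := by
  refine ⟨⟨vertex k, fun i => vertex_mem k (idx k i), fun i => ?_⟩, (unimodular_cone k b).indep⟩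
  exact (mem_active_vertex (k := k)).2 ⟨b i, rfl⟩

lemma exists_factor {a : Fin 3 ↪ Fin 8} (h : range a ⊆ range (idx k)) :
    ∃ b : Fin 3 ↪ Fin 4, ∀ i, a i = idx k (b i) := by
  choose b hb using fun i => h (mem_range_self i)
  refine ⟨⟨b, fun i j e => a.injective ?_⟩, fun i => (hb i).symm⟩
  rw [← hb, ← hb, e]

lemma unimodular_of_subset {a : Fin 3 ↪ Fin 8} (h : range a ⊆ range (idx k)) :
    octa.Unimodular a := by
  obtain ⟨b, hb⟩ := exists_factor h
  have : (fun i => octa.normal (a i)) = fun i => octa.normal (idx k (b i)) := by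
    funext i; rw [hb]
  refine ⟨?_, ?_⟩
  · rw [this]; exact linearIndependent_idx k b
  · rw [this]; exact L_le_span k b

lemma admissible_octa_iff (a : Fin 3 ↪ Fin 8) :
    octa.Admissible a ↔ ∃ k, range a ⊆ range (idx k) := by
  constructor
  · rintro ⟨⟨μ, hμ, ha⟩, -⟩
    have ha' : ∀ i, μ ⬝ᵥ octa.normal (a i) = -1 := ha
    simp only [dot_normal_octa] at ha'
    obtain ⟨⟨h0, h1⟩, ⟨h2, h3⟩, ⟨h4, h5⟩, h6, h7⟩ := by
      simpa only [abs_le] using mem_polyhedron_octa.1 hμ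
    have hd : ∀ x y z : Fin 8, x ≠ y → x ≠ z → y ≠ z →
        (∃ k, (∃ m, idx k m = x) ∧ (∃ m, idx k m = y) ∧ ∃ m, idx k m = z) ∨
        (y = x + 4 ∨ z = x + 4 ∨ z = y + 4) ∨ (x < 4 ∧ y < 4 ∧ z < 4) ∨
        (4 ≤ x ∧ 4 ≤ y ∧ 4 ≤ z) := by decide
    have hopp : ∀ i j, a j ≠ a i + 4 := by
      intro i j e
      have e1 := ha' i
      have e2 := ha' j
      rw [e] at e2
      generalize a i = x at e1 e2
      fin_cases x <;> simp at e1 e2 <;> linarith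
    have hne : ∀ i j, i ≠ j → a i ≠ a j := fun i j h e => h (a.injective e)
    rcases hd (a 0) (a 1) (a 2) (hne _ _ (by decide)) (hne _ _ (by decide)) (hne _ _ (by decide))
      with ⟨k, hx, hy, hz⟩ | h | h | h
    · refine ⟨k, ?_⟩
      rintro _ ⟨i, rfl⟩
      fin_cases i
      · exact hx
      · exact hy
      · exact hz
    · rcases h with h | h | h
      · exact absurd h (hopp _ _)
      · exact absurd h (hopp _ _)
      · exact absurd h (hopp _ _)
    · exfalso
      have n1 := hne 0 1 (by decide)
      have n2 := hne 0 2 (by decide)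
      have n3 := hne 1 2 (by decide)
      have e0 := ha' 0
      have e1 := ha' 1
      have e2 := ha' 2
      generalize a 0 = x at *
      generalize a 1 = y at *
      generalize a 2 = z at *
      clear ha ha' hopp hne hd
      fin_cases x <;> simp at h <;> fin_cases y <;> simp at h n1 <;> fin_cases z <;>
        simp at h n2 n3 <;> simp at e0 e1 e2 <;> linarith
    · exfalso
      have n1 := hne 0 1 (by decide)
      have n2 := hne 0 2 (by decide)
      have n3 := hne 1 2 (by decide)
      have e0 := ha' 0
      have e1 := ha' 1
      have e2 := ha' 2
      generalize a 0 = x at *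
      generalize a 1 = y at *
      generalize a 2 = z at *
      clear ha ha' hopp hne hd
      fin_cases x <;> simp at h <;> fin_cases y <;> simp at h n1 <;> fin_cases z <;>
        simp at h n2 n3 <;> simp at e0 e1 e2 <;> linarith
  · rintro ⟨k, hk⟩
    refine ⟨⟨vertex k, vertex_mem k, fun i => ?_⟩, (unimodular_of_subset hk).indep⟩
    rw [active_vertex]
    exact hk ⟨i, rfl⟩

lemma unimodular_octa (a : Fin 3 ↪ Fin 8) (h : octa.Admissible a) : octa.Unimodular a :=
  let ⟨_, hk⟩ := (admissible_octa_iff a).1 h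
  unimodular_of_subset hk

end Octahedron

namespace ToricData

variable {n d : ℕ} {D : ToricData n d}

lemma proj_apply (θ : ℝ^d) (i : Fin n) : D.proj θ i = ∑ j, θ j * D.normal j i := by
  simp [proj, Fintype.linearCombination_apply, Finset.sum_apply]

lemma mem_N_iff_of_le_span (hL : D.lattice ≤ span ℤ (range D.normal))
    {t} : t ∈ D.N ↔ ∃ θ, D.proj θ = 0 ∧ t = expT θ := by
  constructor
  · rintro ⟨φ, rfl, hφ⟩
    obtain ⟨c, hc⟩ := (mem_span_range_iff_exists_fun ℤ).1 (hL hφ)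
    refine ⟨fun j => φ j - c j, ?_, ?_⟩
    · have : D.proj (fun j => (c j : ℝ)) = D.proj φ := by
        rw [← hc, proj, Fintype.linearCombination_apply]
        exact Finset.sum_congr rfl fun i _ => Int.cast_smul_eq_zsmul ℝ _ _
      have h2 : (fun j => φ j - c j) = φ - fun j => (c j : ℝ) := rfl
      rw [h2, map_sub, this, sub_self]
    · funext j
      have := (expT_eq_one_iff (x := (c j : ℝ))).2 ⟨c j, rfl⟩
      simp only [expT]
      rw [mul_sub, Circle.exp_sub, this, div_one]
  · rintro ⟨θ, h, rfl⟩
    exact ⟨θ, rfl, by rw [h]; exact zero_mem _⟩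

lemma exists_circle_mul_norm (z : ℂ) : ∃ c : Circle, z = c * (‖z‖ : ℂ) := by
  refine ⟨Circle.exp z.arg, ?_⟩
  rw [Circle.coe_exp, mul_comm, norm_mul_exp_arg_mul_I]

lemma exists_exp_two_pi (c : Circle) : ∃ s : ℝ, Circle.exp (2 * Real.pi * s) = c := by
  refine ⟨arg c / (2 * Real.pi), ?_⟩
  rw [mul_div_cancel₀ _ (by positivity), Circle.exp_arg]

lemma connectedSpace_M [Nonempty D.M] : ConnectedSpace D.M := by
  have h : range D.mkM = univ := by
    rw [range_eq_univ]
    exact fun m => ⟨_, D.mkM_outM m⟩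
  let f : ℝ^d × ℝ^n → ℂ^d := fun p => rot (expT p.1)
    fun j => ((√(p.2 ⬝ᵥ D.normal j - D.bound j) : ℝ) : ℂ)
  have hf : Continuous f := by
    refine continuous_rot.comp (Continuous.prodMk ?_ ?_)
    · exact continuous_pi fun j => Circle.exp.continuous.comp (by fun_prop)
    · refine continuous_pi fun j => continuous_ofReal.comp (continuous_sqrt.comp ?_)
      refine Continuous.sub ?_ continuous_const
      simp only [dotProduct]
      fun_prop
  have hfm : ∀ p ∈ (univ : Set ℝ^d) ×ˢ D.polyhedron, f p ∈ D.levelSet := fun p hp =>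
    D.rot_mem_levelSet.2 (D.point_mem p.2 hp.2)
  have hc : IsPreconnected ((univ : Set ℝ^d) ×ˢ D.polyhedron) :=
    isPreconnected_univ.prod (Octahedron.convex_polyhedron D).isPreconnected
  have h2 := hc.image (D.mkM ∘ f) (D.continuousOn_mkM.comp hf.continuousOn hfm)
  have h3 : (D.mkM ∘ f) '' ((univ : Set ℝ^d) ×ˢ D.polyhedron) = univ := by
    refine eq_univ_of_forall fun m => ?_
    obtain ⟨z, hz⟩ := D.exists_repM m
    obtain ⟨μ, hμ⟩ := D.mem_levelSet_iff.1 hz.1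
    choose c hc using fun j => exists_circle_mul_norm (z j)
    choose θ hθ using fun j => exists_exp_two_pi (c j)
    refine ⟨(θ, μ), ⟨mem_univ _, fun j => ?_⟩, ?_⟩
    · rw [hμ]; nlinarith [sq_nonneg ‖z j‖]
    · have : f (θ, μ) = z := by
        funext j
        simp only [f, rot, expT, hθ, hμ]
        rw [add_sub_cancel_right, sqrt_sq (norm_nonneg _), ← hc]
      rw [Function.comp_apply, this, hz.eq_mkM]
  rw [h3] at h2
  exact { isPreconnected_univ := h2, toNonempty := inferInstance }

end ToricData

namespace Octahedron

open ToricData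

variable {t : Fin 4 → Circle} {k : Fin 6} {z : ℂ^8}

/-! ## The groups and the level sets -/

lemma proj_octa_eq_zero_iff {θ : ℝ^8} : octa.proj θ = 0 ↔
    θ 4 - θ 0 = θ 5 - θ 1 ∧ θ 4 - θ 0 = θ 6 - θ 2 ∧ θ 4 - θ 0 = θ 7 - θ 3 := by
  simp only [funext_iff, proj_apply, Fin.forall_fin_succ]
  simp [octa, Y, Fin.sum_univ_succ]
  constructor
  · rintro ⟨h0, h1, h2⟩
    refine ⟨?_, ?_, ?_⟩ <;> linarith
  · rintro ⟨h0, h1, h2⟩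
    refine ⟨?_, ?_, ?_⟩ <;> linarith

lemma proj_cone_eq_zero_iff (k) {θ : ℝ^4} : (cone k).proj θ = 0 ↔
    θ 1 = θ 0 ∧ θ 2 = -θ 0 ∧ θ 3 = -θ 0 := by
  simp only [funext_iff, proj_apply, Fin.forall_fin_succ]
  simp only [cone]
  fin_cases k <;> simp [idx, octa, Y, Fin.sum_univ_succ] <;> constructor <;>
    rintro ⟨h0, h1, h2⟩ <;> refine ⟨?_, ?_, ?_⟩ <;> linarith

lemma proj_square_eq_zero_iff {θ : ℝ^4} : square.proj θ = 0 ↔ θ 1 = θ 0 ∧ θ 3 = θ 2 := by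
  simp only [funext_iff, proj_apply, Fin.forall_fin_succ]
  simp [square, Fin.sum_univ_succ]
  constructor
  · rintro ⟨h0, h1⟩
    constructor <;> linarith
  · rintro ⟨h0, h1⟩
    constructor <;> linarith

lemma L_le_span_normal : octa.lattice ≤ span ℤ (range octa.normal) :=
  (L_le_span 0 ⟨![0, 1, 2], by decide⟩).trans <| span_mono <| by
    rintro _ ⟨i, rfl⟩
    exact ⟨_, rfl⟩

lemma mem_N_octa {t} : t ∈ octa.N ↔ ∃ (θ : ℝ^4) (s : ℝ),
    t = expT ![θ 0, θ 1, θ 2, θ 3, θ 0 + s, θ 1 + s, θ 2 + s, θ 3 + s] := by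
  rw [mem_N_iff_of_le_span L_le_span_normal]
  constructor
  · rintro ⟨θ, h, rfl⟩
    rw [proj_octa_eq_zero_iff] at h
    refine ⟨fun i => θ (Fin.castAdd 4 i), θ 4 - θ 0, congrArg _ ?_⟩
    funext j
    fin_cases j <;> simp <;> first | rfl | linarith
  · rintro ⟨θ, s, rfl⟩
    refine ⟨_, ?_, rfl⟩
    rw [proj_octa_eq_zero_iff]
    simp

lemma mem_N_cone (k) : t ∈ (cone k).N ↔ ∃ s : ℝ, t = expT ![s, s, -s, -s] := by
  have hL : (cone k).lattice ≤ span ℤ (range (cone k).normal) :=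
    (L_le_span k ⟨![0, 1, 2], by decide⟩).trans <| span_mono <| by
      rintro _ ⟨i, rfl⟩
      exact ⟨_, rfl⟩
  rw [mem_N_iff_of_le_span hL]
  constructor
  · rintro ⟨θ, h, rfl⟩
    rw [proj_cone_eq_zero_iff] at h
    refine ⟨θ 0, congrArg _ ?_⟩
    funext j
    fin_cases j <;> simp [h]
  · rintro ⟨s, rfl⟩
    refine ⟨_, ?_, rfl⟩
    rw [proj_cone_eq_zero_iff]
    simp

lemma mem_N_cone_iff (k) : t ∈ (cone k).N ↔ ∃ c : Circle, t = ![c, c, c⁻¹, c⁻¹] := by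
  rw [mem_N_cone]
  constructor
  · rintro ⟨s, rfl⟩
    refine ⟨Circle.exp (2 * Real.pi * s), ?_⟩
    funext j
    fin_cases j <;> simp [expT, Circle.exp_neg]
  · rintro ⟨c, rfl⟩
    obtain ⟨s, rfl⟩ := exists_exp_two_pi c
    refine ⟨s, ?_⟩
    funext j
    fin_cases j <;> simp [expT, Circle.exp_neg]

lemma mem_N_square : t ∈ square.N ↔ ∃ s r : ℝ, t = expT ![s, s, r, r] := by
  have hL : square.lattice ≤ span ℤ (range square.normal) := le_rfl
  rw [mem_N_iff_of_le_span hL]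
  constructor
  · rintro ⟨θ, h, rfl⟩
    rw [proj_square_eq_zero_iff] at h
    refine ⟨θ 0, θ 2, congrArg _ ?_⟩
    funext j
    fin_cases j <;> simp [h]
  · rintro ⟨s, r, rfl⟩
    refine ⟨_, ?_, rfl⟩
    rw [proj_square_eq_zero_iff]
    simp

lemma mem_N_square_iff : t ∈ square.N ↔ ∃ c b : Circle, t = ![c, c, b, b] := by
  rw [mem_N_square]
  constructor
  · rintro ⟨s, r, rfl⟩
    refine ⟨Circle.exp (2 * Real.pi * s), Circle.exp (2 * Real.pi * r), ?_⟩
    funext j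
    fin_cases j <;> simp [expT]
  · rintro ⟨c, b, rfl⟩
    obtain ⟨s, rfl⟩ := exists_exp_two_pi c
    obtain ⟨r, rfl⟩ := exists_exp_two_pi b
    refine ⟨s, r, ?_⟩
    funext j
    fin_cases j <;> simp [expT]

lemma mem_levelSet_octa : z ∈ octa.levelSet ↔ ‖z 0‖ ^ 2 + ‖z 4‖ ^ 2 = 2 ∧ ‖z 1‖ ^ 2 + ‖z 5‖ ^ 2 = 2
    ∧ ‖z 2‖ ^ 2 + ‖z 6‖ ^ 2 = 2 ∧ ‖z 3‖ ^ 2 + ‖z 7‖ ^ 2 = 2 ∧ ‖z 2‖ ^ 2 + ‖z 3‖ ^ 2 = ‖z 4‖ ^ 2 + ‖z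
    5‖ ^ 2 := by
  rw [mem_levelSet_iff]
  have hb : ∀ j, octa.bound j = -1 := fun _ => rfl
  simp only [dot_normal_octa, hb, Fin.forall_fin_succ]
  simp
  constructor
  · rintro ⟨μ, h0, h1, h2, h3, h4, h5, h6, h7⟩
    refine ⟨?_, ?_, ?_, ?_, ?_⟩ <;> linarith
  · rintro ⟨h0, h1, h2, h3, h4⟩
    refine ⟨![(‖z 0‖ ^ 2 + ‖z 1‖ ^ 2) / 2 - 1, (‖z 0‖ ^ 2 + ‖z 2‖ ^ 2) / 2 - 1,
      (‖z 0‖ ^ 2 + ‖z 3‖ ^ 2) / 2 - 1], ?_, ?_, ?_, ?_, ?_, ?_, ?_, ?_⟩ <;> simp <;> linarith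

lemma mem_levelSet_cone (k) {z} : z ∈ (cone k).levelSet ↔
    ‖z 0‖ ^ 2 + ‖z 1‖ ^ 2 = ‖z 2‖ ^ 2 + ‖z 3‖ ^ 2 := by
  have hb : ∀ j, (cone k).bound j = -1 := fun _ => rfl
  constructor
  · intro h
    have := h ![1, 1, -1, -1] (by rw [proj_cone_eq_zero_iff]; simp)
    simp [Fin.sum_univ_succ, hb] at this
    linarith
  · intro h θ hθ
    rw [proj_cone_eq_zero_iff] at hθ
    obtain ⟨h1, h2, h3⟩ := hθ
    simp [Fin.sum_univ_succ, hb, h1, h2, h3]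
    linear_combination θ 0 * h

lemma mem_levelSet_square {z} : z ∈ square.levelSet ↔
    ‖z 0‖ ^ 2 + ‖z 1‖ ^ 2 = 2 ∧ ‖z 2‖ ^ 2 + ‖z 3‖ ^ 2 = 2 := by
  have hb : ∀ j, square.bound j = -1 := fun _ => rfl
  constructor
  · intro h
    have h1 := h ![1, 1, 0, 0] (by rw [proj_square_eq_zero_iff]; simp)
    have h2 := h ![0, 0, 1, 1] (by rw [proj_square_eq_zero_iff]; simp)
    simp [Fin.sum_univ_succ, hb] at h1 h2
    constructor <;> linarith
  · rintro ⟨h, h'⟩ θ hθ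
    rw [proj_square_eq_zero_iff] at hθ
    obtain ⟨h1, h2⟩ := hθ
    simp [Fin.sum_univ_succ, hb, h1, h2]
    linear_combination θ 0 * h + θ 2 * h'

lemma norm_sq_le_octa (hz : z ∈ octa.levelSet) (j : Fin 8) : ‖z j‖ ^ 2 ≤ 2 := by
  obtain ⟨h0, h1, h2, h3, -⟩ := mem_levelSet_octa.1 hz
  fin_cases j <;> simp <;> nlinarith [sq_nonneg ‖z 0‖, sq_nonneg ‖z 1‖, sq_nonneg ‖z 2‖,
    sq_nonneg ‖z 3‖, sq_nonneg ‖z 4‖, sq_nonneg ‖z 5‖, sq_nonneg ‖z 6‖, sq_nonneg ‖z 7‖]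

lemma norm_sq_add_opp (hz : z ∈ octa.levelSet) (j : Fin 8) : ‖z j‖ ^ 2 + ‖z (opp j)‖ ^ 2 = 2 := by
  obtain ⟨h0, h1, h2, h3, -⟩ := mem_levelSet_octa.1 hz
  have hc : ∀ i j : Fin 8, ‖z i‖ ^ 2 + ‖z j‖ ^ 2 = 2 → ‖z j‖ ^ 2 + ‖z i‖ ^ 2 = 2 :=
    fun i j h => by rw [add_comm]; exact h
  fin_cases j
  · exact h0
  · exact h1
  · exact h2
  · exact h3
  · exact hc _ _ h0
  · exact hc _ _ h1
  · exact hc _ _ h2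
  · exact hc _ _ h3

lemma isCompact_levelSet_octa : IsCompact octa.levelSet := by
  refine Metric.isCompact_of_isClosed_isBounded octa.isClosed_levelSet ?_
  refine (Metric.isBounded_closedBall (x := (0 : ℂ^8)) (r := 2)).subset fun z hz => ?_
  rw [mem_closedBall_zero_iff, pi_norm_le_iff_of_nonneg (by norm_num)]
  intro j
  nlinarith [norm_sq_le_octa hz j, norm_nonneg (z j)]

instance : Nonempty octa.M := ⟨singularPoint 0⟩

instance (k : Fin 6) : Nonempty (cone k).M := ⟨apex k⟩

instance : CompactSpace octa.M := octa.compactSpace_M isCompact_levelSet_octa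

lemma admissible_triple345 : octa.Admissible triple345 := by
  rw [admissible_octa_iff]
  refine ⟨0, ?_⟩
  rintro _ ⟨i, rfl⟩
  fin_cases i
  · exact ⟨0, rfl⟩
  · exact ⟨1, rfl⟩
  · exact ⟨2, rfl⟩

lemma unimodular_triple345 : octa.Unimodular triple345 := unimodular_octa _ admissible_triple345

instance : T2Space octa.M := octa.t2Space_M unimodular_triple345.isClosed_N

instance (k : Fin 6) : T2Space (cone k).M :=
  (cone k).t2Space_M (unimodular_cone k ⟨![0, 1, 2], by decide⟩).isClosed_N

instance : SecondCountableTopology octa.M := octa.secondCountable_M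

instance : ConnectedSpace octa.M := connectedSpace_M

/-! ## The singular points -/

lemma notMem_idx_iff (k) (j : Fin 8) : j ∉ range (idx k) ↔ opp j ∈ range (idx k) := by
  have : ∀ (k : Fin 6) (j : Fin 8), (¬ ∃ i, idx k i = j) ↔ ∃ i, idx k i = opp j := by decide
  exact this k j

lemma opp_opp (j : Fin 8) : opp (opp j) = j := by
  revert j; decide

lemma normal_opp (j : Fin 8) : octa.normal (opp j) = -octa.normal j := by
  fin_cases j <;> simp [octa, opp]

lemma forall_idx (k) {P : Fin 8 → Prop} :
    (∀ j, P j) ↔ (∀ i, P (idx k i)) ∧ ∀ i, P (opp (idx k i)) := by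
  refine ⟨fun h => ⟨fun i => h _, fun i => h _⟩, fun h j => ?_⟩
  by_cases hj : j ∈ range (idx k)
  · obtain ⟨i, rfl⟩ := hj
    exact h.1 i
  · obtain ⟨i, hi⟩ := (notMem_idx_iff k j).1 hj
    rw [← opp_opp j, ← hi]
    exact h.2 i

lemma forall_notMem_idx_opp (k) {P : Fin 8 → Prop} :
    (∀ j ∉ range (idx k), P j) ↔ ∀ i, P (opp (idx k i)) := by
  simp only [notMem_idx_iff]
  refine ⟨fun h i => h _ (by rw [opp_opp]; exact ⟨i, rfl⟩), ?_⟩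
  rintro h j ⟨i, hi⟩
  rw [← opp_opp j, ← hi]
  exact h i

lemma opp_idx_notMem (k) : ∀ i, opp (idx k i) ∉ range (idx k) :=
  (forall_notMem_idx_opp k).1 fun _ => id

/-- The tuple with entries `z` at the indices of the `k`-th vertex and `w` opposite to them. -/
def glue {α : Type*} (k : Fin 6) (z w : Fin 4 → α) : Fin 8 → α :=
  extend (idx k) z fun j => extend (idx k) w (fun _ => w 0) (opp j)

lemma glue_idx {α : Type*} (k) (z w : Fin 4 → α) (i : Fin 4) : glue k z w (idx k i) = z i := (idx_injective k).extend_apply _ _ _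

lemma glue_opp {α : Type*} (k) (z w : Fin 4 → α) (i : Fin 4) :
    glue k z w (opp (idx k i)) = w i := by
  rw [glue, extend_apply' _ _ _ (opp_idx_notMem k i), opp_opp,
    (idx_injective k).extend_apply]

lemma eq_glue {α : Type*} (k) {x : Fin 8 → α} {z w : Fin 4 → α}
    (h : ∀ i, x (idx k i) = z i) (h' : ∀ i, x (opp (idx k i)) = w i) : x = glue k z w :=
  funext <| (forall_idx k).2
    ⟨fun i => by rw [h, glue_idx], fun i => by rw [h', glue_opp]⟩

lemma proj_octa_eq (k) (θ : ℝ^8) :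
    octa.proj θ = (cone k).proj fun i => θ (idx k i) - θ (opp (idx k i)) := by
  funext i
  simp only [proj_apply, cone]
  fin_cases k <;> fin_cases i <;> simp [Fin.sum_univ_succ, octa, Y, idx, opp] <;> ring

lemma proj_glue (k) (η φ : ℝ^4) : octa.proj (glue k (η + φ) φ) = (cone k).proj η := by
  rw [proj_octa_eq k]
  congr 1
  funext i
  rw [glue_idx, glue_opp, Pi.add_apply, add_sub_cancel_right]

lemma glue_mem_N (k) {t c} (ht : t ∈ (cone k).N) :
    glue k (t * c) c ∈ octa.N := by
  obtain ⟨η, rfl, h⟩ := ht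
  obtain ⟨φ, rfl⟩ := exists_expT c
  refine ⟨glue k (η + φ) φ, (eq_glue k (fun i => ?_) fun i => ?_).symm, (proj_glue k η φ).symm ▸ h⟩
  · simp [expT, glue_idx, mul_add, Circle.exp_add]
  · simp [expT, glue_opp]

lemma quotient_mem_N (k) {t} (ht : t ∈ octa.N) :
    (fun i => t (idx k i) / t (opp (idx k i))) ∈ (cone k).N := by
  obtain ⟨θ, rfl, h⟩ := ht
  refine ⟨_, ?_, proj_octa_eq k θ ▸ h⟩
  funext i
  simp [expT, mul_sub, Circle.exp_sub]

lemma dot_vertex_normal {j : Fin 8} (hj : j ∉ range (idx k)) : vertex k ⬝ᵥ octa.normal j = 1 := by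
  rw [notMem_idx_iff] at hj
  have h1 : vertex k ⬝ᵥ octa.normal (opp j) = -1 := mem_active_vertex.2 hj
  rw [normal_opp, dotProduct_neg] at h1
  linarith

lemma repM_singularPoint (hz : z ∈ octa.levelSet) :
    octa.RepM z (singularPoint k) ↔ ∀ j ∉ range (idx k), ‖z j‖ ^ 2 = 2 := by
  constructor
  · intro h j hj
    have h1 := unimodular_triple345.moment_dot h j
    have h2 := unimodular_triple345.moment_dot (RepM_point (vertex_mem k)) j
    change unimodular_triple345.moment (octa.point (vertex k) (vertex_mem k)) ⬝ᵥ _ = _ at h1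
    rw [unimodular_triple345.moment_point, dot_vertex_normal hj] at h1
    have : octa.bound j = -1 := rfl
    rw [this] at h1
    linarith
  · intro h
    have h0 : ∀ i, z (idx k i) = 0 := fun i => by
      have h1 : ‖z (idx k i)‖ ^ 2 = 0 := by
        linarith [h _ (opp_idx_notMem k i), norm_sq_add_opp hz (idx k i)]
      simpa using h1
    choose b hb using fun i => exists_circle_mul_norm (z (opp (idx k i)))
    change octa.RepM _ (octa.point (vertex k) (vertex_mem k))
    have hb' (j) : octa.bound j = -1 := rfl
    convert (RepM_point (D := octa) (vertex_mem k)).rot octa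
      (glue_mem_N k (c := b) (one_mem (cone k).N)) using 1
    refine funext <| (forall_idx k).2 ⟨fun i => ?_, fun i => ?_⟩
    · have : vertex k ⬝ᵥ octa.normal (idx k i) = -1 := mem_active_vertex.2 ⟨i, rfl⟩
      simp [rot, h0, this, hb']
    · have h1 := opp_idx_notMem k i
      rw [rot, glue_opp, dot_vertex_normal h1, hb', hb, ← sqrt_sq (norm_nonneg (z _)), h _ h1]
      norm_num

lemma RepM.zero_iff_of_singular
    (h : octa.RepM z (singularPoint k)) (j : Fin 8) : z j = 0 ↔ j ∈ range (idx k) := by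
  have h1 := (repM_singularPoint h.1).1 h
  constructor
  · intro hz
    by_contra hj
    have := h1 j hj
    rw [hz] at this
    norm_num at this
  · intro hj
    have h2 := h1 (opp j) (by rw [notMem_idx_iff, opp_opp]; exact hj)
    have h3 := norm_sq_add_opp h.1 j
    have h4 : ‖z j‖ ^ 2 = 0 := by linarith
    simpa using h4

lemma singularPoint_injective : Injective singularPoint := by
  intro k l h
  have := congrArg unimodular_triple345.moment h
  change unimodular_triple345.moment (octa.point _ _) =
    unimodular_triple345.moment (octa.point _ _) at this
  rw [unimodular_triple345.moment_point, unimodular_triple345.moment_point] at this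
  exact vertex_injective this

lemma isotropy_singular (h : octa.RepM z (singularPoint k)) (t) : (t ∈ octa.N ∧ rot
    t z = z) ↔ ∃ c : Circle, t (idx k 0) = c ∧ t (idx k 1) = c ∧ t (idx k 2) = c⁻¹ ∧ t (idx k 3) =
    c⁻¹ ∧ ∀ j ∉ range (idx k), t j = 1 := by
  have hz := RepM.zero_iff_of_singular h
  have hr : rot t z = z ↔ ∀ j ∉ range (idx k), t j = 1 := by
    rw [funext_iff]
    refine forall_congr' fun j => ?_
    by_cases hj : j ∈ range (idx k)
    · simp [rot, (hz j).2 hj, hj]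
    · have : z j ≠ 0 := fun e => hj ((hz j).1 e)
      have h1 : ((t j : ℂ) = 1) ↔ t j = 1 := by rw [← Circle.coe_one, Circle.coe_inj]
      simp [rot, hj, this, h1]
  rw [hr]
  constructor
  · rintro ⟨h1, h2⟩
    obtain ⟨c, hc⟩ := (mem_N_cone_iff k).1 (quotient_mem_N k h1)
    have := congrFun hc
    simp only [h2 _ (opp_idx_notMem k _), div_one] at this
    exact ⟨c, this 0, this 1, this 2, this 3, h2⟩
  · rintro ⟨c, e0, e1, e2, e3, h1⟩
    refine ⟨?_, h1⟩
    have := glue_mem_N k (c := 1) ((mem_N_cone_iff k).2 ⟨c, rfl⟩)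
    rwa [mul_one, ← eq_glue k (x := t) (w := 1) (fun i => ?_) fun i => h1 _ (opp_idx_notMem k i)] at this
    fin_cases i <;> assumption

lemma active_subset {μ : ℝ^3} (hμ : μ ∈ octa.polyhedron) :
    ∃ k, octa.active μ ⊆ range (idx k) := by
  obtain ⟨⟨h0, h1⟩, ⟨h2, h3⟩, ⟨h4, h5⟩, h6, h7⟩ := by
    simpa only [abs_le] using mem_polyhedron_octa.1 hμ
  have key : ∀ k : Fin 6, (∀ j, (¬ ∃ i, idx k i = j) → μ ⬝ᵥ octa.normal j = -1 → False) →
      ∃ k, octa.active μ ⊆ range (idx k) := fun k h =>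
    ⟨k, fun j hj => by by_contra hn; exact h j hn hj⟩
  have h8 : ∀ k : Fin 6, 0 < μ ⬝ᵥ vertex k → ∃ k, octa.active μ ⊆ range (idx k) := by
    intro k hk
    refine key k fun j hj h => ?_
    rw [dot_normal_octa] at h
    fin_cases k <;> simp [vertex, dotProduct, Fin.sum_univ_succ] at hk <;> fin_cases j <;>
      first | (exfalso; revert hj; decide) | (simp at h; linarith)
  by_cases hc : ∃ k, 0 < μ ⬝ᵥ vertex k
  · exact h8 _ hc.choose_spec
  · push Not at hc
    refine key 0 fun j _ h => ?_
    rw [dot_normal_octa] at h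
    simp only [Fin.forall_fin_succ] at hc
    simp [vertex, dotProduct, Fin.sum_univ_succ] at hc
    obtain ⟨a0, a1, a2, a3, a4, a5⟩ := hc
    fin_cases j <;> simp at h <;> linarith

lemma exists_tuple (k) (i : Fin 4) :
    ∃ a : Fin 3 ↪ Fin 8, range a = range (idx k) \ {idx k i} := by
  let b : Fin 3 ↪ Fin 4 := Fin.succAboveEmb i
  refine ⟨b.trans ⟨idx k, idx_injective k⟩, ?_⟩
  have hb : ∀ l, b.trans ⟨idx k, idx_injective k⟩ l = idx k (i.succAbove l) := fun _ => rfl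
  ext j
  constructor
  · rintro ⟨l, rfl⟩
    rw [hb]
    exact ⟨⟨_, rfl⟩, fun h => Fin.succAbove_ne i l (idx_injective k h)⟩
  · rintro ⟨⟨l, rfl⟩, hl⟩
    obtain ⟨m, rfl⟩ := Fin.exists_succAbove_eq (fun h : l = i => hl (by rw [h]; rfl))
    exact ⟨m, hb m⟩

lemma regular_octa_iff {m : octa.M} (h : octa.RepM z m) :
    m ∉ range singularPoint ↔ ∃ a, octa.Admissible a ∧ z ∈ nz a := by
  constructor
  · intro hm
    obtain ⟨μ, hμ, hz⟩ := octa.level_sub_polystable h.1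
    obtain ⟨k, hk⟩ := active_subset hμ
    obtain ⟨i, hi⟩ : ∃ i, z (idx k i) ≠ 0 := by
      by_contra! hc
      refine hm ⟨k, ((repM_singularPoint h.1).2 fun j hj => ?_).unique octa h⟩
      obtain ⟨i, hi⟩ := (notMem_idx_iff k j).1 hj
      have := norm_sq_add_opp h.1 j
      rw [← hi, hc i] at this
      simpa using this
    obtain ⟨a, ha⟩ := exists_tuple k i
    refine ⟨a, (admissible_octa_iff a).2 ⟨k, by rw [ha]; exact diff_subset⟩, fun j hj hj0 => hj ?_⟩
    rw [ha]
    exact ⟨hk ((hz j).1 hj0), fun e => hi (by rw [← (show j = idx k i from e)]; exact hj0)⟩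
  · rintro ⟨a, ha, hz⟩ ⟨k, rfl⟩
    have h1 : range (idx k) ⊆ range a := fun j hj => by
      by_contra hn
      exact hz j hn ((RepM.zero_iff_of_singular h j).2 hj)
    have h2 := ncard_le_ncard h1 (finite_range a)
    rw [← image_univ, ncard_image_of_injective _ (idx_injective k), ← image_univ,
      ncard_image_of_injective _ a.injective] at h2
    simp at h2

lemma isotropy_regular (hz : z ∈ octa.levelSet) (h : ∀ k, ¬ octa.RepM z (singularPoint k)) {t : Fin
    8 → Circle} (ht : t ∈ octa.N) (htz : rot t z = z) : t = 1 := by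
  have h1 := octa.repM_mkM hz
  obtain ⟨a, ha, hza⟩ := (regular_octa_iff h1).1 (by
    rintro ⟨k, hk⟩
    exact h k (hk ▸ h1))
  refine (unimodular_octa a ha).eq_one_of_mem_N ht fun j hj => ?_
  have := congrFun htz j
  rw [← Circle.coe_inj]
  simpa [rot, hza j hj] using this

lemma isOpen_regular : IsOpen (range singularPoint)ᶜ :=
  (finite_range _).isClosed.isOpen_compl

lemma dense_regular : Dense (range singularPoint)ᶜ := by
  have : Nontrivial octa.M :=
    ⟨singularPoint 0, singularPoint 1, fun h => by simpa using singularPoint_injective h⟩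
  rw [compl_eq_univ_diff]
  exact dense_univ.diff_finite (finite_range _)

lemma exists_level_ne_zero : ∃ z ∈ octa.levelSet, ∀ j, z j ≠ 0 :=
  ⟨fun _ => 1, by rw [mem_levelSet_octa]; norm_num, fun _ => one_ne_zero⟩

lemma moment_eq_vertex_iff (k) (m : octa.M) :
    unimodular_triple345.moment m = vertex k ↔ m = singularPoint k := by
  constructor
  · intro h
    obtain ⟨z, hz⟩ := octa.exists_repM m
    refine hz.unique octa ((repM_singularPoint hz.1).2 fun j hj => ?_)
    have := unimodular_triple345.moment_dot hz j
    rw [h, dot_vertex_normal hj] at this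
    have hb : octa.bound j = -1 := rfl
    rw [hb] at this
    linarith
  · rintro rfl
    exact unimodular_triple345.moment_point _

end Octahedron

namespace Octahedron

open ToricData

variable {z : ℂ^4} {θ : ℝ^4} {k : Fin 6}

/-- The squared norms of the two pairs of coordinates. -/
def nA (z : ℂ^4) : ℝ := ‖z 0‖ ^ 2 + ‖z 1‖ ^ 2

def nB (z : ℂ^4) : ℝ := ‖z 2‖ ^ 2 + ‖z 3‖ ^ 2

lemma nA_nonneg (z : ℂ^4) : 0 ≤ nA z := by unfold nA; positivity

lemma nB_nonneg (z : ℂ^4) : 0 ≤ nB z := by unfold nB; positivity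

lemma continuous_nA : Continuous nA := by unfold nA; fun_prop

lemma continuous_nB : Continuous nB := by unfold nB; fun_prop

lemma nA_eq_zero : nA z = 0 ↔ z 0 = 0 ∧ z 1 = 0 := by
  rw [nA, add_eq_zero_iff_of_nonneg (by positivity) (by positivity)]
  simp

lemma nB_eq_zero : nB z = 0 ↔ z 2 = 0 ∧ z 3 = 0 := by
  rw [nB, add_eq_zero_iff_of_nonneg (by positivity) (by positivity)]
  simp

lemma nA_rot (t : Fin 4 → Circle) (z : ℂ^4) : nA (rot t z) = nA z := by
  simp [nA, norm_rot]

lemma nB_rot (t : Fin 4 → Circle) (z : ℂ^4) : nB (rot t z) = nB z := by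
  simp [nB, norm_rot]

lemma nA_dil (h : θ 1 = θ 0) (z : ℂ^4) : nA (dil θ z) = Real.exp (θ 0) ^ 2 * nA z := by
  have e : ∀ x : ℝ, ‖(Real.exp x : ℂ)‖ = Real.exp x := fun x => by
    rw [norm_real, norm_eq_abs, abs_exp]
  simp only [nA, dil, h, norm_mul, e]
  ring

lemma nB_dil (h : θ 3 = θ 2) (z : ℂ^4) : nB (dil θ z) = Real.exp (θ 2) ^ 2 * nB z := by
  have e : ∀ x : ℝ, ‖(Real.exp x : ℂ)‖ = Real.exp x := fun x => by
    rw [norm_real, norm_eq_abs, abs_exp]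
  simp only [nB, dil, h, norm_mul, e]
  ring

/-- Scaling the two pairs of coordinates. -/
def scale2 (f g : ℝ) (z : ℂ^4) : ℂ^4 :=
  ![(f : ℂ) * z 0, (f : ℂ) * z 1, (g : ℂ) * z 2, (g : ℂ) * z 3]

lemma scale2_apply (f g : ℝ) (z : ℂ^4) (j : Fin 4) :
    scale2 f g z j = ((![f, f, g, g] j : ℝ) : ℂ) * z j := by
  fin_cases j <;> rfl

lemma nA_scale2 (f g : ℝ) (z : ℂ^4) : nA (scale2 f g z) = f ^ 2 * nA z := by
  simp [nA, scale2, mul_pow]; ring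

lemma nB_scale2 (f g : ℝ) (z : ℂ^4) : nB (scale2 f g z) = g ^ 2 * nB z := by
  simp [nB, scale2, mul_pow]; ring

lemma scale2_eq_dil {f g : ℝ} (hf : 0 < f) (hg : 0 < g) (z : ℂ^4) :
    scale2 f g z = dil ![Real.log f, Real.log f, Real.log g, Real.log g] z := by
  funext j
  fin_cases j <;> simp [scale2, dil, Real.exp_log hf, Real.exp_log hg, ← ofReal_exp]

lemma scale2_rot (f g : ℝ) (t : Fin 4 → Circle) (z : ℂ^4) :
    scale2 f g (rot t z) = rot t (scale2 f g z) := by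
  funext j
  rw [scale2_apply, rot, rot, scale2_apply]
  ring

lemma scale2_dil (f g : ℝ) (h : θ 1 = θ 0) (h' : θ 3 = θ 2) (z : ℂ^4) :
    scale2 f g (dil θ z) = scale2 (f * Real.exp (θ 0)) (g * Real.exp (θ 2)) z := by
  funext j
  fin_cases j <;> simp [scale2, dil, h, h'] <;> ring

lemma scale2_one (z : ℂ^4) : scale2 1 1 z = z := by
  funext j
  fin_cases j <;> simp [scale2]

/-! ## The square -/

lemma dot_normal_square (μ : ℝ^2) (j : Fin 4) :
    μ ⬝ᵥ square.normal j = ![μ 0, -μ 0, μ 1, -μ 1] j := by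
  fin_cases j <;> simp [square, dotProduct, Fin.sum_univ_succ]

lemma mem_stable_square : z ∈ square.stable ↔ nA z ≠ 0 ∧ nB z ≠ 0 := by
  have hb : ∀ μ j, j ∈ square.active μ ↔ ![μ 0, -μ 0, μ 1, -μ 1] j = -1 := by
    intro μ j
    rw [← dot_normal_square]
    rfl
  constructor
  · rintro ⟨μ, hμ, h⟩
    simp only [hb] at h
    constructor
    · intro h0
      obtain ⟨h1, h2⟩ := nA_eq_zero.1 h0
      have h3 := not_imp_comm.1 (h 0) (by simpa using h1)
      have h4 := not_imp_comm.1 (h 1) (by simpa using h2)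
      simp at h3 h4
      linarith
    · intro h0
      obtain ⟨h1, h2⟩ := nB_eq_zero.1 h0
      have h3 := not_imp_comm.1 (h 2) (by simpa using h1)
      have h4 := not_imp_comm.1 (h 3) (by simpa using h2)
      simp at h3 h4
      linarith
  · rintro ⟨hA, hB⟩
    rw [Ne, nA_eq_zero, not_and_or] at hA
    rw [Ne, nB_eq_zero, not_and_or] at hB
    have hm : ∀ μ : ℝ^2, |μ 0| ≤ 1 → |μ 1| ≤ 1 → μ ∈ square.polyhedron := by
      intro μ h0 h1 j
      rw [dot_normal_square]
      rw [abs_le] at h0 h1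
      change (-1 : ℝ) ≤ _
      fin_cases j <;> simp <;> linarith
    rcases hA with hA | hA <;> rcases hB with hB | hB
    · refine ⟨![1, 1], hm _ (by simp) (by simp), fun j hj => ?_⟩
      rw [hb] at hj
      fin_cases j <;> simp at hj <;> assumption
    · refine ⟨![1, -1], hm _ (by simp) (by simp), fun j hj => ?_⟩
      rw [hb] at hj
      fin_cases j <;> simp at hj <;> assumption
    · refine ⟨![-1, 1], hm _ (by simp) (by simp), fun j hj => ?_⟩
      rw [hb] at hj
      fin_cases j <;> simp at hj <;> assumption
    · refine ⟨![-1, -1], hm _ (by simp) (by simp), fun j hj => ?_⟩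
      rw [hb] at hj
      fin_cases j <;> simp at hj <;> assumption

/-- Normalization of both pairs of coordinates to norm `√2`. -/
def retractSquare (z : ℂ^4) : ℂ^4 :=
  scale2 (√2 / √(nA z)) (√2 / √(nB z)) z

lemma mem_levelSet_square' : z ∈ square.levelSet ↔ nA z = 2 ∧ nB z = 2 :=
  mem_levelSet_square

lemma isRetraction_square : square.IsRetraction retractSquare where
  continuousOn := by
    intro z hz
    obtain ⟨hA, hB⟩ := mem_stable_square.1 hz
    have hA' : √(nA z) ≠ 0 := by rwa [Ne, sqrt_eq_zero (nA_nonneg z)]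
    have hB' : √(nB z) ≠ 0 := by rwa [Ne, sqrt_eq_zero (nB_nonneg z)]
    refine ContinuousAt.continuousWithinAt ?_
    have h1 : ContinuousAt (fun z => √2 / √(nA z)) z :=
      continuousAt_const.div continuous_nA.sqrt.continuousAt hA'
    have h2 : ContinuousAt (fun z => √2 / √(nB z)) z :=
      continuousAt_const.div continuous_nB.sqrt.continuousAt hB'
    refine continuousAt_pi.2 fun j => ?_
    simp only [retractSquare, scale2_apply]
    refine ContinuousAt.mul (continuous_ofReal.continuousAt.comp ?_)
      (continuous_apply j).continuousAt
    fin_cases j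
    · exact h1
    · exact h1
    · exact h2
    · exact h2
  mem z hz := by
    obtain ⟨hA, hB⟩ := mem_stable_square.1 hz
    rw [mem_levelSet_square', retractSquare, nA_scale2, nB_scale2, div_pow, div_pow,
      sq_sqrt (nA_nonneg z), sq_sqrt (nB_nonneg z), sq_sqrt (by norm_num)]
    constructor <;> field_simp
  closure z hz := by
    obtain ⟨hA, hB⟩ := mem_stable_square.1 hz
    have hA' := (nA_nonneg z).lt_of_ne' hA
    have hB' := (nB_nonneg z).lt_of_ne' hB
    refine subset_closure ⟨_, ?_, scale2_eq_dil (by positivity) (by positivity) z⟩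
    rw [proj_square_eq_zero_iff]
    simp
  dil z hz θ hθ := by
    obtain ⟨h1, h2⟩ := proj_square_eq_zero_iff.1 hθ
    rw [retractSquare, scale2_dil _ _ h1 h2, nA_dil h1, nB_dil h2, retractSquare,
      sqrt_mul (by positivity), sqrt_mul (by positivity),
      sqrt_sq (exp_pos _).le, sqrt_sq (exp_pos _).le]
    have e0 := (exp_pos (θ 0)).ne'
    have e2 := (exp_pos (θ 2)).ne'
    congr 1 <;> field_simp
  rot z hz t ht := by
    rw [retractSquare, scale2_rot, nA_rot, nB_rot, retractSquare]
  self z hz := by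
    obtain ⟨hA, hB⟩ := mem_levelSet_square'.1 hz
    rw [retractSquare, hA, hB, div_self (by positivity), scale2_one]
  ne_zero z hz j hj := by
    obtain ⟨hA, hB⟩ := mem_stable_square.1 (square.polystable_sub_stable hz)
    have hA' := (nA_nonneg z).lt_of_ne' hA
    have hB' := (nB_nonneg z).lt_of_ne' hB
    rw [retractSquare, scale2_apply]
    refine mul_ne_zero ?_ hj
    rw [ofReal_ne_zero]
    have : ∀ x : ℝ, 0 < x → √2 / √x ≠ 0 := fun x hx => by positivity
    fin_cases j
    · exact this _ hA'
    · exact this _ hA'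
    · exact this _ hB'
    · exact this _ hB'

instance : Nonempty square.M :=
  square.nonempty_levelSet_iff.1 ⟨fun _ => 1, by rw [mem_levelSet_square]; norm_num⟩

lemma unimodular_of_ne_neg {a : Fin 2 ↪ Fin 4}
    (h : ∀ i, square.normal (a 1) ≠ ![1, -1] i • square.normal (a 0)) : square.Unimodular a := by
  have key : ∀ x y : Fin 4, square.normal y ≠ square.normal x →
      square.normal y ≠ -square.normal x → ∀ j,
      (j = x ∨ j = y) ∨ (j = ![1, 0, 3, 2] x ∨ j = ![1, 0, 3, 2] y) := by
    have hd : ∀ x y : Fin 4, y ≠ x → y ≠ ![1, 0, 3, 2] x → ∀ j,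
      (j = x ∨ j = y) ∨ (j = ![1, 0, 3, 2] x ∨ j = ![1, 0, 3, 2] y) := by decide
    refine fun x y h1 h2 => hd x y (fun e => h1 (by rw [e])) fun e => h2 ?_
    rw [e]
    fin_cases x <;> simp [square]
  have hn : ∀ x, square.normal (![1, 0, 3, 2] x) = -square.normal x := by
    intro x
    fin_cases x <;> simp [square]
  have hsp : square.lattice ≤ span ℤ (range fun i => square.normal (a i)) := by
    refine span_le.2 ?_
    have hm : ∀ i, square.normal (a i) ∈ span ℤ (range fun i => square.normal (a i)) :=
      fun i => subset_span ⟨i, rfl⟩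
    rintro _ ⟨j, rfl⟩
    change square.normal j ∈ span ℤ (range fun i => square.normal (a i))
    rcases key (a 0) (a 1) (by simpa using h 0) (by simpa using h 1) j with
      (rfl | rfl) | (rfl | rfl)
    · exact hm 0
    · exact hm 1
    · rw [hn]; exact neg_mem (hm 0)
    · rw [hn]; exact neg_mem (hm 1)
  refine ⟨?_, hsp⟩
  refine linearIndependent_of_top_le_span_of_card_eq_finrank ?_ (by simp)
  intro v _
  have h0 : square.normal 0 ∈ span ℝ (range fun i => square.normal (a i)) :=
    span_subset_span ℤ ℝ _ (hsp (square.normal_mem 0))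
  have h2 : square.normal 2 ∈ span ℝ (range fun i => square.normal (a i)) :=
    span_subset_span ℤ ℝ _ (hsp (square.normal_mem 2))
  have : v = v 0 • square.normal 0 + v 1 • square.normal 2 := by
    funext i
    fin_cases i <;> simp [square]
  rw [this]
  exact add_mem (smul_mem _ _ h0) (smul_mem _ _ h2)

lemma unimodular_square (a : Fin 2 ↪ Fin 4) (h : square.Admissible a) : square.Unimodular a := by
  refine unimodular_of_ne_neg fun i hi => ?_
  have h1 := Fintype.linearIndependent_iff.1 h.2 ![![1, -1] i, -1] (by
    funext l
    simp [Fin.sum_univ_succ, hi]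
    fin_cases i <;> simp) 1
  simp at h1

/-- The pairs of normals at the vertices of the square. -/
def pairSquare (i j : Fin 2) : Fin 2 ↪ Fin 4 :=
  ⟨![![0, 1] i, ![2, 3] j], by revert i j; decide⟩

lemma unimodular_pairSquare (i j : Fin 2) : square.Unimodular (pairSquare i j) := by
  refine unimodular_of_ne_neg fun l h => ?_
  have h0 := congrFun h 0
  fin_cases i <;> fin_cases j <;> fin_cases l <;> simp [pairSquare, square] at h0

lemma admissible_pairSquare (i j : Fin 2) : square.Admissible (pairSquare i j) := by
  refine ⟨⟨![![-1, 1] i, ![-1, 1] j], fun l => ?_, fun l => ?_⟩, (unimodular_pairSquare i j).indep⟩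
  · rw [dot_normal_square]
    change (-1 : ℝ) ≤ _
    fin_cases i <;> fin_cases j <;> fin_cases l <;> simp
  · change _ ⬝ᵥ _ = (-1 : ℝ)
    rw [dot_normal_square]
    fin_cases i <;> fin_cases j <;> fin_cases l <;> simp [pairSquare]

lemma mem_nz_pairSquare {i j : Fin 2} :
    z ∈ nz (pairSquare i j) ↔ z (![1, 0] i) ≠ 0 ∧ z (![3, 2] j) ≠ 0 := by
  have hd : ∀ (i j : Fin 2) (l : Fin 4), (¬ ∃ m, pairSquare i j m = l) ↔
      l = ![1, 0] i ∨ l = ![3, 2] j := by decide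
  have : z ∈ nz (pairSquare i j) ↔ ∀ l, (l = ![1, 0] i ∨ l = ![3, 2] j) → z l ≠ 0 :=
    forall_congr' fun l => by rw [← hd]; rfl
  rw [this]
  constructor
  · exact fun h => ⟨h _ (Or.inl rfl), h _ (Or.inr rfl)⟩
  · rintro ⟨h1, h2⟩ l (rfl | rfl)
    · exact h1
    · exact h2

lemma exists_mem_nz_square (hz : z ∈ square.stable) : ∃ i j, z ∈ nz (pairSquare i j) := by
  obtain ⟨hA, hB⟩ := mem_stable_square.1 hz
  rw [Ne, nA_eq_zero, not_and_or] at hA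
  rw [Ne, nB_eq_zero, not_and_or] at hB
  simp only [mem_nz_pairSquare]
  rcases hA with hA | hA <;> rcases hB with hB | hB
  · exact ⟨1, 1, hA, hB⟩
  · exact ⟨1, 0, hA, hB⟩
  · exact ⟨0, 1, hA, hB⟩
  · exact ⟨0, 0, hA, hB⟩

lemma isKahlerOff_square : square.IsKahlerOff ∅ := by
  refine isRetraction_square.isKahlerOff unimodular_square fun z m hm => ?_
  obtain ⟨i, j, h⟩ := exists_mem_nz_square (square.levelSet_subset_stable hm.1)
  exact ⟨fun _ => ⟨_, admissible_pairSquare i j, h⟩, fun _ => notMem_empty _⟩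

lemma polystable_square : square.polystable = square.stable := by
  refine Subset.antisymm square.polystable_sub_stable fun z hz => ?_
  obtain ⟨i, j, h⟩ := exists_mem_nz_square hz
  refine (isRetraction_square.mem_polystable (unimodular_pairSquare i j) h).2 ⟨hz, ?_⟩
  obtain ⟨hA, hB⟩ := mem_stable_square.1 hz
  have hA' := (nA_nonneg z).lt_of_ne' hA
  have hB' := (nB_nonneg z).lt_of_ne' hB
  intro l hl
  rw [retractSquare, scale2_eq_dil (by positivity) (by positivity)]
  exact mul_ne_zero (by exact_mod_cast (exp_pos _).ne') (h l hl)

/-! ## The cones -/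

lemma stable_cone (k) : (cone k).stable = univ := by
  refine eq_univ_of_forall fun z => ⟨vertex k, fun i => vertex_mem k (idx k i), fun j hj => ?_⟩
  exact absurd ((mem_active_vertex (k := k)).2 ⟨j, rfl⟩) hj

lemma apex_rep (k) : (cone k).RepM 0 (apex k) := by
  have := RepM_point (D := cone k) (μ := vertex k) fun i => vertex_mem k (idx k i)
  change (cone k).RepM _ (apex k) at this
  convert this using 1
  funext j
  have h1 : vertex k ⬝ᵥ (cone k).normal j = -1 := (mem_active_vertex (k := k)).2 ⟨j, rfl⟩
  have h2 : (cone k).bound j = -1 := rfl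
  simp [h1, h2]

lemma repM_apex_iff {m : (cone k).M} (h : (cone k).RepM z m) : m = apex k ↔ z = 0 := by
  constructor
  · rintro rfl
    obtain ⟨t, ht, e⟩ := (apex_rep k).exists_rot _ h
    rw [e]
    funext j
    simp [rot]
  · rintro rfl
    exact h.unique _ (apex_rep k)

lemma mem_polystable_cone (hz : z ∈ (cone k).polystable) : nA z = 0 ↔ nB z = 0 := by
  obtain ⟨μ, hμ, h⟩ := hz
  have h1 := (cone k).dot_proj μ ![1, 1, -1, -1]
  rw [(proj_cone_eq_zero_iff k).2 (by simp), dotProduct_zero] at h1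
  simp [Fin.sum_univ_succ] at h1
  have hb : ∀ j, -1 ≤ μ ⬝ᵥ (cone k).normal j := hμ
  have h' : ∀ j, z j = 0 ↔ μ ⬝ᵥ (cone k).normal j = -1 := h
  rw [nA_eq_zero, nB_eq_zero, h', h', h', h']
  constructor
  · rintro ⟨h2, h3⟩
    constructor <;> linarith [hb 2, hb 3]
  · rintro ⟨h2, h3⟩
    constructor <;> linarith [hb 0, hb 1]

/-- The scaling of both pairs of coordinates to the same norm. -/
def retractCone (z : ℂ^4) : ℂ^4 :=
  scale2 (√(√(nA z * nB z)) / √(nA z))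
    (√(√(nA z * nB z)) / √(nB z)) z

lemma retractCone_of_eq_zero (h : nA z * nB z = 0) : retractCone z = 0 := by
  rw [retractCone, h]
  funext j
  fin_cases j <;> simp [scale2]

lemma mem_levelSet_cone' (k) : z ∈ (cone k).levelSet ↔ nA z = nB z := mem_levelSet_cone k

lemma nA_retractCone : nA (retractCone z) = √(nA z * nB z) := by
  by_cases h : nA z = 0
  · rw [retractCone_of_eq_zero (by rw [h, zero_mul]), h]
    simp [nA]
  · rw [retractCone, nA_scale2, div_pow, sq_sqrt (nA_nonneg z), sq_sqrt (by positivity)]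
    field_simp

lemma nB_retractCone : nB (retractCone z) = √(nA z * nB z) := by
  by_cases h : nB z = 0
  · rw [retractCone_of_eq_zero (by rw [h, mul_zero]), h]
    simp [nB]
  · rw [retractCone, nB_scale2, div_pow, sq_sqrt (nB_nonneg z), sq_sqrt (by positivity)]
    field_simp

lemma norm_sq_le_nA_add_nB (z) (j : Fin 4) : ‖z j‖ ^ 2 ≤ nA z + nB z := by
  unfold nA nB
  fin_cases j <;> simp <;> nlinarith [sq_nonneg ‖z 0‖, sq_nonneg ‖z 1‖, sq_nonneg ‖z 2‖,
    sq_nonneg ‖z 3‖]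

lemma continuous_retractCone : Continuous retractCone := by
  rw [continuous_iff_continuousAt]
  intro z
  by_cases h : nA z * nB z = 0
  · rw [ContinuousAt, retractCone_of_eq_zero h, tendsto_pi_nhds]
    intro j
    rw [Pi.zero_apply, tendsto_zero_iff_norm_tendsto_zero]
    have h1 : ∀ z, ‖retractCone z j‖ ≤ √(2 * √(nA z * nB z)) := by
      intro z
      refine le_sqrt_of_sq_le ((norm_sq_le_nA_add_nB _ j).trans ?_)
      rw [nA_retractCone, nB_retractCone]
      linarith
    refine squeeze_zero (fun _ => norm_nonneg _) h1 ?_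
    have h2 : Continuous fun z => √(2 * √(nA z * nB z)) :=
      (continuous_const.mul (continuous_nA.mul continuous_nB).sqrt).sqrt
    have h3 := h2.tendsto z
    simpa only [h, Real.sqrt_zero, mul_zero] using h3
  · have hA' : √(nA z) ≠ 0 := by
      rw [Ne, sqrt_eq_zero (nA_nonneg z)]; exact left_ne_zero_of_mul h
    have hB' : √(nB z) ≠ 0 := by
      rw [Ne, sqrt_eq_zero (nB_nonneg z)]; exact right_ne_zero_of_mul h
    have h0 : Continuous fun z => √(√(nA z * nB z)) :=
      (continuous_nA.mul continuous_nB).sqrt.sqrt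
    have h1 := h0.continuousAt.div continuous_nA.sqrt.continuousAt hA'
    have h2 := h0.continuousAt.div continuous_nB.sqrt.continuousAt hB'
    refine continuousAt_pi.2 fun j => ?_
    simp only [retractCone, scale2_apply]
    refine ContinuousAt.mul (continuous_ofReal.continuousAt.comp ?_)
      (continuous_apply j).continuousAt
    fin_cases j
    · exact h1
    · exact h1
    · exact h2
    · exact h2

lemma zero_mem_closure_orbit_cone (k) (h : nA z * nB z = 0) :
    0 ∈ closure ((cone k).orbit z) := by
  have he : Filter.Tendsto (fun c : ℝ => ((Real.exp (-c) : ℝ) : ℂ)) Filter.atTop (𝓝 0) := by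
    have := (continuous_ofReal.tendsto 0).comp
      (tendsto_exp_neg_atTop_nhds_zero)
    simpa [comp_def] using this
  rcases mul_eq_zero.1 h with h | h
  · obtain ⟨h0, h1⟩ := nA_eq_zero.1 h
    refine mem_closure_of_tendsto (f := fun c : ℝ => dil ![c, c, -c, -c] z) (b := Filter.atTop) ?_
      (Filter.Eventually.of_forall fun c => ⟨_, (proj_cone_eq_zero_iff k).2 (by simp), rfl⟩)
    rw [tendsto_pi_nhds]
    intro j
    fin_cases j
    · simp [dil, h0]
    · simp [dil, h1]
    · simpa [dil] using he.mul_const (z 2)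
    · simpa [dil] using he.mul_const (z 3)
  · obtain ⟨h0, h1⟩ := nB_eq_zero.1 h
    refine mem_closure_of_tendsto (f := fun c : ℝ => dil ![-c, -c, c, c] z) (b := Filter.atTop) ?_
      (Filter.Eventually.of_forall fun c => ⟨_, (proj_cone_eq_zero_iff k).2 (by simp), rfl⟩)
    rw [tendsto_pi_nhds]
    intro j
    fin_cases j
    · simpa [dil] using he.mul_const (z 0)
    · simpa [dil] using he.mul_const (z 1)
    · simp [dil, h0]
    · simp [dil, h1]

lemma retractCone_eq_scale (hA : nA z ≠ 0) (hB : nB z ≠ 0) :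
    ∃ f > 0, retractCone z = scale2 f f⁻¹ z := by
  have hA' := (nA_nonneg z).lt_of_ne' hA
  have hB' := (nB_nonneg z).lt_of_ne' hB
  refine ⟨√(√(nA z * nB z)) / √(nA z), by positivity, ?_⟩
  rw [retractCone]
  congr 1
  rw [inv_div, div_eq_div_iff (by positivity) (by positivity), mul_self_sqrt (by positivity),
    sqrt_mul (by positivity)]

lemma isRetraction_cone (k) : (cone k).IsRetraction retractCone where
  continuousOn := continuous_retractCone.continuousOn
  mem z _ := by rw [mem_levelSet_cone', nA_retractCone, nB_retractCone]
  closure z _ := by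
    by_cases h : nA z * nB z = 0
    · rw [retractCone_of_eq_zero h]
      exact zero_mem_closure_orbit_cone k h
    · obtain ⟨f, hf, e⟩ := retractCone_eq_scale (left_ne_zero_of_mul h) (right_ne_zero_of_mul h)
      refine subset_closure ⟨_, ?_, e.trans (scale2_eq_dil hf (inv_pos.2 hf) z)⟩
      rw [proj_cone_eq_zero_iff]
      simp
  dil z _ θ hθ := by
    obtain ⟨h1, h2, h3⟩ := (proj_cone_eq_zero_iff k).1 hθ
    have e0 := (exp_pos (θ 0)).ne'
    have e2 := (exp_pos (θ 2)).ne'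
    have h4 : Real.exp (θ 0) * Real.exp (θ 2) = 1 := by
      rw [← Real.exp_add, h2, add_neg_cancel, Real.exp_zero]
    have h5 : Real.exp (θ 0) ^ 2 * nA z * (Real.exp (θ 2) ^ 2 * nB z) = nA z * nB z := by
      calc _ = (Real.exp (θ 0) * Real.exp (θ 2)) ^ 2 * (nA z * nB z) := by ring
        _ = _ := by rw [h4]; ring
    rw [retractCone, scale2_dil _ _ h1 (h3.trans h2.symm), nA_dil h1, nB_dil (h3.trans h2.symm),
      retractCone, h5, sqrt_mul (sq_nonneg _) (nA z), sqrt_mul (sq_nonneg _) (nB z),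
      sqrt_sq (exp_pos _).le, sqrt_sq (exp_pos _).le]
    congr 1 <;> field_simp
  rot z _ t ht := by
    rw [retractCone, scale2_rot, nA_rot, nB_rot, retractCone]
  self z hz := by
    rw [mem_levelSet_cone'] at hz
    by_cases h : nB z = 0
    · rw [retractCone_of_eq_zero (by rw [h, mul_zero])]
      obtain ⟨h0, h1⟩ := nA_eq_zero.1 (hz.trans h)
      obtain ⟨h2, h3⟩ := nB_eq_zero.1 h
      funext j
      fin_cases j
      · exact h0.symm
      · exact h1.symm
      · exact h2.symm
      · exact h3.symm
    · have hB' := (nB_nonneg z).lt_of_ne' h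
      rw [retractCone, hz, sqrt_mul_self hB'.le, div_self (by positivity), scale2_one]
  ne_zero z hz j hj := by
    have h := mem_polystable_cone hz
    have h0 : ¬ (nA z = 0 ∧ nB z = 0) := by
      rintro ⟨h0, h1⟩
      have := norm_sq_le_nA_add_nB z j
      rw [h0, h1, add_zero] at this
      exact hj (by simpa using le_antisymm this (by positivity))
    obtain ⟨f, hf, e⟩ := retractCone_eq_scale (fun e => h0 ⟨e, h.1 e⟩) fun e => h0 ⟨h.2 e, e⟩
    rw [e, scale2_eq_dil hf (inv_pos.2 hf)]
    exact mul_ne_zero (by exact_mod_cast (exp_pos _).ne') hj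

lemma regular_cone_iff {m : (cone k).M} (h : (cone k).RepM z m) :
    m ∉ ({apex k} : Set (cone k).M) ↔ ∃ a, (cone k).Admissible a ∧ z ∈ nz a := by
  rw [mem_singleton_iff, repM_apex_iff h]
  constructor
  · intro hz
    obtain ⟨i, hi⟩ := ne_iff.1 hz
    refine ⟨Fin.succAboveEmb i, admissible_cone k _, fun j hj => ?_⟩
    by_cases hji : j = i
    · rwa [hji]
    · obtain ⟨l, hl⟩ := Fin.exists_succAbove_eq hji
      exact absurd ⟨l, hl⟩ hj
  · rintro ⟨a, -, hz⟩ rfl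
    have : Surjective a := fun j => by
      by_contra hj
      exact hz j hj rfl
    have := Fintype.card_le_of_surjective a this
    simp at this

lemma isKahlerOff_cone (k) : (cone k).IsKahlerOff {apex k} :=
  (isRetraction_cone k).isKahlerOff (fun a _ => unimodular_cone k a) fun _ _ h =>
    regular_cone_iff h

end Octahedron

namespace Octahedron

open ToricData

/-! ## The balanced weights of a stable point -/

/-- The weights `x` are balanced with respect to the squared norms `a` and `b`. -/
structure Balanced (a b x : ℝ^4) : Prop where
  nonneg : ∀ i, 0 ≤ x i
  le_one : ∀ i, x i ≤ 1
  sum : ∑ i, x i = 2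
  eq : ∀ i j, x i * (1 - x j) * (b i * a j) = x j * (1 - x i) * (b j * a i)

/-- A stability condition on squared norms. -/
structure Semi (p : Equiv.Perm (Fin 4)) (a b : ℝ^4) : Prop where
  a_nonneg : ∀ i, 0 ≤ a i
  b_nonneg : ∀ i, 0 ≤ b i
  a0 : 0 < a (p 0)
  a1 : 0 < a (p 1)
  b2 : 0 < b (p 2)
  b3 : 0 < b (p 3)

variable {p : Equiv.Perm (Fin 4)} {a b x y : ℝ^4}

lemma Balanced.sum_perm (h : Balanced a b x) (p : Equiv.Perm (Fin 4)) :
    x (p 0) + x (p 1) + x (p 2) + x (p 3) = 2 := by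
  rw [← h.sum, ← Equiv.sum_comp p, Fin.sum_univ_four]

lemma Balanced.pos_of_semi (h : Balanced a b x) (hs : Semi p a b) :
    0 < x (p 0) ∧ 0 < x (p 1) ∧ x (p 2) < 1 ∧ x (p 3) < 1 := by
  have hsum := h.sum_perm p
  have hn := fun i => h.nonneg (p i)
  have hl := fun i => h.le_one (p i)
  have key1 : ∀ i, 0 < a i → x i = 0 → x (p 2) = 0 ∧ x (p 3) = 0 := by
    intro i hi h0
    have e2 := h.eq i (p 2)
    have e3 := h.eq i (p 3)
    rw [h0] at e2 e3
    have := hs.b2.ne'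
    have := hs.b3.ne'
    have := hi.ne'
    constructor
    · simpa [*] using e2
    · simpa [*] using e3
  have key2 : ∀ i, 0 < b i → x i = 1 → x (p 0) = 1 ∧ x (p 1) = 1 := by
    intro i hi h0
    have e2 := h.eq i (p 0)
    have e3 := h.eq i (p 1)
    rw [h0, sub_self] at e2 e3
    have := hs.a0.ne'
    have := hs.a1.ne'
    have := hi.ne'
    constructor
    · have : 1 - x (p 0) = 0 := by simpa [*] using e2
      linarith
    · have : 1 - x (p 1) = 0 := by simpa [*] using e3
      linarith
  refine ⟨(hn 0).lt_of_ne' fun e => ?_, (hn 1).lt_of_ne' fun e => ?_, (hl 2).lt_of_ne fun e => ?_,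
    (hl 3).lt_of_ne fun e => ?_⟩
  · obtain ⟨e2, e3⟩ := key1 _ hs.a0 e
    linarith [hl 1]
  · obtain ⟨e2, e3⟩ := key1 _ hs.a1 e
    linarith [hl 0]
  · obtain ⟨e2, e3⟩ := key2 _ hs.b2 e
    linarith [hn 3]
  · obtain ⟨e2, e3⟩ := key2 _ hs.b3 e
    linarith [hn 2]

lemma Balanced.eq_zero (h : Balanced a b x) (hs : Semi p a b) {i : Fin 4} (hi : a i = 0) :
    x i = 0 := by
  have hsum := h.sum_perm p
  have hn := fun i => h.nonneg (p i)
  by_contra h0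
  have e : b i ≠ 0 → x (p 0) = 1 ∧ x (p 1) = 1 := by
    intro hb
    have e0 := h.eq i (p 0)
    have e1 := h.eq i (p 1)
    rw [hi] at e0 e1
    constructor
    · have : 1 - x (p 0) = 0 := by simpa [h0, hb, hs.a0.ne'] using e0
      linarith
    · have : 1 - x (p 1) = 0 := by simpa [h0, hb, hs.a1.ne'] using e1
      linarith
  obtain ⟨m, rfl⟩ := p.surjective i
  fin_cases m
  · exact hs.a0.ne' hi
  · exact hs.a1.ne' hi
  · obtain ⟨e0, e1⟩ := e hs.b2.ne'
    exact h0 (by change x (p 2) = 0; linarith [hn 2, hn 3])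
  · obtain ⟨e0, e1⟩ := e hs.b3.ne'
    exact h0 (by change x (p 3) = 0; linarith [hn 2, hn 3])

lemma Balanced.eq_one (h : Balanced a b x) (hs : Semi p a b) {i : Fin 4} (hi : b i = 0) :
    x i = 1 := by
  have hsum := h.sum_perm p
  have hl := fun i => h.le_one (p i)
  by_contra h0
  have h0' : 1 - x i ≠ 0 := fun e => h0 (by linarith)
  have e : a i ≠ 0 → x (p 2) = 0 ∧ x (p 3) = 0 := by
    intro hb
    have e0 := h.eq i (p 2)
    have e1 := h.eq i (p 3)
    rw [hi] at e0 e1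
    have := hs.b2.ne'
    have := hs.b3.ne'
    constructor
    · simpa [*] using e0
    · simpa [*] using e1
  obtain ⟨m, rfl⟩ := p.surjective i
  fin_cases m
  · obtain ⟨e0, e1⟩ := e hs.a0.ne'
    exact h0 (by change x (p 0) = 1; linarith [hl 0, hl 1])
  · obtain ⟨e0, e1⟩ := e hs.a1.ne'
    exact h0 (by change x (p 1) = 1; linarith [hl 0, hl 1])
  · exact hs.b2.ne' hi
  · exact hs.b3.ne' hi

lemma Balanced.unique (h : Balanced a b x) (h' : Balanced a b y) (hs : Semi p a b) : x = y := by
  by_contra hne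
  have key : ∀ {x y : ℝ^4}, Balanced a b x → Balanced a b y → (∃ i, x i < y i) →
      ∃ i, y i < x i := by
    intro x y h h' ⟨i, hi⟩
    by_contra! hc
    have := Finset.sum_lt_sum (fun j _ => hc j) ⟨i, Finset.mem_univ i, hi⟩
    rw [h.sum, h'.sum] at this
    exact lt_irrefl _ this
  obtain ⟨i, hi⟩ := ne_iff.1 hne
  have hij : (∃ i, x i < y i) ∧ ∃ i, y i < x i := by
    rcases lt_or_gt_of_ne hi with hi | hi
    · exact ⟨⟨i, hi⟩, key h h' ⟨i, hi⟩⟩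
    · exact ⟨key h' h ⟨i, hi⟩, ⟨i, hi⟩⟩
  obtain ⟨⟨i, hi⟩, j, hj⟩ := hij
  have hb : 0 < b i := (hs.b_nonneg i).lt_of_ne' fun e => by
    rw [h.eq_one hs e, h'.eq_one hs e] at hi
    exact lt_irrefl _ hi
  have ha : 0 < a j := (hs.a_nonneg j).lt_of_ne' fun e => by
    rw [h.eq_zero hs e, h'.eq_zero hs e] at hj
    exact lt_irrefl _ hj
  have h1 : x i * (1 - x j) < y i * (1 - y j) :=
    (mul_le_mul_of_nonneg_left (by linarith) (h.nonneg i)).trans_lt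
      (mul_lt_mul_of_pos_right hi (by linarith [h.le_one j]))
  have h2 : y j * (1 - y i) ≤ x j * (1 - x i) :=
    mul_le_mul hj.le (by linarith) (by linarith [h'.le_one i]) (h.nonneg j)
  have h3 := mul_lt_mul_of_pos_right h1 (mul_pos hb ha)
  have h4 := mul_le_mul_of_nonneg_right h2 (mul_nonneg (hs.b_nonneg j) (hs.a_nonneg i))
  linarith [h.eq i j, h'.eq i j]

/-- The curve of weights from which the balanced weights are chosen. -/
def weightCurve (a b : ℝ) (s : ℝ) : ℝ :=
  if a = 0 then 0 else if b = 0 then 1 else s * a / (s * a + (1 - s) * b)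

lemma continuousOn_weightCurve {a b : ℝ} (ha : 0 ≤ a) (hb : 0 ≤ b) :
    ContinuousOn (weightCurve a b) (Icc 0 1) := by
  by_cases h0 : a = 0
  · have : weightCurve a b = fun _ => 0 := by funext s; simp [weightCurve, h0]
    rw [this]; exact continuousOn_const
  by_cases h1 : b = 0
  · have : weightCurve a b = fun _ => 1 := by funext s; simp [weightCurve, h0, h1]
    rw [this]; exact continuousOn_const
  have : weightCurve a b = fun s => s * a / (s * a + (1 - s) * b) := by
    funext s; simp [weightCurve, h0, h1]
  rw [this]
  have ha' := ha.lt_of_ne' h0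
  have hb' := hb.lt_of_ne' h1
  refine ContinuousOn.div (by fun_prop) (by fun_prop) fun s hs => ?_
  rcases hs.1.lt_or_eq with h | h
  · have := mul_pos h ha'
    have := mul_nonneg (sub_nonneg.2 hs.2) hb
    linarith
  · rw [← h]; simpa using h1

lemma weightCurve_mem {a b s : ℝ} (ha : 0 ≤ a) (hb : 0 ≤ b) (hs : s ∈ Icc (0 : ℝ) 1) :
    0 ≤ weightCurve a b s ∧ weightCurve a b s ≤ 1 := by
  unfold weightCurve
  split_ifs
  · simp
  · simp
  · have h1 := mul_nonneg hs.1 ha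
    have h2 := mul_nonneg (sub_nonneg.2 hs.2) hb
    exact ⟨by positivity, div_le_one_of_le₀ (by linarith) (by linarith)⟩

lemma weightCurve_eq {a b s : ℝ} (ha : 0 ≤ a) (hb : 0 ≤ b) (h0 : 0 < a + b) (hs : s ∈ Ioo (0 : ℝ) 1)
    : 0 < s * a + (1 - s) * b ∧ weightCurve a b s = s * a / (s * a + (1 - s) * b) ∧ 1 - weightCurve
    a b s = (1 - s) * b / (s * a + (1 - s) * b) := by
  have hs' : 0 < 1 - s := by linarith [hs.2]
  have hpos : 0 < s * a + (1 - s) * b := by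
    rcases ha.lt_or_eq with h | h
    · have := mul_pos hs.1 h
      have := mul_nonneg hs'.le hb
      linarith
    · have := mul_pos hs' (show 0 < b by linarith)
      have := mul_nonneg hs.1.le ha
      linarith
  have h1 : weightCurve a b s = s * a / (s * a + (1 - s) * b) := by
    unfold weightCurve
    split_ifs with h h'
    · rw [h]; simp
    · rw [h', mul_zero, add_zero, div_self (mul_ne_zero hs.1.ne' h)]
    · rfl
  refine ⟨hpos, h1, ?_⟩
  rw [h1]
  field_simp
  ring

lemma Semi.exists_balanced (hs : Semi p a b) :
    ∃ s ∈ Icc (0 : ℝ) 1, Balanced a b fun i => weightCurve (a i) (b i) s := by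
  have hc : ContinuousOn (fun s => ∑ i, weightCurve (a i) (b i) s) (Icc 0 1) :=
    continuousOn_finsetSum _ fun i _ => continuousOn_weightCurve (hs.a_nonneg i) (hs.b_nonneg i)
  have h0 : ∑ i, weightCurve (a i) (b i) 0 ≤ 2 := by
    rw [← Equiv.sum_comp p, Fin.sum_univ_four]
    have h1 := (weightCurve_mem (hs.a_nonneg (p 0)) (hs.b_nonneg (p 0)) (s := 0) (by simp)).2
    have h2 := (weightCurve_mem (hs.a_nonneg (p 1)) (hs.b_nonneg (p 1)) (s := 0) (by simp)).2
    have h3 : weightCurve (a (p 2)) (b (p 2)) 0 = 0 := by simp [weightCurve, hs.b2.ne']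
    have h4 : weightCurve (a (p 3)) (b (p 3)) 0 = 0 := by simp [weightCurve, hs.b3.ne']
    linarith
  have h1 : 2 ≤ ∑ i, weightCurve (a i) (b i) 1 := by
    rw [← Equiv.sum_comp p, Fin.sum_univ_four]
    have h1 := (weightCurve_mem (hs.a_nonneg (p 2)) (hs.b_nonneg (p 2)) (s := 1) (by simp)).1
    have h2 := (weightCurve_mem (hs.a_nonneg (p 3)) (hs.b_nonneg (p 3)) (s := 1) (by simp)).1
    have h3 : weightCurve (a (p 0)) (b (p 0)) 1 = 1 := by simp [weightCurve, hs.a0.ne']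
    have h4 : weightCurve (a (p 1)) (b (p 1)) 1 = 1 := by simp [weightCurve, hs.a1.ne']
    linarith
  obtain ⟨s, hsI, hsum⟩ := intermediate_value_Icc zero_le_one hc ⟨h0, h1⟩
  refine ⟨s, hsI, fun i => (weightCurve_mem (hs.a_nonneg i) (hs.b_nonneg i) hsI).1,
    fun i => (weightCurve_mem (hs.a_nonneg i) (hs.b_nonneg i) hsI).2, hsum, fun i j => ?_⟩
  have hcase : ∀ i, (a i = 0 ∧ weightCurve (a i) (b i) s = 0) ∨
      (b i = 0 ∧ weightCurve (a i) (b i) s = 1) ∨ (s * a i + (1 - s) * b i ≠ 0 ∧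
        weightCurve (a i) (b i) s = s * a i / (s * a i + (1 - s) * b i) ∧
        1 - weightCurve (a i) (b i) s = (1 - s) * b i / (s * a i + (1 - s) * b i)) := by
    intro i
    by_cases ha : a i = 0
    · exact Or.inl ⟨ha, by simp [weightCurve, ha]⟩
    by_cases hb : b i = 0
    · exact Or.inr (Or.inl ⟨hb, by simp [weightCurve, ha, hb]⟩)
    have hpos : s * a i + (1 - s) * b i ≠ 0 := by
      have h2 := mul_nonneg hsI.1 (hs.a_nonneg i)
      have h3 := mul_nonneg (sub_nonneg.2 hsI.2) (hs.b_nonneg i)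
      intro e
      have h4 : s = 0 := by
        have : s * a i = 0 := by linarith
        simpa [ha] using this
      rw [h4] at e
      simp [hb] at e
    refine Or.inr (Or.inr ⟨hpos, by simp [weightCurve, ha, hb], ?_⟩)
    simp only [weightCurve, ha, hb, if_false]
    field_simp
    ring
  rcases hcase i with ⟨e1, e2⟩ | ⟨e1, e2⟩ | ⟨e1, e2, e3⟩
  · rw [e2, e1]; ring
  · rw [e2, e1]; ring
  rcases hcase j with ⟨f1, f2⟩ | ⟨f1, f2⟩ | ⟨f1, f2, f3⟩
  · rw [f2, f1]; ring
  · rw [f2, f1]; ring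
  · rw [e3, f3, e2, f2]
    field_simp

/-! ## The retraction for the octahedron -/

/-- The squared norms of the coordinates. -/
def lo (z : ℂ^8) (i : Fin 4) : ℝ := ‖z (Fin.castAdd 4 i)‖ ^ 2

def hi (z : ℂ^8) (i : Fin 4) : ℝ := ‖z (Fin.natAdd 4 i)‖ ^ 2

/-- The numbering of the opposite pairs relative to a vertex. -/
def perm (k : Fin 6) : Equiv.Perm (Fin 4) :=
  ![1, Equiv.swap 0 2 * Equiv.swap 1 3, Equiv.swap 1 2,
    ⟨![1, 3, 0, 2], ![2, 0, 3, 1], by decide, by decide⟩,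
    ⟨![0, 3, 1, 2], ![0, 2, 3, 1], by decide, by decide⟩,
    ⟨![1, 2, 0, 3], ![2, 0, 1, 3], by decide, by decide⟩] k

lemma notMem_idx_iff_perm (k) (j : Fin 8) : j ∉ range (idx k) ↔ j = Fin.castAdd 4 (perm k 0)
    ∨ j = Fin.castAdd 4 (perm k 1) ∨ j = Fin.natAdd 4 (perm k 2) ∨ j = Fin.natAdd 4 (perm k 3) := by
  have : ∀ (k : Fin 6) (j : Fin 8), (¬ ∃ i, idx k i = j) ↔
      j = Fin.castAdd 4 (perm k 0) ∨ j = Fin.castAdd 4 (perm k 1) ∨ j = Fin.natAdd 4 (perm k 2) ∨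
      j = Fin.natAdd 4 (perm k 3) := by decide
  exact this k j

lemma forall_notMem_idx {k} {P : Fin 8 → Prop} : (∀ j ∉ range (idx k), P j) ↔ P (Fin.castAdd
    4 (perm k 0)) ∧ P (Fin.castAdd 4 (perm k 1)) ∧ P (Fin.natAdd 4 (perm k 2)) ∧ P (Fin.natAdd 4
    (perm k 3)) := by
  simp only [notMem_idx_iff_perm]
  constructor
  · exact fun h => ⟨h _ (Or.inl rfl), h _ (Or.inr (Or.inl rfl)), h _ (Or.inr (Or.inr (Or.inl rfl))),
      h _ (Or.inr (Or.inr (Or.inr rfl)))⟩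
  · rintro ⟨h0, h1, h2, h3⟩ j (rfl | rfl | rfl | rfl) <;> assumption

lemma semi_iff {k : Fin 6} {z : ℂ^8} :
    Semi (perm k) (lo z) (hi z) ↔ ∀ j ∉ range (idx k), z j ≠ 0 := by
  rw [forall_notMem_idx]
  constructor
  · rintro ⟨-, -, h0, h1, h2, h3⟩
    have key : ∀ w : ℂ, 0 < ‖w‖ ^ 2 → w ≠ 0 := by
      rintro w hw rfl
      simp at hw
    exact ⟨key _ h0, key _ h1, key _ h2, key _ h3⟩
  · rintro ⟨h0, h1, h2, h3⟩
    exact ⟨fun i => sq_nonneg _, fun i => sq_nonneg _, pow_pos (norm_pos_iff.2 h0) 2,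
      pow_pos (norm_pos_iff.2 h1) 2, pow_pos (norm_pos_iff.2 h2) 2, pow_pos (norm_pos_iff.2 h3) 2⟩

lemma mem_stable_octa {z} : z ∈ octa.stable ↔ ∃ k, ∀ j ∉ range (idx k), z j ≠ 0 := by
  constructor
  · rintro ⟨μ, hμ, h⟩
    obtain ⟨k, hk⟩ := active_subset hμ
    exact ⟨k, fun j hj => h j fun hj' => hj (hk hj')⟩
  · rintro ⟨k, h⟩
    exact ⟨vertex k, vertex_mem k, fun j hj => h j (by rwa [← active_vertex])⟩

lemma exists_semi {z : ℂ^8} (hz : z ∈ octa.stable) : ∃ k, Semi (perm k) (lo z) (hi z) := by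
  obtain ⟨k, hk⟩ := mem_stable_octa.1 hz
  exact ⟨k, semi_iff.2 hk⟩

open Classical in
/-- The balanced weights of a stable point. -/
def weight (z : ℂ^8) : ℝ^4 :=
  if h : ∃ x, Balanced (lo z) (hi z) x then h.choose else 0

lemma balanced_weight {z : ℂ^8} (hz : z ∈ octa.stable) :
    Balanced (lo z) (hi z) (weight z) := by
  obtain ⟨k, hk⟩ := exists_semi hz
  obtain ⟨s, -, h⟩ := hk.exists_balanced
  have h' : ∃ x, Balanced (lo z) (hi z) x := ⟨_, h⟩
  rw [weight, dif_pos h']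
  exact h'.choose_spec

lemma weight_eq {z : ℂ^8} (hz : z ∈ octa.stable) {x : ℝ^4}
    (h : Balanced (lo z) (hi z) x) : weight z = x := by
  obtain ⟨k, hk⟩ := exists_semi hz
  exact (balanced_weight hz).unique h hk

lemma continuous_lo (i : Fin 4) : Continuous fun z => lo z i := by unfold lo; fun_prop

lemma continuous_hi (i : Fin 4) : Continuous fun z => hi z i := by unfold hi; fun_prop

lemma continuousOn_weight : ContinuousOn weight octa.stable := by
  intro z hz
  have hK : IsCompact (Icc (0 : ℝ^4) 1) := isCompact_Icc
  refine hK.tendsto_nhds_of_unique_mapClusterPt ?_ ?_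
  · filter_upwards [self_mem_nhdsWithin] with w hw
    exact ⟨(balanced_weight hw).nonneg, (balanced_weight hw).le_one⟩
  · intro x hx hcl
    obtain ⟨F, hF, hx'⟩ := mapClusterPt_iff_ultrafilter.1 hcl
    have hFz : Filter.Tendsto id (F : Filter ℂ^8) (𝓝 z) :=
      hF.trans nhdsWithin_le_nhds
    have hst : ∀ᶠ w in (F : Filter ℂ^8), w ∈ octa.stable := hF self_mem_nhdsWithin
    have hxi := fun i => (tendsto_pi_nhds.1 hx') i
    have hlo := fun i => ((continuous_lo i).tendsto z).comp hFz
    have hhi := fun i => ((continuous_hi i).tendsto z).comp hFz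
    refine (weight_eq hz ⟨hx.1, hx.2, ?_, fun i j => ?_⟩).symm
    · refine tendsto_nhds_unique_of_eventuallyEq (tendsto_finsetSum _ fun i _ => hxi i)
        (tendsto_const_nhds (x := (2 : ℝ))) ?_
      filter_upwards [hst] with w hw
      exact (balanced_weight hw).sum
    · refine tendsto_nhds_unique_of_eventuallyEq
        (((hxi i).mul (tendsto_const_nhds.sub (hxi j))).mul ((hhi i).mul (hlo j)))
        (((hxi j).mul (tendsto_const_nhds.sub (hxi i))).mul ((hhi j).mul (hlo i))) ?_
      filter_upwards [hst] with w hw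
      exact (balanced_weight hw).eq i j

/-- Replacing the norms of the coordinates by the ones prescribed by the weights. -/
def spread (x : ℝ^4) (z : ℂ^8) : ℂ^8 := fun j =>
  ((√(Fin.append (fun i => 2 * x i) (fun i => 2 * (1 - x i)) j) : ℝ) : ℂ) *
    (z j / (‖z j‖ : ℂ))

def retractOcta (z : ℂ^8) : ℂ^8 := spread (weight z) z

end Octahedron

namespace Octahedron

open ToricData

variable {x : ℝ^4} {z : ℂ^8}

lemma forall_fin_eight {P : Fin 8 → Prop} :
    (∀ j, P j) ↔ (∀ i : Fin 4, P (Fin.castAdd 4 i)) ∧ ∀ i : Fin 4, P (Fin.natAdd 4 i) :=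
  ⟨fun h => ⟨fun _ => h _, fun _ => h _⟩, fun h j => Fin.addCases (m := 4) (n := 4) h.1 h.2 j⟩

lemma spread_lo (x : ℝ^4) (z) (i : Fin 4) : spread x z (Fin.castAdd 4 i) = ((√(2 *
    x i) : ℝ) : ℂ) * (z (Fin.castAdd 4 i) / (‖z (Fin.castAdd 4 i)‖ : ℂ)) := by
  rw [spread, Fin.append_left]

lemma spread_hi (x : ℝ^4) (z) (i : Fin 4) : spread x z (Fin.natAdd 4 i) = ((√(2 *
    (1 - x i)) : ℝ) : ℂ) * (z (Fin.natAdd 4 i) / (‖z (Fin.natAdd 4 i)‖ : ℂ)) := by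
  rw [spread, Fin.append_right]

lemma norm_sqrt_mul_phase {c : ℝ} (hc : 0 ≤ c) {z : ℂ} (h : z = 0 → c = 0) :
    ‖((√c : ℝ) : ℂ) * (z / (‖z‖ : ℂ))‖ ^ 2 = c := by
  by_cases hz : z = 0
  · rw [hz, h hz]; simp
  · have : ‖z‖ ≠ 0 := norm_ne_zero_iff.2 hz
    rw [norm_mul, norm_div, norm_real, norm_real, norm_norm, div_self this, mul_one,
      norm_eq_abs, sq_abs, sq_sqrt hc]

lemma lo_eq_zero {i : Fin 4} : lo z i = 0 ↔ z (Fin.castAdd 4 i) = 0 := by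
  simp [lo]

lemma hi_eq_zero {i : Fin 4} : hi z i = 0 ↔ z (Fin.natAdd 4 i) = 0 := by
  simp [hi]

lemma lo_spread (hz : z ∈ octa.stable)
    (h : Balanced (lo z) (hi z) x) (i : Fin 4) : lo (spread x z) i = 2 * x i := by
  obtain ⟨k, hk⟩ := exists_semi hz
  rw [lo, spread_lo]
  refine norm_sqrt_mul_phase (mul_nonneg zero_le_two (h.nonneg i)) fun e => ?_
  rw [h.eq_zero hk (lo_eq_zero.2 e), mul_zero]

lemma hi_spread (hz : z ∈ octa.stable)
    (h : Balanced (lo z) (hi z) x) (i : Fin 4) : hi (spread x z) i = 2 * (1 - x i) := by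
  obtain ⟨k, hk⟩ := exists_semi hz
  rw [hi, spread_hi]
  refine norm_sqrt_mul_phase (mul_nonneg zero_le_two (by linarith [h.le_one i])) fun e => ?_
  rw [h.eq_one hk (hi_eq_zero.2 e), sub_self, mul_zero]

lemma mem_levelSet_octa_iff : z ∈ octa.levelSet ↔ (∀ i, lo z i + hi z i = 2) ∧ ∑ i, lo z i = 4 := by
  rw [mem_levelSet_octa, Fin.sum_univ_four]
  have h0 : ∀ i : Fin 4, lo z i = ‖z (Fin.castAdd 4 i)‖ ^ 2 := fun _ => rfl
  have h1 : ∀ i : Fin 4, hi z i = ‖z (Fin.natAdd 4 i)‖ ^ 2 := fun _ => rfl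
  have e0 : (Fin.castAdd 4 0 : Fin 8) = 0 := rfl
  have e1 : (Fin.castAdd 4 1 : Fin 8) = 1 := rfl
  have e2 : (Fin.castAdd 4 2 : Fin 8) = 2 := rfl
  have e3 : (Fin.castAdd 4 3 : Fin 8) = 3 := rfl
  have e4 : (Fin.natAdd 4 (0 : Fin 4) : Fin 8) = 4 := rfl
  have e5 : (Fin.natAdd 4 (1 : Fin 4) : Fin 8) = 5 := rfl
  have e6 : (Fin.natAdd 4 (2 : Fin 4) : Fin 8) = 6 := rfl
  have e7 : (Fin.natAdd 4 (3 : Fin 4) : Fin 8) = 7 := rfl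
  constructor
  · rintro ⟨a0, a1, a2, a3, a4⟩
    refine ⟨fun i => ?_, ?_⟩
    · rw [h0, h1]
      fin_cases i
      · exact a0
      · exact a1
      · exact a2
      · exact a3
    · rw [h0, h0, h0, h0, e0, e1, e2, e3]
      linarith
  · rintro ⟨a, b⟩
    have a0 := a 0
    have a1 := a 1
    have a2 := a 2
    have a3 := a 3
    rw [h0, h1, e0, e4] at a0
    rw [h0, h1, e1, e5] at a1
    rw [h0, h1, e2, e6] at a2
    rw [h0, h1, e3, e7] at a3
    rw [h0, h0, h0, h0, e0, e1, e2, e3] at b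
    refine ⟨a0, a1, a2, a3, ?_⟩
    linarith

lemma spread_mem_levelSet (hz : z ∈ octa.stable)
    (h : Balanced (lo z) (hi z) x) : spread x z ∈ octa.levelSet := by
  rw [mem_levelSet_octa_iff]
  simp only [lo_spread hz h, hi_spread hz h]
  refine ⟨fun i => by ring, ?_⟩
  rw [← Finset.mul_sum, h.sum]
  norm_num

lemma spread_rot (x : ℝ^4) (t) (z) :
    spread x (rot t z) = rot t (spread x z) := by
  funext j
  simp only [spread, rot, norm_mul, Circle.norm_coe, one_mul]
  ring

lemma spread_dil (x : ℝ^4) (θ : ℝ^8) (z) :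
    spread x (dil θ z) = spread x z := by
  funext j
  have e : ‖(Real.exp (θ j) : ℂ)‖ = Real.exp (θ j) := by
    rw [norm_real, norm_eq_abs, abs_exp]
  have e' : (Real.exp (θ j) : ℂ) ≠ 0 := by exact_mod_cast (exp_pos _).ne'
  simp only [spread, dil, norm_mul, e]
  rw [ofReal_mul, mul_div_mul_left _ _ e']

lemma lo_rot (t) (z) : lo (rot t z) = lo z := by
  funext i; simp [lo, norm_rot]

lemma hi_rot (t) (z) : hi (rot t z) = hi z := by
  funext i; simp [hi, norm_rot]

lemma lo_dil (θ : ℝ^8) (z) (i : Fin 4) :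
    lo (dil θ z) i = Real.exp (θ (Fin.castAdd 4 i)) ^ 2 * lo z i := by
  simp [lo, dil, mul_pow, ← ofReal_exp]

lemma hi_dil (θ : ℝ^8) (z) (i : Fin 4) :
    hi (dil θ z) i = Real.exp (θ (Fin.natAdd 4 i)) ^ 2 * hi z i := by
  simp only [hi, dil, norm_mul, mul_pow]
  rw [norm_real, norm_eq_abs, abs_exp]

lemma proj_octa_eq_zero_iff' {θ : ℝ^8} : octa.proj θ = 0 ↔
    ∃ s, ∀ i, θ (Fin.natAdd 4 i) = θ (Fin.castAdd 4 i) + s := by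
  rw [proj_octa_eq_zero_iff]
  constructor
  · rintro ⟨h0, h1, h2⟩
    refine ⟨θ 4 - θ 0, fun i => ?_⟩
    fin_cases i
    · change θ 4 = θ 0 + _; ring
    · change θ 5 = θ 1 + _; linarith
    · change θ 6 = θ 2 + _; linarith
    · change θ 7 = θ 3 + _; linarith
  · rintro ⟨s, h⟩
    have h0 : θ 4 = θ 0 + s := h 0
    have h1 : θ 5 = θ 1 + s := h 1
    have h2 : θ 6 = θ 2 + s := h 2
    have h3 : θ 7 = θ 3 + s := h 3
    refine ⟨?_, ?_, ?_⟩ <;> linarith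

lemma Semi.add_pos {p : Equiv.Perm (Fin 4)} {a b : ℝ^4} (h : Semi p a b) (i : Fin 4) :
    0 < a i + b i := by
  obtain ⟨m, rfl⟩ := p.surjective i
  have h1 := h.a_nonneg (p m)
  have h2 := h.b_nonneg (p m)
  have := h.a0
  have := h.a1
  have := h.b2
  have := h.b3
  fin_cases m <;> simp at * <;> linarith

lemma sqrt_mul_phase {c : ℝ} (hc : 0 ≤ c) (z : ℂ) :
    ((√(c * ‖z‖ ^ 2) : ℝ) : ℂ) * (z / (‖z‖ : ℂ)) = (√c : ℝ) * z := by
  by_cases hz : z = 0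
  · simp [hz]
  · have : (‖z‖ : ℂ) ≠ 0 := by simpa using hz
    rw [sqrt_mul hc, sqrt_sq (norm_nonneg z)]
    push_cast
    field_simp

lemma retractOcta_mem_closure (hz : z ∈ octa.stable) : retractOcta z ∈ closure (octa.orbit z) := by
  obtain ⟨k, hk⟩ := exists_semi hz
  obtain ⟨s, hs, h⟩ := hk.exists_balanced
  rw [retractOcta, weight_eq hz h]
  let f : ℝ → ℂ^8 := fun s => spread (fun i => weightCurve (lo z i) (hi z i) s) z
  have hc : ContinuousOn f (Icc 0 1) := by
    refine continuousOn_pi.2 fun j => ?_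
    refine ContinuousOn.mul (continuous_ofReal.comp_continuousOn
      (continuous_sqrt.comp_continuousOn ?_)) continuousOn_const
    revert j
    rw [forall_fin_eight]
    have hw := fun i => continuousOn_weightCurve (hk.a_nonneg i) (hk.b_nonneg i)
    constructor <;> intro i
    · simp only [Fin.append_left]
      exact continuousOn_const.mul (hw i)
    · simp only [Fin.append_right]
      exact continuousOn_const.mul (continuousOn_const.sub (hw i))
  have h1 : f s ∈ closure (f '' Ioo 0 1) := by
    refine ((hc s hs).mono Ioo_subset_Icc_self).mem_closure_image ?_
    rwa [closure_Ioo zero_ne_one]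
  refine closure_mono ?_ h1
  rintro _ ⟨s, hs, rfl⟩
  have hs' : 0 < 1 - s := by linarith [hs.2]
  have hs0 : 0 < s := hs.1
  have hD := fun i => weightCurve_eq (hk.a_nonneg i) (hk.b_nonneg i) (hk.add_pos i) hs
  refine ⟨Fin.append (fun i => Real.log (√(2 * s / (s * lo z i + (1 - s) * hi z i))))
    (fun i => Real.log (√(2 * (1 - s) / (s * lo z i + (1 - s) * hi z i)))), ?_, ?_⟩
  · rw [proj_octa_eq_zero_iff']
    refine ⟨(Real.log (2 * (1 - s)) - Real.log (2 * s)) / 2, fun i => ?_⟩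
    have hDi := (hD i).1
    rw [Fin.append_left, Fin.append_right, log_sqrt (by positivity),
      log_sqrt (by positivity), log_div (by positivity) hDi.ne',
      log_div (by positivity) hDi.ne']
    ring
  · rw [funext_iff, forall_fin_eight]
    constructor <;> intro i <;> obtain ⟨h0, h1, h2⟩ := hD i
    · simp only [f, dil]
      rw [spread_lo, Fin.append_left, Real.exp_log (by positivity), h1,
        ← sqrt_mul_phase (c := 2 * s / (s * lo z i + (1 - s) * hi z i))
          (div_nonneg (by positivity) h0.le)]
      simp only [lo]
      congr 3
      ring_nf
    · simp only [f, dil]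
      rw [spread_hi, Fin.append_right, Real.exp_log (by positivity), h2,
        ← sqrt_mul_phase (c := 2 * (1 - s) / (s * lo z i + (1 - s) * hi z i))
          (div_nonneg (by positivity) h0.le)]
      simp only [hi]
      congr 3
      ring_nf

lemma continuousOn_retractOcta : ContinuousOn retractOcta octa.stable := by
  intro z hz
  refine tendsto_pi_nhds.2 fun j => ?_
  have hv : Filter.Tendsto (fun w => √(Fin.append (fun i => 2 * weight w i)
      (fun i => 2 * (1 - weight w i)) j)) (𝓝[octa.stable] z) (𝓝 (√(Fin.append
      (fun i => 2 * weight z i) (fun i => 2 * (1 - weight z i)) j))) := by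
    refine (continuous_sqrt.tendsto _).comp ?_
    have hw := fun i => (tendsto_pi_nhds.1 (continuousOn_weight z hz)) i
    revert j
    rw [forall_fin_eight]
    constructor <;> intro i
    · simp only [Fin.append_left]
      exact tendsto_const_nhds.mul (hw i)
    · simp only [Fin.append_right]
      exact tendsto_const_nhds.mul (tendsto_const_nhds.sub (hw i))
  by_cases hj : z j = 0
  · have h0 : Fin.append (fun i => 2 * weight z i) (fun i => 2 * (1 - weight z i)) j = 0 := by
      obtain ⟨k, hk⟩ := exists_semi hz
      have hb := balanced_weight hz
      revert j
      rw [forall_fin_eight]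
      constructor <;> intro i _ hi
      · rw [Fin.append_left, hb.eq_zero hk (lo_eq_zero.2 hi), mul_zero]
      · rw [Fin.append_right, hb.eq_one hk (hi_eq_zero.2 hi), sub_self, mul_zero]
    rw [h0, Real.sqrt_zero] at hv
    have h1 : retractOcta z j = 0 := by simp [retractOcta, spread, hj]
    rw [h1]
    refine squeeze_zero_norm (fun w => ?_) hv
    simp only [retractOcta, spread]
    rw [norm_mul, norm_real, norm_eq_abs, abs_of_nonneg (sqrt_nonneg _)]
    refine mul_le_of_le_one_right (sqrt_nonneg _) ?_
    rw [norm_div, norm_real, norm_norm]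
    exact div_self_le_one _
  · have h2 : Filter.Tendsto (fun w : ℂ^8 => w j / (‖w j‖ : ℂ)) (𝓝[octa.stable] z)
        (𝓝 (z j / (‖z j‖ : ℂ))) := by
      have hc : ContinuousAt (fun w : ℂ^8 => w j / (‖w j‖ : ℂ)) z :=
        (continuous_apply j).continuousAt.div
          (continuous_ofReal.comp (continuous_apply j).norm).continuousAt (by simpa using hj)
      exact hc.mono_left nhdsWithin_le_nhds
    exact ((continuous_ofReal.tendsto _).comp hv).mul h2

lemma retractOcta_ne_zero (h : Balanced (lo z) (hi z) x) {j : Fin 8} (hx : ∀ i, (j = Fin.castAdd 4 i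
    → x i ≠ 0) ∧ (j = Fin.natAdd 4 i → x i ≠ 1)) (hj : z j ≠ 0) : spread x z j ≠ 0 := by
  refine mul_ne_zero ?_ (div_ne_zero hj (by simpa using hj))
  rw [ofReal_ne_zero, sqrt_ne_zero']
  revert j
  rw [forall_fin_eight]
  constructor <;> intro i hx _
  · have := (hx i).1 rfl
    rw [Fin.append_left]
    exact mul_pos zero_lt_two ((h.nonneg i).lt_of_ne' this)
  · have := (hx i).2 rfl
    rw [Fin.append_right]
    exact mul_pos zero_lt_two (sub_pos.2 ((h.le_one i).lt_of_ne this))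

lemma mem_stable_of_mem_nz {k} (h : ∀ j ∉ range (idx k), z j ≠ 0) : z ∈ octa.stable := mem_stable_octa.2 ⟨k, h⟩

lemma retractOcta_ne_zero_of_notMem {k}
    (h : ∀ j ∉ range (idx k), z j ≠ 0) : ∀ j ∉ range (idx k), retractOcta z j ≠ 0 := by
  have hs := semi_iff.2 h
  have hb := balanced_weight (mem_stable_of_mem_nz h)
  obtain ⟨h0, h1, h2, h3⟩ := hb.pos_of_semi hs
  have hne : ∀ i l : Fin 4, (Fin.castAdd 4 i : Fin 8) ≠ Fin.natAdd 4 l := by decide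
  rw [forall_notMem_idx] at h ⊢
  obtain ⟨g0, g1, g2, g3⟩ := h
  refine ⟨?_, ?_, ?_, ?_⟩
  · refine retractOcta_ne_zero hb (fun i => ⟨fun e => ?_, fun e => (hne _ _ e).elim⟩) g0
    rw [← Fin.castAdd_injective _ _ e]; exact h0.ne'
  · refine retractOcta_ne_zero hb (fun i => ⟨fun e => ?_, fun e => (hne _ _ e).elim⟩) g1
    rw [← Fin.castAdd_injective _ _ e]; exact h1.ne'
  · refine retractOcta_ne_zero hb (fun i => ⟨fun e => (hne _ _ e.symm).elim, fun e => ?_⟩) g2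
    rw [← Fin.natAdd_injective _ _ e]; exact h2.ne
  · refine retractOcta_ne_zero hb (fun i => ⟨fun e => (hne _ _ e.symm).elim, fun e => ?_⟩) g3
    rw [← Fin.natAdd_injective _ _ e]; exact h3.ne

lemma Balanced.ne_of_polystable (hz : z ∈ octa.polystable) (h : Balanced (lo z) (hi z) x) (i : Fin
    4) : (lo z i ≠ 0 → x i ≠ 0) ∧ (hi z i ≠ 0 → x i ≠ 1) := by
  obtain ⟨k, hk⟩ := exists_semi (octa.polystable_sub_stable hz)
  obtain ⟨μ, hμ, hz'⟩ := hz
  obtain ⟨y, hy, hyz⟩ : ∃ y ∈ octa.levelSet, ∀ j, y j = 0 ↔ z j = 0 := by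
    refine ⟨_, octa.point_mem μ hμ, fun j => ?_⟩
    rw [hz', ofReal_eq_zero, sqrt_eq_zero (sub_nonneg.2 (hμ j)), sub_eq_zero]
    rfl
  obtain ⟨hy1, hy2⟩ := mem_levelSet_octa_iff.1 hy
  have hylo : ∀ j, lo y j = 0 ↔ lo z j = 0 := fun j => by
    rw [lo_eq_zero, lo_eq_zero, hyz]
  have hyhi : ∀ j, hi y j = 0 ↔ hi z j = 0 := fun j => by
    rw [hi_eq_zero, hi_eq_zero, hyz]
  have hsum : ∑ j, lo y j / 2 = ∑ j, x j := by
    rw [← Finset.sum_div, hy2, h.sum]; norm_num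
  constructor
  · intro hi0 hx
    have hx0 : ∀ j, x j = 0 ∨ hi z j = 0 := by
      intro j
      have := h.eq i j
      rw [hx] at this
      simpa [hi0] using this
    refine absurd hsum (Finset.sum_lt_sum (fun j _ => ?_) ⟨i, Finset.mem_univ i, ?_⟩).ne'
    · rcases hx0 j with e | e
      · rw [e]; unfold lo; positivity
      · have := hy1 j
        rw [(hyhi j).2 e] at this
        rw [h.eq_one hk e]
        linarith
    · rw [hx]
      have : 0 < lo y i := (sq_nonneg _).lt_of_ne' (fun e => hi0 ((hylo i).1 e))
      linarith
  · intro hi0 hx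
    have hx0 : ∀ j, 1 - x j = 0 ∨ lo z j = 0 := by
      intro j
      have := h.eq i j
      rw [hx] at this
      simpa [hi0] using this
    refine absurd hsum (Finset.sum_lt_sum (fun j _ => ?_) ⟨i, Finset.mem_univ i, ?_⟩).ne
    · rcases hx0 j with e | e
      · have := hy1 j
        have : 0 ≤ hi y j := sq_nonneg _
        linarith
      · rw [(hylo j).2 e, h.eq_zero hk e, zero_div]
    · rw [hx]
      have : 0 < hi y i := (sq_nonneg _).lt_of_ne' (fun e => hi0 ((hyhi i).1 e))
      linarith [hy1 i]

lemma isRetraction_octa : octa.IsRetraction retractOcta where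
  continuousOn := continuousOn_retractOcta
  mem z hz := spread_mem_levelSet hz (balanced_weight hz)
  closure z hz := retractOcta_mem_closure hz
  dil z hz θ hθ := by
    have hz' : dil θ z ∈ octa.stable := (isNC_exp hθ).mul_mem_stable hz
    have hb := balanced_weight hz
    have : weight (dil θ z) = weight z := by
      refine weight_eq hz' ⟨hb.nonneg, hb.le_one, hb.sum, fun i j => ?_⟩
      obtain ⟨s, hs⟩ := proj_octa_eq_zero_iff'.1 hθ
      have e := hb.eq i j
      simp only [lo_dil, hi_dil, hs, Real.exp_add]
      linear_combination (Real.exp (θ (Fin.castAdd 4 i)) ^ 2 *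
        Real.exp (θ (Fin.castAdd 4 j)) ^ 2 * Real.exp s ^ 2) * e
    rw [retractOcta, this, spread_dil, retractOcta]
  rot z hz t ht := by
    have : weight (rot t z) = weight z := by
      unfold weight
      rw [lo_rot, hi_rot]
    rw [retractOcta, this, spread_rot, retractOcta]
  self z hz := by
    have hz' := octa.levelSet_subset_stable hz
    obtain ⟨h1, h2⟩ := mem_levelSet_octa_iff.1 hz
    have hlo : ∀ i, 0 ≤ lo z i := fun i => sq_nonneg _
    have hhi : ∀ i, 0 ≤ hi z i := fun i => sq_nonneg _
    have : weight z = fun i => lo z i / 2 := by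
      refine weight_eq hz' ⟨fun i => by linarith [hlo i], fun i => by linarith [hhi i, h1 i], ?_,
        fun i j => ?_⟩
      · rw [← Finset.sum_div, h2]; norm_num
      · have e : ∀ i, hi z i = 2 - lo z i := fun i => by linarith [h1 i]
        rw [e, e]; ring
    have hsq : ∀ c : ℂ, ((√(‖c‖ ^ 2) : ℝ) : ℂ) * (c / (‖c‖ : ℂ)) = c := by
      intro c
      have := sqrt_mul_phase zero_le_one c
      rwa [one_mul, Real.sqrt_one, ofReal_one, one_mul] at this
    rw [retractOcta, this, funext_iff, forall_fin_eight]
    constructor <;> intro i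
    · rw [spread_lo]
      have : 2 * (lo z i / 2) = ‖z (Fin.castAdd 4 i)‖ ^ 2 := by rw [lo]; ring
      rw [this, hsq]
    · rw [spread_hi]
      have : 2 * (1 - lo z i / 2) = ‖z (Fin.natAdd 4 i)‖ ^ 2 := by
        have : hi z i = ‖z (Fin.natAdd 4 i)‖ ^ 2 := rfl
        linarith [h1 i]
      rw [this, hsq]
  ne_zero z hz j hj := by
    have hb := balanced_weight (octa.polystable_sub_stable hz)
    refine retractOcta_ne_zero hb (fun i => ⟨?_, ?_⟩) hj
    · rintro rfl
      exact (hb.ne_of_polystable hz i).1 (fun e => hj (lo_eq_zero.1 e))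
    · rintro rfl
      exact (hb.ne_of_polystable hz i).2 (fun e => hj (hi_eq_zero.1 e))

lemma isKahlerOff_octa : octa.IsKahlerOff (range singularPoint) :=
  isRetraction_octa.isKahlerOff unimodular_octa fun _ _ h => regular_octa_iff h

end Octahedron

namespace ToricData

variable {n d : ℕ} {D : ToricData n d} {a : Fin n ↪ Fin d}
variable {z w : ℂ^d}

lemma mem_polystable_congr (h : ∀ j, z j = 0 ↔ w j = 0) : z ∈ D.polystable ↔ w ∈ D.polystable := by
  simp only [polystable, mem_setOf_eq, h]

lemma exists_level_of_polystable (hz : z ∈ D.polystable) :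
    ∃ y ∈ D.levelSet, ∀ j, y j = 0 ↔ z j = 0 := by
  obtain ⟨μ, hμ, hz'⟩ := hz
  refine ⟨_, D.point_mem μ hμ, fun j => ?_⟩
  rw [hz', ofReal_eq_zero, sqrt_eq_zero (sub_nonneg.2 (hμ j)), sub_eq_zero]
  rfl

lemma eq_zero_of_mem_closure_orbit (h : w ∈ closure (D.orbit z)) {j : Fin d}
    (hz : z j = 0) : w j = 0 := by
  have hc : IsClosed {w : ℂ^d | w j = 0} := isClosed_eq (continuous_apply j) continuous_const
  refine hc.closure_subset_iff.2 ?_ h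
  rintro _ ⟨θ, -, rfl⟩
  simp [dil, hz]

variable {r : ℂ^d → ℂ^d}

lemma IsRetraction.eq_zero_iff (hr : D.IsRetraction r) (hz : z ∈ D.polystable)
    (j : Fin d) : r z j = 0 ↔ z j = 0 :=
  ⟨not_imp_not.1 (hr.ne_zero z hz j),
    eq_zero_of_mem_closure_orbit (hr.closure z (D.polystable_sub_stable hz))⟩

lemma IsRetraction.eq_zero_iff_of_repX (hr : D.IsRetraction r) {x} (hz : D.RepX z x) (hz' : z
    ∈ D.polystable) (hw : D.RepX w x) (hw' : w ∈ D.polystable) (j : Fin d) : z j = 0 ↔ w j = 0 := by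
  obtain ⟨-, t, -, e⟩ := (hr.repX_iff hz).1 hw
  rw [← hr.eq_zero_iff hz', ← hr.eq_zero_iff hw', e]
  simp [ToricData.rot]

lemma IsComplexChart.mem_source_iff {f : OpenPartialHomeomorph D.X ℂ^n}
    (hf : D.IsComplexChart a f) (hr : D.IsRetraction r) {x}
    (hz : D.RepX z x) (hz' : z ∈ D.polystable) : x ∈ f.source ↔ z ∈ nz a := by
  rw [hf.1]
  constructor
  · rintro ⟨w, hw, hx, hw'⟩ j hj h0
    exact hw' j hj ((hr.eq_zero_iff_of_repX hz hz' hx hw j).1 h0)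
  · exact fun h => ⟨z, hz', hz, h⟩

lemma IsComplexChart.eventually_symm {f : OpenPartialHomeomorph D.X ℂ^n}
    (hf : D.IsComplexChart a f) {u} (hu : u ∈ f.target) :
    ∀ᶠ y in 𝓝 u, D.RepX (iot a y) (f.symm y) ∧ iot a y ∈ D.polystable := by
  filter_upwards [f.open_target.mem_nhds hu] with y hy
  exact ⟨(hf.symm_apply hy).2, (hf.symm_apply hy).1⟩

end ToricData

namespace Octahedron

open ToricData

variable {i : Fin 2} {v : ℂ^2}

/-! ## The explicit charts of the octahedron -/

lemma notMem_triple345 (j : Fin 8) : j ∉ range triple345 ↔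
    j = 0 ∨ j = 1 ∨ j = 5 ∨ j = 6 ∨ j = 7 := by
  have : ∀ j : Fin 8, (¬ ∃ i, triple345 i = j) ↔ j = 0 ∨ j = 1 ∨ j = 5 ∨ j = 6 ∨ j = 7 := by
    decide
  exact this j

lemma forall_notMem_triple345 {P : Fin 8 → Prop} :
    (∀ j ∉ range triple345, P j) ↔ P 0 ∧ P 1 ∧ P 5 ∧ P 6 ∧ P 7 := by
  simp only [notMem_triple345, forall_eq_or_imp, forall_eq]

lemma tau_comp (u) : tau u ∘ triple345 = u := by
  funext i; fin_cases i <;> rfl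

lemma tau_mem {u} (hu : u ∈ U) : tau u ∈ octa.levelSet ∧
    ∀ j ∉ range triple345, ∃ r : ℝ, 0 < r ∧ tau u j = (r : ℂ) := by
  obtain ⟨-, h1, h2, h3⟩ := hu
  have h30 := h3 0
  have h31 := h3 1
  have h32 := h3 2
  constructor
  · rw [mem_levelSet_octa]
    have hs : ∀ x : ℝ, 0 < x → ‖((√x : ℝ) : ℂ)‖ ^ 2 = x := fun x hx => by
      rw [norm_real, norm_eq_abs, sq_abs, sq_sqrt hx.le]
    have e0 : ‖tau u 0‖ ^ 2 = 2 - ‖u 2‖ ^ 2 := hs _ (by linarith)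
    have e1 : ‖tau u 1‖ ^ 2 = 2 - ‖u 0‖ ^ 2 - ‖u 1‖ ^ 2 + ‖u 2‖ ^ 2 := hs _ (by linarith)
    have e5 : ‖tau u 5‖ ^ 2 = ‖u 0‖ ^ 2 + ‖u 1‖ ^ 2 - ‖u 2‖ ^ 2 := hs _ (by linarith)
    have e6 : ‖tau u 6‖ ^ 2 = 2 - ‖u 0‖ ^ 2 := hs _ (by linarith)
    have e7 : ‖tau u 7‖ ^ 2 = 2 - ‖u 1‖ ^ 2 := hs _ (by linarith)
    have e2 : tau u 2 = u 0 := rfl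
    have e3 : tau u 3 = u 1 := rfl
    have e4 : tau u 4 = u 2 := rfl
    rw [e0, e1, e2, e3, e4, e5, e6, e7]
    refine ⟨?_, ?_, ?_, ?_, ?_⟩ <;> ring
  · rw [forall_notMem_triple345]
    exact ⟨⟨_, sqrt_pos.2 (by linarith), rfl⟩, ⟨_, sqrt_pos.2 (by linarith), rfl⟩,
      ⟨_, sqrt_pos.2 (by linarith), rfl⟩, ⟨_, sqrt_pos.2 (by linarith), rfl⟩,
      ⟨_, sqrt_pos.2 (by linarith), rfl⟩⟩

lemma symTarget_triple345 : octa.symTarget triple345 = U := by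
  refine Set.ext fun u => ⟨fun hu => ?_, fun hu => ?_⟩
  · have h1 := unimodular_triple345.sig_mem_levelSet hu
    have h2 := sig_mem_nz hu
    have e : octa.sig triple345 u ∘ triple345 = u := sig_comp _ _ _
    generalize octa.sig triple345 u = z at h1 h2 e
    subst e
    have h3 : z 0 ≠ 0 ∧ z 1 ≠ 0 ∧ z 5 ≠ 0 ∧ z 6 ≠ 0 ∧ z 7 ≠ 0 := forall_notMem_triple345.1 h2
    obtain ⟨a0, a1, a2, a3, a4⟩ := mem_levelSet_octa.1 h1
    have hp : ∀ c : ℂ, c ≠ 0 → 0 < ‖c‖ ^ 2 := fun c hc => pow_pos (norm_pos_iff.2 hc) 2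
    obtain ⟨b0, b1, b5, b6, b7⟩ := h3
    have b0 := hp _ b0
    have b1 := hp _ b1
    have b5 := hp _ b5
    have b6 := hp _ b6
    have b7 := hp _ b7
    change _ ≠ _ ∧ ‖z 4‖ ^ 2 < ‖z 2‖ ^ 2 + ‖z 3‖ ^ 2 ∧ ‖z 2‖ ^ 2 + ‖z 3‖ ^ 2 < 2 + ‖z 4‖ ^ 2 ∧ _
    refine ⟨fun e => ?_, by linarith, by linarith, fun i => ?_⟩
    · have e2 : z 2 = 0 := congrFun e 0
      have e3 : z 3 = 0 := congrFun e 1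
      rw [e2, e3, norm_zero] at a4
      nlinarith [sq_nonneg ‖z 4‖]
    · fin_cases i
      · change ‖z 2‖ ^ 2 < 2
        linarith
      · change ‖z 3‖ ^ 2 < 2
        linarith
      · change ‖z 4‖ ^ 2 < 2
        linarith
  · obtain ⟨h1, h2⟩ := tau_mem hu
    rw [← tau_comp u]
    refine unimodular_triple345.comp_mem_symTarget h1 fun j hj => ?_
    obtain ⟨r, hr, e⟩ := h2 j hj
    rw [e]
    exact_mod_cast hr.ne'

lemma exists_symplecticChart_triple345 : ∃ e, octa.IsSymplecticChart triple345 e ∧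
    e.target = U ∧ ∀ u ∈ U, octa.RepM (tau u) (e.symm u) := by
  have he := unimodular_triple345.isSymplecticChart_symChart
  have ht : unimodular_triple345.symChart.target = U := symTarget_triple345
  refine ⟨_, he, ht, fun u hu => ?_⟩
  obtain ⟨h1, h2⟩ := tau_mem hu
  have := he.symm_apply unimodular_triple345 (u := u) (by rw [ht]; exact hu)
  have e : octa.sig triple345 (tau u ∘ triple345) = tau u :=
    unimodular_triple345.sig_comp_self h1 h2
  rw [tau_comp] at e
  rwa [e] at this

lemma iot_triple345 (u) : iot triple345 u = tauC u := by
  have : tauC u ∘ triple345 = u := by funext i; fin_cases i <;> rfl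
  conv_lhs => rw [← this]
  exact iot_comp_self (by rw [forall_notMem_triple345]; exact ⟨rfl, rfl, rfl, rfl, rfl⟩)

lemma tauC_mem_polystable {u} : tauC u ∈ octa.polystable ↔ u ∈ V := by
  constructor
  · rintro h ⟨h0, h1⟩
    obtain ⟨y, hy, e⟩ := exists_level_of_polystable h
    obtain ⟨-, -, -, -, h4⟩ := mem_levelSet_octa.1 hy
    have h5 : y 5 ≠ 0 := fun h => one_ne_zero ((e 5).1 h)
    rw [(e 2).2 h0, (e 3).2 h1, norm_zero] at h4
    have := pow_pos (norm_pos_iff.2 h5) 2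
    nlinarith [sq_nonneg ‖y 4‖]
  · intro h
    classical
    let c : ℝ^3 := ![9 / 10, 9 / 10, 1 / 2]
    let v : ℂ^3 := fun i => if u i = 0 then 0 else c i
    have hc : ∀ i, c i ≠ 0 := by intro i; fin_cases i <;> norm_num [c]
    have hv : ∀ i, v i = 0 ↔ u i = 0 := by
      intro i
      simp only [v]
      split_ifs with h
      · simp [h]
      · simp [h, hc]
    have hn : ∀ i, ‖v i‖ ^ 2 ≤ c i ^ 2 := by
      intro i
      simp only [v]
      split_ifs with h
      · simp; positivity
      · simp
    have hn' : ∀ i, u i ≠ 0 → ‖v i‖ ^ 2 = c i ^ 2 := by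
      intro i hi
      simp [v, hi]
    have n0 := hn 0
    have n1 := hn 1
    have n2 := hn 2
    simp only [c, Matrix.cons_val_zero, Matrix.cons_val_one, Matrix.cons_val] at n0 n1 n2
    have hsum : (9 / 10) ^ 2 ≤ ‖v 0‖ ^ 2 + ‖v 1‖ ^ 2 := by
      rcases not_and_or.1 h with h | h
      · rw [hn' 0 h]
        simp only [c, Matrix.cons_val_zero]
        nlinarith [sq_nonneg ‖v 1‖]
      · rw [hn' 1 h]
        simp only [c, Matrix.cons_val_one, Matrix.cons_val_zero]
        nlinarith [sq_nonneg ‖v 0‖]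
    have hvU : v ∈ U := by
      refine ⟨fun e => ?_, by linarith, by nlinarith [sq_nonneg ‖v 2‖], fun i => ?_⟩
      · rw [e] at hsum; norm_num at hsum
      · fin_cases i <;> simp only [Fin.zero_eta, Fin.mk_one, Fin.reduceFinMk] <;> linarith
    obtain ⟨h1, h2⟩ := tau_mem hvU
    refine (mem_polystable_congr fun j => ?_).1 (octa.level_sub_polystable h1)
    by_cases hj : j ∈ range triple345
    · obtain ⟨i, rfl⟩ := hj
      have e1 : tau v (triple345 i) = v i := congrFun (tau_comp v) i
      have e2 : tauC u (triple345 i) = u i := by rw [← iot_triple345, iot_self]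
      rw [e1, e2, hv]
    · obtain ⟨r, hr, e⟩ := h2 j hj
      rw [e, ← iot_triple345, iot_of_notMem u hj]
      simp [hr.ne']

lemma exists_complexChart_triple345 : ∃ f, octa.IsComplexChart triple345 f ∧
    f.target = V ∧ ∀ u ∈ V, octa.RepX (tauC u) (f.symm u) := by
  have hf := unimodular_triple345.isComplexChart_complexChart isRetraction_octa
  have ht : (unimodular_triple345.complexChart isRetraction_octa).target = V := by
    rw [hf.target_eq isRetraction_octa unimodular_triple345]
    refine Set.ext fun u => ?_
    rw [mem_setOf_eq, iot_triple345, tauC_mem_polystable]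
  refine ⟨_, hf, ht, fun u hu => ?_⟩
  rw [← iot_triple345]
  exact (hf.symm_apply (by rw [ht]; exact hu)).2

/-! ## The projective line -/

lemma isOpenQuotientMap_mk : IsOpenQuotientMap
    fun v : C2star => (ℙmk v.1 v.2 : CP1) := by
  refine ⟨fun p => ?_, continuous_quot_mk, fun O hO => ?_⟩
  · exact ⟨⟨p.rep, p.rep_nonzero⟩, p.mk_rep⟩
  · change IsOpen ((fun v : C2star => (ℙmk v.1 v.2 : CP1)) ⁻¹'
      ((fun v : C2star => (ℙmk v.1 v.2 : CP1)) '' O))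
    have : (fun v : C2star => (ℙmk v.1 v.2 : CP1)) ⁻¹'
        ((fun v : C2star => (ℙmk v.1 v.2 : CP1)) '' O) =
        ⋃ c : ℂˣ, {v : C2star | (⟨c • v.1, smul_ne_zero c.ne_zero v.2⟩ : C2star) ∈ O} := by
      refine Set.ext fun v => ?_
      rw [mem_iUnion]
      constructor
      · rintro ⟨w, hw, e⟩
        obtain ⟨c, hc⟩ := (Projectivization.mk_eq_mk_iff ℂ w.1 v.1 w.2 v.2).1 e
        refine ⟨c, ?_⟩
        have : (⟨c • v.1, smul_ne_zero c.ne_zero v.2⟩ : C2star) = w := Subtype.ext hc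
        rw [mem_setOf_eq, this]
        exact hw
      · rintro ⟨c, hc⟩
        exact ⟨_, hc, (Projectivization.mk_eq_mk_iff ℂ _ _ _ v.2).2 ⟨c, rfl⟩⟩
    rw [this]
    exact isOpen_iUnion fun c => hO.preimage
      ((continuous_const.smul continuous_subtype_val).subtype_mk _)

/-- The vector with `i`-th coordinate `1` and the other one `u`. -/
def aff (i : Fin 2) (u : ℂ) : ℂ^2 := ![![1, u], ![u, 1]] i

lemma aff_self (i : Fin 2) (u : ℂ) : aff i u i = 1 := by fin_cases i <;> rfl

lemma aff_add (i : Fin 2) (u : ℂ) : aff i u (i + 1) = u := by fin_cases i <;> rfl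

lemma aff_ne_zero (i : Fin 2) (u : ℂ) : aff i u ≠ 0 := fun h => by
  have := congrFun h i
  rw [aff_self] at this
  exact one_ne_zero this

lemma aff_div (hv : v i ≠ 0) : v i • aff i (v (i + 1) / v i) = v := by
  funext j
  fin_cases i <;> fin_cases j <;> simp [aff] at hv ⊢ <;> field_simp

lemma contDiff_aff (i : Fin 2) : ContDiff ℂ ∞ (aff i) := by
  refine contDiff_pi.2 fun j => ?_
  fin_cases i <;> fin_cases j <;> simp [aff] <;> fun_prop

/-- The affine coordinate of a point of the projective line. -/
def affCoord (i : Fin 2) : CP1 → ℂ := Projectivization.lift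
  (fun v : {v : ℂ^2 // v ≠ 0} => v.1 (i + 1) / v.1 i) (by
    rintro ⟨v, hv⟩ ⟨w, hw⟩ t rfl
    have ht : t ≠ 0 := by rintro rfl; simp at hv
    exact mul_div_mul_left _ _ ht)

lemma affCoord_mk (i : Fin 2) (v) (hv : v ≠ 0) :
    affCoord i (ℙmk v hv) = v (i + 1) / v i := rfl

/-- The set of points of the projective line with nonzero `i`-th coordinate. -/
def affSet (i : Fin 2) : Set CP1 :=
  {p | ∃ (v : ℂ^2) (hv : v ≠ 0), p = ℙmk v hv ∧ v i ≠ 0}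

lemma mk_mem_affSet {hv : v ≠ 0} : ℙmk v hv ∈ affSet i ↔ v i ≠ 0 := by
  constructor
  · rintro ⟨w, hw, e, h⟩
    obtain ⟨c, hc⟩ := (Projectivization.mk_eq_mk_iff ℂ v w hv hw).1 e
    rw [← hc]
    exact mul_ne_zero c.ne_zero h
  · exact fun h => ⟨v, hv, rfl, h⟩

lemma mk_aff_div (hv : v ≠ 0) (h : v i ≠ 0) : ℙmk (aff i (v (i + 1) / v i))
    (aff_ne_zero _ _) = ℙmk v hv :=
  (Projectivization.mk_eq_mk_iff' ℂ _ _ _ _).2 ⟨(v i)⁻¹, by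
    have e := congrArg (fun w => (v i)⁻¹ • w) (aff_div h)
    simp only [smul_smul, inv_mul_cancel₀ h, one_smul] at e
    exact e.symm⟩

/-- The affine charts of the projective line. -/
def affChart (i : Fin 2) : OpenPartialHomeomorph CP1 ℂ where
  toFun := affCoord i
  invFun u := ℙmk (aff i u) (aff_ne_zero i u)
  source := affSet i
  target := univ
  map_source' _ _ := mem_univ _
  map_target' u _ := mk_mem_affSet.2 (by rw [aff_self]; exact one_ne_zero)
  left_inv' := by
    rintro _ ⟨v, hv, rfl, h⟩
    rw [affCoord_mk, mk_aff_div hv h]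
  right_inv' u _ := by rw [affCoord_mk, aff_self, aff_add, div_one]
  open_source := by
    rw [← isOpenQuotientMap_mk.isQuotientMap.isOpen_preimage]
    have : (fun v : C2star => (ℙmk v.1 v.2 : CP1)) ⁻¹' affSet i =
        {v : C2star | v.1 i ≠ 0} := Set.ext fun v => mk_mem_affSet
    rw [this]
    exact isOpen_ne_fun ((continuous_apply i).comp continuous_subtype_val) continuous_const
  open_target := isOpen_univ
  continuousOn_toFun := by
    rintro _ ⟨v, hv, rfl, h⟩
    refine ContinuousAt.continuousWithinAt ?_
    refine (isOpenQuotientMap_mk.continuousAt_comp_iff (x := (⟨v, hv⟩ : C2star))).1 ?_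
    exact ((continuous_apply (i + 1)).comp continuous_subtype_val).continuousAt.div
      ((continuous_apply i).comp continuous_subtype_val).continuousAt h
  continuousOn_invFun := by
    refine Continuous.continuousOn ?_
    exact isOpenQuotientMap_mk.continuous.comp
      ((contDiff_aff i).continuous.subtype_mk (aff_ne_zero i))

lemma affChart_mem (i : Fin 2) : affChart i ∈ affineCharts :=
  ⟨i, rfl, fun v hv h => affCoord_mk i v hv⟩

/-- What a member of `affineCharts` looks like. -/
structure IsAffChart (i : Fin 2) (c : OpenPartialHomeomorph CP1 ℂ) : Prop where
  source : ∀ v hv, ℙmk v hv ∈ c.source ↔ v i ≠ 0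
  apply : ∀ v hv, v i ≠ 0 → c (ℙmk v hv) = v (i + 1) / v i
  symm_apply : ∀ u, c.symm u = ℙmk (aff i u) (aff_ne_zero i u)
  target : c.target = univ

lemma isAffChart_of_mem {c : OpenPartialHomeomorph CP1 ℂ} (hc : c ∈ affineCharts) :
    ∃ i, IsAffChart i c := by
  obtain ⟨i, h1, h2⟩ := hc
  have hs : ∀ v hv, ℙmk v hv ∈ c.source ↔ v i ≠ 0 := fun v hv => by
    rw [h1]; exact mk_mem_affSet
  have key : ∀ u, ℙmk (aff i u) (aff_ne_zero i u) ∈ c.source ∧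
      c (ℙmk (aff i u) (aff_ne_zero i u)) = u := by
    intro u
    have : aff i u i ≠ 0 := by rw [aff_self]; exact one_ne_zero
    exact ⟨(hs _ _).2 this, by rw [h2 _ _ this, aff_self, aff_add, div_one]⟩
  refine ⟨i, hs, h2, fun u => ?_, eq_univ_of_forall fun u => ?_⟩
  · conv_lhs => rw [← (key u).2]
    exact c.left_inv (key u).1
  · rw [← (key u).2]
    exact c.map_source (key u).1

lemma contDiffOn_trans_affine {c c' : OpenPartialHomeomorph CP1 ℂ} (hc : c ∈ affineCharts)
    (hc' : c' ∈ affineCharts) : ContDiffOn ℂ ∞ (c.symm ≫ₕ c') (c.symm ≫ₕ c').source := by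
  obtain ⟨i, h⟩ := isAffChart_of_mem hc
  obtain ⟨j, h'⟩ := isAffChart_of_mem hc'
  have h1 : (c.symm ≫ₕ c').source = {u | aff i u j ≠ 0} := by
    refine Set.ext fun u => ?_
    rw [trans_source]
    simp [h.target, h.symm_apply, h'.source]
  rw [h1]
  have hd := contDiff_pi.1 (contDiff_aff i)
  refine ((hd (j + 1)).contDiffOn.div (hd j).contDiffOn fun u hu => hu).congr fun u hu => ?_
  rw [trans_apply, h.symm_apply, h'.apply _ _ hu]
  rfl

lemma isAtlasOn_affineCharts : IsAtlasOn ℂ affineCharts univ := by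
  refine ⟨eq_univ_of_forall fun p => ?_, fun c hc c' hc' => ?_⟩
  · induction p using Projectivization.ind with | h v hv =>
    obtain ⟨i, hi⟩ := ne_iff.1 hv
    exact mem_biUnion (affChart_mem i) (mk_mem_affSet.2 hi)
  · rw [contDiffGroupoid, mem_groupoid_of_pregroupoid]
    have e : (c.symm ≫ₕ c').symm = c'.symm ≫ₕ c := rfl
    constructor
    · simpa [contDiffPregroupoid] using contDiffOn_trans_affine hc hc'
    · simpa [contDiffPregroupoid] using contDiffOn_trans_affine hc' hc

end Octahedron

namespace Octahedron
open ToricData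

variable {v w : ℂ^2} {z : ℂ^4} {x : square.X} {c : ℂ}

/-! ## Joining two vectors of the plane -/

lemma fst2_join (v w) : fst2 (join v w) = v := by
  funext i; fin_cases i <;> rfl

lemma snd2_join (v w) : snd2 (join v w) = w := by
  funext i; fin_cases i <;> rfl

lemma join_fst2_snd2 (z) : join (fst2 z) (snd2 z) = z := by
  funext i; fin_cases i <;> rfl

lemma fst2_eq_zero : fst2 z = 0 ↔ nA z = 0 := by
  rw [nA_eq_zero]
  refine ⟨fun h => ⟨congrFun h 0, congrFun h 1⟩, fun h => ?_⟩
  funext i; fin_cases i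
  exacts [h.1, h.2]

lemma snd2_eq_zero : snd2 z = 0 ↔ nB z = 0 := by
  rw [nB_eq_zero]
  refine ⟨fun h => ⟨congrFun h 0, congrFun h 1⟩, fun h => ?_⟩
  funext i; fin_cases i
  exacts [h.1, h.2]

lemma continuous_join : Continuous fun p : ℂ^2 × ℂ^2 => join p.1 p.2 := by
  refine continuous_pi fun i => ?_
  fin_cases i <;> simp [join] <;> fun_prop

lemma continuous_fst2 : Continuous fst2 := by
  refine continuous_pi fun i => ?_
  fin_cases i <;> simp [fst2] <;> fun_prop

lemma continuous_snd2 : Continuous snd2 := by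
  refine continuous_pi fun i => ?_
  fin_cases i <;> simp [snd2] <;> fun_prop

lemma contDiffAt_join {𝕜 E : Type*} [NontriviallyNormedField 𝕜] [NormedAlgebra 𝕜 ℂ]
    [NormedAddCommGroup E] [NormedSpace 𝕜 E] {v w : E → ℂ^2} {x : E} (hv : ContDiffAt 𝕜 ∞ v x)
    (hw : ContDiffAt 𝕜 ∞ w x) : ContDiffAt 𝕜 ∞ (fun y => join (v y) (w y)) x := by
  rw [contDiffAt_pi] at hv hw ⊢
  intro i
  fin_cases i
  exacts [hv 0, hv 1, hw 0, hw 1]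

lemma join_smul_smul (c b : ℂ) (z) :
    join (c • fst2 z) (b • snd2 z) = fun j => (![c, c, b, b] : ℂ^4) j * z j := by
  funext i; fin_cases i <;> rfl

lemma rot_eq_join (c b : Circle) (z) :
    rot ![c, c, b, b] z = join ((c : ℂ) • fst2 z) ((b : ℂ) • snd2 z) := by
  funext i; fin_cases i <;> rfl

lemma scale2_eq_join (f g : ℝ) (z) :
    scale2 f g z = join ((f : ℂ) • fst2 z) ((g : ℂ) • snd2 z) := by
  funext i; fin_cases i <;> rfl

lemma exists_circle_mul_exp (hc : c ≠ 0) : ∃ (t : Circle) (l : ℝ), c = t * (Real.exp l : ℝ) := by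
  obtain ⟨t, ht⟩ := exists_circle_mul_norm c
  exact ⟨t, Real.log ‖c‖, by rw [Real.exp_log (norm_pos_iff.2 hc)]; exact ht⟩

lemma isNC_square {b : ℂ} (hc : c ≠ 0) (hb : b ≠ 0) : square.IsNC (![c, c, b, b] : ℂ^4) := by
  obtain ⟨t, l, rfl⟩ := exists_circle_mul_exp hc
  obtain ⟨s, m, rfl⟩ := exists_circle_mul_exp hb
  refine ⟨![t, t, s, s], mem_N_square_iff.2 ⟨t, s, rfl⟩, ![l, l, m, m],
    proj_square_eq_zero_iff.2 ⟨rfl, rfl⟩, fun j => ?_⟩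
  fin_cases j <;> rfl

lemma isNC_cone (k) (hc : c ≠ 0) : (cone k).IsNC (![c, c, c⁻¹, c⁻¹] : ℂ^4) := by
  obtain ⟨t, l, rfl⟩ := exists_circle_mul_exp hc
  refine ⟨![t, t, t⁻¹, t⁻¹], (mem_N_cone_iff k).2 ⟨t, rfl⟩, ![l, l, -l, -l],
    (proj_cone_eq_zero_iff k).2 ⟨rfl, rfl, rfl⟩, fun j => ?_⟩
  fin_cases j <;> simp [mul_comm, Complex.exp_neg]

lemma mem_stable_square_iff : z ∈ square.stable ↔ fst2 z ≠ 0 ∧ snd2 z ≠ 0 := by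
  rw [mem_stable_square, Ne, Ne, Ne, Ne, fst2_eq_zero, snd2_eq_zero]

lemma join_mem_stable_square (hv : v ≠ 0) (hw : w ≠ 0) : join v w ∈ square.stable := by
  rw [mem_stable_square_iff, fst2_join, snd2_join]
  exact ⟨hv, hw⟩

lemma repX_square_iff {w} (h : square.RepX z x) :
    square.RepX w x ↔ ∃ c b : ℂ, c ≠ 0 ∧ b ≠ 0 ∧ w = join (c • fst2 z) (b • snd2 z) := by
  constructor
  · intro h'
    obtain ⟨hw, t, ht, e⟩ := (isRetraction_square.repX_iff h).1 h'
    obtain ⟨c, b, rfl⟩ := mem_N_square_iff.1 ht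
    obtain ⟨hA, hB⟩ := mem_stable_square.1 h.1
    obtain ⟨hA', hB'⟩ := mem_stable_square.1 hw
    have pA := (nA_nonneg z).lt_of_ne' hA
    have pB := (nB_nonneg z).lt_of_ne' hB
    have pA' := (nA_nonneg w).lt_of_ne' hA'
    have pB' := (nB_nonneg w).lt_of_ne' hB'
    have h2 : ((√2 / √(nA w) : ℝ) : ℂ) ≠ 0 := by
      rw [ofReal_ne_zero]; positivity
    have h3 : ((√2 / √(nB w) : ℝ) : ℂ) ≠ 0 := by
      rw [ofReal_ne_zero]; positivity
    have h4 : ((√2 / √(nA z) : ℝ) : ℂ) ≠ 0 := by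
      rw [ofReal_ne_zero]; positivity
    have h5 : ((√2 / √(nB z) : ℝ) : ℂ) ≠ 0 := by
      rw [ofReal_ne_zero]; positivity
    refine ⟨((√2 / √(nA w) : ℝ) : ℂ)⁻¹ * (c * (√2 / √(nA z) : ℝ)),
      ((√2 / √(nB w) : ℝ) : ℂ)⁻¹ * (b * (√2 / √(nB z) : ℝ)),
      mul_ne_zero (inv_ne_zero h2) (mul_ne_zero (Circle.coe_ne_zero c) h4),
      mul_ne_zero (inv_ne_zero h3) (mul_ne_zero (Circle.coe_ne_zero b) h5), ?_⟩
    rw [retractSquare, retractSquare, rot_eq_join, scale2_eq_join, scale2_eq_join, fst2_join,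
      snd2_join] at e
    have e1 := congrArg fst2 e
    have e2 := congrArg snd2 e
    rw [fst2_join, fst2_join] at e1
    rw [snd2_join, snd2_join] at e2
    rw [mul_smul, mul_smul, mul_smul, mul_smul, ← e1, ← e2, smul_smul, smul_smul,
      inv_mul_cancel₀ h2, inv_mul_cancel₀ h3, one_smul, one_smul, join_fst2_snd2]
  · rintro ⟨c, b, hc, hb, rfl⟩
    rw [join_smul_smul]
    exact h.mul (isNC_square hc hb)

lemma mem_stable_cone (k) (z) : z ∈ (cone k).stable := by
  rw [stable_cone]; trivial

lemma repX_cone_mul {k} {x : (cone k).X} (h : (cone k).RepX z x)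
    (hc : c ≠ 0) : (cone k).RepX (join (c • fst2 z) (c⁻¹ • snd2 z)) x := by
  rw [join_smul_smul]
  exact h.mul (isNC_cone k hc)

lemma repX_cone_iff {k} {w} {x : (cone k).X} (h : (cone k).RepX z x)
    (hA : fst2 z ≠ 0) (hB : snd2 z ≠ 0) :
    (cone k).RepX w x ↔ ∃ c : ℂ, c ≠ 0 ∧ w = join (c • fst2 z) (c⁻¹ • snd2 z) := by
  constructor
  · intro h'
    obtain ⟨hw, t, ht, e⟩ := ((isRetraction_cone k).repX_iff h).1 h'
    obtain ⟨c, rfl⟩ := (mem_N_cone_iff k).1 ht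
    rw [Ne, fst2_eq_zero] at hA
    rw [Ne, snd2_eq_zero] at hB
    have hAB : nA w * nB w ≠ 0 := by
      intro h0
      have := congrArg nA e
      rw [nA_rot, nA_retractCone, nA_retractCone, h0, Real.sqrt_zero, eq_comm,
        sqrt_eq_zero (mul_nonneg (nA_nonneg _) (nB_nonneg _))] at this
      exact mul_ne_zero hA hB this
    obtain ⟨hA', hB'⟩ := mul_ne_zero_iff.1 hAB
    obtain ⟨f, hf, ef⟩ := retractCone_eq_scale hA hB
    obtain ⟨g, hg, eg⟩ := retractCone_eq_scale hA' hB'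
    have hf' : (f : ℂ) ≠ 0 := ofReal_ne_zero.2 hf.ne'
    have hg' : (g : ℂ) ≠ 0 := ofReal_ne_zero.2 hg.ne'
    refine ⟨(g : ℂ)⁻¹ * (c * f), mul_ne_zero (inv_ne_zero hg')
      (mul_ne_zero (Circle.coe_ne_zero c) hf'), ?_⟩
    rw [ef, eg, rot_eq_join, scale2_eq_join, scale2_eq_join, fst2_join, snd2_join] at e
    have e1 := congrArg fst2 e
    have e2 := congrArg snd2 e
    rw [fst2_join, fst2_join] at e1
    rw [snd2_join, snd2_join] at e2
    have e3 : ((g : ℂ)⁻¹ * (c * f))⁻¹ = g * (((c⁻¹ : Circle) : ℂ) * ((f⁻¹ : ℝ) : ℂ)) := by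
      rw [Circle.coe_inv, ofReal_inv, mul_inv, mul_inv, inv_inv]
    rw [e3, mul_smul, mul_smul, mul_smul, mul_smul, ← e1, ← e2, smul_smul, smul_smul,
      inv_mul_cancel₀ hg', ofReal_inv, mul_inv_cancel₀ hg', one_smul, one_smul,
      join_fst2_snd2]
  · rintro ⟨c, hc, rfl⟩
    exact repX_cone_mul h hc

/-! ## The complex link -/

lemma mk_eq_mk_of_smul (hc : c ≠ 0) (h : w = c • v) (hv : v ≠ 0)
    (hw : w ≠ 0) : (ℙmk v hv : CP1) = ℙmk w hw :=
  (Projectivization.mk_eq_mk_iff' ℂ _ _ _ _).2 ⟨c⁻¹, by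
    rw [h, smul_smul, inv_mul_cancel₀ hc, one_smul]⟩

/-- The isomorphism of the complex link with `ℂℙ¹ × ℂℙ¹`. -/
def kappaFun : square.X → CP1 × CP1 :=
  Quot.lift (fun z : square.stable =>
    (ℙmk (fst2 z.1) (mem_stable_square_iff.1 z.2).1,
      ℙmk (snd2 z.1) (mem_stable_square_iff.1 z.2).2)) (by
    intro z w h
    have h1 : square.RepX z (square.clsX z) := ⟨z.2, rfl⟩
    have h2 : square.RepX w (square.clsX z) := ⟨w.2, Quot.sound h⟩
    obtain ⟨c, b, hc, hb, e⟩ := (repX_square_iff h1).1 h2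
    refine Prod.ext (mk_eq_mk_of_smul hc ?_ _ _) (mk_eq_mk_of_smul hb ?_ _ _)
    · rw [e, fst2_join]
    · rw [e, snd2_join])

lemma kappaFun_repX (h : square.RepX z x) : kappaFun x = (ℙmk (fst2 z)
    (mem_stable_square_iff.1 h.1).1, ℙmk (snd2 z) (mem_stable_square_iff.1
    h.1).2) := by
  obtain ⟨hz, rfl⟩ := h
  rfl

lemma kappaFun_join (hv : v ≠ 0) (hw : w ≠ 0) (h : square.RepX (join v w) x) : kappaFun x =
    (ℙmk v hv, ℙmk w hw) := by
  rw [kappaFun_repX h]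
  simp only [fst2_join, snd2_join]

lemma continuous_kappaFun : Continuous kappaFun := by
  refine continuous_quot_lift _ (Continuous.prodMk ?_ ?_)
  · exact isOpenQuotientMap_mk.continuous.comp
      ((continuous_fst2.comp continuous_subtype_val).subtype_mk
        fun z : square.stable => (mem_stable_square_iff.1 z.2).1)
  · exact isOpenQuotientMap_mk.continuous.comp
      ((continuous_snd2.comp continuous_subtype_val).subtype_mk
        fun z : square.stable => (mem_stable_square_iff.1 z.2).2)

/-- The homeomorphism of the complex link with `ℂℙ¹ × ℂℙ¹`. -/
def kappa : square.X ≃ₜ CP1 × CP1 where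
  toFun := kappaFun
  invFun p := square.mkX (join p.1.rep p.2.rep)
  left_inv x := by
    obtain ⟨z, hz⟩ := square.exists_repX x
    obtain ⟨h1, h2⟩ := mem_stable_square_iff.1 hz.1
    rw [kappaFun_repX hz]
    obtain ⟨a, ha⟩ := Projectivization.exists_smul_eq_mk_rep ℂ (fst2 z) h1
    obtain ⟨b, hb⟩ := Projectivization.exists_smul_eq_mk_rep ℂ (snd2 z) h2
    refine (((repX_square_iff hz).2 ⟨a, b, a.ne_zero, b.ne_zero, ?_⟩).eq_mkX).symm
    rw [← ha, ← hb]
    rfl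
  right_inv p := by
    rw [kappaFun_join p.1.rep_nonzero p.2.rep_nonzero
      (square.repX_mkX (join_mem_stable_square p.1.rep_nonzero p.2.rep_nonzero)),
      Projectivization.mk_rep, Projectivization.mk_rep]
  continuous_toFun := continuous_kappaFun
  continuous_invFun := by
    refine (isOpenQuotientMap_mk.prodMap isOpenQuotientMap_mk).isQuotientMap.continuous_iff.2 ?_
    have : Continuous fun p : C2star × C2star => square.mkX (join p.1.1 p.2.1) :=
      square.continuousOn_mkX.comp_continuous (continuous_join.comp
        ((continuous_subtype_val.comp continuous_fst).prodMk
          (continuous_subtype_val.comp continuous_snd)))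
        fun p => join_mem_stable_square p.1.2 p.2.2
    refine this.congr fun p => ?_
    have h := square.repX_mkX (join_mem_stable_square p.1.2 p.2.2)
    obtain ⟨a, ha⟩ := Projectivization.exists_smul_eq_mk_rep ℂ p.1.1 p.1.2
    obtain ⟨b, hb⟩ := Projectivization.exists_smul_eq_mk_rep ℂ p.2.1 p.2.2
    refine ((repX_square_iff h).2 ⟨a, b, a.ne_zero, b.ne_zero, ?_⟩).eq_mkX
    rw [fst2_join, snd2_join]
    change join (ℙmk p.1.1 p.1.2).rep (ℙmk p.2.1 p.2.2).rep = _
    rw [← ha, ← hb]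
    rfl

lemma kappa_apply (x : square.X) : kappa x = kappaFun x := rfl

lemma repX_kappa_symm (hv : v ≠ 0) (hw : w ≠ 0) : square.RepX (join v w) (kappa.symm
    (ℙmk v hv, ℙmk w hw)) := by
  have h := square.repX_mkX (join_mem_stable_square hv hw)
  have : kappa.symm (ℙmk v hv, ℙmk w hw) =
      square.mkX (join v w) := by
    rw [Homeomorph.symm_apply_eq, kappa_apply, kappaFun_join hv hw h]
  rw [this]
  exact h

lemma isDiffeoInCharts_kappa : IsDiffeoInCharts ℂ square.complexCharts
    (prodCharts affineCharts affineCharts) kappa.toOpenPartialHomeomorph := by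
  rintro f ⟨a, ha, hf⟩ _ ⟨c, hc, c', hc', rfl⟩
  obtain ⟨i, hi⟩ := isAffChart_of_mem hc
  obtain ⟨j, hj⟩ := isAffChart_of_mem hc'
  have hU := unimodular_square a ha
  constructor
  · intro u hu
    have hu1 : u ∈ f.target := hu.1
    have hu2 : kappa (f.symm u) ∈ (c.prod c').source := hu.2.2
    obtain ⟨-, hs⟩ := hf.symm_apply hu1
    rw [kappa_apply, kappaFun_repX hs, prod_source] at hu2
    have h1 : fst2 (iot a u) i ≠ 0 := (hi.source _ _).1 hu2.1
    have h2 : snd2 (iot a u) j ≠ 0 := (hj.source _ _).1 hu2.2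
    have hd1 : ∀ l, ContDiff ℂ ∞ fun u => fst2 (iot a u) l := fun l => by
      have := contDiff_pi.1 (contDiff_iot a)
      fin_cases l
      exacts [this 0, this 1]
    have hd2 : ∀ l, ContDiff ℂ ∞ fun u => snd2 (iot a u) l := fun l => by
      have := contDiff_pi.1 (contDiff_iot a)
      fin_cases l
      exacts [this 2, this 3]
    refine ContDiffAt.contDiffWithinAt (ContDiffAt.congr_of_eventuallyEq
      (((hd1 (i + 1)).contDiffAt.div (hd1 i).contDiffAt h1).prodMk
        ((hd2 (j + 1)).contDiffAt.div (hd2 j).contDiffAt h2)) ?_)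
    filter_upwards [hf.eventually_symm hu1, (hd1 i).continuous.continuousAt.eventually_ne h1,
      (hd2 j).continuous.continuousAt.eventually_ne h2] with y hy hy1 hy2
    change (c.prod c') (kappa (f.symm y)) = _
    rw [kappa_apply, kappaFun_repX hy.1]
    exact Prod.ext (hi.apply _ _ hy1) (hj.apply _ _ hy2)
  · intro q hq
    rw [trans_target] at hq
    have hz : ∀ q : ℂ × ℂ, square.RepX (join (aff i q.1) (aff j q.2))
        (kappa.symm ((c.prod c').symm q)) := fun q => by
      change square.RepX _ (kappa.symm (c.symm q.1, c'.symm q.2))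
      rw [hi.symm_apply, hj.symm_apply]
      exact repX_kappa_symm _ _
    have hp : ∀ q : ℂ × ℂ, join (aff i q.1) (aff j q.2) ∈ square.polystable := fun q => by
      rw [polystable_square]; exact (hz q).1
    have hs : kappa.symm ((c.prod c').symm q) ∈ f.source := by
      simpa using hq.2
    refine ContDiffAt.contDiffWithinAt ?_
    exact hf.contDiffAt_apply (z := fun q : ℂ × ℂ => join (aff i q.1) (aff j q.2))
      (F := fun q => kappa.symm ((c.prod c').symm q)) isRetraction_square hU
      (contDiffAt_join ((contDiff_aff i).contDiffAt.comp q contDiffAt_fst)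
        ((contDiff_aff j).contDiffAt.comp q contDiffAt_snd))
      (Filter.Eventually.of_forall hz) (Filter.Eventually.of_forall hp)
      ((hf.mem_source_iff isRetraction_square (hz q) (hp q)).1 hs)

end Octahedron

namespace Octahedron
open ToricData

variable {z : ℂ^4} {m : square.M}

/-! ## The symplectic link is `S² × S²` -/

/-- The Hopf map of `ℂ²`. -/
def hopf (v : ℂ^2) : 𝔼^3 :=
  !₂[(v 0 * star (v 1)).re, (v 0 * star (v 1)).im, (‖v 0‖ ^ 2 - ‖v 1‖ ^ 2) / 2]

lemma mem_sphere_three {q : 𝔼^3} :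
    q ∈ Metric.sphere (0 : 𝔼^3) 1 ↔ q 0 ^ 2 + q 1 ^ 2 + q 2 ^ 2 = 1 := by
  rw [mem_sphere_zero_iff_norm, EuclideanSpace.norm_eq, sqrt_eq_one, Fin.sum_univ_three]
  simp only [norm_eq_abs, sq_abs]

lemma hopf_mem {v : ℂ^2} (h : ‖v 0‖ ^ 2 + ‖v 1‖ ^ 2 = 2) :
    hopf v ∈ Metric.sphere (0 : 𝔼^3) 1 := by
  rw [mem_sphere_three]
  have h0 := normSq_apply (v 0)
  have h1 := normSq_apply (v 1)
  rw [normSq_eq_norm_sq] at h0 h1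
  rw [h0, h1] at h
  simp only [hopf, h0, h1, star_def, mul_re, mul_im, conj_re, conj_im]
  simp
  linear_combination (1 / 4) * ((v 0).re * (v 0).re + (v 0).im * (v 0).im +
    ((v 1).re * (v 1).re + (v 1).im * (v 1).im) + 2) * h

lemma hopf_smul {c : Circle} (v : ℂ^2) : hopf ((c : ℂ) • v) = hopf v := by
  have h : (c : ℂ) * star (c : ℂ) = 1 := by
    rw [star_def, mul_conj, Circle.normSq_coe, ofReal_one]
  have : ((c : ℂ) • v) 0 * star (((c : ℂ) • v) 1) = v 0 * star (v 1) := by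
    simp only [Pi.smul_apply, smul_eq_mul, star_mul]
    linear_combination (v 0 * star (v 1)) * h
  have hn : ∀ i, ‖((c : ℂ) • v) i‖ = ‖v i‖ := fun i => by
    rw [Pi.smul_apply, norm_smul, Circle.norm_coe, one_mul]
  simp only [hopf, this, hn]

lemma exists_smul_of_hopf_eq {v w : ℂ^2} (hv : ‖v 0‖ ^ 2 + ‖v 1‖ ^ 2 = 2)
    (hw : ‖w 0‖ ^ 2 + ‖w 1‖ ^ 2 = 2) (h : hopf v = hopf w) : ∃ c : Circle, w = (c : ℂ) • v := by
  have h0 : (hopf v) 0 = (hopf w) 0 := by rw [h]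
  have h1 : (hopf v) 1 = (hopf w) 1 := by rw [h]
  have h2 : (hopf v) 2 = (hopf w) 2 := by rw [h]
  simp only [hopf] at h0 h1 h2
  have e : v 0 * star (v 1) = w 0 * star (w 1) := Complex.ext h0 h1
  have e' : star (v 0) * v 1 = star (w 0) * w 1 := by
    have := congrArg star e
    rwa [star_mul, star_mul, star_star, star_star, mul_comm, mul_comm (w 1)] at this
  have h2' : ‖v 0‖ ^ 2 - ‖v 1‖ ^ 2 = ‖w 0‖ ^ 2 - ‖w 1‖ ^ 2 := by
    simp at h2
    linarith
  have n0 : ‖v 0‖ ^ 2 = ‖w 0‖ ^ 2 := by linarith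
  have n1 : ‖v 1‖ ^ 2 = ‖w 1‖ ^ 2 := by linarith
  have m : ∀ z : ℂ, z * star z = (‖z‖ ^ 2 : ℝ) := fun z => by
    rw [star_def, mul_conj, normSq_eq_norm_sq]
  have k0 : v 0 * star (v 0) = w 0 * star (w 0) := by rw [m, m, n0]
  have k1 : v 1 * star (v 1) = w 1 * star (w 1) := by rw [m, m, n1]
  have k2 : w 0 * star (w 0) + w 1 * star (w 1) = 2 := by
    rw [m, m]; exact_mod_cast hw
  set c : ℂ := (w 0 * star (v 0) + w 1 * star (v 1)) / 2 with hc
  have e0 : w 0 = c * v 0 := by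
    rw [hc]
    linear_combination (-1 / 2) * w 0 * k0 - (1 / 2) * w 1 * e - (1 / 2) * w 0 * k2
  have e1 : w 1 = c * v 1 := by
    rw [hc]
    linear_combination (-1 / 2) * w 1 * k1 - (1 / 2) * w 0 * e' - (1 / 2) * w 1 * k2
  have hn : ‖c‖ ^ 2 = 1 := by
    rw [e0, e1, norm_mul, norm_mul] at hw
    nlinarith
  have hn' : ‖c‖ = 1 := by nlinarith [norm_nonneg c]
  refine ⟨⟨c, mem_sphere_zero_iff_norm.2 hn'⟩, ?_⟩
  funext i
  fin_cases i
  exacts [e0, e1]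

/-- Local lifts of points of the sphere under the Hopf map, up to a positive factor. -/
def hopfLift (i : Fin 2) (q : 𝔼^3) : ℂ^2 :=
  ![![((1 + q 2 : ℝ) : ℂ), q 0 - I * q 1], ![q 0 + I * q 1, ((1 - q 2 : ℝ) : ℂ)]] i

lemma contDiff_hopfLift (i : Fin 2) : ContDiff ℝ ∞ (hopfLift i) := by
  have h : ∀ l : Fin 3, ContDiff ℝ ∞ fun q : 𝔼^3 => ((q l : ℝ) : ℂ) :=
    fun l => ofRealCLM.contDiff.comp (contDiff_piLp_apply 2)
  refine contDiff_pi.2 fun j => ?_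
  have h0 := h 0
  have h1 := h 1
  have h2 := h 2
  fin_cases i <;> fin_cases j <;> simp [hopfLift] <;> fun_prop

lemma hopf_hopfLift (i : Fin 2) {q : 𝔼^3} (hq : q ∈ Metric.sphere (0 :
    𝔼^3) 1) {f : ℝ} (hf : f ^ 2 * (‖hopfLift i q 0‖ ^ 2 + ‖hopfLift i q 1‖ ^ 2)
    = 2) : hopf ((f : ℂ) • hopfLift i q) = q := by
  rw [mem_sphere_three] at hq
  have h0 := normSq_apply (hopfLift i q 0)
  have h1 := normSq_apply (hopfLift i q 1)
  rw [normSq_eq_norm_sq] at h0 h1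
  rw [h0, h1] at hf
  have hn : ∀ j, ‖((f : ℂ) • hopfLift i q) j‖ ^ 2 = f ^ 2 * ‖hopfLift i q j‖ ^ 2 := fun j => by
    rw [Pi.smul_apply, norm_smul, mul_pow, norm_real, norm_eq_abs, sq_abs]
  ext l
  simp only [hopf, hn, h0, h1]
  fin_cases i
  · simp [hopfLift] at hf ⊢
    have hf' : f ^ 2 * (1 + q 2) = 1 := by linear_combination (1 / 2) * hf - (1 / 2) * f ^ 2 * hq
    fin_cases l
    · simp; linear_combination q 0 * hf'
    · simp; linear_combination q 1 * hf'
    · simp; linear_combination q 2 * hf' - (1 / 2) * f ^ 2 * hq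
  · simp [hopfLift] at hf ⊢
    have hf' : f ^ 2 * (1 - q 2) = 1 := by linear_combination (1 / 2) * hf - (1 / 2) * f ^ 2 * hq
    fin_cases l
    · simp; linear_combination q 0 * hf'
    · simp; linear_combination q 1 * hf'
    · simp; linear_combination q 2 * hf' + (1 / 2) * f ^ 2 * hq

lemma exists_hopfLift_ne_zero (q : 𝔼^3) : ∃ i, hopfLift i q ≠ 0 := by
  by_contra! h
  have h0 := congrFun (h 0) 0
  have h1 := congrFun (h 1) 1
  simp only [hopfLift, Matrix.cons_val_zero, Matrix.cons_val_one, Pi.zero_apply,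
    ofReal_eq_zero] at h0 h1
  linarith

lemma norm_fst2 (h : z ∈ square.levelSet) : ‖fst2 z 0‖ ^ 2 + ‖fst2 z 1‖ ^ 2 = 2 := (mem_levelSet_square.1 h).1

lemma norm_snd2 (h : z ∈ square.levelSet) : ‖snd2 z 0‖ ^ 2 + ‖snd2 z 1‖ ^ 2 = 2 := (mem_levelSet_square.1 h).2

lemma continuous_hopf : Continuous hopf := by
  refine (PiLp.continuous_toLp 2 _).comp (continuous_pi fun l => ?_)
  fin_cases l <;> simp <;> fun_prop

lemma contDiff_hopf : ContDiff ℝ ∞ hopf := by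
  have hs : ContDiff ℝ ∞ fun v : ℂ^2 => v 0 * star (v 1) :=
    ContDiff.mul (by fun_prop) ((conjCLE.contDiff).comp (by fun_prop))
  refine contDiff_euclidean.2 fun l => ?_
  fin_cases l
  · exact reCLM.contDiff.comp hs
  · exact imCLM.contDiff.comp hs
  · exact (((contDiff_apply ℝ ℂ (0 : Fin 2)).norm_sq ℝ).sub
      ((contDiff_apply ℝ ℂ (1 : Fin 2)).norm_sq ℝ)).div_const 2

/-- The map of the symplectic link to `S² × S²`. -/
def etaFun : square.M → S2 × S2 :=
  Quotient.lift (fun z : square.levelSet =>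
    ((⟨hopf (fst2 z.1), hopf_mem (norm_fst2 z.2)⟩, ⟨hopf (snd2 z.1), hopf_mem (norm_snd2 z.2)⟩) :
      S2 × S2)) (by
    rintro z w ⟨t, ht, e⟩
    obtain ⟨c, b, rfl⟩ := mem_N_square_iff.1 ht
    rw [rot_eq_join] at e
    refine Prod.ext (Subtype.ext ?_) (Subtype.ext ?_)
    · simp only [e, fst2_join, hopf_smul]
    · simp only [e, snd2_join, hopf_smul])

lemma etaFun_fst (h : square.RepM z m) :
    ((etaFun m).1 : 𝔼^3) = hopf (fst2 z) := by
  obtain ⟨hz, rfl⟩ := h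
  rfl

lemma etaFun_snd (h : square.RepM z m) :
    ((etaFun m).2 : 𝔼^3) = hopf (snd2 z) := by
  obtain ⟨hz, rfl⟩ := h
  rfl

lemma continuous_etaFun : Continuous etaFun := by
  refine continuous_quot_lift _ (Continuous.prodMk (Continuous.subtype_mk ?_ _)
    (Continuous.subtype_mk ?_ _))
  · exact continuous_hopf.comp (continuous_fst2.comp continuous_subtype_val)
  · exact continuous_hopf.comp (continuous_snd2.comp continuous_subtype_val)

lemma etaFun_hopfLift {i j : Fin 2} {p : S2 × S2} (hi : hopfLift i p.1 ≠ 0) (hj : hopfLift j p.2 ≠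
    0) (h : square.RepM (retractSquare (join (hopfLift i p.1) (hopfLift j p.2))) m) : etaFun m =
    p := by
  have hs := join_mem_stable_square hi hj
  have hl := isRetraction_square.mem _ hs
  have h1 := norm_fst2 hl
  have h2 := norm_snd2 hl
  simp only [retractSquare, scale2_eq_join, fst2_join, snd2_join] at h h1 h2
  have hn : ∀ (f : ℝ) (v : ℂ^2) l, ‖((f : ℂ) • v) l‖ ^ 2 = f ^ 2 * ‖v l‖ ^ 2 :=
    fun f v l => by
      rw [Pi.smul_apply, norm_smul, mul_pow, norm_real, norm_eq_abs, sq_abs]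
  rw [hn, hn, ← mul_add] at h1 h2
  refine Prod.ext (Subtype.ext ?_) (Subtype.ext ?_)
  · rw [etaFun_fst h, fst2_join, hopf_hopfLift i p.1.2 h1]
  · rw [etaFun_snd h, snd2_join, hopf_hopfLift j p.2.2 h2]

lemma bijective_etaFun : Bijective etaFun := by
  refine ⟨fun m m' h => ?_, fun p => ?_⟩
  · obtain ⟨z, hz⟩ := square.exists_repM m
    obtain ⟨w, hw⟩ := square.exists_repM m'
    obtain ⟨c, hc⟩ := exists_smul_of_hopf_eq (norm_fst2 hz.1) (norm_fst2 hw.1)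
      (by rw [← etaFun_fst hz, ← etaFun_fst hw, h])
    obtain ⟨b, hb⟩ := exists_smul_of_hopf_eq (norm_snd2 hz.1) (norm_snd2 hw.1)
      (by rw [← etaFun_snd hz, ← etaFun_snd hw, h])
    have hrot := hz.rot square (mem_N_square_iff.2 ⟨c, b, rfl⟩)
    rw [rot_eq_join, ← hc, ← hb, join_fst2_snd2] at hrot
    exact hrot.unique square hw
  · obtain ⟨i, hi⟩ := exists_hopfLift_ne_zero p.1
    obtain ⟨j, hj⟩ := exists_hopfLift_ne_zero p.2
    exact ⟨_, etaFun_hopfLift hi hj (square.repM_mkM (isRetraction_square.mem _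
      (join_mem_stable_square hi hj)))⟩

lemma isCompact_levelSet_square : IsCompact square.levelSet := by
  refine Metric.isCompact_of_isClosed_isBounded square.isClosed_levelSet
    ((Metric.isBounded_closedBall (x := (0 : ℂ^4)) (r := 2)).subset fun z hz => ?_)
  obtain ⟨h1, h2⟩ := mem_levelSet_square.1 hz
  rw [mem_closedBall_zero_iff, pi_norm_le_iff_of_nonneg (by norm_num)]
  intro j
  fin_cases j <;> simp <;>
    nlinarith [norm_nonneg (z 0), norm_nonneg (z 1), norm_nonneg (z 2), norm_nonneg (z 3)]

instance : CompactSpace square.M := square.compactSpace_M isCompact_levelSet_square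

/-- The homeomorphism of the symplectic link with `S² × S²`. -/
def eta : square.M ≃ₜ S2 × S2 :=
  Continuous.homeoOfEquivCompactToT2 (f := Equiv.ofBijective etaFun bijective_etaFun)
    continuous_etaFun

lemma eta_apply (m : square.M) : eta m = etaFun m := rfl

lemma finrank_three : Fact (Module.finrank ℝ 𝔼^3 = 2 + 1) :=
  ⟨by simp⟩

lemma contMDiff_coe_S2 : ContMDiff (𝓡 2) 𝓘(ℝ, 𝔼^3) ∞
    (fun q : S2 => (q : 𝔼^3)) :=
  have := finrank_three
  contMDiff_coe_sphere (n := 2)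

lemma contMDiffOn_sphere {E : Type*} [NormedAddCommGroup E] [NormedSpace ℝ E] {f : E → S2} {s : Set
    E} (hs : IsOpen s) (hf : ContDiffOn ℝ ∞ (fun u => (f u : 𝔼^3)) s) :
    ContMDiffOn 𝓘(ℝ, E) (𝓡 2) ∞ f s := by
  intro u hu
  refine ContMDiffAt.contMDiffWithinAt ?_
  let O : TopologicalSpace.Opens E := ⟨s, hs⟩
  refine (contMDiffAt_subtype_iff (U := O) (x := ⟨u, hu⟩)).1 ?_
  have h : ContMDiff 𝓘(ℝ, E) 𝓘(ℝ, 𝔼^3) ∞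
      (fun x : O => (f x : 𝔼^3)) := fun x => by
    rw [contMDiffAt_subtype_iff (f := fun u => (f u : 𝔼^3))]
    exact (hf.contDiffAt (hs.mem_nhds x.2)).contMDiffAt
  have := finrank_three
  exact (h.codRestrict_sphere (n := 2) fun x => (f x).2).contMDiffAt

lemma contDiffAt_retractSquare (hz : z ∈ square.stable) : ContDiffAt ℝ ∞ retractSquare z := by
  obtain ⟨hA, hB⟩ := mem_stable_square.1 hz
  have pA := (nA_nonneg z).lt_of_ne' hA
  have pB := (nB_nonneg z).lt_of_ne' hB
  have cA : ContDiffAt ℝ ∞ nA z := by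
    unfold nA
    exact (((contDiff_apply ℝ ℂ (0 : Fin 4)).norm_sq ℝ).add
      ((contDiff_apply ℝ ℂ (1 : Fin 4)).norm_sq ℝ)).contDiffAt
  have cB : ContDiffAt ℝ ∞ nB z := by
    unfold nB
    exact (((contDiff_apply ℝ ℂ (2 : Fin 4)).norm_sq ℝ).add
      ((contDiff_apply ℝ ℂ (3 : Fin 4)).norm_sq ℝ)).contDiffAt
  have fA := ofRealCLM.contDiff.contDiffAt.comp z
    ((contDiffAt_const (c := √2)).div (cA.sqrt hA) (sqrt_pos.2 pA).ne')
  have fB := ofRealCLM.contDiff.contDiffAt.comp z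
    ((contDiffAt_const (c := √2)).div (cB.sqrt hB) (sqrt_pos.2 pB).ne')
  refine contDiffAt_pi.2 fun l => ?_
  have hl : ContDiffAt ℝ ∞ (fun z : ℂ^4 => z l) z := (contDiff_apply ℝ ℂ l).contDiffAt
  fin_cases l
  exacts [fA.mul hl, fA.mul hl, fB.mul hl, fB.mul hl]

lemma contMDiffOn_eta {e : OpenPartialHomeomorph square.M ℂ^2}
    (he : e ∈ square.symplecticCharts) :
    ContMDiffOn 𝓘(ℝ, ℂ^2) ((𝓡 2).prod (𝓡 2)) ∞ (fun u => eta (e.symm u)) e.target := by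
  obtain ⟨a, ha, he⟩ := he
  have hU := unimodular_square a ha
  have hs : ∀ u ∈ e.target, ∀ l, ContDiffAt ℝ ∞ (fun u => square.sig a u l) u := fun u hu =>
    contDiffAt_pi.1 (contDiffAt_sig (he.target_eq hU ▸ hu))
  refine ContMDiffOn.prodMk (contMDiffOn_sphere e.open_target ?_)
    (contMDiffOn_sphere e.open_target ?_)
  · have : ContDiffOn ℝ ∞ (fun u => hopf (fst2 (square.sig a u))) e.target := by
      refine contDiff_hopf.comp_contDiffOn fun u hu => ContDiffAt.contDiffWithinAt ?_
      refine contDiffAt_pi.2 fun l => ?_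
      fin_cases l
      exacts [hs u hu 0, hs u hu 1]
    exact this.congr fun u hu => etaFun_fst (he.symm_apply hU hu)
  · have : ContDiffOn ℝ ∞ (fun u => hopf (snd2 (square.sig a u))) e.target := by
      refine contDiff_hopf.comp_contDiffOn fun u hu => ContDiffAt.contDiffWithinAt ?_
      refine contDiffAt_pi.2 fun l => ?_
      fin_cases l
      exacts [hs u hu 2, hs u hu 3]
    exact this.congr fun u hu => etaFun_snd (he.symm_apply hU hu)

lemma contMDiffOn_eta_symm {e : OpenPartialHomeomorph square.M ℂ^2} (he : e ∈
    square.symplecticCharts) : ContMDiffOn ((𝓡 2).prod (𝓡 2)) 𝓘(ℝ, ℂ^2) ∞ (fun p => e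
    (eta.symm p)) (eta '' e.source) := by
  obtain ⟨a, ha, he⟩ := he
  have hU := unimodular_square a ha
  rintro _ ⟨m, hm, rfl⟩
  set p := eta m with hp
  obtain ⟨i, hi⟩ := exists_hopfLift_ne_zero p.1
  obtain ⟨j, hj⟩ := exists_hopfLift_ne_zero p.2
  let Z : 𝔼^3 × 𝔼^3 → ℂ^4 := fun q =>
    join (hopfLift i q.1) (hopfLift j q.2)
  have hZ : ContDiff ℝ ∞ Z := contDiff_iff_contDiffAt.2 fun q =>
    contDiffAt_join ((contDiff_hopfLift i).contDiffAt.comp q contDiffAt_fst)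
      ((contDiff_hopfLift j).contDiffAt.comp q contDiffAt_snd)
  have hst : Z (p.1, p.2) ∈ square.stable := join_mem_stable_square hi hj
  have hrep : ∀ q : S2 × S2, Z (q.1, q.2) ∈ square.stable →
      square.RepM (retractSquare (Z (q.1, q.2))) (eta.symm q) := by
    intro q hq
    have h := square.repM_mkM (isRetraction_square.mem _ hq)
    have hq' := mem_stable_square_iff.1 hq
    simp only [Z, fst2_join, snd2_join] at hq'
    have e1 : eta.symm q = square.mkM (retractSquare (Z (q.1, q.2))) := by
      rw [Homeomorph.symm_apply_eq, eta_apply, etaFun_hopfLift hq'.1 hq'.2 h]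
    rw [e1]
    exact h
  have hev : ∀ᶠ q in 𝓝 ((p.1 : 𝔼^3), (p.2 : 𝔼^3)),
      Z q ∈ square.stable :=
    hZ.continuous.continuousAt.eventually_mem (square.isOpen_stable.mem_nhds hst)
  have hG := he.contDiffAt_apply hU (z := fun q => retractSquare (Z q))
    (F := fun q => square.mkM (retractSquare (Z q)))
    ((contDiffAt_retractSquare hst).comp _ hZ.contDiffAt)
    (hev.mono fun q hq => square.repM_mkM (isRetraction_square.mem _ hq))
    ((he.mem_source (hrep p hst)).1 (by rw [hp, Homeomorph.symm_apply_apply]; exact hm))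
  have hι : ContMDiff ((𝓡 2).prod (𝓡 2))
      𝓘(ℝ, 𝔼^3 × 𝔼^3) ∞
      (fun q : S2 × S2 => ((q.1 : 𝔼^3), (q.2 : 𝔼^3))) :=
    (contMDiff_coe_S2.comp contMDiff_fst).prodMk_space
      (contMDiff_coe_S2.comp contMDiff_snd)
  refine ContMDiffAt.contMDiffWithinAt ?_
  have hc := ContMDiffAt.comp p (hG.contMDiffAt (x := (p.1.1, p.2.1))) (hι p)
  refine hc.congr_of_eventuallyEq ?_
  filter_upwards [hι.continuous.continuousAt.eventually hev] with q hq
  exact congrArg e (hrep q hq).eq_mkM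

end Octahedron

namespace Octahedron
open ToricData

variable {i : Fin 2} {v w : ℂ^2} {l : RealLink}

/-! ## The real link -/

lemma contDiffAt_smul {E : Type*} [NormedAddCommGroup E] [NormedSpace ℝ E] {c : E → ℂ}
    {v : E → ℂ^2} {x : E} (hc : ContDiffAt ℝ ∞ c x) (hv : ContDiffAt ℝ ∞ v x) :
    ContDiffAt ℝ ∞ (fun y => c y • v y) x :=
  contDiffAt_pi.2 fun i => hc.mul (contDiffAt_pi.1 hv i)

lemma contDiff_smul {E : Type*} [NormedAddCommGroup E] [NormedSpace ℝ E] {c : E → ℂ} {v : E → Fin 2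
    → ℂ} (hc : ContDiff ℝ ∞ c) (hv : ContDiff ℝ ∞ v) : ContDiff ℝ ∞ (fun y => c y • v y) :=
  contDiff_iff_contDiffAt.2 fun _ => contDiffAt_smul hc.contDiffAt hv.contDiffAt

lemma contDiffAt_div {E : Type*} [NormedAddCommGroup E] [NormedSpace ℝ E] {f g : E → ℂ} {x : E}
    (hf : ContDiffAt ℝ ∞ f x) (hg : ContDiffAt ℝ ∞ g x) (h : g x ≠ 0) :
    ContDiffAt ℝ ∞ (fun y => f y / g y) x := by
  simp only [div_eq_mul_inv]
  exact hf.mul (hg.inv h)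

/-- The square of the Euclidean norm of a vector of `ℂ²`. -/
def nrm (v : ℂ^2) : ℝ := ‖v 0‖ ^ 2 + ‖v 1‖ ^ 2

lemma nrm_smul (c : ℂ) (v : ℂ^2) : nrm (c • v) = ‖c‖ ^ 2 * nrm v := by
  simp only [nrm, Pi.smul_apply, norm_smul]; ring

lemma nrm_nonneg (v : ℂ^2) : 0 ≤ nrm v := by unfold nrm; positivity

lemma nrm_pos (hv : v ≠ 0) : 0 < nrm v := by
  obtain ⟨i, hi⟩ := ne_iff.1 hv
  have := norm_pos_iff.2 hi
  unfold nrm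
  fin_cases i
  · exact add_pos_of_pos_of_nonneg (pow_pos this 2) (sq_nonneg _)
  · exact add_pos_of_nonneg_of_pos (sq_nonneg _) (pow_pos this 2)

lemma contDiff_nrm : ContDiff ℝ ∞ nrm :=
  ((contDiff_apply ℝ ℂ (0 : Fin 2)).norm_sq ℝ).add ((contDiff_apply ℝ ℂ (1 : Fin 2)).norm_sq ℝ)

lemma nrm_ne_zero_of_eq_two (hv : nrm v = 2) : v ≠ 0 := by
  rintro rfl
  norm_num [nrm] at hv

lemma mem_S3 {x : EuclideanSpace ℂ (Fin 2)} :
    x ∈ Metric.sphere (0 : EuclideanSpace ℂ (Fin 2)) (√2) ↔ nrm x = 2 := by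
  rw [mem_sphere_zero_iff_norm, EuclideanSpace.norm_eq,
    sqrt_inj (Finset.sum_nonneg fun _ _ => sq_nonneg _) (by norm_num), Fin.sum_univ_two]
  rfl

/-- `l = [v : w]` for vectors of `ℂ²` given by their coordinates. -/
def IsRepL (v w : ℂ^2) (l : RealLink) : Prop := RepL (WithLp.toLp 2 v) (WithLp.toLp 2 w) l

lemma isRepL_of_repL {x y : EuclideanSpace ℂ (Fin 2)} (h : RepL x y l) : IsRepL x y l := h

lemma IsRepL.fst (h : IsRepL v w l) : nrm v = 2 :=
  mem_S3.1 h.1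

lemma IsRepL.snd (h : IsRepL v w l) : nrm w = 2 :=
  mem_S3.1 h.2.1

/-- The class in the real link. -/
def clsL : S3 × S3 → RealLink := Quotient.mk linkSetoid

lemma clsL_surjective : Surjective clsL := Quotient.mk_surjective

/-- The class of a pair of vectors in the real link, with an arbitrary value off the level set. -/
def pairL (hv : nrm v = 2) (hw : nrm w = 2) : S3 × S3 :=
  (⟨WithLp.toLp 2 v, mem_S3.2 hv⟩, ⟨WithLp.toLp 2 w, mem_S3.2 hw⟩)

lemma isRepL_pairL (hv : nrm v = 2) (hw : nrm w = 2) : IsRepL v w (clsL (pairL hv hw)) := ⟨_, _, rfl⟩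

lemma isRepL_clsL (p : S3 × S3) : IsRepL p.1.1 p.2.1 (clsL p) := ⟨p.1.2, p.2.2, rfl⟩

lemma exists_isRepL (l) : ∃ v w, IsRepL v w l := by
  obtain ⟨p, rfl⟩ := clsL_surjective l
  exact ⟨_, _, isRepL_clsL p⟩

lemma IsRepL.unique {l'} (h : IsRepL v w l) (h' : IsRepL v w l') : l = l' := by
  obtain ⟨_, _, rfl⟩ := h
  obtain ⟨_, _, rfl⟩ := h'
  rfl

lemma IsRepL.smul (h : IsRepL v w l) (c : Circle) :
    IsRepL ((c : ℂ) • v) (((c⁻¹ : Circle) : ℂ) • w) l := by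
  have h1 : nrm ((c : ℂ) • v) = 2 := by rw [nrm_smul, Circle.norm_coe, h.fst]; norm_num
  have h2 : nrm (((c⁻¹ : Circle) : ℂ) • w) = 2 := by
    rw [nrm_smul, Circle.norm_coe, h.snd]; norm_num
  obtain ⟨_, _, rfl⟩ := h
  exact ⟨mem_S3.2 h1, mem_S3.2 h2, Quotient.sound (s := linkSetoid) ⟨c, rfl, rfl⟩⟩

lemma isOpenQuotientMap_clsL : IsOpenQuotientMap clsL := by
  refine ⟨clsL_surjective, continuous_quot_mk, fun O hO => ?_⟩
  have hm : ∀ (c : Circle) (x : S3), (c : ℂ) • x.1 ∈ Metric.sphere 0 (√2) := fun c x => by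
    rw [mem_sphere_zero_iff_norm, norm_smul, Circle.norm_coe, one_mul,
      mem_sphere_zero_iff_norm.1 x.2]
  let act : Circle → S3 × S3 → S3 × S3 := fun c p => (⟨(c : ℂ) • p.1.1, hm c p.1⟩,
    ⟨((c⁻¹ : Circle) : ℂ) • p.2.1, hm c⁻¹ p.2⟩)
  have hact : ∀ c, Continuous (act c) := fun c =>
    (((continuous_subtype_val.comp continuous_fst).const_smul (c : ℂ)).subtype_mk _).prodMk
      (((continuous_subtype_val.comp continuous_snd).const_smul ((c⁻¹ : Circle) : ℂ)).subtype_mk _)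
  have e : clsL ⁻¹' (clsL '' O) = ⋃ c, act c ⁻¹' O := by
    refine Set.ext fun p => ?_
    rw [mem_iUnion]
    constructor
    · rintro ⟨q, hq, e⟩
      obtain ⟨c, h1, h2⟩ := Quotient.exact (s := linkSetoid) e.symm
      refine ⟨c, ?_⟩
      have : act c p = q := Prod.ext (Subtype.ext h1.symm) (Subtype.ext h2.symm)
      rw [mem_preimage, this]
      exact hq
    · rintro ⟨c, hc⟩
      exact ⟨_, hc, (Quotient.sound (s := linkSetoid) ⟨c, rfl, rfl⟩ : clsL p = _).symm⟩
  change IsOpen (clsL ⁻¹' (clsL '' O))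
  rw [e]
  exact isOpen_iUnion fun c => hO.preimage (hact c)

instance : CompactSpace RealLink := by
  have : ProperSpace (EuclideanSpace ℂ (Fin 2)) := inferInstance
  exact clsL_surjective.compactSpace isOpenQuotientMap_clsL.continuous

/-- The invariant function `x_i y_j`. -/
def prodL (i j : Fin 2) : RealLink → ℂ :=
  Quotient.lift (fun p : S3 × S3 => p.1.1 i * p.2.1 j) (by
    rintro p q ⟨c, h1, h2⟩
    simp only [h1, h2, PiLp.smul_apply, smul_eq_mul, Circle.coe_inv]
    field_simp [Circle.coe_ne_zero c])

lemma prodL_apply (i j : Fin 2) (h : IsRepL v w l) : prodL i j l = v i * w j := by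
  obtain ⟨_, _, rfl⟩ := h
  rfl

lemma continuous_coord (i : Fin 2) : Continuous fun x : EuclideanSpace ℂ (Fin 2) => x i :=
  (EuclideanSpace.proj i : EuclideanSpace ℂ (Fin 2) →L[ℂ] ℂ).continuous

lemma continuous_prodL (i j : Fin 2) : Continuous (prodL i j) :=
  continuous_quot_lift _ (((continuous_coord i).comp
    (continuous_subtype_val.comp continuous_fst)).mul ((continuous_coord j).comp
    (continuous_subtype_val.comp continuous_snd)))

lemma mul_star_add_of_nrm (h : nrm v = 2) : v 0 * star (v 0) + v 1 * star (v 1) = 2 := by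
  have m : ∀ z : ℂ, z * star z = (‖z‖ ^ 2 : ℝ) := fun z => by
    rw [star_def, mul_conj, normSq_eq_norm_sq]
  rw [m, m]
  exact_mod_cast h

lemma eq_of_prodL_eq {l' : RealLink} (h : ∀ i j, prodL i j l = prodL i j l') : l = l' := by
  obtain ⟨v, w, hl⟩ := exists_isRepL l
  obtain ⟨v', w', hl'⟩ := exists_isRepL l'
  simp only [prodL_apply _ _ hl, prodL_apply _ _ hl'] at h
  have k := mul_star_add_of_nrm hl.fst
  have k1 := mul_star_add_of_nrm hl'.fst
  have k2 := mul_star_add_of_nrm hl'.snd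
  set c : ℂ := (w 0 * star (w' 0) + w 1 * star (w' 1)) / 2 with hc
  have e : v' = c • v := by
    funext i
    rw [Pi.smul_apply, smul_eq_mul, hc]
    linear_combination (-1 / 2) * v' i * k2 - (1 / 2) * star (w' 0) * h i 0 -
      (1 / 2) * star (w' 1) * h i 1
  have hn : ‖c‖ = 1 := by
    have := hl'.fst
    rw [e, nrm_smul, hl.fst] at this
    nlinarith [norm_nonneg c]
  have e0 : star c * c = 1 := by
    rw [star_def, mul_comm, mul_conj, normSq_eq_norm_sq, hn]
    norm_num
  have e' : w' = star c • w := by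
    funext j
    have h0 := h 0 j
    have h1 := h 1 j
    rw [e] at h0 h1
    simp only [Pi.smul_apply, smul_eq_mul] at h0 h1 ⊢
    linear_combination (-1 / 2) * (w' j - star c * w j) * k - (w' j) * e0 * 0 -
      (1 / 2) * star c * star (v 0) * h0 - (1 / 2) * star c * star (v 1) * h1 -
      (1 / 2) * (v 0 * star (v 0) + v 1 * star (v 1)) * w' j * e0
  let C : Circle := ⟨c, mem_sphere_zero_iff_norm.2 hn⟩
  have h2 := hl.smul C
  have h3 : ((C⁻¹ : Circle) : ℂ) = star c := by rw [Circle.coe_inv_eq_conj]; rfl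
  rw [h3, ← e'] at h2
  change IsRepL (c • v) w' l at h2
  rw [← e] at h2
  exact h2.unique hl'

instance : T2Space RealLink := by
  refine T2Space.of_injective_continuous (f := fun l => fun p : Fin 2 × Fin 2 => prodL p.1 p.2 l)
    (fun l l' h => eq_of_prodL_eq fun i j => congrFun h (i, j))
    (continuous_pi fun p => continuous_prodL p.1 p.2)

/-! ## Charts of the real link -/

/-- The invariant function `x_{i+1} / x_i`. -/
def fstRatio (i : Fin 2) : RealLink → ℂ :=
  Quotient.lift (fun p : S3 × S3 => p.1.1 (i + 1) / p.1.1 i) (by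
    rintro p q ⟨c, h1, h2⟩
    simp only [h1, PiLp.smul_apply, smul_eq_mul]
    exact (mul_div_mul_left _ _ (Circle.coe_ne_zero c)).symm)

/-- The invariant function `y_{j+1} / y_j`. -/
def sndRatio (j : Fin 2) : RealLink → ℂ :=
  Quotient.lift (fun p : S3 × S3 => p.2.1 (j + 1) / p.2.1 j) (by
    rintro p q ⟨c, h1, h2⟩
    simp only [h2, PiLp.smul_apply, smul_eq_mul]
    exact (mul_div_mul_left _ _ (Circle.coe_ne_zero c⁻¹)).symm)

lemma fstRatio_apply (i : Fin 2) (h : IsRepL v w l) : fstRatio i l = v (i + 1) / v i := by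
  obtain ⟨_, _, rfl⟩ := h
  rfl

lemma sndRatio_apply (j : Fin 2) (h : IsRepL v w l) : sndRatio j l = w (j + 1) / w j := by
  obtain ⟨_, _, rfl⟩ := h
  rfl

/-- The vector of norm `√2` on the ray of the vector with `i`-th coordinate `1` and the other
one `u`. -/
def affS (i : Fin 2) (u : ℂ) : ℂ^2 := ((√2 / √(1 + ‖u‖ ^ 2) : ℝ) : ℂ) • aff i u

lemma nrm_aff (i : Fin 2) (u : ℂ) : nrm (aff i u) = 1 + ‖u‖ ^ 2 := by
  fin_cases i <;> simp [nrm, aff, add_comm]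

lemma nrm_affS (i : Fin 2) (u : ℂ) : nrm (affS i u) = 2 := by
  rw [affS, nrm_smul, nrm_aff, norm_real, norm_eq_abs, sq_abs, div_pow,
    sq_sqrt (by norm_num), sq_sqrt (by positivity)]
  field_simp

lemma contDiff_affS (i : Fin 2) : ContDiff ℝ ∞ (affS i) := by
  have h : ContDiff ℝ ∞ (aff i) :=
    ContDiff.restrict_scalars (𝕜' := ℂ) (𝕜 := ℝ) (contDiff_aff i)
  refine contDiff_smul ?_ h
  refine ofRealCLM.contDiff.comp (contDiff_const.div ?_ fun u => ?_)
  · exact (contDiff_const.add (contDiff_id.norm_sq ℝ)).sqrt fun u => by positivity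
  · positivity

lemma affS_self (i : Fin 2) (u : ℂ) : affS i u i = ((√2 / √(1 + ‖u‖ ^ 2) : ℝ) : ℂ) := by
  rw [affS, Pi.smul_apply, aff_self, smul_eq_mul, mul_one]

lemma affS_pos (u : ℂ) : 0 < √2 / √(1 + ‖u‖ ^ 2) := by positivity

lemma affS_ratio (i : Fin 2) (u : ℂ) : affS i u (i + 1) / affS i u i = u := by
  rw [affS_self, affS, Pi.smul_apply, aff_add, smul_eq_mul,
    mul_div_cancel_left₀ _ (ofReal_ne_zero.2 (affS_pos u).ne')]

lemma affS_div (hv : nrm v = 2) (hi : v i ≠ 0) : v = (v i / ‖v i‖) • affS i (v (i + 1) / v i) := by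
  have h1 : ‖v i‖ ^ 2 * (1 + ‖v (i + 1) / v i‖ ^ 2) = 2 := by
    rw [← hv, norm_div, nrm]
    have := norm_pos_iff.2 hi
    field_simp
    fin_cases i <;> simp [add_comm]
  have h2 : √2 / √(1 + ‖v (i + 1) / v i‖ ^ 2) = ‖v i‖ := by
    rw [← h1, sqrt_mul (by positivity), sqrt_sq (norm_nonneg _), mul_div_assoc,
      div_self (by positivity), mul_one]
  have h3 : (‖v i‖ : ℂ) ≠ 0 := ofReal_ne_zero.2 (norm_ne_zero_iff.2 hi)
  rw [affS, h2, smul_smul, div_mul_cancel₀ _ h3, aff_div hi]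

/-- First component of the representative in the inverse of a chart of the real link. -/
def linkFst (i : Fin 2) (ε : Circle) (q : ℂ × ℂ × ℝ) : ℂ^2 :=
  ((Circle.exp q.2.2 * ε⁻¹ : Circle) : ℂ) • affS i q.1

lemma nrm_linkFst (i : Fin 2) (ε : Circle) (q : ℂ × ℂ × ℝ) : nrm (linkFst i ε q) = 2 := by
  rw [linkFst, nrm_smul, Circle.norm_coe, nrm_affS]; norm_num

lemma contDiff_linkFst (i : Fin 2) (ε : Circle) : ContDiff ℝ ∞ (linkFst i ε) := by
  refine contDiff_smul ?_ ((contDiff_affS i).comp contDiff_fst)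
  simp only [Circle.coe_mul, Circle.coe_exp]
  have h : ContDiff ℝ ∞ fun q : ℂ × ℂ × ℝ => ((q.2.2 : ℝ) : ℂ) :=
    ofRealCLM.contDiff.comp (contDiff_snd.comp contDiff_snd)
  have h' : ContDiff ℝ ∞ fun q : ℂ × ℂ × ℝ => ((q.2.2 : ℝ) : ℂ) * I :=
    h.mul contDiff_const
  exact ContDiff.mul h'.cexp contDiff_const

/-- The point with given coordinates. -/
def linkInv (i j : Fin 2) (ε : Circle) (q : ℂ × ℂ × ℝ) : RealLink :=
  clsL (pairL (nrm_linkFst i ε q) (nrm_affS j q.2.1))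

lemma isRepL_linkInv (i j : Fin 2) (ε : Circle) (q : ℂ × ℂ × ℝ) :
    IsRepL (linkFst i ε q) (affS j q.2.1) (linkInv i j ε q) := isRepL_pairL _ _

lemma prodL_linkInv (i j : Fin 2) (ε : Circle) (q : ℂ × ℂ × ℝ) : (ε : ℂ) * prodL i j (linkInv i j ε
    q) = ((√2 / √(1 + ‖q.1‖ ^ 2) * (√2 / √(1 + ‖q.2.1‖ ^ 2)) : ℝ) : ℂ) * Complex.exp (q.2.2 *
    I) := by
  rw [prodL_apply i j (isRepL_linkInv i j ε q), affS_self, linkFst, Pi.smul_apply, affS_self,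
    Circle.coe_mul, Circle.coe_exp, Circle.coe_inv, smul_eq_mul]
  have := Circle.coe_ne_zero ε
  rw [ofReal_mul]
  field_simp

lemma circle_coe_exp_arg {z : ℂ} (hz : z ≠ 0) : ((Circle.exp z.arg : Circle) : ℂ) = z / ‖z‖ := by
  have h : (‖z‖ : ℂ) ≠ 0 := ofReal_ne_zero.2 (norm_ne_zero_iff.2 hz)
  rw [Circle.coe_exp, eq_div_iff h, mul_comm]
  exact norm_mul_exp_arg_mul_I z

lemma arg_prodL_linkInv (i j : Fin 2) (ε : Circle) {q : ℂ × ℂ × ℝ} (hq : q.2.2 ∈ Ioo (-Real.pi)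
    Real.pi) : ((ε : ℂ) * prodL i j (linkInv i j ε q)).arg = q.2.2 := by
  rw [prodL_linkInv, exp_mul_I]
  exact arg_mul_cos_add_sin_mul_I (mul_pos (affS_pos _) (affS_pos _)) ⟨hq.1, hq.2.le⟩

lemma IsRepL.ne_zero_of_prodL {j : Fin 2}
    (h : IsRepL v w l) (hl : prodL i j l ≠ 0) : v i ≠ 0 ∧ w j ≠ 0 := by
  rw [prodL_apply i j h] at hl
  exact mul_ne_zero_iff.1 hl

lemma prodL_ne_zero {j : Fin 2} {ε : Circle}
    (hl : (ε : ℂ) * prodL i j l ∈ slitPlane) : prodL i j l ≠ 0 :=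
  right_ne_zero_of_mul (slitPlane_ne_zero hl)

lemma linkInv_left (i j : Fin 2) (ε : Circle) (hl : prodL i j l ≠ 0) :
    linkInv i j ε (fstRatio i l, sndRatio j l, (ε * prodL i j l : ℂ).arg) = l := by
  obtain ⟨v, w, h⟩ := exists_isRepL l
  obtain ⟨hv, hw⟩ := h.ne_zero_of_prodL hl
  have h1 := isRepL_linkInv i j ε (fstRatio i l, sndRatio j l, (ε * prodL i j l : ℂ).arg)
  have hε := Circle.coe_ne_zero ε
  have hne : (ε : ℂ) * (v i * w j) ≠ 0 := mul_ne_zero hε (mul_ne_zero hv hw)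
  simp only [linkFst, Circle.coe_mul, Circle.coe_inv] at h1
  rw [prodL_apply i j h, fstRatio_apply i h, sndRatio_apply j h, circle_coe_exp_arg hne] at h1
  rw [prodL_apply i j h, fstRatio_apply i h, sndRatio_apply j h]
  have h2 := h.smul (Circle.exp (w j).arg)
  rw [Circle.coe_inv, circle_coe_exp_arg hw] at h2
  have n1 : (‖v i‖ : ℂ) ≠ 0 := ofReal_ne_zero.2 (norm_ne_zero_iff.2 hv)
  have n2 : (‖w j‖ : ℂ) ≠ 0 := ofReal_ne_zero.2 (norm_ne_zero_iff.2 hw)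
  have e1 : ((w j / ‖w j‖ : ℂ)) • v =
      ((ε : ℂ) * (v i * w j) / ‖(ε : ℂ) * (v i * w j)‖ * (ε : ℂ)⁻¹) •
        affS i (v (i + 1) / v i) := by
    conv_lhs => rw [affS_div h.fst hv]
    rw [smul_smul]
    congr 1
    rw [norm_mul, norm_mul, Circle.norm_coe, one_mul, ofReal_mul]
    field_simp
  have e2 : ((w j / ‖w j‖ : ℂ))⁻¹ • w = affS j (w (j + 1) / w j) := by
    refine (congrArg (fun x => ((w j / ‖w j‖ : ℂ))⁻¹ • x) (affS_div h.snd hw)).trans ?_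
    rw [smul_smul, inv_mul_cancel₀ (div_ne_zero hw n2), one_smul]
  rw [e1, e2] at h2
  exact h1.unique h2

/-- A chart of the real link with values in `ℂ × ℂ × ℝ`. -/
def linkChart (i j : Fin 2) (ε : Circle) : OpenPartialHomeomorph RealLink (ℂ × ℂ × ℝ) where
  toFun l := (fstRatio i l, sndRatio j l, (ε * prodL i j l : ℂ).arg)
  invFun := linkInv i j ε
  source := {l | (ε : ℂ) * prodL i j l ∈ slitPlane}
  target := univ ×ˢ univ ×ˢ Ioo (-Real.pi) Real.pi
  map_source' l hl := by
    refine ⟨trivial, trivial, neg_pi_lt_arg _, ?_⟩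
    exact (arg_le_pi _).lt_of_ne (mem_slitPlane_iff_arg.1 hl).1
  map_target' q hq := by
    rw [mem_setOf_eq, mem_slitPlane_iff_arg, arg_prodL_linkInv i j ε hq.2.2]
    refine ⟨hq.2.2.2.ne, ?_⟩
    rw [prodL_linkInv]
    exact mul_ne_zero (ofReal_ne_zero.2 (mul_pos (affS_pos _) (affS_pos _)).ne')
      (Complex.exp_ne_zero _)
  left_inv' l hl := linkInv_left i j ε (prodL_ne_zero hl)
  right_inv' q hq := by
    have h := isRepL_linkInv i j ε q
    refine Prod.ext ?_ (Prod.ext ?_ (arg_prodL_linkInv i j ε hq.2.2))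
    · simp only [fstRatio_apply i h, linkFst, Pi.smul_apply, smul_eq_mul]
      rw [mul_div_mul_left _ _ (Circle.coe_ne_zero _), affS_ratio]
    · simp only [sndRatio_apply j h, affS_ratio]
  open_source := isOpen_slitPlane.preimage (continuous_const.mul (continuous_prodL i j))
  open_target := isOpen_univ.prod (isOpen_univ.prod isOpen_Ioo)
  continuousOn_toFun := by
    have hO : IsOpen {l | (ε : ℂ) * prodL i j l ∈ slitPlane} :=
      isOpen_slitPlane.preimage (continuous_const.mul (continuous_prodL i j))
    have c1 : ∀ l : Fin 2, Continuous fun p : S3 × S3 => p.1.1 l := fun l =>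
      (continuous_coord l).comp (continuous_subtype_val.comp continuous_fst)
    have c2 : ∀ l : Fin 2, Continuous fun p : S3 × S3 => p.2.1 l := fun l =>
      (continuous_coord l).comp (continuous_subtype_val.comp continuous_snd)
    refine (isOpenQuotientMap_clsL.isQuotientMap.continuousOn_isOpen_iff hO).2 ?_
    refine ContinuousOn.prodMk ?_ (ContinuousOn.prodMk ?_ ?_)
    · exact (c1 (i + 1)).continuousOn.div (c1 i).continuousOn fun p hp =>
        ((isRepL_clsL p).ne_zero_of_prodL (prodL_ne_zero hp)).1
    · exact (c2 (j + 1)).continuousOn.div (c2 j).continuousOn fun p hp =>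
        ((isRepL_clsL p).ne_zero_of_prodL (prodL_ne_zero hp)).2
    · intro p hp
      have hc : Continuous fun p : S3 × S3 => (ε : ℂ) * (p.1.1 i * p.2.1 j) :=
        continuous_const.mul ((c1 i).mul (c2 j))
      exact (ContinuousAt.comp (f := fun p : S3 × S3 => (ε : ℂ) * (p.1.1 i * p.2.1 j))
        (continuousAt_arg hp) hc.continuousAt).continuousWithinAt
  continuousOn_invFun := by
    refine Continuous.continuousOn (isOpenQuotientMap_clsL.continuous.comp ?_)
    exact (((PiLp.continuous_toLp 2 _).comp (contDiff_linkFst i ε).continuous).subtype_mk _).prodMk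
      (((PiLp.continuous_toLp 2 _).comp ((contDiff_affS j).continuous.comp
        (continuous_fst.comp continuous_snd))).subtype_mk _)

/-- An identification of `ℂ × ℂ × ℝ` with `ℝ⁵`. -/
def equivFive : (ℂ × ℂ × ℝ) ≃L[ℝ] 𝔼^5 :=
  ContinuousLinearEquiv.ofFinrankEq (by simp [finrank_real_complex])

/-- The charts of the real link. -/
def linkCharts : Set (OpenPartialHomeomorph RealLink 𝔼^5) :=
  {c | ∃ i j ε, c = (linkChart i j ε).trans
    equivFive.toHomeomorph.toOpenPartialHomeomorph}

lemma exists_mem_linkCharts (l) : ∃ c ∈ linkCharts, l ∈ c.source := by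
  obtain ⟨v, w, h⟩ := exists_isRepL l
  obtain ⟨i, hi⟩ := ne_iff.1 (nrm_ne_zero_of_eq_two h.fst)
  obtain ⟨j, hj⟩ := ne_iff.1 (nrm_ne_zero_of_eq_two h.snd)
  have hne : v i * w j ≠ 0 := mul_ne_zero hi hj
  refine ⟨_, ⟨i, j, (Circle.exp (v i * w j).arg)⁻¹, rfl⟩, ?_⟩
  rw [trans_source]
  refine ⟨?_, trivial⟩
  change (((Circle.exp (v i * w j).arg)⁻¹ : Circle) : ℂ) * prodL i j l ∈ slitPlane
  rw [prodL_apply i j h, Circle.coe_inv, circle_coe_exp_arg hne, inv_div, div_mul_cancel₀ _ hne]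
  exact ofReal_mem_slitPlane.2 (norm_pos_iff.2 hne)

lemma contDiffAt_linkChart {c : OpenPartialHomeomorph RealLink 𝔼^5} (hc : c ∈
    linkCharts) {E : Type*} [NormedAddCommGroup E] [NormedSpace ℝ E] {v w : E → ℂ^2} {x : E}
    {F : E → RealLink} (hv : ContDiffAt ℝ ∞ v x) (hw : ContDiffAt ℝ ∞ w x) (hF : ∀ᶠ y in 𝓝 x, IsRepL
    (v y) (w y) (F y)) (hx : F x ∈ c.source) : ContDiffAt ℝ ∞ (fun y => c (F y)) x := by
  obtain ⟨i, j, ε, rfl⟩ := hc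
  rw [trans_source] at hx
  have hx1 : (ε : ℂ) * prodL i j (F x) ∈ slitPlane := hx.1
  have hn := hF.self_of_nhds.ne_zero_of_prodL (prodL_ne_zero hx1)
  rw [prodL_apply i j hF.self_of_nhds] at hx1
  have hv' := contDiffAt_pi.1 hv
  have hw' := contDiffAt_pi.1 hw
  have h3 : ContDiffAt ℝ ∞ (fun y => ((ε : ℂ) * (v y i * w y j)).arg) x := by
    have h4 : ContDiffAt ℝ ∞ (fun y => (ε : ℂ) * (v y i * w y j)) x :=
      contDiffAt_const.mul ((hv' i).mul (hw' j))
    have h5 := imCLM.contDiff.contDiffAt.comp x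
      (((Complex.contDiffAt_log hx1 (n := ∞)).restrict_scalars ℝ).comp x h4)
    refine h5.congr_of_eventuallyEq (Filter.Eventually.of_forall fun y => ?_)
    exact (log_im _).symm
  have h6 : ContDiffAt ℝ ∞ (fun y => v y (i + 1) / v y i) x := 
    contDiffAt_div (hv' (i + 1)) (hv' i) hn.1
  have h7 : ContDiffAt ℝ ∞ (fun y => w y (j + 1) / w y j) x := 
    contDiffAt_div (hw' (j + 1)) (hw' j) hn.2
  refine (equivFive.contDiff.contDiffAt.comp x (h6.prodMk (h7.prodMk h3))).congr_of_eventuallyEq ?_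
  filter_upwards [hF] with y hy
  change equivFive (fstRatio i (F y), sndRatio j (F y), (ε * prodL i j (F y) : ℂ).arg) = _
  rw [prodL_apply i j hy, fstRatio_apply i hy, sndRatio_apply j hy]
  rfl

lemma exists_rep_linkChart_symm {c : OpenPartialHomeomorph RealLink 𝔼^5} (hc
    : c ∈ linkCharts) : ∃ v w : 𝔼^5 → ℂ^2, ContDiff ℝ ∞ v ∧ ContDiff ℝ ∞
    w ∧ ∀ u, IsRepL (v u) (w u) (c.symm u) := by
  obtain ⟨i, j, ε, rfl⟩ := hc
  exact ⟨fun u => linkFst i ε (equivFive.symm u), fun u => affS j (equivFive.symm u).2.1,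
    (contDiff_linkFst i ε).comp equivFive.symm.contDiff,
    (contDiff_affS j).comp ((contDiff_fst.comp contDiff_snd).comp equivFive.symm.contDiff),
    fun u => isRepL_linkInv i j ε _⟩

lemma isAtlasOn_linkCharts : IsAtlasOn ℝ linkCharts univ := by
  have hsm : ∀ c ∈ linkCharts, ∀ c' ∈ linkCharts,
      ContDiffOn ℝ ∞ (c.symm ≫ₕ c') (c.symm ≫ₕ c').source := by
    intro c hc c' hc' u hu
    obtain ⟨v, w, hv, hw, h⟩ := exists_rep_linkChart_symm hc
    rw [trans_source] at hu
    exact (contDiffAt_linkChart hc' hv.contDiffAt hw.contDiffAt (Filter.Eventually.of_forall h)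
      hu.2).contDiffWithinAt
  refine ⟨eq_univ_of_forall fun l => ?_, fun c hc c' hc' => ?_⟩
  · obtain ⟨c, hc, hl⟩ := exists_mem_linkCharts l
    exact mem_biUnion hc hl
  · rw [contDiffGroupoid, mem_groupoid_of_pregroupoid]
    constructor
    · simpa [contDiffPregroupoid] using hsm c hc c' hc'
    · simpa [contDiffPregroupoid] using hsm c' hc' c hc

end Octahedron

namespace Octahedron
open ToricData

variable {i j : Fin 2} {v w : ℂ^2} {l : RealLink} {c : ℂ}

/-! ## The circle bundle over the symplectic link -/

lemma join_mem_levelSet_square (hv : nrm v = 2) (hw : nrm w = 2) : join v w ∈ square.levelSet := mem_levelSet_square.2 ⟨hv, hw⟩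

lemma isEmbedding_circle : Topology.IsEmbedding ((↑) : Circle → ℂ) := Topology.IsEmbedding.subtypeVal

/-- The projection of the real link to the symplectic link. -/
def linkProj : RealLink → square.M :=
  Quotient.lift (fun p : S3 × S3 => square.cls ⟨join p.1.1 p.2.1,
    join_mem_levelSet_square (mem_S3.1 p.1.2) (mem_S3.1 p.2.2)⟩) (by
    rintro p q ⟨c, h1, h2⟩
    refine cls_eq_iff.2 ⟨![c, c, c⁻¹, c⁻¹], mem_N_square_iff.2 ⟨c, c⁻¹, rfl⟩, ?_⟩
    change join q.1.1 q.2.1 = _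
    rw [rot_eq_join, fst2_join, snd2_join, h1, h2]
    rfl)

lemma repM_linkProj (h : IsRepL v w l) : square.RepM (join v w) (linkProj l) := by
  have hm := join_mem_levelSet_square h.fst h.snd
  obtain ⟨_, _, rfl⟩ := h
  exact ⟨hm, rfl⟩

lemma continuous_linkProj : Continuous linkProj := by
  refine continuous_quot_lift _ (square.continuous_cls.comp (Continuous.subtype_mk ?_ _))
  have h1 : Continuous fun p : S3 × S3 => (p.1.1 : ℂ^2) :=
    (PiLp.continuous_ofLp 2 _).comp (continuous_subtype_val.comp continuous_fst)
  have h2 : Continuous fun p : S3 × S3 => (p.2.1 : ℂ^2) :=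
    (PiLp.continuous_ofLp 2 _).comp (continuous_subtype_val.comp continuous_snd)
  exact continuous_join.comp (h1.prodMk h2)

/-- The circle action `c · [x : y] = [c x : y]`. -/
def linkAct (c : Circle) : RealLink → RealLink :=
  Quotient.lift (fun p : S3 × S3 => clsL (⟨(c : ℂ) • p.1.1, by
    rw [mem_sphere_zero_iff_norm, norm_smul, Circle.norm_coe, one_mul,
      mem_sphere_zero_iff_norm.1 p.1.2]⟩, p.2)) (by
    rintro p q ⟨b, h1, h2⟩
    refine Quotient.sound (s := linkSetoid) ⟨b, ?_, h2⟩
    change (c : ℂ) • q.1.1 = (b : ℂ) • (c : ℂ) • p.1.1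
    rw [h1, smul_comm])

lemma isRepL_linkAct (h : IsRepL v w l) (c : Circle) : IsRepL ((c : ℂ) • v) w (linkAct c l) := by
  obtain ⟨_, h2, rfl⟩ := h
  exact ⟨_, h2, rfl⟩

lemma continuous_linkAct : Continuous fun q : Circle × RealLink => linkAct q.1 q.2 := by
  refine (IsOpenQuotientMap.id.prodMap isOpenQuotientMap_clsL).isQuotientMap.continuous_iff.2 ?_
  refine isOpenQuotientMap_clsL.continuous.comp (Continuous.prodMk (Continuous.subtype_mk ?_ _)
    (continuous_snd.comp continuous_snd))
  exact (isEmbedding_circle.continuous.comp continuous_fst).smul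
    (continuous_subtype_val.comp (continuous_fst.comp continuous_snd))

lemma linkProj_eq_iff {l'} : linkProj l = linkProj l' ↔ ∃ c, l' = linkAct c l := by
  obtain ⟨v, w, h⟩ := exists_isRepL l
  constructor
  · intro e
    obtain ⟨v', w', h'⟩ := exists_isRepL l'
    obtain ⟨t, ht, e'⟩ := (repM_linkProj h).exists_rot square (e ▸ repM_linkProj h')
    obtain ⟨c, b, rfl⟩ := mem_N_square_iff.1 ht
    rw [rot_eq_join, fst2_join, snd2_join] at e'
    have e1 := congrArg fst2 e'
    have e2 := congrArg snd2 e'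
    rw [fst2_join, fst2_join] at e1
    rw [snd2_join, snd2_join] at e2
    refine ⟨c * b, IsRepL.unique h' ?_⟩
    have h1 := (isRepL_linkAct h (c * b)).smul b⁻¹
    rw [smul_smul, ← Circle.coe_mul, mul_comm c b, inv_mul_cancel_left, inv_inv, ← e1, ← e2] at h1
    rw [mul_comm]
    exact h1
  · rintro ⟨c, rfl⟩
    have h1 := (repM_linkProj h).rot square (t := ![c, c, 1, 1]) (mem_N_square_iff.2 ⟨c, 1, rfl⟩)
    rw [rot_eq_join, fst2_join, snd2_join, Circle.coe_one, one_smul] at h1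
    exact h1.unique square (repM_linkProj (isRepL_linkAct h c))

lemma prodL_linkAct (i j : Fin 2) (c : Circle) (l) :
    prodL i j (linkAct c l) = c * prodL i j l := by
  obtain ⟨v, w, h⟩ := exists_isRepL l
  rw [prodL_apply i j h, prodL_apply i j (isRepL_linkAct h c), Pi.smul_apply, smul_eq_mul,
    mul_assoc]

lemma exists_prodL_ne_zero (l) : ∃ i j, prodL i j l ≠ 0 := by
  obtain ⟨v, w, h⟩ := exists_isRepL l
  obtain ⟨i, hi⟩ := ne_iff.1 (nrm_ne_zero_of_eq_two h.fst)
  obtain ⟨j, hj⟩ := ne_iff.1 (nrm_ne_zero_of_eq_two h.snd)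
  exact ⟨i, j, by rw [prodL_apply i j h]; exact mul_ne_zero hi hj⟩

lemma linkAct_free {c : Circle} (h : linkAct c l = l) : c = 1 := by
  obtain ⟨i, j, hl⟩ := exists_prodL_ne_zero l
  have h1 := prodL_linkAct i j c l
  rw [h] at h1
  rw [← Circle.coe_inj, Circle.coe_one]
  exact (mul_eq_right₀ hl).1 h1.symm

/-- The phase of a complex number. -/
def phase (z : ℂ) : Circle := Circle.exp z.arg

lemma coe_phase {z : ℂ} (hz : z ≠ 0) : (phase z : ℂ) = z / ‖z‖ := circle_coe_exp_arg hz

lemma phase_mul {z w : ℂ} (hz : z ≠ 0) (hw : w ≠ 0) : phase (z * w) = phase z * phase w := by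
  rw [← Circle.coe_inj, Circle.coe_mul, coe_phase hz, coe_phase hw, coe_phase (mul_ne_zero hz hw),
    norm_mul, ofReal_mul, mul_div_mul_comm]

lemma phase_circle (c : Circle) : phase c = c := by
  rw [← Circle.coe_inj, coe_phase (Circle.coe_ne_zero c), Circle.norm_coe, ofReal_one,
    div_one]

lemma continuousOn_phase : ContinuousOn phase {0}ᶜ := by
  refine isEmbedding_circle.continuousOn_iff.2 ?_
  have : ContinuousOn (fun z : ℂ => z / ‖z‖) {0}ᶜ :=
    continuousOn_id.div (continuous_ofReal.comp continuous_norm).continuousOn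
      fun z hz => ofReal_ne_zero.2 (norm_ne_zero_iff.2 hz)
  exact this.congr fun z hz => coe_phase hz

/-- A representative of a class of the symplectic link in the real link, with `x_i y_j > 0`. -/
def normL (i j : Fin 2) (z : ℂ^4) : ℂ^2 :=
  (((phase (fst2 z i))⁻¹ * (phase (snd2 z j))⁻¹ : Circle) : ℂ) • fst2 z

lemma nrm_normL (i j : Fin 2) {z} (hz : z ∈ square.levelSet) :
    nrm (normL i j z) = 2 := by
  rw [normL, nrm_smul, Circle.norm_coe, one_pow, one_mul]
  exact norm_fst2 hz

/-- A local section of the circle bundle. -/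
def linkSec (i j : Fin 2) (m : square.M) : RealLink :=
  clsL (pairL (nrm_normL i j (square.outM_mem m)) (norm_snd2 (square.outM_mem m)))

lemma isRepL_linkSec (i j : Fin 2) (m : square.M) :
    IsRepL (normL i j (square.outM m)) (snd2 (square.outM m)) (linkSec i j m) := isRepL_pairL _ _

lemma linkProj_linkSec (i j : Fin 2) (m : square.M) : linkProj (linkSec i j m) = m := by
  have h := (square.repM_outM m).rot square (mem_N_square_iff.2
    ⟨(phase (fst2 (square.outM m) i))⁻¹ * (phase (snd2 (square.outM m) j))⁻¹, 1, rfl⟩)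
  rw [rot_eq_join, Circle.coe_one, one_smul] at h
  exact (repM_linkProj (isRepL_linkSec i j m)).unique square h

/-- The domain of a local trivialization of the circle bundle. -/
def linkBase (i j : Fin 2) : Set square.M := {m | ∃ z, square.RepM z m ∧ fst2 z i ≠ 0 ∧ snd2 z j ≠ 0}

lemma mem_linkBase {z} {m : square.M} (h : square.RepM z m) :
    m ∈ linkBase i j ↔ fst2 z i ≠ 0 ∧ snd2 z j ≠ 0 := by
  refine ⟨?_, fun h' => ⟨z, h, h'⟩⟩
  rintro ⟨w, hw, h1, h2⟩
  obtain ⟨t, ht, rfl⟩ := hw.exists_rot square h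
  obtain ⟨c, b, rfl⟩ := mem_N_square_iff.1 ht
  rw [rot_eq_join, fst2_join, snd2_join]
  exact ⟨mul_ne_zero (Circle.coe_ne_zero c) h1, mul_ne_zero (Circle.coe_ne_zero b) h2⟩

lemma continuous_fst2_apply (i : Fin 2) : Continuous fun z => fst2 z i :=
  (continuous_apply i).comp continuous_fst2

lemma continuous_snd2_apply (i : Fin 2) : Continuous fun z => snd2 z i :=
  (continuous_apply i).comp continuous_snd2

lemma isOpen_linkBase (i j : Fin 2) : IsOpen (linkBase i j) :=
  square.isOpen_image_mk (V := {z | fst2 z i ≠ 0 ∧ snd2 z j ≠ 0})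
    ((isOpen_ne_fun (continuous_fst2_apply i) continuous_const).inter
      (isOpen_ne_fun (continuous_snd2_apply j) continuous_const))

lemma linkProj_mem_linkBase : linkProj l ∈ linkBase i j ↔ prodL i j l ≠ 0 := by
  obtain ⟨v, w, h⟩ := exists_isRepL l
  rw [mem_linkBase (repM_linkProj h), fst2_join, snd2_join, prodL_apply i j h, mul_ne_zero_iff]

lemma phase_prodL_linkSec {m : square.M} (hm : m ∈ linkBase i j) :
    phase (prodL i j (linkSec i j m)) = 1 := by
  obtain ⟨h1, h2⟩ := (mem_linkBase (square.repM_outM m)).1 hm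
  rw [prodL_apply i j (isRepL_linkSec i j m), normL, Pi.smul_apply, smul_eq_mul,
    phase_mul (mul_ne_zero (Circle.coe_ne_zero _) h1) h2, phase_mul (Circle.coe_ne_zero _) h1,
    phase_circle, mul_assoc, ← mul_inv, inv_mul_cancel]

open Classical in
lemma continuousOn_linkSec (i j : Fin 2) : ContinuousOn (linkSec i j) (linkBase i j) := by
  let g : ℂ^4 → RealLink := fun z => if h : z ∈ square.levelSet then
    clsL (pairL (nrm_normL i j h) (norm_snd2 h)) else linkSec i j (square.mkM 0)
  have hg : ∀ z (h : z ∈ square.levelSet), g z =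
      clsL (pairL (nrm_normL i j h) (norm_snd2 h)) := fun z h => dif_pos h
  have hgr : ∀ z (h : z ∈ square.levelSet), IsRepL (normL i j z) (snd2 z) (g z) := fun z h => by
    rw [hg z h]; exact isRepL_pairL _ _
  have hc : ContinuousOn (fun m => g (square.outM m)) (linkBase i j) := by
    refine square.continuousOn_comp_outM (isOpen_linkBase i j) ?_ ?_
    · rw [continuousOn_iff_continuous_domRestrict]
      let S := {z ∈ square.levelSet | square.mkM z ∈ linkBase i j}
      have hne : ∀ z : S, fst2 z.1 i ≠ 0 ∧ snd2 z.1 j ≠ 0 := fun z =>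
        (mem_linkBase (square.repM_mkM z.2.1)).1 z.2.2
      have h1 : Continuous fun z : S => normL i j z.1 := by
        have k1 := continuousOn_phase.comp_continuous
          ((continuous_fst2_apply i).comp continuous_subtype_val) fun z : S => (hne z).1
        have k2 := continuousOn_phase.comp_continuous
          ((continuous_snd2_apply j).comp continuous_subtype_val) fun z : S => (hne z).2
        exact (isEmbedding_circle.continuous.comp (k1.inv.mul k2.inv)).smul
          (continuous_fst2.comp continuous_subtype_val)
      have h2 : Continuous fun z : S => clsL (pairL (nrm_normL i j z.2.1) (norm_snd2 z.2.1)) :=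
        isOpenQuotientMap_clsL.continuous.comp
          ((((PiLp.continuous_toLp 2 _).comp h1).subtype_mk _).prodMk
          (((PiLp.continuous_toLp 2 _).comp
            (continuous_snd2.comp continuous_subtype_val)).subtype_mk _))
      exact h2.congr fun z => (hg z.1 z.2.1).symm
    · intro z hz hm t ht
      obtain ⟨h1, h2⟩ := (mem_linkBase (square.repM_mkM hz)).1 hm
      have hz' := square.rot_mem_levelSet (t := t).2 hz
      obtain ⟨c, b, rfl⟩ := mem_N_square_iff.1 ht
      refine (hgr _ hz').unique ?_
      have h3 := (hgr z hz).smul b⁻¹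
      rw [inv_inv] at h3
      rw [rot_eq_join, snd2_join]
      convert h3 using 1
      simp only [normL, fst2_join, snd2_join, smul_smul, ← Circle.coe_mul, Pi.smul_apply,
        smul_eq_mul]
      rw [phase_mul (Circle.coe_ne_zero c) h1, phase_mul (Circle.coe_ne_zero b) h2, phase_circle,
        phase_circle]
      congr 2
      rw [mul_inv, mul_inv]
      rw [mul_comm _ c, mul_assoc c⁻¹, mul_inv_cancel_left, mul_left_comm]
  exact hc.congr fun m hm => (hg _ (square.outM_mem m)).symm

/-- A local trivialization of the circle bundle. -/
def linkTriv (i j : Fin 2) : Bundle.Trivialization Circle linkProj where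
  toFun l := (linkProj l, phase (prodL i j l))
  invFun q := linkAct q.2 (linkSec i j q.1)
  source := linkProj ⁻¹' linkBase i j
  target := linkBase i j ×ˢ univ
  map_source' l hl := ⟨hl, trivial⟩
  map_target' q hq := by
    rw [mem_preimage, ← linkProj_eq_iff.2 ⟨q.2, rfl⟩, linkProj_linkSec]
    exact hq.1
  left_inv' l hl := by
    have h1 : linkProj (linkSec i j (linkProj l)) = linkProj l := linkProj_linkSec i j _
    obtain ⟨c, hc⟩ := linkProj_eq_iff.1 h1
    have h2 := phase_prodL_linkSec hl
    have h3 : prodL i j (linkSec i j (linkProj l)) ≠ 0 := by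
      rw [← linkProj_mem_linkBase, h1]; exact hl
    have h4 : phase (prodL i j l) = c := by
      conv_lhs => rw [hc, prodL_linkAct, phase_mul (Circle.coe_ne_zero c) h3, phase_circle, h2,
        mul_one]
    change linkAct (phase (prodL i j l)) (linkSec i j (linkProj l)) = l
    rw [h4]
    exact hc.symm
  right_inv' q hq := by
    have h1 : linkProj (linkAct q.2 (linkSec i j q.1)) = q.1 := by
      rw [← linkProj_eq_iff.2 ⟨q.2, rfl⟩, linkProj_linkSec]
    have h3 : prodL i j (linkSec i j q.1) ≠ 0 := by
      rw [← linkProj_mem_linkBase, linkProj_linkSec]; exact hq.1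
    refine Prod.ext h1 ?_
    change phase (prodL i j (linkAct q.2 (linkSec i j q.1))) = q.2
    rw [prodL_linkAct, phase_mul (Circle.coe_ne_zero _) h3, phase_circle,
      phase_prodL_linkSec hq.1, mul_one]
  open_source := (isOpen_linkBase i j).preimage continuous_linkProj
  open_target := (isOpen_linkBase i j).prod isOpen_univ
  continuousOn_toFun := continuous_linkProj.continuousOn.prodMk
    (continuousOn_phase.comp (continuous_prodL i j).continuousOn
      fun l hl => linkProj_mem_linkBase.1 hl)
  continuousOn_invFun := continuous_linkAct.comp_continuousOn
    (continuousOn_snd.prodMk ((continuousOn_linkSec i j).comp continuousOn_fst fun q hq => hq.1))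
  baseSet := linkBase i j
  open_baseSet := isOpen_linkBase i j
  source_eq := rfl
  target_eq := rfl
  proj_toFun l hl := rfl

lemma isCircleBundle_linkProj : IsCircleBundle linkCharts linkProj linkAct where
  continuous := continuous_linkProj
  formula x y l h := repM_linkProj (isRepL_of_repL h)
  smooth := by
    rintro c hc e ⟨a, ha, he⟩ u hu
    obtain ⟨v, w, hv, hw, h⟩ := exists_rep_linkChart_symm hc
    have hr : ∀ u, square.RepM (join (v u) (w u)) (linkProj (c.symm u)) := fun u =>
      repM_linkProj (h u)
    exact (he.contDiffAt_apply (unimodular_square a ha)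
      (contDiffAt_join hv.contDiffAt hw.contDiffAt) (Filter.Eventually.of_forall hr)
      ((he.mem_source (hr u)).1 hu.2)).contDiffWithinAt
  surjective m := ⟨linkSec 0 0 m, linkProj_linkSec 0 0 m⟩
  action_continuous := continuous_linkAct
  action_formula c x y l h := isRepL_linkAct (isRepL_of_repL h) c
  free c l h := linkAct_free h
  fiber l l' := linkProj_eq_iff
  locally_trivial q := by
    obtain ⟨i, j, h⟩ := exists_prodL_ne_zero (linkSec 0 0 q)
    have h' := linkProj_mem_linkBase.2 h
    rw [linkProj_linkSec] at h'
    refine ⟨linkTriv i j, h', fun c l hl => ?_⟩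
    change phase (prodL i j (linkAct c l)) = c * phase (prodL i j l)
    rw [prodL_linkAct, phase_mul (Circle.coe_ne_zero c) (linkProj_mem_linkBase.1 hl), phase_circle]

/-! ## The complex description of the real link -/

lemma normalize_mem (hv : v ≠ 0) : nrm (((√2 / √(nrm v) : ℝ) : ℂ) • v) = 2 := by
  have := nrm_pos hv
  rw [nrm_smul, norm_real, norm_eq_abs, sq_abs, div_pow, sq_sqrt (by norm_num),
    sq_sqrt this.le]
  field_simp

lemma isRepL_repLC (h : IsRepL v w l) : v ≠ 0 ∧ w ≠ 0 :=
  ⟨nrm_ne_zero_of_eq_two h.fst, nrm_ne_zero_of_eq_two h.snd⟩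

lemma ne_zero_of_S3 (x : S3) : (x.1 : ℂ^2) ≠ 0 := nrm_ne_zero_of_eq_two (mem_S3.1 x.2)

/-- The class in the complex description of the link. -/
def clsLC : C2star × C2star → RealLinkC := Quotient.mk linkCSetoid

/-- The map of the real link to its complex description. -/
def linkToC : RealLink → RealLinkC :=
  Quotient.lift (fun p : S3 × S3 => clsLC (⟨p.1.1, ne_zero_of_S3 p.1⟩, ⟨p.2.1, ne_zero_of_S3 p.2⟩))
    (by
      rintro p q ⟨c, h1, h2⟩
      refine Quotient.sound (s := linkCSetoid) ⟨Units.mk0 (c : ℂ) (Circle.coe_ne_zero c), 1,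
        one_pos, ?_, ?_⟩
      · simp [h1]
      · simp [h2])

lemma repLC_linkToC (h : IsRepL v w l) : RepLC v w (linkToC l) := by
  have h0 := isRepL_repLC h
  obtain ⟨_, _, rfl⟩ := h
  exact ⟨h0.1, h0.2, rfl⟩

lemma RepLC_unique {l l' : RealLinkC} (h : RepLC v w l) (h' : RepLC v w l') : l = l' := by
  obtain ⟨_, _, rfl⟩ := h
  obtain ⟨_, _, rfl⟩ := h'
  rfl

lemma RepLC_smul {l : RealLinkC} (h : RepLC v w l) {s : ℝ}
    (hc : c ≠ 0) (hs : 0 < s) : RepLC (((s : ℂ) * c) • v) (((s : ℂ) * c⁻¹) • w) l := by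
  obtain ⟨hv, hw, rfl⟩ := h
  have hs' : (s : ℂ) ≠ 0 := ofReal_ne_zero.2 hs.ne'
  exact ⟨smul_ne_zero (mul_ne_zero hs' hc) hv, smul_ne_zero (mul_ne_zero hs' (inv_ne_zero hc)) hw,
    Quotient.sound (s := linkCSetoid) ⟨Units.mk0 c hc, s, hs, rfl, by simp⟩⟩

lemma exists_RepLC (l : RealLinkC) : ∃ v w, RepLC v w l := by
  obtain ⟨p, rfl⟩ := Quotient.mk_surjective l
  exact ⟨p.1.1, p.2.1, p.1.2, p.2.2, rfl⟩

lemma normalize_smul (hc : c ≠ 0) :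
    ((√2 / √(nrm (c • v)) : ℝ) : ℂ) • c • v = (phase c : ℂ) • ((√2 / √(nrm v) : ℝ) : ℂ) • v := by
  have hn : (‖c‖ : ℂ) ≠ 0 := ofReal_ne_zero.2 (norm_ne_zero_iff.2 hc)
  rw [smul_smul, smul_smul, nrm_smul, sqrt_mul (sq_nonneg _), sqrt_sq (norm_nonneg _),
    coe_phase hc]
  congr 1
  push_cast
  field_simp

lemma phase_real_mul {s : ℝ} (hs : 0 < s) (hc : c ≠ 0) : phase (s * c) = phase c := by
  have hs' : (s : ℂ) ≠ 0 := ofReal_ne_zero.2 hs.ne'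
  rw [phase_mul hs' hc]
  have : phase (s : ℂ) = 1 := by
    rw [phase, arg_ofReal_of_nonneg hs.le, Circle.exp_zero]
  rw [this, one_mul]

lemma phase_inv (hc : c ≠ 0) : phase c⁻¹ = (phase c)⁻¹ := by
  rw [eq_inv_iff_mul_eq_one, ← phase_mul (inv_ne_zero hc) hc, inv_mul_cancel₀ hc, phase,
    arg_one, Circle.exp_zero]

/-- The inverse of `linkToC`. -/
def linkOfC : RealLinkC → RealLink :=
  Quotient.lift (fun p : C2star × C2star =>
    clsL (pairL (normalize_mem p.1.2) (normalize_mem p.2.2))) (by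
    rintro p q ⟨c, s, hs, h1, h2⟩
    have hs' : (s : ℂ) ≠ 0 := ofReal_ne_zero.2 hs.ne'
    have h := (isRepL_pairL (normalize_mem p.1.2) (normalize_mem p.2.2)).smul (phase c)
    refine h.unique ?_
    have h' := isRepL_pairL (normalize_mem q.1.2) (normalize_mem q.2.2)
    have e1 := normalize_smul (v := p.1.1) (mul_ne_zero hs' c.ne_zero)
    have e2 := normalize_smul (v := p.2.1) (mul_ne_zero hs' c⁻¹.ne_zero)
    rw [phase_real_mul hs c.ne_zero, ← h1] at e1
    rw [phase_real_mul hs c⁻¹.ne_zero, ← h2, Units.val_inv_eq_inv_val, phase_inv c.ne_zero] at e2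
    rwa [← e1, ← e2])

lemma isRepL_linkOfC {l : RealLinkC} (h : RepLC v w l) :
    IsRepL (((√2 / √(nrm v) : ℝ) : ℂ) • v) (((√2 / √(nrm w) : ℝ) : ℂ) • w) (linkOfC l) := by
  obtain ⟨hv, hw, rfl⟩ := h
  exact isRepL_pairL (normalize_mem hv) (normalize_mem hw)

/-- The homeomorphism of the real link with its complex description. -/
def linkHomeo : RealLink ≃ₜ RealLinkC where
  toFun := linkToC
  invFun := linkOfC
  left_inv l := by
    obtain ⟨v, w, h⟩ := exists_isRepL l
    have h' := isRepL_linkOfC (repLC_linkToC h)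
    rw [h.fst, h.snd, div_self (by positivity), ofReal_one, one_smul, one_smul] at h'
    exact h'.unique h
  right_inv l := by
    obtain ⟨v, w, h⟩ := exists_RepLC l
    have h' := repLC_linkToC (isRepL_linkOfC h)
    have hv := h.1
    have hw := h.2.1
    have pv := sqrt_pos.2 (nrm_pos hv)
    have pw := sqrt_pos.2 (nrm_pos hw)
    have p2 : 0 < √2 := by positivity
    have hc : ((√(√(nrm w) / √(nrm v)) : ℝ) : ℂ) ≠ 0 := ofReal_ne_zero.2 (by positivity)
    have h2 := RepLC_smul h hc (s := √2 / √(√(nrm w) * √(nrm v))) (by positivity)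
    refine RepLC_unique h' ?_
    have s1 : √(√(nrm w)) ≠ 0 := by positivity
    have s2 : √(√(nrm v)) ≠ 0 := by positivity
    have m1 : √(√(nrm w)) ^ 2 = √(nrm w) := sq_sqrt pw.le
    have m2 : √(√(nrm v)) ^ 2 = √(nrm v) := sq_sqrt pv.le
    rw [← ofReal_inv, ← ofReal_mul, ← ofReal_mul, sqrt_mul pw.le,
      sqrt_div pw.le] at h2
    have e1 : √2 / (√(√(nrm w)) * √(√(nrm v))) * (√(√(nrm w)) / √(√(nrm v))) = √2 / √(nrm v) := by
      field_simp
      rw [m2]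
    have e2 : √2 / (√(√(nrm w)) * √(√(nrm v))) * (√(√(nrm w)) / √(√(nrm v)))⁻¹ =
        √2 / √(nrm w) := by
      field_simp
      rw [m1]
    rwa [e1, e2] at h2
  continuous_toFun := by
    refine continuous_quot_lift _ (continuous_quot_mk.comp (Continuous.prodMk
      (Continuous.subtype_mk ?_ _) (Continuous.subtype_mk ?_ _)))
    · exact (PiLp.continuous_ofLp 2 _).comp (continuous_subtype_val.comp continuous_fst)
    · exact (PiLp.continuous_ofLp 2 _).comp (continuous_subtype_val.comp continuous_snd)
  continuous_invFun := by
    have hc : Continuous fun v : C2star => ((√2 / √(nrm v.1) : ℝ) : ℂ) • v.1 := by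
      refine (continuous_ofReal.comp (continuous_const.div
        (continuous_sqrt.comp (contDiff_nrm.continuous.comp continuous_subtype_val))
        fun v => (sqrt_pos.2 (nrm_pos v.2)).ne')).smul continuous_subtype_val
    refine continuous_quot_lift _ (isOpenQuotientMap_clsL.continuous.comp (Continuous.prodMk
      (Continuous.subtype_mk ?_ _) (Continuous.subtype_mk ?_ _)))
    · exact (PiLp.continuous_toLp 2 _).comp (hc.comp continuous_fst)
    · exact (PiLp.continuous_toLp 2 _).comp (hc.comp continuous_snd)

lemma repLC_linkHomeo (h : IsRepL v w l) : RepLC v w (linkHomeo l) := repLC_linkToC h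

/-- The projection of the complex description of the link to `ℂℙ¹ × ℂℙ¹`. -/
def linkProjC : RealLinkC → CP1 × CP1 :=
  Quotient.lift (fun p : C2star × C2star => ((ℙmk p.1.1 p.1.2 : CP1),
    (ℙmk p.2.1 p.2.2 : CP1))) (by
    rintro p q ⟨c, s, hs, h1, h2⟩
    have hs' : (s : ℂ) ≠ 0 := ofReal_ne_zero.2 hs.ne'
    exact Prod.ext (mk_eq_mk_of_smul (mul_ne_zero hs' c.ne_zero) h1 _ _)
      (mk_eq_mk_of_smul (mul_ne_zero hs' c⁻¹.ne_zero) h2 _ _))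

lemma continuous_linkProjC : Continuous linkProjC :=
  continuous_quot_lift _ ((isOpenQuotientMap_mk.continuous.comp continuous_fst).prodMk
    (isOpenQuotientMap_mk.continuous.comp continuous_snd))

lemma linkProjC_apply (hv : v ≠ 0) (hw : w ≠ 0) {l : RealLinkC} (h : RepLC v w l) : linkProjC l =
    (ℙmk v hv, ℙmk w hw) := by
  obtain ⟨_, _, rfl⟩ := h
  rfl

lemma linkProjC_linkHomeo (l) :
    linkProjC (linkHomeo l) = kappa (square.chi (linkProj l)) := by
  obtain ⟨v, w, h⟩ := exists_isRepL l
  obtain ⟨hv, hw⟩ := isRepL_repLC h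
  rw [linkProjC_apply hv hw (repLC_linkHomeo h), kappa_apply,
    kappaFun_join hv hw (repM_linkProj h).repX]

end Octahedron

namespace Octahedron
open ToricData

variable {z : ℂ^4} {k : Fin 6} {r : ℝ} {m : (cone k).M} {x : (cone k).X}

/-! ## The cones at the vertices -/

lemma dot_cone_normal (k) (μ : ℝ^3) (hμ : μ ⬝ᵥ vertex k = 0) : μ ⬝ᵥ (cone k).normal 1
    = -(μ ⬝ᵥ (cone k).normal 0) ∧ μ ⬝ᵥ (cone k).normal 3 = -(μ ⬝ᵥ (cone k).normal 2) := by
  revert hμ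
  fin_cases k <;>
    simp [cone, octa, idx, Y, vertex, dotProduct, Fin.sum_univ_succ] <;> intro h <;> constructor <;>
    linarith

lemma bijOn_cone_section (k) : BijOn (fun μ => ![μ ⬝ᵥ (cone k).normal 0, μ ⬝ᵥ (cone
    k).normal 2]) ((cone k).polyhedron ∩ {μ | μ ⬝ᵥ vertex k = 0}) square.polyhedron := by
  have hsq : ∀ p : ℝ^2, p ∈ square.polyhedron ↔
      (-1 ≤ p 0 ∧ -1 ≤ -p 0) ∧ -1 ≤ p 1 ∧ -1 ≤ -p 1 := fun p => by
    change (∀ j, (-1 : ℝ) ≤ p ⬝ᵥ square.normal j) ↔ _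
    rw [Fin.forall_fin_succ, Fin.forall_fin_succ, Fin.forall_fin_two]
    simp [square, dotProduct, Fin.sum_univ_succ, and_assoc]
  have hco : ∀ μ : ℝ^3, μ ∈ (cone k).polyhedron ↔
      (-1 ≤ μ ⬝ᵥ (cone k).normal 0 ∧ -1 ≤ μ ⬝ᵥ (cone k).normal 1) ∧
        -1 ≤ μ ⬝ᵥ (cone k).normal 2 ∧ -1 ≤ μ ⬝ᵥ (cone k).normal 3 := fun μ => by
    change (∀ j, (-1 : ℝ) ≤ μ ⬝ᵥ (cone k).normal j) ↔ _
    rw [Fin.forall_fin_succ, Fin.forall_fin_succ, Fin.forall_fin_two, and_assoc]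
    rfl
  have hiff : ∀ μ : ℝ^3, μ ⬝ᵥ vertex k = 0 → (μ ∈ (cone k).polyhedron ↔
      ![μ ⬝ᵥ (cone k).normal 0, μ ⬝ᵥ (cone k).normal 2] ∈ square.polyhedron) := fun μ h => by
    rw [hco, hsq, (dot_cone_normal k μ h).1, (dot_cone_normal k μ h).2]
    rfl
  refine ⟨fun μ hμ => (hiff μ hμ.2).1 hμ.1, ?_, ?_⟩
  · intro μ hμ μ' hμ' e
    have e0 := congrFun e 0
    have e1 := congrFun e 1
    have h := hμ.2
    have h' := hμ'.2
    clear e hμ hμ' hsq hco hiff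
    simp only [mem_setOf_eq] at h h'
    revert e0 e1 h h'
    fin_cases k <;>
      simp [cone, octa, idx, Y, vertex, dotProduct, Fin.sum_univ_succ] <;> intro e0 e1 h h' <;>
      funext l <;> fin_cases l <;> simp <;> linarith
  · intro p hp
    let μ : ℝ^3 := (p 0 / 2) • ((cone k).normal 0 + vertex k) +
      (p 1 / 2) • ((cone k).normal 2 + vertex k)
    have h0 : μ ⬝ᵥ vertex k = 0 := by
      simp only [μ]
      clear hsq hco hiff
      fin_cases k <;> simp [cone, octa, idx, Y, vertex, dotProduct, Fin.sum_univ_succ]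
    have h1 : (fun μ => ![μ ⬝ᵥ (cone k).normal 0, μ ⬝ᵥ (cone k).normal 2]) μ = p := by
      simp only [μ]
      clear hsq hco hiff h0
      fin_cases k <;> funext l <;> fin_cases l <;>
        simp [cone, octa, idx, Y, vertex, dotProduct, Fin.sum_univ_succ] <;> ring
    refine ⟨μ, ⟨(hiff μ h0).2 ?_, h0⟩, h1⟩
    change (fun μ => ![μ ⬝ᵥ (cone k).normal 0, μ ⬝ᵥ (cone k).normal 2]) μ ∈ square.polyhedron
    rwa [h1]

lemma ne_apex_iff (h : (cone k).RepX z x) :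
    x ≠ (cone k).chi (apex k) ↔ fst2 z ≠ 0 ∧ snd2 z ≠ 0 := by
  have hm := (isRetraction_cone k).repM_symm h
  have h1 : x = (cone k).chi (apex k) ↔ retractCone z = 0 := by
    rw [← repM_apex_iff hm, ← (isRetraction_cone k).homeo_apply, Homeomorph.symm_apply_eq]
  rw [Ne, h1, Ne, Ne, fst2_eq_zero, snd2_eq_zero, ← not_or, ← mul_eq_zero, not_iff_not]
  refine ⟨fun h0 => ?_, retractCone_of_eq_zero⟩
  have h2 := nA_retractCone (z := z)
  rw [h0, nA_eq_zero.2 ⟨rfl, rfl⟩, eq_comm,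
    sqrt_eq_zero (mul_nonneg (nA_nonneg _) (nB_nonneg _))] at h2
  exact h2

lemma coneDescription (k) : ConeDescription k where
  group t := mem_N_cone k
  level z := mem_levelSet_cone k
  stable := stable_cone k
  apex_rep := apex_rep k
  link_polygon := bijOn_cone_section k
  kahler := isKahlerOff_cone k
  ne_apex z x h := ne_apex_iff h
  eq_iff z w x y hz hw hx := by
    obtain ⟨h1, h2⟩ := (ne_apex_iff hz).1 hx
    constructor
    · rintro rfl
      obtain ⟨c, hc, e⟩ := (repX_cone_iff hz h1 h2).1 hw
      exact ⟨Units.mk0 c hc, by simpa using e⟩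
    · rintro ⟨c, rfl⟩
      have := repX_cone_mul hz c.ne_zero
      rw [← Units.val_inv_eq_inv_val] at this
      exact this.unique hw

/-! ## The projection of the complex cone to the complex link -/

instance : Nonempty RealLinkC :=
  have h : (1 : ℂ^2) ≠ 0 := one_ne_zero
  ⟨clsLC (⟨1, h⟩, ⟨1, h⟩)⟩

instance : Nonempty RealLink := ⟨linkHomeo.symm (Classical.arbitrary _)⟩

open Classical in
/-- The class in the complex link of a vector, with an arbitrary value at the apex. -/
def toLinkC (z : ℂ^4) : RealLinkC :=
  if h : fst2 z ≠ 0 ∧ snd2 z ≠ 0 then clsLC (⟨fst2 z, h.1⟩, ⟨snd2 z, h.2⟩)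
  else Classical.arbitrary _

lemma repLC_toLinkC (h : fst2 z ≠ 0 ∧ snd2 z ≠ 0) : RepLC (fst2 z) (snd2 z) (toLinkC z) := ⟨h.1, h.2, dif_pos h⟩

lemma toLinkC_eq {w} (hz : (cone k).RepX z x)
    (hw : (cone k).RepX w x) : toLinkC z = toLinkC w := by
  by_cases h : fst2 z ≠ 0 ∧ snd2 z ≠ 0
  · obtain ⟨c, hc, rfl⟩ := (repX_cone_iff hz h.1 h.2).1 hw
    have h' := (ne_apex_iff hw).1 ((ne_apex_iff hz).2 h)
    have h1 := repLC_toLinkC h'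
    have h2 := RepLC_smul (repLC_toLinkC h) hc one_pos
    rw [ofReal_one, one_mul, one_mul] at h2
    rw [fst2_join, snd2_join] at h1
    exact RepLC_unique h2 h1
  · have h' : ¬ (fst2 w ≠ 0 ∧ snd2 w ≠ 0) := fun h' => h ((ne_apex_iff hz).1 ((ne_apex_iff hw).2 h'))
    rw [toLinkC, toLinkC, dif_neg h, dif_neg h']

/-- The projection of the complex cone to the complex link, arbitrary at the apex. -/
def coneToLinkC (k) : (cone k).X → RealLinkC :=
  Quot.lift (fun z : (cone k).stable => toLinkC z) fun z w h =>
    toLinkC_eq (x := (cone k).clsX z) ⟨z.2, rfl⟩ ⟨w.2, Quot.sound h⟩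

lemma coneToLinkC_apply (h : (cone k).RepX z x) : coneToLinkC k x = toLinkC z := by
  obtain ⟨_, rfl⟩ := h
  rfl

lemma repLC_coneToLinkC (h : (cone k).RepX z x)
    (hx : x ≠ (cone k).chi (apex k)) : RepLC (fst2 z) (snd2 z) (coneToLinkC k x) := by
  rw [coneToLinkC_apply h]
  exact repLC_toLinkC ((ne_apex_iff h).1 hx)

instance (k : Fin 6) : T2Space (cone k).X := (isRetraction_cone k).homeo.t2Space

lemma isQuotientMap_clsX (k) : Topology.IsQuotientMap (cone k).clsX := isQuotientMap_quot_mk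

lemma continuousOn_coneToLinkC (k) :
    ContinuousOn (coneToLinkC k) {(cone k).chi (apex k)}ᶜ := by
  refine ((isQuotientMap_clsX k).continuousOn_isOpen_iff isOpen_compl_singleton).2 ?_
  rw [continuousOn_iff_continuous_domRestrict]
  let S : Set (cone k).stable := (cone k).clsX ⁻¹' {(cone k).chi (apex k)}ᶜ
  have hne : ∀ z : S, fst2 z.1.1 ≠ 0 ∧ snd2 z.1.1 ≠ 0 := fun z =>
    (ne_apex_iff (x := (cone k).clsX z.1) ⟨z.1.2, rfl⟩).1 z.2
  have hc : Continuous fun z : S => clsLC (⟨fst2 z.1.1, (hne z).1⟩, ⟨snd2 z.1.1, (hne z).2⟩) :=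
    continuous_quot_mk.comp (((continuous_fst2.comp
      (continuous_subtype_val.comp continuous_subtype_val)).subtype_mk _).prodMk
      ((continuous_snd2.comp (continuous_subtype_val.comp continuous_subtype_val)).subtype_mk _))
  refine hc.congr fun z => ?_
  change _ = toLinkC z.1.1
  rw [toLinkC, dif_pos (hne z)]

/-! ## The cone over the real link -/

lemma join_real_mem_levelSet_cone (k) {v w} (hv : nrm v = 2) (hw : nrm w = 2)
    (r : ℝ) : join ((r : ℂ) • v) ((r : ℂ) • w) ∈ (cone k).levelSet := by
  refine (mem_levelSet_cone k).2 ?_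
  change nrm ((r : ℂ) • v) = nrm ((r : ℂ) • w)
  rw [nrm_smul, nrm_smul, hv, hw]

/-- The map `([x : y], r) ↦ [r x : r y]`. -/
def linkToCone (k) (q : RealLink × ℝ) : (cone k).M :=
  Quotient.lift (fun p : S3 × S3 => (cone k).cls ⟨join ((q.2 : ℂ) • (p.1.1 : ℂ^2))
    ((q.2 : ℂ) • (p.2.1 : ℂ^2)),
    join_real_mem_levelSet_cone k (mem_S3.1 p.1.2) (mem_S3.1 p.2.2) q.2⟩) (by
    rintro p p' ⟨c, h1, h2⟩
    refine cls_eq_iff.2 ⟨![c, c, c⁻¹, c⁻¹], (mem_N_cone_iff k).2 ⟨c, rfl⟩, ?_⟩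
    change join ((q.2 : ℂ) • (p'.1.1 : ℂ^2)) ((q.2 : ℂ) • (p'.2.1 : ℂ^2)) = _
    rw [rot_eq_join, fst2_join, snd2_join, h1, h2, smul_comm, smul_comm _ (q.2 : ℂ)]
    rfl) q.1

lemma repM_linkToCone (k) {v w} {l} (h : IsRepL v w l) (r : ℝ) :
    (cone k).RepM (join ((r : ℂ) • v) ((r : ℂ) • w)) (linkToCone k (l, r)) := by
  have hm := join_real_mem_levelSet_cone k h.fst h.snd r
  obtain ⟨_, _, rfl⟩ := h
  exact ⟨hm, rfl⟩

lemma continuous_linkToCone (k) : Continuous (linkToCone k) := by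
  refine (isOpenQuotientMap_clsL.prodMap IsOpenQuotientMap.id).isQuotientMap.continuous_iff.2 ?_
  refine (cone k).continuous_cls.comp (Continuous.subtype_mk ?_ _)
  have h1 : Continuous fun q : (S3 × S3) × ℝ => (q.1.1.1 : ℂ^2) :=
    (PiLp.continuous_ofLp 2 _).comp (continuous_subtype_val.comp (continuous_fst.comp continuous_fst))
  have h2 : Continuous fun q : (S3 × S3) × ℝ => (q.1.2.1 : ℂ^2) :=
    (PiLp.continuous_ofLp 2 _).comp (continuous_subtype_val.comp (continuous_snd.comp continuous_fst))
  have h3 : Continuous fun q : (S3 × S3) × ℝ => (q.2 : ℂ) :=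
    continuous_ofReal.comp continuous_snd
  exact continuous_join.comp ((h3.smul h1).prodMk (h3.smul h2))

/-- The distance to the apex, up to a constant. -/
def radius (k) : (cone k).M → ℝ :=
  Quotient.lift (fun z : (cone k).levelSet => √(nA z / 2)) (by
    rintro z w ⟨t, -, h⟩
    simp only [h, nA_rot])

lemma radius_apply (h : (cone k).RepM z m) : radius k m = √(nA z / 2) := by
  obtain ⟨_, rfl⟩ := h
  rfl

lemma continuous_radius (k) : Continuous (radius k) :=
  continuous_quot_lift _ (continuous_sqrt.comp
    ((continuous_nA.comp continuous_subtype_val).div_const 2))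

lemma radius_linkToCone (k) (l) (hr : 0 ≤ r) :
    radius k (linkToCone k (l, r)) = r := by
  obtain ⟨v, w, h⟩ := exists_isRepL l
  rw [radius_apply (repM_linkToCone k h r)]
  change √(nrm (fst2 (join ((r : ℂ) • v) ((r : ℂ) • w))) / 2) = r
  rw [fst2_join, nrm_smul, h.fst, norm_real, norm_eq_abs, sq_abs,
    mul_div_cancel_right₀ _ (by norm_num), sqrt_sq hr]

lemma radius_eq_zero_iff : radius k m = 0 ↔ m = apex k := by
  obtain ⟨z, hz⟩ := (cone k).exists_repM m
  rw [radius_apply hz, repM_apex_iff hz, sqrt_eq_zero (by have := nA_nonneg z; positivity)]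
  have h := (mem_levelSet_cone' k).1 hz.1
  constructor
  · intro h0
    have h1 : nA z = 0 := by linarith
    rw [← join_fst2_snd2 z, fst2_eq_zero.2 h1, snd2_eq_zero.2 (h ▸ h1)]
    funext i
    fin_cases i <;> rfl
  · rintro rfl
    rw [nA_eq_zero.2 ⟨rfl, rfl⟩, zero_div]

/-- The direction of a point of the cone, arbitrary at the apex. -/
def direction (k) (m : (cone k).M) : RealLink :=
  linkHomeo.symm (coneToLinkC k ((cone k).chi m))

lemma chi_ne_apex (hm : m ≠ apex k) : (cone k).chi m ≠ (cone k).chi (apex k) :=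
  fun h => hm ((isRetraction_cone k).homeo.injective h)

lemma isRepL_direction (h : (cone k).RepM z m) (hm : m ≠ apex k) : IsRepL (((√2 / √(nrm (fst2 z)) :
    ℝ) : ℂ) • fst2 z) (((√2 / √(nrm (snd2 z)) : ℝ) : ℂ) • snd2 z) (direction k m) :=
  isRepL_linkOfC (repLC_coneToLinkC h.repX (chi_ne_apex hm))

lemma continuousOn_direction (k) : ContinuousOn (direction k) {apex k}ᶜ :=
  linkHomeo.symm.continuous.comp_continuousOn ((continuousOn_coneToLinkC k).comp
    (cone k).continuous_chi.continuousOn fun _ hm => chi_ne_apex hm)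

lemma linkToCone_direction (hm : m ≠ apex k) : linkToCone k (direction k m, radius k m) = m := by
  obtain ⟨z, hz⟩ := (cone k).exists_repM m
  have h := repM_linkToCone k (isRepL_direction hz hm) (radius k m)
  have hr := radius_eq_zero_iff.not.2 hm
  have hA : √(nrm (fst2 z) / 2) ≠ 0 := by rwa [radius_apply hz] at hr
  have hB : nrm (snd2 z) = nrm (fst2 z) := ((mem_levelSet_cone' k).1 hz.1).symm
  have e : √(nrm (fst2 z) / 2) * (√2 / √(nrm (fst2 z))) = 1 := by
    rw [sqrt_div (nrm_nonneg _)] at hA ⊢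
    have h1 : √(nrm (fst2 z)) ≠ 0 := fun h => hA (by rw [h, zero_div])
    field_simp
  rw [hB, radius_apply hz, smul_smul, smul_smul, ← ofReal_mul] at h
  change (cone k).RepM (join (((√(nrm (fst2 z) / 2) * _ : ℝ) : ℂ) • _)
    (((√(nrm (fst2 z) / 2) * _ : ℝ) : ℂ) • _)) _ at h
  rw [e, ofReal_one, one_smul, one_smul, join_fst2_snd2, ← radius_apply hz] at h
  exact h.unique _ hz

lemma direction_linkToCone (k) (l) (hr : 0 < r) : coneToLinkC k ((cone k).chi
    (linkToCone k (l, r))) = linkHomeo l ∧ linkToCone k (l, r) ≠ apex k := by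
  obtain ⟨v, w, h⟩ := exists_isRepL l
  have h1 : linkToCone k (l, r) ≠ apex k := by
    rw [Ne, ← radius_eq_zero_iff, radius_linkToCone k l hr.le]
    exact hr.ne'
  have h2 := repLC_coneToLinkC (repM_linkToCone k h r).repX (chi_ne_apex h1)
  rw [fst2_join, snd2_join] at h2
  have h3 := RepLC_smul (repLC_linkHomeo h) one_ne_zero hr
  rw [inv_one, mul_one] at h3
  exact ⟨RepLC_unique h2 h3, h1⟩

/-- The map of the open cone over the real link. -/
def coneFun (k) : RealCone RealLink → (cone k).M :=
  Quot.lift (fun p : RealLink × Set.Ici (0 : ℝ) => linkToCone k (p.1, p.2)) (by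
    rintro ⟨l, r⟩ ⟨l', r'⟩ ⟨h, h'⟩
    exact (radius_eq_zero_iff.1 ((radius_linkToCone k l r.2).trans h)).trans
      (radius_eq_zero_iff.1 ((radius_linkToCone k l' r'.2).trans h')).symm)

lemma coneFun_mk (k) (l) (hr : 0 ≤ r) :
    coneFun k (RealCone.mk l r hr) = linkToCone k (l, r) := rfl

lemma continuous_coneFun (k) : Continuous (coneFun k) :=
  continuous_quot_lift _ ((continuous_linkToCone k).comp
    (continuous_fst.prodMk (continuous_subtype_val.comp continuous_snd)))

lemma isClosedMap_coneFun (k) : IsClosedMap (coneFun k) := by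
  let H : RealLink × Set.Ici (0 : ℝ) → (cone k).M := fun p => linkToCone k (p.1, p.2)
  have hH : Continuous H := (continuous_linkToCone k).comp
    (continuous_fst.prodMk (continuous_subtype_val.comp continuous_snd))
  have h0 : ∀ m, 0 ≤ radius k m := fun m => by
    obtain ⟨z, hz⟩ := (cone k).exists_repM m
    rw [radius_apply hz]
    exact sqrt_nonneg _
  have hp : IsProperMap H := by
    refine isProperMap_of_comp_of_t2 (g := fun m => (⟨radius k m, h0 m⟩ : Set.Ici (0 : ℝ))) hH
      ((continuous_radius k).subtype_mk _) ?_
    have : (fun m => (⟨radius k m, h0 m⟩ : Set.Ici (0 : ℝ))) ∘ H = Prod.snd := by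
      funext p
      exact Subtype.ext (radius_linkToCone k p.1 p.2.2)
    rw [this]
    exact isProperMap_snd_of_compactSpace
  intro C hC
  have hq : Continuous (Quot.mk (fun p q : RealLink × Set.Ici (0 : ℝ) =>
      (p.2 : ℝ) = 0 ∧ (q.2 : ℝ) = 0)) := continuous_quot_mk
  have e : coneFun k '' C = H '' (Quot.mk _ ⁻¹' C) := by
    refine Set.ext fun m => ⟨?_, ?_⟩
    · rintro ⟨x, hx, rfl⟩
      obtain ⟨p, rfl⟩ := Quot.mk_surjective x
      exact ⟨p, hx, rfl⟩
    · rintro ⟨p, hp, rfl⟩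
      exact ⟨_, hp, rfl⟩
  rw [e]
  exact hp.isClosedMap _ (hC.preimage hq)

lemma bijective_coneFun (k) : Bijective (coneFun k) := by
  constructor
  · intro x y h
    obtain ⟨⟨l, r, hr⟩, rfl⟩ := Quot.mk_surjective x
    obtain ⟨⟨l', r', hr'⟩, rfl⟩ := Quot.mk_surjective y
    change linkToCone k (l, r) = linkToCone k (l', r') at h
    have e := congrArg (radius k) h
    rw [radius_linkToCone k l hr, radius_linkToCone k l' hr'] at e
    subst e
    rcases (show (0 : ℝ) ≤ r from hr).eq_or_lt with h0 | h0
    · exact Quot.sound ⟨h0.symm, h0.symm⟩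
    · have h1 := (direction_linkToCone k l h0).1
      rw [h, (direction_linkToCone k l' h0).1] at h1
      rw [linkHomeo.injective h1]
  · intro m
    by_cases hm : m = apex k
    · refine ⟨RealCone.mk (Classical.arbitrary _) 0 le_rfl, ?_⟩
      rw [coneFun_mk, hm, ← radius_eq_zero_iff, radius_linkToCone k _ le_rfl]
    · refine ⟨RealCone.mk (direction k m) (radius k m) ?_, linkToCone_direction hm⟩
      obtain ⟨z, hz⟩ := (cone k).exists_repM m
      rw [radius_apply hz]
      exact sqrt_nonneg _

/-- The homeomorphism of the open cone over the real link with the symplectic cone. -/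
def coneHomeo (k) : RealCone RealLink ≃ₜ (cone k).M :=
  (Equiv.ofBijective (coneFun k) (bijective_coneFun k)).toHomeomorphOfContinuousClosed
    (continuous_coneFun k) (isClosedMap_coneFun k)

/-- Polar coordinates of the symplectic cone. -/
def coneDiffeo (k) : OpenPartialHomeomorph (RealLink × ℝ) (cone k).M where
  toFun := linkToCone k
  invFun m := (direction k m, radius k m)
  source := {p | 0 < p.2}
  target := {apex k}ᶜ
  map_source' p hp := (direction_linkToCone k p.1 hp).2
  map_target' m hm := by
    obtain ⟨z, hz⟩ := (cone k).exists_repM m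
    have h := radius_eq_zero_iff.not.2 hm
    rw [radius_apply hz] at h
    change 0 < radius k m
    rw [radius_apply hz]
    exact (sqrt_nonneg _).lt_of_ne' h
  left_inv' p hp := by
    refine Prod.ext ?_ (radius_linkToCone k p.1 (le_of_lt hp))
    change linkHomeo.symm _ = p.1
    rw [(direction_linkToCone k p.1 hp).1, Homeomorph.symm_apply_apply]
  right_inv' m hm := linkToCone_direction hm
  open_source := isOpen_lt continuous_const continuous_snd
  open_target := isOpen_compl_singleton
  continuousOn_toFun := (continuous_linkToCone k).continuousOn
  continuousOn_invFun := (continuousOn_direction k).prodMk (continuous_radius k).continuousOn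

lemma contDiffAt_normalize {E : Type*} [NormedAddCommGroup E] [NormedSpace ℝ E]
    {v : E → ℂ^2} {x : E} (hv : ContDiffAt ℝ ∞ v x) (h : v x ≠ 0) :
    ContDiffAt ℝ ∞ (fun y => ((√2 / √(nrm (v y)) : ℝ) : ℂ) • v y) x := by
  have h1 : ContDiffAt ℝ ∞ (fun y => nrm (v y)) x := contDiff_nrm.contDiffAt.comp x hv
  have hp := nrm_pos h
  exact contDiffAt_smul (ofRealCLM.contDiff.contDiffAt.comp x
    (contDiffAt_const.div (h1.sqrt hp.ne') (sqrt_pos.2 hp).ne')) hv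

lemma contDiffAt_fst2 {𝕜 E : Type*} [NontriviallyNormedField 𝕜] [NormedAlgebra 𝕜 ℂ]
    [NormedAddCommGroup E] [NormedSpace 𝕜 E] {z : E → ℂ^4} {x : E}
    (hz : ContDiffAt 𝕜 ∞ z x) : ContDiffAt 𝕜 ∞ (fun y => fst2 (z y)) x := by
  rw [contDiffAt_pi] at hz ⊢
  intro i
  fin_cases i
  exacts [hz 0, hz 1]

lemma contDiffAt_snd2 {𝕜 E : Type*} [NontriviallyNormedField 𝕜] [NormedAlgebra 𝕜 ℂ]
    [NormedAddCommGroup E] [NormedSpace 𝕜 E] {z : E → ℂ^4} {x : E}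
    (hz : ContDiffAt 𝕜 ∞ z x) : ContDiffAt 𝕜 ∞ (fun y => snd2 (z y)) x := by
  rw [contDiffAt_pi] at hz ⊢
  intro i
  fin_cases i
  exacts [hz 2, hz 3]

lemma isDiffeoInCharts_coneDiffeo (k) : IsDiffeoInCharts ℝ (prodCharts linkCharts
    {OpenPartialHomeomorph.refl ℝ}) (cone k).symplecticCharts (coneDiffeo k) := by
  rintro _ ⟨c, hc, _, rfl, rfl⟩ e ⟨a, ha, he⟩
  have hU := unimodular_cone k a
  constructor
  · rintro ⟨u, r⟩ hu
    obtain ⟨v, w, hv, hw, h⟩ := exists_rep_linkChart_symm hc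
    have hs : coneDiffeo k (c.symm u, r) ∈ e.source := hu.2.2
    let Z : 𝔼^5 × ℝ → ℂ^4 := fun q =>
      join ((q.2 : ℂ) • v q.1) ((q.2 : ℂ) • w q.1)
    have hr : ContDiff ℝ ∞ fun q : 𝔼^5 × ℝ => ((q.2 : ℝ) : ℂ) :=
      ofRealCLM.contDiff.comp contDiff_snd
    have hZ : ContDiffAt ℝ ∞ Z (u, r) := contDiffAt_join
      (contDiff_smul hr (hv.comp contDiff_fst)).contDiffAt
      (contDiff_smul hr (hw.comp contDiff_fst)).contDiffAt
    have hrep : ∀ q : 𝔼^5 × ℝ,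
        (cone k).RepM (Z q) (linkToCone k (c.symm q.1, q.2)) := fun q => repM_linkToCone k (h q.1) q.2
    exact (he.contDiffAt_apply hU hZ (Filter.Eventually.of_forall hrep)
      ((he.mem_source (hrep (u, r))).1 hs)).contDiffWithinAt
  · intro u hu
    rw [trans_target] at hu
    have hu1 : u ∈ e.target := by
      have := hu.1
      rw [trans_target] at this
      exact this.1
    have hu2 : e.symm u ≠ apex k := by
      have := hu.1
      rw [trans_target] at this
      exact this.2
    have hu3 : direction k (e.symm u) ∈ c.source := by
      have h : ((coneDiffeo k).symm (e.symm u)).1 ∈ c.source := by simpa using hu.2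
      exact h
    have hrep := he.symm_apply hU hu1
    have hne := (ne_apex_iff hrep.repX).1 (chi_ne_apex hu2)
    have hZ : ContDiffAt ℝ ∞ ((cone k).sig a) u := contDiffAt_sig (he.target_eq hU ▸ hu1)
    have hz1 := contDiffAt_fst2 hZ
    have hz2 := contDiffAt_snd2 hZ
    have hev : ∀ᶠ y in 𝓝 u, (cone k).RepM ((cone k).sig a y) (e.symm y) ∧ e.symm y ≠ apex k := by
      filter_upwards [he.eventually_symm hU hu1, hz1.continuousAt.eventually_ne hne.1,
        hz2.continuousAt.eventually_ne hne.2] with y h1 h2 h3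
      refine ⟨h1, fun h => (ne_apex_iff h1.repX).2 ⟨h2, h3⟩ (by rw [h])⟩
    have hd := contDiffAt_linkChart hc (F := fun y => direction k (e.symm y))
      (contDiffAt_normalize hz1 hne.1) (contDiffAt_normalize hz2 hne.2)
      (hev.mono fun y hy => isRepL_direction hy.1 hy.2) hu3
    have hr : ContDiffAt ℝ ∞ (fun y => √(nrm (fst2 ((cone k).sig a y)) / 2)) u := by
      have h1 : ContDiffAt ℝ ∞ (fun y => nrm (fst2 ((cone k).sig a y)) / 2) u :=
        (contDiff_nrm.contDiffAt.comp u hz1).div_const 2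
      exact h1.sqrt (by have := nrm_pos hne.1; positivity)
    refine ContDiffAt.contDiffWithinAt ((hd.prodMk hr).congr_of_eventuallyEq ?_)
    filter_upwards [hev] with y hy
    exact Prod.ext rfl (radius_apply hy.1)

lemma isRealConeModel (k) : IsRealConeModel k linkCharts (coneHomeo k) (coneDiffeo k) where
  formula x y l r hr h := repM_linkToCone k (isRepL_of_repL h) r
  source := rfl
  target := rfl
  restrict l r hr := rfl
  diffeo := isDiffeoInCharts_coneDiffeo k

lemma isConeDiagram (k) : IsConeDiagram k linkHomeo linkProjC (coneHomeo k)
    (coneToLinkC k) (fun x => linkProjC (coneToLinkC k x)) where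
  continuous := continuousOn_coneToLinkC k
  formula z x h hx := repLC_coneToLinkC h hx
  real l r hr := (direction_linkToCone k l hr).1
  complex x hx := rfl

end Octahedron

namespace Octahedron
open ToricData

variable {i : Fin 2} {z : ℂ^4} {k : Fin 6} {x : (cone k).X}

/-! ## The complex cone over `ℂℙ¹ × ℂℙ¹` -/

lemma polystable_of_ne_zero (k) (hA : fst2 z ≠ 0) (hB : snd2 z ≠ 0) :
    z ∈ (cone k).polystable := by
  obtain ⟨f, hf, e⟩ := retractCone_eq_scale (fst2_eq_zero.not.1 hA) (snd2_eq_zero.not.1 hB)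
  refine (mem_polystable_congr fun j => ?_).1 ((cone k).level_sub_polystable
    ((isRetraction_cone k).mem z (mem_stable_cone k z)))
  rw [e, scale2_eq_dil hf (inv_pos.2 hf)]
  simp [dil]

/-- The projection of the complex cone to `ℂℙ¹ × ℂℙ¹`, arbitrary at the apex. -/
def coneProj (k) (x : (cone k).X) : CP1 × CP1 := linkProjC (coneToLinkC k x)

lemma coneProj_apply (hv : fst2 z ≠ 0) (hw : snd2 z ≠ 0) (h : (cone k).RepX z x) : coneProj k x =
    (ℙmk (fst2 z) hv, ℙmk (snd2 z) hw) :=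
  linkProjC_apply hv hw (repLC_coneToLinkC h ((ne_apex_iff h).2 ⟨hv, hw⟩))

lemma continuousOn_coneProj (k) : ContinuousOn (coneProj k) {(cone k).chi (apex k)}ᶜ :=
  continuous_linkProjC.comp_continuousOn (continuousOn_coneToLinkC k)

lemma repX_apex_iff : (cone k).RepX z ((cone k).chi (apex k)) ↔ ¬ (fst2 z ≠ 0 ∧ snd2 z ≠ 0) := by
  have h := (cone k).repX_mkX (mem_stable_cone k z)
  rw [← ne_apex_iff h, not_not]
  exact ⟨fun h' => h.unique h', fun e => e ▸ h⟩

lemma repX_scale {w} {y : (cone k).X} (t : ℂ) (hz : (cone k).RepX z x) (hw : (cone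
    k).RepX w x) (hy : (cone k).RepX (join (t • fst2 z) (snd2 z)) y) : (cone k).RepX (join (t • fst2
    w) (snd2 w)) y := by
  by_cases h : fst2 z ≠ 0 ∧ snd2 z ≠ 0
  · obtain ⟨c, hc, rfl⟩ := (repX_cone_iff hz h.1 h.2).1 hw
    have := repX_cone_mul hy hc
    rw [fst2_join, snd2_join] at this ⊢
    rwa [smul_comm]
  · have hx : x = (cone k).chi (apex k) := by
      by_contra hx
      exact h ((ne_apex_iff hz).1 hx)
    have h' : ¬ (fst2 w ≠ 0 ∧ snd2 w ≠ 0) := repX_apex_iff.1 (hx ▸ hw)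
    have key : ∀ u : ℂ^4, ¬ (fst2 u ≠ 0 ∧ snd2 u ≠ 0) →
        (cone k).RepX (join (t • fst2 u) (snd2 u)) ((cone k).chi (apex k)) := fun u hu => by
      rw [repX_apex_iff, fst2_join, snd2_join]
      exact fun hu' => hu ⟨right_ne_zero_of_smul hu'.1, hu'.2⟩
    rw [hy.unique (key z h)]
    exact key w h'

/-- Multiplication of the complex cone by scalars. -/
def coneScale (k) (t : ℂ) : (cone k).X → (cone k).X :=
  Quot.lift (fun z : (cone k).stable => (cone k).mkX (join (t • fst2 z.1) (snd2 z.1)))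
    fun z w h => (repX_scale t (x := (cone k).clsX z) ⟨z.2, rfl⟩ ⟨w.2, Quot.sound h⟩
      ((cone k).repX_mkX (mem_stable_cone k _))).eq_mkX

lemma repX_coneScale (t : ℂ)
    (h : (cone k).RepX z x) : (cone k).RepX (join (t • fst2 z) (snd2 z)) (coneScale k t x) := by
  obtain ⟨_, rfl⟩ := h
  exact (cone k).repX_mkX (mem_stable_cone k _)

lemma continuous_coneScale (k) :
    Continuous fun q : ℂ × (cone k).X => coneScale k q.1 q.2 := by
  have h1 : Continuous fun q : ℂ × (cone k).M => coneScale k q.1 ((cone k).chi q.2) := by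
    refine (IsOpenQuotientMap.id.prodMap (cone k).isOpenQuotientMap_cls).isQuotientMap.continuous_iff.2 ?_
    have hc : Continuous fun q : ℂ × (cone k).levelSet =>
        (cone k).mkX (join (q.1 • fst2 q.2.1) (snd2 q.2.1)) := by
      refine (cone k).continuousOn_mkX.comp_continuous (continuous_join.comp
        ((continuous_fst.smul (continuous_fst2.comp
          (continuous_subtype_val.comp continuous_snd))).prodMk
        (continuous_snd2.comp (continuous_subtype_val.comp continuous_snd)))) fun q =>
          mem_stable_cone k _
    exact hc
  have h2 := h1.comp (continuous_fst.prodMk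
    ((isRetraction_cone k).homeo.symm.continuous.comp continuous_snd))
  refine h2.congr fun q => ?_
  exact congrArg (coneScale k q.1) ((isRetraction_cone k).homeo.apply_symm_apply q.2)

/-- The invariant function `z_i w_j`. -/
def coneProd (k) (i j : Fin 2) : (cone k).X → ℂ :=
  Quot.lift (fun z : (cone k).stable => fst2 z.1 i * snd2 z.1 j) fun z w h => by
    have hz : (cone k).RepX z ((cone k).clsX z) := ⟨z.2, rfl⟩
    have hw : (cone k).RepX w ((cone k).clsX z) := ⟨w.2, Quot.sound h⟩
    by_cases hne : fst2 z.1 ≠ 0 ∧ snd2 z.1 ≠ 0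
    · obtain ⟨c, hc, e⟩ := (repX_cone_iff hz hne.1 hne.2).1 hw
      rw [e, fst2_join, snd2_join, Pi.smul_apply, Pi.smul_apply, smul_eq_mul, smul_eq_mul]
      field_simp
    · have hne' : ¬ (fst2 w.1 ≠ 0 ∧ snd2 w.1 ≠ 0) := fun h' =>
        hne ((ne_apex_iff hz).1 ((ne_apex_iff hw).2 h'))
      have key : ∀ u : ℂ^4, ¬ (fst2 u ≠ 0 ∧ snd2 u ≠ 0) → fst2 u i * snd2 u j = 0 :=
        fun u hu => by
          by_contra h0
          exact hu ⟨fun h => h0 (by rw [h, Pi.zero_apply, zero_mul]),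
            fun h => h0 (by rw [h, Pi.zero_apply, mul_zero])⟩
      rw [key _ hne, key _ hne']

lemma coneProd_apply (i j : Fin 2)
    (h : (cone k).RepX z x) : coneProd k i j x = fst2 z i * snd2 z j := by
  obtain ⟨_, rfl⟩ := h
  rfl

lemma continuous_coneProd (k) (i j : Fin 2) : Continuous (coneProd k i j) :=
  continuous_quot_lift _ (((continuous_fst2_apply i).comp continuous_subtype_val).mul
    ((continuous_snd2_apply j).comp continuous_subtype_val))

/-- Representatives of the inverse of a trivialization. -/
def coneTrivRep (i j : Fin 2) (q : (CP1 × CP1) × ℂ) : ℂ^4 :=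
  join (q.2 • aff i (affCoord i q.1.1)) (aff j (affCoord j q.1.2))

lemma mk_aff_affCoord {p : CP1} (hp : p ∈ affSet i) :
    ℙmk (aff i (affCoord i p)) (aff_ne_zero _ _) = p := by
  obtain ⟨v, hv, rfl, h⟩ := hp
  rw [affCoord_mk]
  exact mk_aff_div hv h

lemma fst2_coneTrivRep {j : Fin 2} {q : (CP1 × CP1) × ℂ} (hq : q.2 ≠ 0) :
    fst2 (coneTrivRep i j q) ≠ 0 := by
  rw [coneTrivRep, fst2_join]
  exact smul_ne_zero hq (aff_ne_zero _ _)

lemma snd2_coneTrivRep (i j : Fin 2) (q : (CP1 × CP1) × ℂ) : snd2 (coneTrivRep i j q) ≠ 0 := by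
  rw [coneTrivRep, snd2_join]
  exact aff_ne_zero _ _

lemma isOpen_affSet (i : Fin 2) : IsOpen (affSet i) := (affChart i).open_source

lemma continuousOn_affCoord (i : Fin 2) : ContinuousOn (affCoord i) (affSet i) :=
  (affChart i).continuousOn_toFun

/-- A local trivialization of the complex cone off its apex. -/
def coneTriv (k) (i j : Fin 2) : OpenPartialHomeomorph (cone k).X ((CP1 × CP1) × ℂ) where
  toFun x := (coneProj k x, coneProd k i j x)
  invFun q := (cone k).mkX (coneTrivRep i j q)
  source := {x | x ≠ (cone k).chi (apex k) ∧ coneProj k x ∈ affSet i ×ˢ affSet j}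
  target := (affSet i ×ˢ affSet j) ×ˢ {0}ᶜ
  map_source' := by
    rintro x ⟨hx, hx'⟩
    refine ⟨hx', ?_⟩
    obtain ⟨z, hz⟩ := (cone k).exists_repX x
    obtain ⟨h1, h2⟩ := (ne_apex_iff hz).1 hx
    rw [coneProj_apply h1 h2 hz] at hx'
    rw [mem_compl_singleton_iff, coneProd_apply i j hz]
    exact mul_ne_zero (mk_mem_affSet.1 hx'.1) (mk_mem_affSet.1 hx'.2)
  map_target' := by
    rintro q ⟨⟨h1, h2⟩, h3⟩
    have hr := (cone k).repX_mkX (mem_stable_cone k (coneTrivRep i j q))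
    have ha := fst2_coneTrivRep (i := i) (j := j) h3
    have hb := snd2_coneTrivRep i j q
    refine ⟨(ne_apex_iff hr).2 ⟨ha, hb⟩, ?_⟩
    rw [coneProj_apply ha hb hr]
    refine ⟨mk_mem_affSet.2 ?_, mk_mem_affSet.2 ?_⟩
    · rw [coneTrivRep, fst2_join, Pi.smul_apply, aff_self, smul_eq_mul, mul_one]; exact h3
    · rw [coneTrivRep, snd2_join, aff_self]; exact one_ne_zero
  left_inv' := by
    rintro x ⟨hx, hx'⟩
    obtain ⟨z, hz⟩ := (cone k).exists_repX x
    obtain ⟨h1, h2⟩ := (ne_apex_iff hz).1 hx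
    rw [coneProj_apply h1 h2 hz] at hx' ⊢
    have k1 := mk_mem_affSet.1 hx'.1
    have k2 := mk_mem_affSet.1 hx'.2
    refine (RepX.eq_mkX ((repX_cone_iff hz h1 h2).2 ⟨snd2 z j, k2, ?_⟩)).symm
    rw [coneTrivRep, coneProd_apply i j hz, affCoord_mk, affCoord_mk]
    congr 1
    · rw [mul_comm, mul_smul, aff_div k1]
    · refine Eq.trans ?_ (congrArg (fun v => (snd2 z j)⁻¹ • v) (aff_div k2))
      rw [smul_smul, inv_mul_cancel₀ k2, one_smul]
  right_inv' := by
    rintro q ⟨⟨h1, h2⟩, h3⟩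
    have hr := (cone k).repX_mkX (mem_stable_cone k (coneTrivRep i j q))
    have ha := fst2_coneTrivRep (i := i) (j := j) h3
    have hb := snd2_coneTrivRep i j q
    refine Prod.ext ?_ ?_
    · change coneProj k _ = q.1
      rw [coneProj_apply ha hb hr]
      refine Prod.ext (Eq.trans ?_ (mk_aff_affCoord h1)) (Eq.trans ?_ (mk_aff_affCoord h2))
      · refine (mk_eq_mk_of_smul (h3 : q.2 ≠ 0) ?_ _ _).symm
        rw [coneTrivRep, fst2_join]
      · refine (mk_eq_mk_of_smul one_ne_zero ?_ _ _).symm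
        rw [coneTrivRep, snd2_join, one_smul]
    · change coneProd k i j _ = q.2
      rw [coneProd_apply i j hr, coneTrivRep, fst2_join, snd2_join, Pi.smul_apply, aff_self,
        aff_self, smul_eq_mul, mul_one, mul_one]
  open_source := (continuousOn_coneProj k).isOpen_inter_preimage isOpen_compl_singleton
    ((isOpen_affSet i).prod (isOpen_affSet j))
  open_target := ((isOpen_affSet i).prod (isOpen_affSet j)).prod isOpen_compl_singleton
  continuousOn_toFun := ((continuousOn_coneProj k).mono fun x hx => hx.1).prodMk
    (continuous_coneProd k i j).continuousOn
  continuousOn_invFun := by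
    refine (cone k).continuousOn_mkX.comp ?_ fun q _ => mem_stable_cone k _
    have h1 : ContinuousOn (fun q : (CP1 × CP1) × ℂ => affCoord i q.1.1)
        ((affSet i ×ˢ affSet j) ×ˢ {0}ᶜ) :=
      (continuousOn_affCoord i).comp (continuous_fst.comp continuous_fst).continuousOn
        fun q hq => hq.1.1
    have h2 : ContinuousOn (fun q : (CP1 × CP1) × ℂ => affCoord j q.1.2)
        ((affSet i ×ˢ affSet j) ×ˢ {0}ᶜ) :=
      (continuousOn_affCoord j).comp (continuous_snd.comp continuous_fst).continuousOn
        fun q hq => hq.1.2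
    exact continuous_join.comp_continuousOn
      ((continuousOn_snd.smul ((contDiff_aff i).continuous.comp_continuousOn h1)).prodMk
        ((contDiff_aff j).continuous.comp_continuousOn h2))

lemma contDiffAt_aff_affCoord {i' : Fin 2} {E : Type*} [NormedAddCommGroup E] [NormedSpace ℂ E] {g :
    E → ℂ} {x : E} (hg : ContDiffAt ℂ ∞ g x) (h : aff i' (g x) i ≠ 0) : ContDiffAt ℂ ∞ (fun y => aff
    i (affCoord i (ℙmk (aff i' (g y)) (aff_ne_zero _ _)))) x := by
  have h1 := fun l => (contDiff_pi.1 (contDiff_aff i') l).contDiffAt.comp x hg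
  have h2 : ContDiffAt ℂ ∞ (fun y => aff i' (g y) (i + 1) / aff i' (g y) i) x :=
    (h1 (i + 1)).div (h1 i) h
  exact (contDiff_aff i).contDiffAt.comp x h2

lemma isDiffeoInCharts_coneTriv (k) (i j : Fin 2) : IsDiffeoInCharts ℂ (cone
    k).complexCharts (prodCharts (prodCharts affineCharts affineCharts) {OpenPartialHomeomorph.refl
    ℂ}) (coneTriv k i j) := by
  rintro f ⟨a, ha, hf⟩ _ ⟨_, ⟨c, hc, c', hc', rfl⟩, _, rfl, rfl⟩
  obtain ⟨i', hi⟩ := isAffChart_of_mem hc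
  obtain ⟨j', hj⟩ := isAffChart_of_mem hc'
  have hU := unimodular_cone k a
  constructor
  · intro u hu
    have hu1 : u ∈ f.target := hu.1
    have hu2 : f.symm u ≠ (cone k).chi (apex k) := hu.2.1.1
    have hu3 : coneTriv k i j (f.symm u) ∈
      ((c.prod c').prod (OpenPartialHomeomorph.refl ℂ)).source := hu.2.2
    have hs := (hf.symm_apply hu1).2
    have hne := (ne_apex_iff hs).1 hu2
    have hu4 : coneProj k (f.symm u) ∈ (c.prod c').source := hu3.1
    rw [coneProj_apply hne.1 hne.2 hs] at hu4
    have h1 : fst2 (iot a u) i' ≠ 0 := (hi.source _ _).1 hu4.1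
    have h2 : snd2 (iot a u) j' ≠ 0 := (hj.source _ _).1 hu4.2
    have hd1 : ∀ l, ContDiffAt ℂ ∞ (fun u => fst2 (iot a u) l) u :=
      contDiffAt_pi.1 (contDiffAt_fst2 (contDiff_iot a).contDiffAt)
    have hd2 : ∀ l, ContDiffAt ℂ ∞ (fun u => snd2 (iot a u) l) u :=
      contDiffAt_pi.1 (contDiffAt_snd2 (contDiff_iot a).contDiffAt)
    refine ContDiffAt.contDiffWithinAt (ContDiffAt.congr_of_eventuallyEq
      ((((hd1 (i' + 1)).div (hd1 i') h1).prodMk ((hd2 (j' + 1)).div (hd2 j') h2)).prodMk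
        ((hd1 i).mul (hd2 j))) ?_)
    filter_upwards [hf.eventually_symm hu1, (hd1 i').continuousAt.eventually_ne h1,
      (hd2 j').continuousAt.eventually_ne h2] with y hy hy1 hy2
    have n1 : fst2 (iot a y) ≠ 0 := fun h => hy1 (by rw [h, Pi.zero_apply])
    have n2 : snd2 (iot a y) ≠ 0 := fun h => hy2 (by rw [h, Pi.zero_apply])
    change ((c.prod c') (coneProj k (f.symm y)), coneProd k i j (f.symm y)) = _
    rw [coneProj_apply n1 n2 hy.1, coneProd_apply i j hy.1]
    exact Prod.ext (Prod.ext (hi.apply _ _ hy1) (hj.apply _ _ hy2)) rfl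
  · rintro q hq
    rw [trans_target, trans_target] at hq
    let P : (ℂ × ℂ) × ℂ → (CP1 × CP1) × ℂ := fun q => ((c.symm q.1.1, c'.symm q.1.2), q.2)
    have hP : P q ∈ (affSet i ×ˢ affSet j) ×ˢ ({0}ᶜ : Set ℂ) := hq.1.2
    have hs : (cone k).mkX (coneTrivRep i j (P q)) ∈ f.source := by
      have h : (coneTriv k i j).symm (P q) ∈ f.source := by simpa using hq.2
      exact h
    have hrep : ∀ q, (cone k).RepX (coneTrivRep i j (P q)) ((cone k).mkX (coneTrivRep i j (P q))) :=
      fun q => (cone k).repX_mkX (mem_stable_cone k _)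
    have hpoly : ∀ q, q.2 ≠ 0 → coneTrivRep i j (P q) ∈ (cone k).polystable := fun q h =>
      polystable_of_ne_zero k (fst2_coneTrivRep h) (snd2_coneTrivRep i j _)
    obtain ⟨⟨h1, h2⟩, h3⟩ := hP
    have h1' : c.symm q.1.1 ∈ affSet i := h1
    have h2' : c'.symm q.1.2 ∈ affSet j := h2
    rw [hi.symm_apply, mk_mem_affSet] at h1'
    rw [hj.symm_apply, mk_mem_affSet] at h2'
    have hZ : ContDiffAt ℂ ∞ (fun q => coneTrivRep i j (P q)) q := by
      simp only [coneTrivRep, P, hi.symm_apply, hj.symm_apply]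
      refine contDiffAt_join (contDiffAt_snd.smul ?_) ?_
      · exact contDiffAt_aff_affCoord (contDiffAt_fst.comp q contDiffAt_fst) h1'
      · exact contDiffAt_aff_affCoord (contDiffAt_snd.comp q contDiffAt_fst) h2'
    exact (hf.contDiffAt_apply (isRetraction_cone k) hU (F := fun q => (cone k).mkX
      (coneTrivRep i j (P q))) hZ (Filter.Eventually.of_forall hrep)
      ((ContinuousAt.eventually_ne (continuousAt_snd (p := q)) h3).mono hpoly)
      ((hf.mem_source_iff (isRetraction_cone k) (hrep q) (hpoly q h3)).1 hs)).contDiffWithinAt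

lemma coneProj_eq_iff {y : (cone k).X} (hx : x ≠ (cone k).chi (apex k)) (hy : y ≠ (cone k).chi (apex
    k)) : coneProj k x = coneProj k y ↔ ∃ t, t ≠ 0 ∧ y = coneScale k t x := by
  obtain ⟨z, hz⟩ := (cone k).exists_repX x
  obtain ⟨h1, h2⟩ := (ne_apex_iff hz).1 hx
  constructor
  · intro e
    obtain ⟨w, hw⟩ := (cone k).exists_repX y
    obtain ⟨h3, h4⟩ := (ne_apex_iff hw).1 hy
    rw [coneProj_apply h1 h2 hz, coneProj_apply h3 h4 hw, Prod.mk.injEq] at e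
    obtain ⟨a, ha⟩ := (Projectivization.mk_eq_mk_iff ℂ _ _ _ _).1 e.1.symm
    obtain ⟨b, hb⟩ := (Projectivization.mk_eq_mk_iff ℂ _ _ _ _).1 e.2.symm
    refine ⟨b * a, mul_ne_zero b.ne_zero a.ne_zero, ?_⟩
    have h5 := repX_cone_mul hw b.ne_zero
    have h6 := repX_coneScale ((b : ℂ) * a) hz
    refine h5.unique ?_
    convert h6 using 2
    · rw [mul_smul, ← ha]; rfl
    · rw [← hb, Units.smul_def, smul_smul, inv_mul_cancel₀ b.ne_zero, one_smul]
  · rintro ⟨t, ht, rfl⟩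
    have h5 := repX_coneScale t hz
    have h6 := (ne_apex_iff h5).1 hy
    rw [coneProj_apply h1 h2 hz, coneProj_apply h6.1 h6.2 h5]
    refine Prod.ext (mk_eq_mk_of_smul ht ?_ _ _) (mk_eq_mk_of_smul one_ne_zero ?_ _ _)
    · rw [fst2_join]
    · rw [snd2_join, one_smul]

lemma isComplexCone (k) : IsComplexCone k (coneProj k) (coneScale k) where
  proj_continuous := continuousOn_coneProj k
  proj_formula z x hv hw h := coneProj_apply hv hw h
  scale_continuous := continuous_coneScale k
  scale_formula t z x h := repX_coneScale t h
  scale_zero x := by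
    obtain ⟨z, hz⟩ := (cone k).exists_repX x
    refine (repX_coneScale 0 hz).unique (repX_apex_iff.2 ?_)
    rw [fst2_join, zero_smul]
    exact fun h => h.1 rfl
  free t x hx h := by
    obtain ⟨z, hz⟩ := (cone k).exists_repX x
    obtain ⟨h1, h2⟩ := (ne_apex_iff hz).1 hx
    have h3 := repX_coneScale t hz
    rw [h] at h3
    obtain ⟨c, hc, e⟩ := (repX_cone_iff hz h1 h2).1 h3
    have e1 := congrArg fst2 e
    have e2 := congrArg snd2 e
    rw [fst2_join, fst2_join] at e1
    rw [snd2_join, snd2_join] at e2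
    have e3 : t = c := smul_left_injective ℂ h1 e1
    have e4 : (1 : ℂ) = c⁻¹ := smul_left_injective ℂ h2 (by simpa using e2)
    rw [e3, ← inv_inv c, ← e4, inv_one]
  fiber x y hx hy := coneProj_eq_iff hx hy
  locally_trivial := by
    rintro ⟨p, p'⟩
    have hex : ∀ p : CP1, ∃ i, p ∈ affSet i := fun p => by
      induction p using Projectivization.ind with | h v hv =>
      obtain ⟨i, hi⟩ := ne_iff.1 hv
      exact ⟨i, mk_mem_affSet.2 hi⟩
    obtain ⟨i, hi⟩ := hex p
    obtain ⟨j, hj⟩ := hex p'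
    refine ⟨affSet i ×ˢ affSet j, coneTriv k i j, (isOpen_affSet i).prod (isOpen_affSet j),
      ⟨hi, hj⟩, rfl, rfl, fun x hx => ⟨rfl, fun t ht => ?_⟩, isDiffeoInCharts_coneTriv k i j⟩
    obtain ⟨z, hz⟩ := (cone k).exists_repX x
    change coneProd k i j (coneScale k t x) = t * coneProd k i j x
    rw [coneProd_apply i j hz, coneProd_apply i j (repX_coneScale t hz), fst2_join, snd2_join,
      Pi.smul_apply, smul_eq_mul, mul_assoc]

end Octahedron

/-! ## Local models at the singular points -/

section lift

variable {α β M M' : Type*} [TopologicalSpace α] [TopologicalSpace β] [TopologicalSpace M]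
  [TopologicalSpace M'] {A : Set α} {B : Set β} {q : α → M} {q' : β → M'} {S : Set M}

lemma exists_continuousOn_lift (hq : Topology.IsQuotientMap (A.domRestrict q)) (hq' : ContinuousOn
    q' B) (hS : IsOpen S) {F : α → β} (hF : ContinuousOn F {a ∈ A | q a ∈ S}) (hB : ∀ a ∈ A, q a ∈ S
    → F a ∈ B) (hc : ∀ a ∈ A, ∀ b ∈ A, q a ∈ S → q a = q b → q' (F a) = q' (F b)) : ∃ g : M → M',
    ContinuousOn g S ∧ ∀ a ∈ A, q a ∈ S → g (q a) = q' (F a) := by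
  choose s hs using hq.surjective
  have hg : ∀ a ∈ A, q a ∈ S → q' (F (s (q a))) = q' (F a) := fun a ha h =>
    (hc a ha _ (s _).2 h (hs _).symm).symm
  refine ⟨fun m => q' (F (s m)), ?_, hg⟩
  refine (hq.continuousOn_isOpen_iff hS).2 <| ((hq'.comp hF fun a ha => hB a ha.1 ha.2).comp continuous_subtype_val.continuousOn
    fun a ha => ⟨a.2, ha⟩).congr fun a ha => hg a a.2 ha

/-- Mutually inverse correspondences of representatives define a partial homeomorphism. -/
lemma exists_openPartialHomeomorph_of_lift (hq : Topology.IsQuotientMap (A.domRestrict q)) (hq' :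
    Topology.IsQuotientMap (B.domRestrict q')) (hS : IsOpen S) {S' : Set M'} (hS' : IsOpen S') {F :
    α → β} {F' : β → α} (hF : ContinuousOn F {a ∈ A | q a ∈ S}) (hF' : ContinuousOn F' {b ∈ B | q' b
    ∈ S'}) (hm : ∀ a ∈ A, q a ∈ S → F a ∈ B ∧ q' (F a) ∈ S' ∧ q (F' (F a)) = q a) (hm' : ∀ b ∈ B, q'
    b ∈ S' → F' b ∈ A ∧ q (F' b) ∈ S ∧ q' (F (F' b)) = q' b) (hc : ∀ a ∈ A, ∀ b ∈ A, q a ∈ S → q a =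
    q b → q' (F a) = q' (F b)) (hc' : ∀ a ∈ B, ∀ b ∈ B, q' a ∈ S' → q' a = q' b → q (F' a) = q (F'
    b)) : ∃ Θ : OpenPartialHomeomorph M M', Θ.source = S ∧ Θ.target = S' ∧ (∀ a ∈ A, q a ∈ S → Θ (q
    a) = q' (F a)) ∧ ∀ b ∈ B, q' b ∈ S' → Θ.symm (q' b) = q (F' b) := by
  obtain ⟨g, hg, eg⟩ := exists_continuousOn_lift hq (continuousOn_iff_continuous_domRestrict.2
    hq'.continuous) hS hF (fun a ha h => (hm a ha h).1) hc
  obtain ⟨g', hg', eg'⟩ := exists_continuousOn_lift hq' (continuousOn_iff_continuous_domRestrict.2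
    hq.continuous) hS' hF' (fun a ha h => (hm' a ha h).1) hc'
  have key : ∀ m ∈ S, g m ∈ S' ∧ g' (g m) = m := fun m h => by
    obtain ⟨⟨a, ha⟩, rfl⟩ := hq.surjective m
    obtain ⟨h1, h2, h3⟩ := hm a ha h
    simp only [domRestrict_apply] at h ⊢
    rw [eg a ha h, eg' _ h1 h2]
    exact ⟨h2, h3⟩
  have key' : ∀ m ∈ S', g' m ∈ S ∧ g (g' m) = m := fun m h => by
    obtain ⟨⟨a, ha⟩, rfl⟩ := hq'.surjective m
    obtain ⟨h1, h2, h3⟩ := hm' a ha h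
    simp only [domRestrict_apply] at h ⊢
    rw [eg' a ha h, eg _ h1 h2]
    exact ⟨h2, h3⟩
  exact ⟨{
    toFun := g
    invFun := g'
    source := S
    target := S'
    map_source' := fun m h => (key m h).1
    map_target' := fun m h => (key' m h).1
    left_inv' := fun m h => (key m h).2
    right_inv' := fun m h => (key' m h).2
    open_source := hS
    open_target := hS'
    continuousOn_toFun := hg
    continuousOn_invFun := hg' }, rfl, rfl, eg, eg'⟩

end lift

namespace ToricData

variable {n d : ℕ} {D : ToricData n d} [Nonempty D.M]

lemma isQuotientMap_mkM : Topology.IsQuotientMap (D.levelSet.domRestrict D.mkM) := by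
  have : D.levelSet.domRestrict D.mkM = D.cls := funext fun z => dif_pos z.2
  exact this ▸ D.isOpenQuotientMap_cls.isQuotientMap

lemma isQuotientMap_mkX : Topology.IsQuotientMap (D.stable.domRestrict D.mkX) := by
  have : D.stable.domRestrict D.mkX = D.clsX := funext fun z => dif_pos z.2
  exact this ▸ isQuotientMap_quot_mk

end ToricData

namespace Octahedron

open ToricData

lemma isNC_glue (k) {s c} (hs : (cone k).IsNC s) (hc : ∀ i, c i ≠ 0) :
    octa.IsNC (glue k (s * c) c) := by
  obtain ⟨t, ht, θ, hθ, e⟩ := hs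
  choose b hb using fun i => exists_circle_mul_norm (c i)
  refine ⟨_, glue_mem_N k (c := b) ht, glue k (θ + fun i => Real.log ‖c i‖) _,
    (proj_glue k θ _).trans hθ, (forall_idx k).2 ⟨fun i => ?_, fun i => ?_⟩⟩
  · simp only [glue_idx, Pi.mul_apply, Pi.add_apply, e, Circle.coe_mul, Real.exp_add,
      Real.exp_log (norm_pos_iff.2 (hc i))]
    conv_lhs => rw [hb i]
    push_cast; ring
  · simp only [glue_opp, Real.exp_log (norm_pos_iff.2 (hc i))]
    exact hb i

lemma mem_levelSet_octa_idx (k) {z} : z ∈ octa.levelSet ↔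
    (∀ i, ‖z (idx k i)‖ ^ 2 + ‖z (opp (idx k i))‖ ^ 2 = 2) ∧ z ∘ idx k ∈ (cone k).levelSet := by
  constructor
  · intro h
    obtain ⟨μ, hμ⟩ := octa.mem_levelSet_iff.1 h
    exact ⟨fun i => norm_sq_add_opp h _, (cone k).mem_levelSet_iff.2 ⟨μ, fun i => hμ _⟩⟩
  · rintro ⟨h, h'⟩
    obtain ⟨μ, hμ⟩ := (cone k).mem_levelSet_iff.1 h'
    refine octa.mem_levelSet_iff.2 ⟨μ, (forall_idx k).2 ⟨hμ, fun i => ?_⟩⟩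
    have h1 : μ ⬝ᵥ octa.normal (idx k i) = ‖z (idx k i)‖ ^ 2 + -1 := hμ i
    rw [normal_opp, dotProduct_neg, h1]
    change _ = _ + -1
    linarith [h i]

end Octahedron

namespace ToricData

variable {n d d' : ℕ} {D : ToricData n d} {D' : ToricData n d'}

/-- `F` maps `N`-orbits of the part `P` of the level set to orbits in the part `P'`,
and `F'` is an inverse on orbits. -/
structure IsLift (D : ToricData n d) (D' : ToricData n d') (P : Set ℂ^d)
    (P' : Set (Fin d' → ℂ)) (F : ℂ^d → Fin d' → ℂ) (F' : (Fin d' → ℂ) → ℂ^d) :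
    Prop where
  isOpen : IsOpen P
  rot_mem : ∀ t, ∀ z ∈ P, rot t z ∈ P
  continuousAt : ∀ z ∈ P, ContinuousAt F z
  mem : ∀ z ∈ D.levelSet, z ∈ P → F z ∈ D'.levelSet ∧ F z ∈ P'
  rot : ∀ z ∈ P, ∀ t ∈ D.N, ∃ t' ∈ D'.N, F (rot t z) = ToricData.rot t' (F z)
  inv : ∀ z ∈ D.levelSet, z ∈ P → ∃ t ∈ D.N, F' (F z) = ToricData.rot t z

variable {P : Set ℂ^d} {P' : Set (Fin d' → ℂ)} {F : ℂ^d → Fin d' → ℂ}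
  {F' : (Fin d' → ℂ) → ℂ^d}

lemma IsLift.mem_iff (h : IsLift D D' P P' F F') {z} {m} (hz : D.RepM z m) :
    m ∈ {m | ∃ z, D.RepM z m ∧ z ∈ P} ↔ z ∈ P := by
  refine ⟨?_, fun hP => ⟨z, hz, hP⟩⟩
  rintro ⟨w, hw, hP⟩
  obtain ⟨t, -, rfl⟩ := hw.exists_rot D hz
  exact h.rot_mem t w hP

lemma IsLift.exists_lift [Nonempty D.M] [Nonempty D'.M] (h : IsLift D D' P P' F F') (h' : IsLift D'
    D P' P F' F) : ∃ Θ : OpenPartialHomeomorph D.M D'.M, Θ.source = {m | ∃ z, D.RepM z m ∧ z ∈ P} ∧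
    Θ.target = {m | ∃ z, D'.RepM z m ∧ z ∈ P'} ∧ (∀ z m, D.RepM z m → z ∈ P → D'.RepM (F z) (Θ m)) ∧
    ∀ z m, D'.RepM z m → z ∈ P' → D.RepM (F' z) (Θ.symm m) := by
  have aux : ∀ {d d' : ℕ} {D : ToricData n d} {D' : ToricData n d'} {P P' F F'} [Nonempty D.M]
      [Nonempty D'.M], IsLift D D' P P' F F' → IsLift D' D P' P F' F →
      ContinuousOn F {a ∈ D.levelSet | D.mkM a ∈ {m | ∃ z, D.RepM z m ∧ z ∈ P}} ∧
      (∀ a ∈ D.levelSet, D.mkM a ∈ {m | ∃ z, D.RepM z m ∧ z ∈ P} → F a ∈ D'.levelSet ∧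
        D'.mkM (F a) ∈ {m | ∃ z, D'.RepM z m ∧ z ∈ P'} ∧ D.mkM (F' (F a)) = D.mkM a) ∧
      ∀ a ∈ D.levelSet, ∀ b ∈ D.levelSet, D.mkM a ∈ {m | ∃ z, D.RepM z m ∧ z ∈ P} →
        D.mkM a = D.mkM b → D'.mkM (F a) = D'.mkM (F b) := by
    intro d d' D D' P P' F F' _ _ h h'
    refine ⟨fun a ha => (h.continuousAt a ((h.mem_iff (D.repM_mkM ha.1)).1
      ha.2)).continuousWithinAt, fun a ha hm => ?_, fun a ha b hb hm e => ?_⟩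
    · have hP := (h.mem_iff (D.repM_mkM ha)).1 hm
      obtain ⟨h1, h2⟩ := h.mem a ha hP
      obtain ⟨t, ht, e⟩ := h.inv a ha hP
      exact ⟨h1, ⟨_, D'.repM_mkM h1, h2⟩, by rw [e, D.mkM_rot ha ht]⟩
    · have hP := (h.mem_iff (D.repM_mkM ha)).1 hm
      obtain ⟨t, ht, rfl⟩ := (D.repM_mkM ha).exists_rot D (e ▸ D.repM_mkM hb)
      obtain ⟨t', ht', e'⟩ := h.rot a hP t ht
      rw [e', D'.mkM_rot (h.mem a ha hP).1 ht']
  obtain ⟨h1, h2, h3⟩ := aux h h'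
  obtain ⟨h1', h2', h3'⟩ := aux h' h
  obtain ⟨Θ, hs, ht, e, e'⟩ := exists_openPartialHomeomorph_of_lift isQuotientMap_mkM
    isQuotientMap_mkM (D.isOpen_image_mk h.isOpen) (D'.isOpen_image_mk h'.isOpen) h1 h1' h2 h2'
    h3 h3'
  refine ⟨Θ, hs, ht, fun z m hz hP => ?_, fun z m hz hP => ?_⟩
  · rw [hz.eq_mkM, e z hz.1 ⟨z, D.repM_mkM hz.1, hP⟩]
    exact D'.repM_mkM (h.mem z hz.1 hP).1
  · rw [hz.eq_mkM, e' z hz.1 ⟨z, D'.repM_mkM hz.1, hP⟩]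
    exact D.repM_mkM (h'.mem z hz.1 hP).1

lemma contDiffAt_lift (hU : ∀ a, D.Admissible a → D.Unimodular a) (hU' : ∀ a, D'.Admissible a →
    D'.Unimodular a) {Θ : OpenPartialHomeomorph D.M D'.M} (hF : ∀ z m, D.RepM z m → m ∈ Θ.source →
    D'.RepM (F z) (Θ m) ∧ ContDiffAt ℝ ∞ F z) {e : OpenPartialHomeomorph D.M ℂ^n} (he : e ∈
    D.symplecticCharts) {f : OpenPartialHomeomorph D'.M ℂ^n} (hf : f ∈ D'.symplecticCharts)
    {u} (hu : u ∈ e.target) (huS : e.symm u ∈ Θ.source) (huf : Θ (e.symm u) ∈ f.source)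
    : ContDiffAt ℝ ∞ (fun u => f (Θ (e.symm u))) u ∧ ∃ z, D.RepM z (e.symm u) ∧ ((∀ v v', omega0
    (fderiv ℝ F z v) (fderiv ℝ F z v') = omega0 v v') → ∀ v v', omega0 (fderiv ℝ (fun u => f (Θ
    (e.symm u))) u v) (fderiv ℝ (fun u => f (Θ (e.symm u))) u v') = omega0 v v') := by
  obtain ⟨a, ha, he⟩ := he
  obtain ⟨b, hb, hf⟩ := hf
  have hs := he.symm_apply (hU a ha) hu
  have ht : u ∈ D.symTarget a := (he.target_eq (hU a ha)) ▸ hu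
  obtain ⟨h1, h2⟩ := hF _ _ hs huS
  have hev : ∀ᶠ y in 𝓝 u, D'.RepM (F (D.sig a y)) (Θ (e.symm y)) := by
    filter_upwards [e.open_target.mem_nhds hu,
      (e.continuousAt_symm hu).eventually_mem (Θ.open_source.mem_nhds huS)] with y hy hy'
    exact (hF _ _ (he.symm_apply (hU a ha) hy) hy').1
  have hn := (hf.mem_source h1).1 huf
  refine ⟨hf.contDiffAt_apply (hU' b hb) (h2.comp u (contDiffAt_sig ht)) hev hn, _, hs,
    fun hω v v' => ?_⟩
  obtain ⟨Z, hZ, -, -, hZω⟩ := hasFDerivAt_sig ht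
  have hd := (h2.differentiableAt (by simp)).hasFDerivAt.comp u hZ
  rw [hf.omega_apply (hU' b hb) hd hev hn]
  exact (hω _ _).trans (hZω v v')

lemma isSymplectoInCharts_of_lift (hU : ∀ a, D.Admissible a → D.Unimodular a) (hU' : ∀ a,
    D'.Admissible a → D'.Unimodular a) {Θ : OpenPartialHomeomorph D.M D'.M} (hF : ∀ z m, D.RepM z m
    → m ∈ Θ.source → D'.RepM (F z) (Θ m) ∧ ContDiffAt ℝ ∞ F z) (hω : ∀ z m, D.RepM z m → m ∈
    Θ.source → ∀ v v', omega0 (fderiv ℝ F z v) (fderiv ℝ F z v') = omega0 v v') (hF' : ∀ z m,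
    D'.RepM z m → m ∈ Θ.target → D.RepM (F' z) (Θ.symm m) ∧ ContDiffAt ℝ ∞ F' z) :
    IsSymplectoInCharts D.symplecticCharts D'.symplecticCharts Θ := by
  refine ⟨fun e he f hf => ⟨fun u hu => ?_, fun u hu => ?_⟩, fun e he f hf u hu v v' => ?_⟩
  · exact (contDiffAt_lift hU hU' hF he hf hu.1 hu.2.1 hu.2.2).1.contDiffWithinAt
  · rw [trans_target, trans_target] at hu
    exact (contDiffAt_lift (Θ := Θ.symm) hU' hU hF' hf he hu.1.1 hu.1.2
      (by simpa using hu.2)).1.contDiffWithinAt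
  · obtain ⟨-, z, hz, h⟩ := contDiffAt_lift hU hU' hF he hf hu.1 hu.2.1 hu.2.2
    exact h (hω z _ hz hu.2.1) v v'

end ToricData

namespace Octahedron

open ToricData

variable {z : ℂ^4}

variable (k : Fin 6)

def fillS (z : ℂ^4) : ℂ^8 := glue k z fun i => (√(2 - ‖z i‖ ^ 2) : ℝ)

def unfill (w : ℂ^8) (i : Fin 4) : ℂ := w (idx k i) / w (opp (idx k i))

def unfillS (w : ℂ^8) (i : Fin 4) : ℂ := unfill k w i * (‖w (opp (idx k i))‖ : ℝ)

def smallSet : Set ℂ^4 := {z | ∀ i, ‖z i‖ ^ 2 < 2}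

def nzOpp : Set ℂ^8 := {w | ∀ i, w (opp (idx k i)) ≠ 0}

variable {k}

lemma fillS_idx (z) (i : Fin 4) : fillS k z (idx k i) = z i := glue_idx k _ _ i

lemma fillS_opp (z) (i : Fin 4) : fillS k z (opp (idx k i)) = (√(2 - ‖z i‖ ^ 2) : ℝ) := glue_opp k _ _ i

lemma norm_fillS_opp (z) (i : Fin 4) :
    ‖fillS k z (opp (idx k i))‖ = √(2 - ‖z i‖ ^ 2) := by
  rw [fillS_opp, norm_real, Real.norm_of_nonneg (sqrt_nonneg _)]

lemma fillS_mem_nzOpp (hz : z ∈ smallSet) : fillS k z ∈ nzOpp k := fun i => by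
  rw [fillS_opp]
  exact_mod_cast (sqrt_pos.2 (sub_pos.2 (hz i))).ne'

lemma norm_unfillS {w : ℂ^8} (hw : w ∈ nzOpp k) (i : Fin 4) :
    ‖unfillS k w i‖ = ‖w (idx k i)‖ := by
  rw [unfillS, unfill, norm_mul, norm_div, norm_real, norm_norm,
    div_mul_cancel₀ _ (norm_ne_zero_iff.2 (hw i))]

lemma isOpen_smallSet : IsOpen smallSet := by
  simp only [smallSet, setOf_forall]
  exact isOpen_iInter_of_finite fun i => isOpen_lt (by fun_prop) continuous_const

lemma isOpen_nzOpp : IsOpen (nzOpp k) := by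
  simp only [nzOpp, setOf_forall]
  exact isOpen_iInter_of_finite fun i => isOpen_ne_fun (by fun_prop) continuous_const

lemma contDiffAt_fillS (hz : z ∈ smallSet) : ContDiffAt ℝ ∞ (fillS k) z := by
  refine contDiffAt_pi.2 ((forall_idx k).2 ⟨fun i => ?_, fun i => ?_⟩)
  · simp only [fillS_idx]; fun_prop
  · simp only [fillS_opp]
    exact ofRealCLM.contDiff.contDiffAt.comp z <|
      (contDiffAt_const.sub (ContDiffAt.norm_sq ℝ (by fun_prop))).sqrt (sub_pos.2 (hz i)).ne'

lemma contDiffAt_unfillS {w : ℂ^8} (hw : w ∈ nzOpp k) : ContDiffAt ℝ ∞ (unfillS k) w :=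
  contDiffAt_pi.2 fun i => (contDiffAt_div (f := fun w : ℂ^8 => w (idx k i))
    (g := fun w => w (opp (idx k i))) (by fun_prop) (by fun_prop) (hw i)).mul
    (ofRealCLM.contDiff.contDiffAt.comp w (ContDiffAt.norm ℝ
      (f := fun w : ℂ^8 => w (opp (idx k i))) (by fun_prop) (hw i)))

lemma omega0_fillS (hz : z ∈ smallSet) (v v') :
    omega0 (fderiv ℝ (fillS k) z v) (fderiv ℝ (fillS k) z v') = omega0 v v' := by
  have hd := hasFDerivAt_pi'.1 ((contDiffAt_fillS (k := k) hz).differentiableAt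
    (by simp)).hasFDerivAt
  have h1 : ∀ v, fderiv ℝ (fillS k) z v ∘ idx k = v := fun v => funext fun i => by
    have h2 := hd (idx k i)
    simp only [fillS_idx] at h2
    exact DFunLike.congr_fun (h2.unique
      (ContinuousLinearMap.proj (R := ℝ) (φ := fun _ : Fin 4 => ℂ) i).hasFDerivAt) v
  have h2 : ∀ v, ∀ j ∉ range (idx k), (fderiv ℝ (fillS k) z v j).im = 0 := fun v =>
    (forall_notMem_idx_opp k).2 fun i => im_eq_zero_of_eventually (hd _)
      (Filter.Eventually.of_forall fun y => by rw [fillS_opp, ofReal_im]) v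
  rw [← omega0_comp (a := ⟨idx k, idx_injective k⟩) (h2 v) (h2 v')]
  exact congrArg₂ omega0 (h1 v) (h1 v')

lemma isLift_fillS : IsLift (cone k) octa smallSet (nzOpp k) (fillS k) (unfillS k) where
  isOpen := isOpen_smallSet
  rot_mem t z hz i := by rw [norm_rot]; exact hz i
  continuousAt z hz := (contDiffAt_fillS hz).continuousAt
  mem z hz hs := by
    refine ⟨(mem_levelSet_octa_idx k).2 ⟨fun i => ?_, ?_⟩, fillS_mem_nzOpp hs⟩
    · rw [fillS_idx, norm_fillS_opp, sq_sqrt (sub_pos.2 (hs i)).le]; ring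
    · rwa [show fillS k z ∘ idx k = z from funext (fillS_idx z)]
  rot z hz t ht := by
    refine ⟨_, glue_mem_N k (c := 1) ht, (eq_glue k (fun i => ?_) fun i => ?_).symm⟩
    · simp [ToricData.rot, glue_idx, fillS_idx]
    · rw [norm_rot]
      simp [ToricData.rot, glue_opp, fillS_opp]
  inv z hz hs := by
    refine ⟨1, one_mem _, ?_⟩
    funext i
    rw [rot_one, unfillS, unfill, norm_fillS_opp, ← fillS_opp, fillS_idx,
      div_mul_cancel₀ _ (fillS_mem_nzOpp hs i)]

lemma isLift_unfillS : IsLift octa (cone k) (nzOpp k) smallSet (unfillS k) (fillS k) where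
  isOpen := isOpen_nzOpp
  rot_mem t z hz i := mul_ne_zero (Circle.coe_ne_zero _) (hz i)
  continuousAt z hz := (contDiffAt_unfillS hz).continuousAt
  mem z hz hs := by
    obtain ⟨h, h'⟩ := (mem_levelSet_octa_idx k).1 hz
    refine ⟨?_, fun i => ?_⟩
    · rw [mem_levelSet_cone] at h' ⊢
      simpa only [norm_unfillS hs] using! h'
    · rw [norm_unfillS hs]
      linarith [h i, pow_pos (norm_pos_iff.2 (hs i)) 2]
  rot z hz t ht := by
    refine ⟨_, quotient_mem_N k ht, ?_⟩
    funext i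
    simp only [unfillS, unfill, ToricData.rot, norm_mul, Circle.norm_coe, one_mul, Circle.coe_div]
    rw [mul_div_mul_comm, mul_assoc]
  inv z hz hs := by
    choose c hc using fun i => exists_circle_mul_norm (z (opp (idx k i)))
    refine ⟨_, glue_mem_N k (t := 1) (c := c⁻¹) (one_mem _),
      (eq_glue k (fun i => ?_) fun i => ?_).symm⟩
    · simp only [ToricData.rot, glue_idx, one_mul, Pi.inv_apply, Circle.coe_inv, unfillS, unfill]
      have := hs i
      have h2 : (‖z (opp (idx k i))‖ : ℂ) ≠ 0 := by simpa using this
      conv_rhs => rw [hc i]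
      rw [norm_mul, Circle.norm_coe, one_mul, norm_real, norm_norm]
      field_simp [Circle.coe_ne_zero]
    · rw [norm_unfillS hs, show 2 - ‖z (idx k i)‖ ^ 2 = ‖z (opp (idx k i))‖ ^ 2 by
        linarith [((mem_levelSet_octa_idx k).1 hz).1 i], sqrt_sq (norm_nonneg _)]
      simp only [ToricData.rot, glue_opp, Pi.inv_apply, Circle.coe_inv]
      conv_lhs => rw [hc i]
      rw [inv_mul_cancel_left₀ (Circle.coe_ne_zero _)]

lemma repM_fillS_zero : octa.RepM (fillS k 0) (singularPoint k) := by
  refine (repM_singularPoint (isLift_fillS.mem 0 (apex_rep k).1 fun i => by simp).1).2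
    ((forall_notMem_idx_opp k).2 fun i => ?_)
  rw [norm_fillS_opp, sq_sqrt] <;> simp

lemma exists_isSymplecticLocalModel (k : Fin 6) : ∃ Θ, IsSymplecticLocalModel k Θ := by
  obtain ⟨Θ, hs, ht, h, h'⟩ := (isLift_fillS (k := k)).exists_lift isLift_unfillS
  refine ⟨Θ, hs, ?_, ?_, fun z m hz hP => ⟨_, h z m hz hP, fillS_idx z,
    (forall_notMem_idx_opp k).2 fun i => ?_⟩, ?_⟩
  · simp only [ht, forall_notMem_idx_opp]; rfl
  · exact (h 0 _ (apex_rep k) fun i => by simp).unique _ repM_fillS_zero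
  · rw [opp_opp, fillS_idx, fillS_opp]
  · refine isSymplectoInCharts_of_lift (fun a _ => unimodular_cone k a) unimodular_octa
      (F := fillS k) (F' := unfillS k) (fun z m hz hm => ?_) (fun z m hz hm => ?_)
      (fun z m hz hm => ?_)
    · have hP := (isLift_fillS.mem_iff hz).1 (hs ▸ hm)
      exact ⟨h z m hz hP, contDiffAt_fillS hP⟩
    · exact omega0_fillS ((isLift_fillS.mem_iff hz).1 (hs ▸ hm))
    · have hP := (isLift_unfillS.mem_iff hz).1 (ht ▸ hm)
      exact ⟨h' z m hz hP, contDiffAt_unfillS hP⟩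

end Octahedron

namespace ToricData

variable {n d d' : ℕ} {D : ToricData n d} {D' : ToricData n d'} {r : ℂ^d → ℂ^d}
  {r' : (Fin d' → ℂ) → Fin d' → ℂ} {F : ℂ^d → Fin d' → ℂ} {P : Set ℂ^d}

lemma IsRetraction.repX_of_lift (hr : D.IsRetraction r) (hP : ∀ z ∈ P, r z ∈ P)
    (hc : ∀ z ∈ P, ContinuousAt F z) (hs : ∀ z ∈ P, F z ∈ D'.stable)
    (hd : ∀ z θ, D.proj θ = 0 → ∃ θ', D'.proj θ' = 0 ∧ F (ToricData.dil θ z) = ToricData.dil θ' (F z))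
    (ht : ∀ z, ∀ t ∈ D.N, ∃ t' ∈ D'.N, F (ToricData.rot t z) = ToricData.rot t' (F z))
    {z w} {x} {y : D'.X} (hz : D.RepX z x) (hw : D.RepX w x) (hzP : z ∈ P)
    (hwP : w ∈ P) (hy : D'.RepX (F z) y) : D'.RepX (F w) y := by
  have key : ∀ z ∈ P, z ∈ D.stable → ∀ y, D'.RepX (F z) y → D'.RepX (F (r z)) y := by
    intro z hz hzs y hy
    refine RepX.closure hy (hs _ (hP z hz)) ((hc _ (hP z hz)).continuousWithinAt.mem_closure
      (hr.closure z hzs) ?_)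
    rintro _ ⟨θ, hθ, rfl⟩
    obtain ⟨θ', h, e⟩ := hd z θ hθ
    exact ⟨θ', h, e⟩
  obtain ⟨-, t, htN, e⟩ := (hr.repX_iff hz).1 hw
  obtain ⟨t', ht', e'⟩ := ht (r z) t htN
  have h1 := RepX.mul (key z hzP hz.1 y hy) (isNC_of_mem_N ht')
  have h2 : D'.RepX (F w) (D'.clsX ⟨_, hs w hwP⟩) := ⟨hs w hwP, rfl⟩
  have h3 := key w hwP hw.1 _ h2
  rw [e, e'] at h3
  rwa [RepX.unique h1 h3]

lemma contDiffAt_liftX (hU : ∀ a, D'.Admissible a → D'.Unimodular a) (hr : D.IsRetraction r) (hr' :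
    D'.IsRetraction r') {Θ : OpenPartialHomeomorph D.X D'.X} (hF : ∀ z x, D.RepX z x → z ∈
    D.polystable → x ∈ Θ.source → D'.RepX (F z) (Θ x) ∧ F z ∈ D'.polystable ∧ ContDiffAt ℂ ∞ F z) {e
    : OpenPartialHomeomorph D.X ℂ^n} (he : e ∈ D.complexCharts) {f : OpenPartialHomeomorph
    D'.X ℂ^n} (hf : f ∈ D'.complexCharts) {u} (hu : u ∈ e.target) (huS : e.symm
    u ∈ Θ.source) (huf : Θ (e.symm u) ∈ f.source) : ContDiffAt ℂ ∞ (fun u => f (Θ (e.symm u)))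
    u := by
  obtain ⟨a, ha, he⟩ := he
  obtain ⟨b, hb, hf⟩ := hf
  obtain ⟨hp, hs⟩ := he.symm_apply hu
  obtain ⟨h1, h2, h3⟩ := hF _ _ hs hp huS
  have hev : ∀ᶠ y in 𝓝 u, D'.RepX (F (iot a y)) (Θ (e.symm y)) ∧ F (iot a y) ∈ D'.polystable := by
    filter_upwards [he.eventually_symm hu,
      (e.continuousAt_symm hu).eventually_mem (Θ.open_source.mem_nhds huS)] with y hy hy'
    exact ⟨(hF _ _ hy.1 hy.2 hy').1, (hF _ _ hy.1 hy.2 hy').2.1⟩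
  exact hf.contDiffAt_apply hr' (hU b hb) (h3.comp u (contDiff_iot a).contDiffAt)
    (hev.mono fun _ h => h.1) (hev.mono fun _ h => h.2) ((hf.mem_source_iff hr' h1 h2).1 huf)

end ToricData

namespace Octahedron

open ToricData

variable {z : ℂ^4} {w : ℂ^8} {x : octa.X}

variable (k : Fin 6)

def fillC (z : ℂ^4) : ℂ^8 := glue k z 1

def shrink (z : ℂ^4) : ℂ^4 := (1 + ‖z‖)⁻¹ • z

def expand (z : ℂ^4) : ℂ^4 := (1 - ‖z‖)⁻¹ • z

variable {k}

lemma smul_mem_levelSet_cone (hz : z ∈ (cone k).levelSet) (c : ℝ) : c • z ∈ (cone k).levelSet := by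
  rw [mem_levelSet_cone] at hz ⊢
  simp only [Pi.smul_apply, norm_smul, mul_pow, ← mul_add, hz]

lemma smul_rot (c : ℝ) (t : Fin 4 → Circle) (z : ℂ^4) : c • rot t z = rot t (c • z) := by
  funext i
  simp only [Pi.smul_apply, rot, mul_smul_comm]

lemma norm_rot_eq (t : Fin 4 → Circle) (z : ℂ^4) : ‖rot t z‖ = ‖z‖ := by
  have : ∀ i, ‖rot t z i‖₊ = ‖z i‖₊ := fun i => NNReal.eq (norm_rot t z i)
  simp only [Pi.norm_def, this]

lemma norm_shrink (z) : ‖shrink z‖ = (1 + ‖z‖)⁻¹ * ‖z‖ := by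
  rw [shrink, norm_smul, Real.norm_of_nonneg (by positivity)]

lemma norm_shrink_lt (z) : ‖shrink z‖ < 1 := by
  rw [norm_shrink, inv_mul_lt_iff₀ (by positivity)]
  linarith

lemma shrink_mem_smallSet (z) : shrink z ∈ smallSet := fun i => by
  have := (norm_le_pi_norm (shrink z) i).trans_lt (norm_shrink_lt z)
  nlinarith [norm_nonneg (shrink z i)]

lemma isLift_shrink : IsLift (cone k) (cone k) univ (Metric.ball 0 1) shrink expand where
  isOpen := isOpen_univ
  rot_mem _ _ _ := mem_univ _
  continuousAt z _ := by
    have : Continuous shrink :=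
      ((continuous_const.add continuous_norm).inv₀ fun z =>
        (add_pos_of_pos_of_nonneg one_pos (norm_nonneg z)).ne').smul continuous_id
    exact this.continuousAt
  mem z hz _ := ⟨smul_mem_levelSet_cone hz _, by simpa using norm_shrink_lt z⟩
  rot z _ t ht := ⟨t, ht, by rw [shrink, norm_rot_eq, smul_rot]; rfl⟩
  inv z _ _ := by
    refine ⟨1, one_mem _, ?_⟩
    have : 0 < 1 + ‖z‖ := by positivity
    rw [rot_one, expand, norm_shrink, shrink, smul_smul, ← mul_inv,
      show (1 - (1 + ‖z‖)⁻¹ * ‖z‖) * (1 + ‖z‖) = 1 by field_simp; ring, inv_one, one_smul]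

lemma isLift_expand : IsLift (cone k) (cone k) (Metric.ball 0 1) univ expand shrink where
  isOpen := Metric.isOpen_ball
  rot_mem t z hz := by simpa [norm_rot_eq] using hz
  continuousAt z hz := by
    refine ContinuousAt.smul (ContinuousAt.inv₀
      (continuousAt_const.sub continuous_norm.continuousAt) ?_) continuousAt_id
    exact (sub_pos.2 (mem_ball_zero_iff.1 hz)).ne'
  mem z hz _ := ⟨smul_mem_levelSet_cone hz _, mem_univ _⟩
  rot z _ t ht := ⟨t, ht, by rw [expand, norm_rot_eq, smul_rot]; rfl⟩
  inv z _ hz := by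
    refine ⟨1, one_mem _, ?_⟩
    rw [mem_ball_zero_iff] at hz
    have h0 : 0 < 1 - ‖z‖ := by linarith
    rw [rot_one, shrink, expand, norm_smul, Real.norm_of_nonneg (by positivity), smul_smul,
      ← mul_inv, show (1 + (1 - ‖z‖)⁻¹ * ‖z‖) * (1 - ‖z‖) = 1 by field_simp; ring, inv_one,
      one_smul]

lemma exists_isOpenEmbedding_realCone (k) : ∃ G : RealCone RealLink → octa.M,
    Topology.IsOpenEmbedding G ∧ ∀ l, G (RealCone.mk l 0 le_rfl) = singularPoint k := by
  obtain ⟨Θ, hΘ⟩ := exists_isSymplecticLocalModel k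
  obtain ⟨T, hs, -, h, -⟩ := (isLift_shrink (k := k)).exists_lift isLift_expand
  have hm : ∀ m, ∃ z, (cone k).RepM z m ∧ (cone k).RepM (shrink z) (T m) := fun m =>
    let ⟨z, hz⟩ := (cone k).exists_repM m
    ⟨z, hz, h z m hz (mem_univ z)⟩
  have hsrc : (T ≫ₕ Θ).source = univ := by
    refine eq_univ_of_forall fun m => ?_
    obtain ⟨z, hz, hz'⟩ := hm m
    rw [trans_source, hs, hΘ.source]
    exact ⟨⟨z, hz, mem_univ z⟩, _, hz', shrink_mem_smallSet z⟩
  refine ⟨_, ((T ≫ₕ Θ).isOpenEmbedding hsrc).comp (coneHomeo k).isOpenEmbedding, fun l => ?_⟩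
  obtain ⟨⟨x, y⟩, rfl⟩ := Quotient.mk_surjective l
  have h0 := (isRealConeModel k).formula x.1 y.1 _ 0 le_rfl ⟨x.2, y.2, rfl⟩
  have h1 := h _ _ h0 (mem_univ _)
  have h2 : T (coneHomeo k (RealCone.mk _ 0 le_rfl)) = apex k := (repM_apex_iff h1).2 (by
    funext i; fin_cases i <;> simp [shrink, join])
  rw [← hΘ.apex, ← h2]
  rfl

lemma fillC_mem_nzOpp (z) : fillC k z ∈ nzOpp k := fun i => by
  rw [fillC, glue_opp]; exact one_ne_zero

lemma stable_of_mem_nzOpp (hw : w ∈ nzOpp k) : w ∈ octa.stable :=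
  mem_stable_of_mem_nz ((forall_notMem_idx_opp k).2 hw)

lemma retractOcta_mem_nzOpp (hw : w ∈ nzOpp k) : retractOcta w ∈ nzOpp k :=
  (forall_notMem_idx_opp k).1 <|
    retractOcta_ne_zero_of_notMem ((forall_notMem_idx_opp k).2 hw)

lemma mem_nzOpp_of_repX {z} (hz : octa.RepX z x) (hw : octa.RepX w x)
    (h : z ∈ nzOpp k) : w ∈ nzOpp k := fun i hi => by
  obtain ⟨hs, t, -, e⟩ := (isRetraction_octa.repX_iff hz).1 hw
  have h1 := eq_zero_of_mem_closure_orbit (isRetraction_octa.closure w hs) hi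
  rw [e] at h1
  exact mul_ne_zero (Circle.coe_ne_zero _) (retractOcta_mem_nzOpp h i) h1

lemma contDiff_fillC : ContDiff ℂ ∞ (fillC k) :=
  contDiff_pi.2 <| (forall_idx k).2 ⟨fun i => by simp only [fillC, glue_idx]; fun_prop,
    fun i => by simp only [fillC, glue_opp]; fun_prop⟩

lemma contDiffAt_unfill (hw : w ∈ nzOpp k) : ContDiffAt ℂ ∞ (unfill k) w :=
  contDiffAt_pi.2 fun i => ContDiffAt.div (f := fun w : ℂ^8 => w (idx k i))
    (g := fun w => w (opp (idx k i))) (by fun_prop) (by fun_prop) (hw i)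

lemma unfill_fillC (z) : unfill k (fillC k z) = z := by
  funext i
  rw [unfill, fillC, glue_idx, glue_opp, Pi.one_apply, div_one]

lemma repX_fillC_unfill (hw : w ∈ nzOpp k) (h : octa.RepX w x) :
    octa.RepX (fillC k (unfill k w)) x := by
  have h1 := RepX.mul h (isNC_glue k (isNC_of_mem_N (one_mem (cone k).N))
    fun i => inv_ne_zero (hw i))
  convert h1 using 1
  refine (funext <| (forall_idx k).2 ⟨fun i => ?_, fun i => ?_⟩)
  · rw [fillC, glue_idx, glue_idx, Pi.mul_apply, Pi.one_apply, Circle.coe_one, one_mul, unfill, div_eq_inv_mul]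
  · rw [fillC, glue_opp, glue_opp, inv_mul_cancel₀ (hw i)]; rfl

lemma repX_fillC {w} {x : (cone k).X} {y : octa.X} (hz : (cone k).RepX z x)
    (hw : (cone k).RepX w x) (hy : octa.RepX (fillC k z) y) : octa.RepX (fillC k w) y := by
  refine (isRetraction_cone k).repX_of_lift (P := univ) (fun _ _ => mem_univ _)
    (fun z _ => contDiff_fillC.continuous.continuousAt)
    (fun z _ => stable_of_mem_nzOpp (fillC_mem_nzOpp z)) (fun z θ hθ => ?_) (fun z t ht => ?_)
    hz hw (mem_univ _) (mem_univ _) hy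
  · refine ⟨_, (proj_glue k θ 0).trans hθ, (eq_glue k (fun i => ?_) fun i => ?_).symm⟩
    · simp [fillC, dil, glue_idx]
    · simp [fillC, dil, glue_opp]
  · refine ⟨_, glue_mem_N k (c := 1) ht, (eq_glue k (fun i => ?_) fun i => ?_).symm⟩
    · simp [fillC, rot, glue_idx]
    · simp [fillC, rot, glue_opp]

lemma repX_unfill {z} {y : (cone k).X} (hz : octa.RepX z x) (hw : octa.RepX w x) (hn : z
    ∈ nzOpp k) (hy : (cone k).RepX (unfill k z) y) : (cone k).RepX (unfill k w) y := by
  refine isRetraction_octa.repX_of_lift (P := nzOpp k) (fun _ => retractOcta_mem_nzOpp)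
    (fun z hz => (contDiffAt_unfill hz).continuousAt) (fun z _ => stable_cone k ▸ mem_univ _)
    (fun z θ hθ => ⟨_, (proj_octa_eq k θ).symm.trans hθ, ?_⟩)
    (fun z t ht => ⟨_, quotient_mem_N k ht, ?_⟩) hz hw hn (mem_nzOpp_of_repX hz hw hn) hy
  · funext i
    simp only [unfill, dil, Real.exp_sub]
    push_cast
    rw [mul_div_mul_comm]
  · funext i
    simp only [unfill, rot, Circle.coe_div]
    rw [mul_div_mul_comm]

lemma fillC_mem_polystable (hz : z ∈ (cone k).polystable) : fillC k z ∈ octa.polystable := by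
  obtain ⟨y, hy, e⟩ := exists_level_of_polystable hz
  have h1 := (isLift_fillS (k := k)).mem _ (smul_mem_levelSet_cone hy (1 + ‖y‖)⁻¹)
    (shrink_mem_smallSet y)
  refine (mem_polystable_congr ((forall_idx k).2 ⟨fun i => ?_, fun i => ?_⟩)).1
    (octa.level_sub_polystable h1.1)
  · have : 1 + ‖y‖ ≠ 0 := (add_pos_of_pos_of_nonneg one_pos (norm_nonneg y)).ne'
    rw [fillS_idx, fillC, glue_idx, ← e, Pi.smul_apply, smul_eq_zero_iff_right (inv_ne_zero this)]
  · exact iff_of_false (h1.2 i) (fillC_mem_nzOpp z i)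

lemma unfill_mem_polystable (hw : w ∈ octa.polystable) (hn : w ∈ nzOpp k) :
    unfill k w ∈ (cone k).polystable := by
  obtain ⟨y, hy, e⟩ := exists_level_of_polystable hw
  have hn' : y ∈ nzOpp k := fun i => (e _).not.2 (hn i)
  refine (mem_polystable_congr fun i => ?_).1
    ((cone k).level_sub_polystable (isLift_unfillS.mem y hy hn').1)
  rw [← norm_eq_zero, norm_unfillS hn', norm_eq_zero, e, unfill, div_eq_zero_iff,
    or_iff_left (hn i)]

lemma exists_isComplexLocalModel (k) : ∃ Ξ, IsComplexLocalModel k Ξ := by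
  have hC : ∀ z, z ∈ (cone k).stable := fun z => stable_cone k ▸ mem_univ z
  have hF : ∀ z, octa.RepX (fillC k z) (octa.mkX (fillC k z)) := fun z =>
    octa.repX_mkX (stable_of_mem_nzOpp (fillC_mem_nzOpp z))
  let S : Set octa.X := {x | ∃ z, octa.RepX z x ∧ z ∈ nzOpp k}
  have hS : ∀ {z x}, octa.RepX z x → x ∈ S → z ∈ nzOpp k := fun {z x} hz ⟨w, hw, h⟩ =>
    mem_nzOpp_of_repX hw hz h
  have hSo : IsOpen S := by
    rw [← octa.isQuotientMap_mkX.isOpen_preimage]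
    convert (isOpen_nzOpp (k := k)).preimage (continuous_subtype_val (p := (· ∈ octa.stable)))
    refine Set.ext fun z => ?_
    exact ⟨hS (octa.repX_mkX (Subtype.prop _)), fun h => ⟨_, octa.repX_mkX (Subtype.prop _), h⟩⟩
  obtain ⟨Ξ, hs, ht, e, e'⟩ := exists_openPartialHomeomorph_of_lift
    (q := (cone k).mkX) (q' := octa.mkX) isQuotientMap_mkX isQuotientMap_mkX isOpen_univ hSo
    (F := fillC k) (F' := unfill k) contDiff_fillC.continuous.continuousOn
    (fun w hw => (contDiffAt_unfill (hS (octa.repX_mkX hw.1) hw.2)).continuousAt.continuousWithinAt)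
    (fun z _ _ => ⟨(hF z).1, ⟨_, hF z, fillC_mem_nzOpp z⟩, by rw [unfill_fillC]⟩)
    (fun w hw h => ⟨hC _, mem_univ _,
      ((repX_fillC_unfill (hS (octa.repX_mkX hw) h) (octa.repX_mkX hw)).eq_mkX).symm⟩)
    (fun z _ w _ _ h => (repX_fillC ((cone k).repX_mkX (hC z))
      (h ▸ (cone k).repX_mkX (hC w)) (hF z)).eq_mkX)
    (fun z hz w hw hn h => (repX_unfill (octa.repX_mkX hz) (h ▸ octa.repX_mkX hw)
      (hS (octa.repX_mkX hz) hn) ((cone k).repX_mkX (hC _))).eq_mkX)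
  have h : ∀ z x, (cone k).RepX z x → octa.RepX (fillC k z) (Ξ x) := fun z x hz => by
    rw [hz.eq_mkX, e z (hC z) (mem_univ _)]
    exact hF z
  have h' : ∀ w x, octa.RepX w x → x ∈ S → (cone k).RepX (unfill k w) (Ξ.symm x) :=
    fun w x hw hx => by
      rw [hw.eq_mkX] at hx ⊢
      rw [e' w hw.1 hx]
      exact (cone k).repX_mkX (hC _)
  have hA : ∀ z x, (cone k).RepX z x → z ∈ (cone k).polystable → x ∈ Ξ.source →
      octa.RepX (fillC k z) (Ξ x) ∧ fillC k z ∈ octa.polystable ∧ ContDiffAt ℂ ∞ (fillC k) z :=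
    fun z x hz hp _ => ⟨h z x hz, fillC_mem_polystable hp, contDiff_fillC.contDiffAt⟩
  have hB : ∀ w x, octa.RepX w x → w ∈ octa.polystable → x ∈ Ξ.symm.source →
      (cone k).RepX (unfill k w) (Ξ.symm x) ∧ unfill k w ∈ (cone k).polystable ∧
        ContDiffAt ℂ ∞ (unfill k) w := fun w x hw hp hx => by
    have hx' : x ∈ S := ht ▸ hx
    exact ⟨h' w x hw hx', unfill_mem_polystable hp (hS hw hx'), contDiffAt_unfill (hS hw hx')⟩
  refine ⟨Ξ, hs, ?_, ?_, fun z x hz => ⟨_, h z x hz, glue_idx k _ _,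
    (forall_notMem_idx_opp k).2 (glue_opp k _ _)⟩,
    fun f hf g hg => ⟨fun u hu => ?_, fun u hu => ?_⟩⟩
  · simp only [ht, forall_notMem_idx_opp]; rfl
  · have h0 := h 0 _ (apex_rep k).repX
    have h1 := repX_fillC_unfill (fillS_mem_nzOpp fun i => by simp)
      (repM_fillS_zero (k := k)).repX
    rw [show unfill k (fillS k 0) = 0 from funext fun i => by simp [unfill, fillS_idx]] at h1
    exact h0.unique h1
  · exact (contDiffAt_liftX unimodular_octa (isRetraction_cone k) isRetraction_octa hA hf hg
      hu.1 hu.2.1 hu.2.2).contDiffWithinAt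
  · rw [trans_target, trans_target] at hu
    exact (contDiffAt_liftX (Θ := Ξ.symm) (fun a _ => unimodular_cone k a) isRetraction_octa
      (isRetraction_cone k) hB hg hf hu.1.1 hu.1.2 (by simpa using hu.2)).contDiffWithinAt

end Octahedron

end

open ToricData Octahedron

theorem mainTheorem2 :
    -- The octahedron and the lattice `L`.
    (DiscreteTopology L ∧ Submodule.span ℝ (L : Set (Fin 3 → ℝ)) = ⊤) ∧
    (octa.polyhedron = convexHull ℝ (range vertex) ∧
      octa.polyhedron.extremePoints ℝ = range vertex ∧ Function.Injective vertex) ∧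
    -- Every vertex lies on four facet planes, every facet plane contains three vertices.
    (∀ k, octa.active (vertex k) = range (idx k) ∧ (octa.active (vertex k)).ncard = 4) ∧
    (∀ j, octa.face j ∈ octa.facets ∧
      octa.face j = convexHull ℝ (vertex '' {k | j ∈ octa.active (vertex k)}) ∧
      {k | j ∈ octa.active (vertex k)}.ncard = 3) ∧
    ¬ octa.IsSimple ∧
    -- The group `N` and the level set.
    (∀ t, t ∈ octa.N ↔ ∃ (θ : Fin 4 → ℝ) (s : ℝ),
      t = expT ![θ 0, θ 1, θ 2, θ 3, θ 0 + s, θ 1 + s, θ 2 + s, θ 3 + s]) ∧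
    (∀ z, z ∈ octa.levelSet ↔
      ‖z 0‖ ^ 2 + ‖z 4‖ ^ 2 = 2 ∧ ‖z 1‖ ^ 2 + ‖z 5‖ ^ 2 = 2 ∧ ‖z 2‖ ^ 2 + ‖z 6‖ ^ 2 = 2 ∧
      ‖z 3‖ ^ 2 + ‖z 7‖ ^ 2 = 2 ∧ ‖z 2‖ ^ 2 + ‖z 3‖ ^ 2 = ‖z 4‖ ^ 2 + ‖z 5‖ ^ 2) ∧
    IsCompact octa.levelSet ∧
    -- The singular points: their orbits in the level set, and the isotropy groups of `N`.
    (∀ k, ∀ z ∈ octa.levelSet,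
      octa.RepM z (singularPoint k) ↔ ∀ j ∉ range (idx k), ‖z j‖ ^ 2 = 2) ∧
    (∀ k, ∀ z ∈ octa.levelSet, octa.RepM z (singularPoint k) →
      ∀ t, (t ∈ octa.N ∧ rot t z = z) ↔ ∃ c : Circle, t (idx k 0) = c ∧ t (idx k 1) = c ∧
        t (idx k 2) = c⁻¹ ∧ t (idx k 3) = c⁻¹ ∧ ∀ j ∉ range (idx k), t j = 1) ∧
    (∀ z ∈ octa.levelSet, (∀ k, ¬ octa.RepM z (singularPoint k)) →
      ∀ t ∈ octa.N, rot t z = z → t = 1) ∧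
    Function.Injective singularPoint ∧
    -- The space `M_Δ ≃ X_Δ` and its regular stratum, a Kähler manifold of complex dimension `3`.
    (CompactSpace octa.M ∧ T2Space octa.M ∧ SecondCountableTopology octa.M ∧
      ConnectedSpace octa.M) ∧
    (IsOpen (range singularPoint)ᶜ ∧ Dense (range singularPoint)ᶜ) ∧
    octa.IsKahlerOff (range singularPoint) ∧
    -- The torus action and the moment mapping.
    (∃ (ρ : (Fin 3 → ℝ) ⧸ L → octa.M → octa.M) (Φ : octa.M → Fin 3 → ℝ),
      octa.IsTorusAction ρ ∧ Continuous Φ ∧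
      (∀ z m, octa.RepM z m → ∀ j, Φ m ⬝ᵥ octa.normal j = ‖z j‖ ^ 2 + octa.bound j) ∧
      range Φ = octa.polyhedron ∧ (∀ k m, Φ m = vertex k ↔ m = singularPoint k) ∧
      octa.IsHamiltonianInCharts ρ Φ) ∧
    -- The explicit charts.
    (∀ a : Fin 3 ↪ Fin 8, octa.Admissible a ↔ ∃ k, range a ⊆ range (idx k)) ∧
    (∃ e, octa.IsSymplecticChart triple345 e ∧ e.target = U ∧
      ∀ u ∈ U, octa.RepM (tau u) (e.symm u)) ∧
    (∃ f, octa.IsComplexChart triple345 f ∧ f.target = V ∧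
      ∀ u ∈ V, octa.RepX (tauC u) (f.symm u)) ∧
    -- The symplectic link, the complex link, and the real link.
    (∀ t, t ∈ square.N ↔ ∃ s r : ℝ, t = expT ![s, s, r, r]) ∧
    (∀ z, z ∈ square.levelSet ↔ ‖z 0‖ ^ 2 + ‖z 1‖ ^ 2 = 2 ∧ ‖z 2‖ ^ 2 + ‖z 3‖ ^ 2 = 2) ∧
    square.IsKahlerOff ∅ ∧
    (∃ η : square.M ≃ₜ S2 × S2, ∀ e ∈ square.symplecticCharts,
      ContMDiffOn 𝓘(ℝ, Fin 2 → ℂ) ((𝓡 2).prod (𝓡 2)) ∞ (fun u => η (e.symm u)) e.target ∧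
      ContMDiffOn ((𝓡 2).prod (𝓡 2)) 𝓘(ℝ, Fin 2 → ℂ) ∞ (fun p => e (η.symm p))
        (η '' e.source)) ∧
    IsAtlasOn ℂ affineCharts univ ∧
    ∃ (κ : square.X ≃ₜ CP1 × CP1) (ℓ : RealLink ≃ₜ RealLinkC)
      (A : Set (OpenPartialHomeomorph RealLink (EuclideanSpace ℝ (Fin 5))))
      (p₂ : RealLink → square.M) (p₂C : RealLinkC → CP1 × CP1) (α : Circle → RealLink → RealLink),
      (∀ (v w : Fin 2 → ℂ) (hv : v ≠ 0) (hw : w ≠ 0) (x : square.X), square.RepX (join v w) x →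
        κ x = (Projectivization.mk ℂ v hv, Projectivization.mk ℂ w hw)) ∧
      IsDiffeoInCharts ℂ square.complexCharts (prodCharts affineCharts affineCharts)
        κ.toOpenPartialHomeomorph ∧
      (∀ x y l, RepL x y l → RepLC x y (ℓ l)) ∧
      -- The real link is a closed manifold of dimension `5`, a circle bundle over `M_{Δ_L}`.
      (CompactSpace RealLink ∧ T2Space RealLink ∧ IsAtlasOn ℝ A univ) ∧
      IsCircleBundle A p₂ α ∧
      Continuous p₂C ∧
      (∀ (v w : Fin 2 → ℂ) (hv : v ≠ 0) (hw : w ≠ 0) l, RepLC v w l →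
        p₂C l = (Projectivization.mk ℂ v hv, Projectivization.mk ℂ w hw)) ∧
      (∀ l, p₂C (ℓ l) = κ (square.chi (p₂ l))) ∧
      -- Around each of the six singular points.
      ∀ k : Fin 6, ConeDescription k ∧
        (∃ Θ, IsSymplecticLocalModel k Θ) ∧ (∃ Ξ, IsComplexLocalModel k Ξ) ∧
        (∃ G : RealCone RealLink → octa.M, Topology.IsOpenEmbedding G ∧
          ∀ l, G (RealCone.mk l 0 le_rfl) = singularPoint k) ∧
        ∃ h g p₁C pC σ, IsRealConeModel k A h g ∧ IsComplexCone k pC σ ∧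
          IsConeDiagram k ℓ p₂C h p₁C pC := by
  refine ⟨⟨discreteTopology_L, span_L_eq_top⟩,
    ⟨polyhedron_octa_eq, extremePoints_octa, vertex_injective⟩,
    fun k => ⟨active_vertex k, ncard_active_vertex k⟩,
    fun j => ⟨face_mem_facets j, face_octa_eq j, ncard_setOf_mem_active j⟩, not_isSimple,
    fun t => mem_N_octa, fun z => mem_levelSet_octa, isCompact_levelSet_octa,
    fun k z hz => repM_singularPoint hz, fun k z _ h => isotropy_singular h,
    fun z hz h t ht htz => isotropy_regular hz h ht htz, singularPoint_injective,
    ⟨inferInstance, inferInstance, inferInstance, inferInstance⟩,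
    ⟨isOpen_regular, dense_regular⟩, isKahlerOff_octa,
    ⟨unimodular_triple345.act, unimodular_triple345.moment,
      unimodular_triple345.isTorusAction exists_level_ne_zero,
      unimodular_triple345.continuous_moment, fun z m h => unimodular_triple345.moment_dot h,
      unimodular_triple345.range_moment, moment_eq_vertex_iff,
      unimodular_triple345.isHamiltonianInCharts unimodular_octa⟩,
    admissible_octa_iff, exists_symplecticChart_triple345, exists_complexChart_triple345,
    fun t => mem_N_square, fun z => mem_levelSet_square, isKahlerOff_square,
    ⟨eta, fun e he => ⟨contMDiffOn_eta he, contMDiffOn_eta_symm he⟩⟩, isAtlasOn_affineCharts,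
    kappa, linkHomeo, linkCharts, linkProj, linkProjC, linkAct,
    fun v w hv hw x h => kappaFun_join hv hw h, isDiffeoInCharts_kappa,
    fun x y l h => repLC_linkHomeo (isRepL_of_repL h),
    ⟨inferInstance, inferInstance, isAtlasOn_linkCharts⟩, isCircleBundle_linkProj,
    continuous_linkProjC, fun v w hv hw l h => linkProjC_apply hv hw h, linkProjC_linkHomeo,
    fun k => ⟨coneDescription k, exists_isSymplecticLocalModel k, exists_isComplexLocalModel k,
      exists_isOpenEmbedding_realCone k, coneHomeo k, coneDiffeo k, coneToLinkC k, coneProj k,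
      coneScale k, isRealConeModel k, isComplexCone k, isConeDiagram k⟩⟩
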